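/- Let $\mathbb{F}_q$ be a finite field with $q$ elements, $k=\mathbb{F}_q(\theta)$, $k_\infty=\mathbb{F}_q((1/\theta))$, let $\mathbb{C}_\infty$ be the completion of an algebraic closure of $k_\infty$, and let $\mathbb{K}$ be an algebraically closed field with $k\subset\mathbb{K}\subset\mathbb{C}_\infty$. Let $t$ be a variable. For a function $f$ with coefficients in $\mathbb{K}$, $f^{(n)}$ denotes the result of raising its coefficients to the $q^n$-th power; $P^{(n)}$ and $D^{(n)}$ are the corresponding twists of points and divisors. **Dual $t$-motives.** A dual $t$-motive over $\mathbb{K}$ is a $\mathbb{K}[t]$-module $M$ with an additive map $\sigma$ satisfying $\sigma(fm)=f^{(-1)}\sigma m$ for $f\in\mathbb{K}[t]$, $m\in M$ (i.e. a left $\mathbb{K}[t,\sigma]$-module), such that $M$ is free of finite rank over $\mathbb{K}[t]$ and over $\mathbb{K}[\sigma]$, and $(t-\theta)^N M\subset\sigma M$ for some $N$. It is pure if there are a $\mathbb{K}[[1/t]]$-lattice $L$ of full rank in $\mathbb{K}((1/t))\otimes_{\mathbb{K}[t]}M$ and integers $u,w>0$ with $t^uL=\sigma^wL$, where $\sigma(f\otimes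 m)=f^{(-1)}\otimes\sigma m$. **CM fields and CM types.** A finite extension of $\mathbb{F}_q(t)$ is totally real if the place $\infty$ of $\mathbb{F}_q(t)$ splits completely in it. A CM field is a finite separable extension $K/\mathbb{F}_q(t)$ such that each place above $\infty$ of its maximal totally real subfield $K^+$ has a unique extension to $K$. Let $O_K$ be the integral closure of $\mathbb{F}_q[t]$ in $K$ and $O_{\mathbf K}=\mathbb{K}\otimes_{\mathbb{F}_q}O_K$. Let $X$ and $X^+$ be the smooth projective curves with function fields $K$ and $K^+$, viewed as $\mathbb{F}_q$-schemes, let $\mathbf{X},\mathbf{X}^+$ be their base changes from $\mathbb{F}_q$ to $\mathbb{K}$, $\mathbf{U}=\operatorname{Spec}O_{\mathbf K}$ the part of $\mathbf{X}$ not above $\infty$, and $J_K,J_{K^+}$ the sets of points above $t=\theta$. A generalized CM type of $K$ is a nonzero effective divisor $\Xi=\sum_{\xi\in J_K}m_\xi\xi$ such that $\sum_{\xi\mapsto\xi^+}m_\xi$ is the same for all $\xi^+\in J_{K^+}$. For $\xi\in J_K$ let $\mathfrak{P}_\xi\subset O_{\mathbf K}$ be its maximal ideal, let $\nu_\xi:K\to\mathbb{K}$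 be evaluation at $\xi$, and let $\overline\infty_\xi\in\mathbf{X}$ be the point given by $\nu_\xi^{-1}(O_{\mathbb{C}_\infty})\to O_{\mathbb{C}_\infty}\to\overline{\mathbb{F}}_q\subset\mathbb{K}$. Put $\mathfrak{I}_\Xi=\prod_\xi\mathfrak{P}_\xi^{m_\xi}$. **CM dual $t$-motives.** Let $\mathbb{F}_{q^\ell}$ be the constant field of $K$, and fix an embedding $\mathbb{F}_{q^\ell}\subset\mathbb{K}$. Then $\mathbf{X}=\coprod_{i=0}^{\ell-1}\mathbf{X}_{(i)}$, where $\mathbf{X}_{(i)}$ is the base change of $X$ along $\mathbb{F}_{q^\ell}\to\mathbb{K}$, $\varepsilon\mapsto\varepsilon^{1/q^i}$; let $\mathbf{U}_{(i)}=\mathbf{U}\cap\mathbf{X}_{(i)}$ and let $\Xi_{(i)}=\sum_{\xi\in J_K\cap\mathbf{X}_{(i)}}m_\xi\xi$, $I_{\Xi_{(i)}}=\sum_{\xi\in J_K\cap\mathbf{X}_{(i)}}m_\xi\overline\infty_\xi$, $\Xi^\#=\Xi_{(0)}+\sum_{j=1}^{\ell-1}\Xi_{(j)}^{(j-\ell)}$,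 $I_\Xi^\#=I_{\Xi_{(0)}}+\sum_{j=1}^{\ell-1}I_{\Xi_{(j)}}^{(j-\ell)}$. For a divisor $W$ of $\mathbf{X}_{(0)}$, a shtuka function associated to $W$ is a rational function $h$ on $\mathbf{X}_{(0)}$ with $\operatorname{div}(h)=W^{(\ell)}-W+\Xi^\#-I_\Xi^\#$, and $$M_{(W,h)}=\prod_{i=0}^{\ell-1}\Gamma\Bigl(\mathbf{U}_{(i)},\mathcal{O}_{\mathbf{X}_{(i)}}\bigl(-W^{(\ell-i)}+\textstyle\sum_{j=1}^{i}\Xi_{(j)}^{(j-i)}\bigr)\Bigr),\qquad \sigma(m_{(0)},\dots,m_{(\ell-1)})=\bigl(h\,m_{(\ell-1)}^{(-1)},m_{(0)}^{(-1)},\dots,m_{(\ell-2)}^{(-1)}\bigr).$$ A CM dual $t$-motive with generalized CM type $(K,\Xi)$ is a dual $t$-motive isomorphic, as a $\mathbb{K}[t,\sigma]$-module, to some such $M_{(W,h)}$. **Proposition.** Let $K$ be a CM field over $\mathbb{F}_q(t)$ and let $M$ be a dual $t$-motive over $\mathbb{K}$ such that 1. $\operatorname{rank}_{\mathbb{K}[t]}M=[K:\mathbb{F}_q(t)]$;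 2. there is an $\mathbb{F}_q[t]$-algebra embedding $O_K\hookrightarrow\operatorname{End}_{\mathbb{K}[t,\sigma]}(M)$, which makes $M$ an $O_{\mathbf K}$-module; 3. $\sigma M=\mathfrak{I}_\Xi M$ for a generalized CM type $\Xi$ of $K$; 4. $M$ is pure. Then $M$ is a CM dual $t$-motive with generalized CM type $(K,\Xi)$. -/

import Mathlib

open Polynomial TensorProduct
open scoped WithZero NNReal

set_option linter.unusedSectionVars false

noncomputable section

namespace CMMotive

/-! ### The field `ℂ_∞` -/

section CInfty

variable (Fq : Type*) [Field Fq] [Fintype Fq]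

/-- The local field `k_∞ = 𝔽_q((1/θ))`: Laurent series over `𝔽_q` in the variable `1/θ`. -/
abbrev KInf : Type _ := LaurentSeries Fq

theorem one_lt_q : (1 : ℝ≥0) < Fintype.card Fq := by
  exact_mod_cast Fintype.one_lt_card

theorem valuation_uniformizer :
    (Valued.v (HahnSeries.single (1 : ℤ) (1 : Fq) : KInf Fq) : ℤᵐ⁰) < 1 := by
  have h := LaurentSeries.valuation_X_pow Fq 1
  simp only [Nat.cast_one] at h
  have h' : (Valued.v (HahnSeries.single (1 : ℤ) (1 : Fq) : KInf Fq) : ℤᵐ⁰)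
      = WithZero.exp (-1) := by simpa using h
  rw [h', ← WithZero.exp_zero, WithZero.exp_lt_exp]
  norm_num

/-- The absolute value of `k_∞`, normalized by `|θ| = q`. -/
instance kInfRankOne : Valuation.RankOne (Valued.v : Valuation (KInf Fq) ℤᵐ⁰) where
  hom' := (WithZeroMulInt.toNNReal (zero_lt_one.trans (one_lt_q Fq)).ne').comp
    MonoidWithZeroHom.ValueGroup₀.embedding
  strictMono' := (WithZeroMulInt.toNNReal_strictMono (one_lt_q Fq)).comp
    MonoidWithZeroHom.ValueGroup₀.embedding_strictMono
  exists_val_nontrivial := ⟨HahnSeries.single 1 1,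
    by simp, (valuation_uniformizer Fq).ne⟩

instance kInfNormedField : NormedField (KInf Fq) := Valued.toNormedField (KInf Fq) ℤᵐ⁰

instance kInfNontriviallyNormedField : NontriviallyNormedField (KInf Fq) where
  non_trivial := by
    refine ⟨(HahnSeries.single (1 : ℤ) (1 : Fq) : KInf Fq)⁻¹, ?_⟩
    rw [norm_inv, one_lt_inv_iff₀]
    exact ⟨by simp, Valued.toNormedField.norm_lt_one_iff.2 (valuation_uniformizer Fq)⟩

/-- An algebraic closure of `k_∞`, with the unique extension of the absolute value. -/
abbrev KInfBar : Type _ := AlgebraicClosure (KInf Fq)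

instance kInfBarNormedField : NormedField (KInfBar Fq) :=
  spectralNorm.normedField (KInf Fq) (KInfBar Fq)

/-- `ℂ_∞`: the completion of an algebraic closure of `k_∞`. -/
abbrev CInf : Type _ := UniformSpace.Completion (KInfBar Fq)

instance cInfAlgebra : Algebra Fq (CInf Fq) :=
  ((algebraMap (KInfBar Fq) (CInf Fq)).comp (algebraMap Fq (KInfBar Fq))).toAlgebra

/-- The element `θ` of `ℂ_∞`. -/
def theta : CInf Fq :=
  algebraMap (KInfBar Fq) (CInf Fq)
    (algebraMap (KInf Fq) (KInfBar Fq) (HahnSeries.single (-1 : ℤ) (1 : Fq)))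

variable {Fq}

/-- The absolute value `|·|_∞` on a subfield `𝕂` of `ℂ_∞`. -/
def absOn (𝕂 : IntermediateField Fq (CInf Fq)) : AbsoluteValue 𝕂 ℝ :=
  (NormedField.toAbsoluteValue (CInf Fq)).comp (f := algebraMap 𝕂 (CInf Fq))
    (algebraMap 𝕂 (CInf Fq)).injective

end CInfty

/-! ### CM fields over `𝔽_q(t)` -/

section CMFields

variable (Fq : Type*) [Field Fq]

open Classical in
/-- The valuation ring of the place `∞` of `𝔽_q(t)`. -/
def inftyRing : ValuationSubring (RatFunc Fq) := (RatFunc.inftyValuation Fq).valuationSubring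

/-- The places above `∞` of an extension `L` of `𝔽_q(t)`, given by their valuation rings. -/
def placesAboveInfty (L : Type*) [Field L] [Algebra (RatFunc Fq) L] :
    Set (ValuationSubring L) :=
  {A | A.comap (algebraMap (RatFunc Fq) L) = inftyRing Fq}

/-- A finite extension `L` of `𝔽_q(t)` is totally real if `∞` splits completely in `L`, i.e. there
are `[L : 𝔽_q(t)]` places of `L` above `∞`. -/
def IsTotallyReal (L : Type*) [Field L] [Algebra (RatFunc Fq) L] : Prop :=
  FiniteDimensional (RatFunc Fq) L ∧
    (placesAboveInfty Fq L).ncard = Module.finrank (RatFunc Fq) L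

variable {Fq}

/-- `K` is a CM field with maximal totally real subfield `Kp`. -/
structure IsCMField {K : Type*} [Field K] [Algebra (RatFunc Fq) K]
    (Kp : IntermediateField (RatFunc Fq) K) : Prop where
  finite : FiniteDimensional (RatFunc Fq) K
  separable : Algebra.IsSeparable (RatFunc Fq) K
  maximal_real : IsGreatest {L : IntermediateField (RatFunc Fq) K | IsTotallyReal Fq L} Kp
  nonsplit : ∀ B ∈ placesAboveInfty Fq Kp, ∃! A : ValuationSubring K,
    A.comap (algebraMap Kp K) = B

end CMFields

/-! ### The base-changed curve `𝐗 = 𝕂 ×_{𝔽_q} X` -/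

section Curve

variable (Fq : Type*) [Field Fq] [Fintype Fq] (𝕂 : Type*) [Field 𝕂] [Algebra Fq 𝕂]

/-- The `q`-th power Frobenius of `𝕂`, an `𝔽_q`-automorphism. -/
def frob [IsAlgClosed 𝕂] : 𝕂 ≃ₐ[Fq] 𝕂 :=
  AlgEquiv.ofBijective (FiniteField.frobeniusAlgHom Fq 𝕂)
    ⟨(FiniteField.frobeniusAlgHom Fq 𝕂).toRingHom.injective,
      fun x => IsAlgClosed.exists_pow_nat_eq x Fintype.card_pos⟩

variable (L : Type*) [Field L] [Algebra Fq L]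

/-- The ring `𝐊` of rational functions on `𝐗 = 𝕂 ×_{𝔽_q} X`, where `X` is the smooth projective
curve with function field `L`: the total ring of fractions of `𝕂 ⊗_{𝔽_q} L`. It is the product of
the function fields of the connected components of `𝐗`. -/
abbrev FunRing : Type _ := FractionRing (𝕂 ⊗[Fq] L)

variable {𝕂 L}

/-- The element `c ⊗ 1` of `𝐊`. -/
def const (c : 𝕂) : FunRing Fq 𝕂 L := algebraMap (𝕂 ⊗[Fq] L) _ (c ⊗ₜ 1)

/-- The element `1 ⊗ a` of `𝐊`. -/
def fn (a : L) : FunRing Fq 𝕂 L := algebraMap (𝕂 ⊗[Fq] L) _ (1 ⊗ₜ a)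

variable (𝕂 L)

/-- The automorphism of `𝐊` induced by an automorphism of the scalar field `𝕂`. -/
def scalarAut (g : 𝕂 ≃ₐ[Fq] 𝕂) : FunRing Fq 𝕂 L ≃+* FunRing Fq 𝕂 L :=
  IsFractionRing.ringEquivOfRingEquiv
    (Algebra.TensorProduct.congr g (AlgEquiv.refl : L ≃ₐ[Fq] L)).toRingEquiv

theorem scalarAut_const (g : 𝕂 ≃ₐ[Fq] 𝕂) (c : 𝕂) :
    scalarAut Fq 𝕂 L g (const Fq c) = const Fq (g c) := by
  simp [scalarAut, const]

/-- The `n`-th Frobenius twist `f ↦ f^{(n)}` on `𝐊`, raising coefficients to the power `q ^ n`. -/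
def funTwist [IsAlgClosed 𝕂] (n : ℤ) : FunRing Fq 𝕂 L ≃+* FunRing Fq 𝕂 L :=
  scalarAut Fq 𝕂 L (frob Fq 𝕂 ^ n)

/-- A closed point of `𝐗`: a normalized discrete valuation on `𝐊`, trivial on the constants `𝕂`.
The support of the valuation, a prime ideal of the product of fields `𝐊`, selects the connected
component of `𝐗` on which the point lies. In terms of the order of vanishing at the point,
`val f = exp (- ord f)`, and `val f = 0` iff `f` vanishes on the whole component. -/
@[ext] structure ClosedPoint where
  val : Valuation (FunRing Fq 𝕂 L) ℤᵐ⁰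
  surjective : Function.Surjective val
  trivial_on_const : ∀ c : 𝕂, c ≠ 0 → val (const Fq c) = 1

variable {Fq 𝕂 L}

/-- The Frobenius twist `P^{(n)}` of a point: `ord_{P^{(n)}} (f^{(n)}) = ord_P f`. -/
def ClosedPoint.twist [IsAlgClosed 𝕂] (n : ℤ) (P : ClosedPoint Fq 𝕂 L) : ClosedPoint Fq 𝕂 L where
  val := P.val.comap (funTwist Fq 𝕂 L (-n)).toRingHom
  surjective := P.surjective.comp (funTwist Fq 𝕂 L (-n)).surjective
  trivial_on_const c hc := by
    change P.val (scalarAut Fq 𝕂 L _ _) = 1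
    rw [scalarAut_const]
    exact P.trivial_on_const _ (by simpa using hc)

variable (Fq 𝕂 L) in
/-- Divisors on `𝐗`. -/
abbrev Divisor : Type _ := ClosedPoint Fq 𝕂 L →₀ ℤ

/-- The Frobenius twist `D^{(n)}` of a divisor. -/
def twistDiv [IsAlgClosed 𝕂] (n : ℤ) (D : Divisor Fq 𝕂 L) : Divisor Fq 𝕂 L :=
  D.mapDomain (ClosedPoint.twist n)

variable (Fq L) in
/-- The constant field of `L`, the algebraic closure of `𝔽_q` in `L`. -/
abbrev ConstField : IntermediateField Fq L := algebraicClosure Fq L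

variable (Fq L) in
/-- The degree `ℓ` of the constant field of `L` over `𝔽_q`. -/
def constDegree : ℕ := Module.finrank Fq (ConstField Fq L)

/-- The component `𝐗_{(i)}` of `𝐗`, i.e. the base change of `X` along
`Frob_q^{-i} : 𝔽_{q^ℓ} → 𝕂`, `ε ↦ ε^{1/q^i}`, where `𝔽_{q^ℓ} ⊆ 𝕂` via `ι`: the component on which
each constant `ε` of `L` equals the scalar `ε^{1/q^i}`. -/
def component [IsAlgClosed 𝕂] (ι : ConstField Fq L →ₐ[Fq] 𝕂) (i : ℕ) :
    Set (ClosedPoint Fq 𝕂 L) :=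
  {P | ∀ ε : ConstField Fq L,
    P.val (fn Fq (ε : L) - const Fq ((frob Fq 𝕂 ^ (-(i : ℤ))) (ι ε))) = 0}

section OverLine

variable [Algebra (RatFunc Fq) L]

variable (Fq 𝕂 L) in
/-- The function `t` on `𝐗`. -/
def tFun : FunRing Fq 𝕂 L := fn Fq (algebraMap (RatFunc Fq) L RatFunc.X)

variable (Fq 𝕂 L) in
/-- The affine part `𝐔` of `𝐗`: the points not lying above `∞`. -/
def affinePart : Set (ClosedPoint Fq 𝕂 L) := {P | P.val (tFun Fq 𝕂 L) ≤ 1}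

variable (Fq L) in
/-- The set `J_L` of points of `𝐗` above the point `t = θ` of the projective line. -/
def pointsAbove (θ : 𝕂) : Set (ClosedPoint Fq 𝕂 L) :=
  {P | P.val (tFun Fq 𝕂 L - const Fq θ) < 1}

/-- `P` is the point `∞̄_ξ` to which `ξ ∈ J_L` reduces. Here `ν` is the embedding `ν_ξ : L → 𝕂`
obtained by evaluating functions at `ξ`. The residue field of `𝕂` contains `𝔽̄_q ⊆ 𝕂`, and an
element `a` of the valuation ring `{a | |ν a| ≤ 1}` of `L` reduces to the `c ∈ 𝔽̄_q` for which
`|ν a - c| < 1`; the value of `a` at `P` has to be this `c`. -/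
def IsReductionAtInfty (abv : AbsoluteValue 𝕂 ℝ) (ξ P : ClosedPoint Fq 𝕂 L) : Prop :=
  ∃ ν : L →ₐ[Fq] 𝕂, (∀ a : L, ξ.val (fn Fq a - const Fq (ν a)) < 1) ∧
    ∀ (a : L) (c : 𝕂), IsAlgebraic Fq c → abv (ν a - c) < 1 → P.val (fn Fq a - const Fq c) < 1

/-- The point `∞̄_ξ`; for `ξ ∈ J_L` exactly one point satisfies the defining condition. -/
def inftyPoint (abv : AbsoluteValue 𝕂 ℝ) (ξ : ClosedPoint Fq 𝕂 L) : ClosedPoint Fq 𝕂 L :=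
  @Classical.epsilon _ ⟨ξ⟩ (IsReductionAtInfty abv ξ)

end OverLine

end Curve

/-! ### Generalized CM types -/

section CMTypes

variable {Fq : Type*} [Field Fq] [Fintype Fq] {𝕂 : Type*} [Field 𝕂] [Algebra Fq 𝕂]
  {K : Type*} [Field K] [Algebra Fq K] [Algebra (RatFunc Fq) K] [IsScalarTower Fq (RatFunc Fq) K]
  {Kp : IntermediateField (RatFunc Fq) K}

/-- `π_{𝐗/𝐗⁺} (P) = Q`: the valuation of `P` restricts to that of `Q`, up to equivalence. -/
def LiesOver (P : ClosedPoint Fq 𝕂 K) (Q : ClosedPoint Fq 𝕂 Kp) : Prop :=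
  (P.val.comap ((algebraMap (𝕂 ⊗[Fq] K) (FunRing Fq 𝕂 K)).comp
    (Algebra.TensorProduct.map (AlgHom.id Fq 𝕂) (Kp.val.restrictScalars Fq)).toRingHom)).IsEquiv
  (Q.val.comap (algebraMap (𝕂 ⊗[Fq] Kp) (FunRing Fq 𝕂 Kp)))

variable (Kp) in
open Classical in
/-- A generalized CM type of `K`: a nonzero effective divisor `Ξ = ∑ m_ξ ξ` supported on `J_K` such
that the sum of the `m_ξ` over the `ξ` above `ξ⁺` does not depend on `ξ⁺ ∈ J_{K⁺}`. -/
structure IsGeneralizedCMType (θ : 𝕂) (Ξ : ClosedPoint Fq 𝕂 K →₀ ℕ) : Prop where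
  ne_zero : Ξ ≠ 0
  support_subset : ∀ ξ ∈ Ξ.support, ξ ∈ pointsAbove Fq K θ
  weight : ∀ Q₁ ∈ pointsAbove Fq Kp θ, ∀ Q₂ ∈ pointsAbove Fq Kp θ,
    ∑ ξ ∈ Ξ.support with LiesOver ξ Q₁, Ξ ξ = ∑ ξ ∈ Ξ.support with LiesOver ξ Q₂, Ξ ξ

end CMTypes

/-! ### Shtuka functions and the modules `M_{(W,h)}` -/

section Shtuka

variable {Fq : Type*} [Field Fq] [Fintype Fq] {𝕂 : Type*} [Field 𝕂] [Algebra Fq 𝕂] [IsAlgClosed 𝕂]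
  {K : Type*} [Field K] [Algebra Fq K]

/-- An effective divisor, as a divisor. -/
def toDivisor (Ξ : ClosedPoint Fq 𝕂 K →₀ ℕ) : Divisor Fq 𝕂 K :=
  Ξ.mapRange (fun n : ℕ => (n : ℤ)) Nat.cast_zero

open Classical in
/-- The part `Ξ_{(i)}` of `Ξ` on `𝐗_{(i)}`. -/
def partOn (ι : ConstField Fq K →ₐ[Fq] 𝕂) (Ξ : ClosedPoint Fq 𝕂 K →₀ ℕ) (i : ℕ) :
    Divisor Fq 𝕂 K :=
  (toDivisor Ξ).filter (· ∈ component ι i)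

/-- The part `I_{Ξ_{(i)}} = ∑ m_ξ ∞̄_ξ` (sum over `ξ ∈ 𝐗_{(i)}`) of the divisor `I_Ξ`. -/
def inftyPartOn (abv : AbsoluteValue 𝕂 ℝ) (ι : ConstField Fq K →ₐ[Fq] 𝕂)
    (Ξ : ClosedPoint Fq 𝕂 K →₀ ℕ) (i : ℕ) : Divisor Fq 𝕂 K :=
  (partOn ι Ξ i).mapDomain (inftyPoint abv)

/-- For divisors `D i` on `𝐗_{(i)}`, the divisor `∑_{1 ≤ j < ℓ} (D j)^{(j-ℓ)} + D 0` on `𝐗_{(0)}`. -/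
def sharp (D : ℕ → Divisor Fq 𝕂 K) : Divisor Fq 𝕂 K :=
  (∑ j ∈ Finset.Ico 1 (constDegree Fq K), twistDiv ((j : ℤ) - constDegree Fq K) (D j)) + D 0

/-- `h` is a shtuka function on `𝐗_{(0)}` associated to the divisor `W` of `𝐗_{(0)}`:
`div h = W^{(ℓ)} - W + Ξ^# - I_Ξ^#` on `𝐗_{(0)}`. A nonzero function on `𝐗_{(0)}` is regarded as an
element of `𝐊` by extending it by `1` to the other components. For `ℓ = 1` this is
`div h = W^{(1)} - W + Ξ - I_Ξ` on `𝐗`. -/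
structure IsShtukaFunction (abv : AbsoluteValue 𝕂 ℝ) (ι : ConstField Fq K →ₐ[Fq] 𝕂)
    (Ξ : ClosedPoint Fq 𝕂 K →₀ ℕ) (W : Divisor Fq 𝕂 K) (h : FunRing Fq 𝕂 K) : Prop where
  support_subset : ∀ P ∈ W.support, P ∈ component ι 0
  eq_one : ∀ P ∉ component ι 0, P.val (h - 1) = 0
  div_eq : ∀ P ∈ component ι 0, P.val h = WithZero.exp
    (-((twistDiv (constDegree Fq K) W - W + sharp (partOn ι Ξ)
      - sharp (inftyPartOn abv ι Ξ)) P))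

/-- The divisor on `𝐗` whose restriction to `𝐗_{(i)}`, `0 ≤ i < ℓ`, is
`-W^{(ℓ-i)} + ∑_{1 ≤ j ≤ i} Ξ_{(j)}^{(j-i)}`. -/
def motiveDivisor (ι : ConstField Fq K →ₐ[Fq] 𝕂) (Ξ : ClosedPoint Fq 𝕂 K →₀ ℕ)
    (W : Divisor Fq 𝕂 K) : Divisor Fq 𝕂 K :=
  ∑ i ∈ Finset.range (constDegree Fq K),
    (-twistDiv ((constDegree Fq K : ℤ) - i) W
      + ∑ j ∈ Finset.Icc 1 i, twistDiv ((j : ℤ) - i) (partOn ι Ξ j))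

/-- The sections `Γ(𝐔, O_𝐗(D))`. -/
def affineSections [Algebra (RatFunc Fq) K] (D : Divisor Fq 𝕂 K) :
    AddSubgroup (FunRing Fq 𝕂 K) where
  carrier := {f | ∀ P ∈ affinePart Fq 𝕂 K, P.val f ≤ WithZero.exp (D P)}
  zero_mem' P _ := by simp
  add_mem' hf hg P hP := P.val.map_add_le (hf P hP) (hg P hP)
  neg_mem' hf P hP := by simpa [Valuation.map_neg] using hf P hP

end Shtuka

/-! ### Dual `t`-motives -/

section DualTMotives

variable (Fq : Type*) [Field Fq] [Fintype Fq] (𝕂 : Type*) [Field 𝕂] [Algebra Fq 𝕂] [IsAlgClosed 𝕂]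

/-- The inverse Frobenius twist `f ↦ f^{(-1)}` on `𝕂[t]`. -/
def polyTwistInv : 𝕂[X] →+* 𝕂[X] := Polynomial.mapRingHom ((frob Fq 𝕂).symm : 𝕂 →+* 𝕂)

variable {Fq 𝕂} {M : Type*} [AddCommGroup M] [Module 𝕂[X] M]

/-- A dual `t`-motive over `𝕂`. A left `𝕂[t,σ]`-module is a `𝕂[t]`-module `M` with an additive map
`σ` such that `σ (f m) = f^{(-1)} σ m`. -/
structure IsDualTMotive (θ : 𝕂) (σ : M →ₛₗ[polyTwistInv Fq 𝕂] M) : Prop where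
  free : Module.Free 𝕂[X] M
  finite : Module.Finite 𝕂[X] M
  /-- `M` is free of finite rank over `𝕂[σ]`: there are `b 1, …, b d` such that each element of `M`
  is uniquely of the form `∑ (∑ c_{j,i} σ^i) b_j`. -/
  sigma_free : ∃ (d : ℕ) (b : Fin d → M), ∀ m : M, ∃! c : (Fin d × ℕ) →₀ 𝕂,
    m = c.sum fun ji a => (C a : 𝕂[X]) • σ^[ji.2] (b ji.1)
  torsion : ∃ N : ℕ, ∀ m : M, ∃ m' : M, σ m' = (X - C θ) ^ N • m

/-- The field `𝕂((1/t))`: Laurent series in the variable `1/t`. -/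
def LaurentAtInfty (𝕂 : Type*) [Field 𝕂] : Type _ := LaurentSeries 𝕂

instance laurentField (𝕂 : Type*) [Field 𝕂] : Field (LaurentAtInfty 𝕂) :=
  inferInstanceAs (Field (LaurentSeries 𝕂))

/-- `𝕂[t] ⊆ 𝕂((1/t))`: the polynomial variable `t` is the inverse of the series variable. -/
instance laurentAlgebra (𝕂 : Type*) [Field 𝕂] : Algebra 𝕂[X] (LaurentAtInfty 𝕂) :=
  RingHom.toAlgebra (S := LaurentAtInfty 𝕂)
    (Polynomial.eval₂RingHom (S := LaurentSeries 𝕂) HahnSeries.C (HahnSeries.single (-1 : ℤ) 1))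

/-- The subring `𝕂[[1/t]]` of `𝕂((1/t))`. -/
def powerSeriesAtInfty (𝕂 : Type*) [Field 𝕂] : Subring (LaurentAtInfty 𝕂) :=
  RingHom.range (S := LaurentAtInfty 𝕂) (HahnSeries.ofPowerSeries ℤ 𝕂)

variable (Fq 𝕂) in
/-- The inverse Frobenius twist on the coefficients of the series in `𝕂((1/t))`. -/
def laurentTwistInv : LaurentAtInfty 𝕂 →+* LaurentAtInfty 𝕂 where
  toFun f := HahnSeries.map (Γ := ℤ) (R := 𝕂) f ((frob Fq 𝕂).symm : 𝕂 →+* 𝕂)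
  map_one' := HahnSeries.map_one (Γ := ℤ) (R := 𝕂) ((frob Fq 𝕂).symm : 𝕂 →+* 𝕂).toMonoidWithZeroHom
  map_mul' _ _ := HahnSeries.map_mul (Γ := ℤ) (R := 𝕂)
    (((frob Fq 𝕂).symm : 𝕂 →+* 𝕂) : 𝕂 →ₙ+* 𝕂)
  map_zero' := HahnSeries.map_zero (Γ := ℤ) (R := 𝕂) (((frob Fq 𝕂).symm : 𝕂 →+* 𝕂) : ZeroHom 𝕂 𝕂)
  map_add' _ _ := HahnSeries.map_add (Γ := ℤ) (R := 𝕂) (((frob Fq 𝕂).symm : 𝕂 →+* 𝕂) : 𝕂 →+ 𝕂)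

theorem laurentTwistInv_algebraMap (p : 𝕂[X]) :
    laurentTwistInv Fq 𝕂 (algebraMap 𝕂[X] (LaurentAtInfty 𝕂) p)
      = algebraMap 𝕂[X] (LaurentAtInfty 𝕂) (polyTwistInv Fq 𝕂 p) := by
  have h : (laurentTwistInv Fq 𝕂).comp (algebraMap 𝕂[X] (LaurentAtInfty 𝕂))
      = (algebraMap 𝕂[X] (LaurentAtInfty 𝕂)).comp (polyTwistInv Fq 𝕂) := by
    refine Polynomial.ringHom_ext (fun c => ?_) ?_
    · change HahnSeries.map (Γ := ℤ) (R := 𝕂) (Polynomial.eval₂ (S := LaurentSeries 𝕂)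
          HahnSeries.C (HahnSeries.single (-1 : ℤ) 1) (C c)) ((frob Fq 𝕂).symm : 𝕂 →+* 𝕂)
        = Polynomial.eval₂ (S := LaurentSeries 𝕂) HahnSeries.C (HahnSeries.single (-1 : ℤ) 1)
          (Polynomial.map ((frob Fq 𝕂).symm : 𝕂 →+* 𝕂) (C c))
      rw [Polynomial.map_C, Polynomial.eval₂_C, Polynomial.eval₂_C, HahnSeries.map_C]
    · change HahnSeries.map (Γ := ℤ) (R := 𝕂) (Polynomial.eval₂ (S := LaurentSeries 𝕂)
          HahnSeries.C (HahnSeries.single (-1 : ℤ) 1) X) ((frob Fq 𝕂).symm : 𝕂 →+* 𝕂)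
        = Polynomial.eval₂ (S := LaurentSeries 𝕂) HahnSeries.C (HahnSeries.single (-1 : ℤ) 1)
          (Polynomial.map ((frob Fq 𝕂).symm : 𝕂 →+* 𝕂) X)
      rw [Polynomial.map_X, Polynomial.eval₂_X]
      ext n
      by_cases hn : n = -1 <;> simp [hn]
  exact DFunLike.congr_fun h p

/-- The action `f ⊗ m ↦ f^{(-1)} ⊗ σ m` of `σ` on `𝕂((1/t)) ⊗_{𝕂[t]} M`. -/
def laurentSigma (σ : M →ₛₗ[polyTwistInv Fq 𝕂] M) :
    LaurentAtInfty 𝕂 ⊗[𝕂[X]] M →+ LaurentAtInfty 𝕂 ⊗[𝕂[X]] M :=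
  TensorProduct.liftAddHom
    { toFun := fun f =>
        { toFun := fun m => laurentTwistInv Fq 𝕂 f ⊗ₜ[𝕂[X]] σ m
          map_zero' := by simp
          map_add' := fun _ _ => by simp [TensorProduct.tmul_add] }
      map_zero' := by ext; simp
      map_add' := fun _ _ => by ext; simp [TensorProduct.add_tmul] }
    (fun r f m => by
      simp only [AddMonoidHom.coe_mk, ZeroHom.coe_mk, Algebra.smul_def, map_mul,
        laurentTwistInv_algebraMap, LinearMap.map_smulₛₗ]
      rw [← Algebra.smul_def, TensorProduct.smul_tmul])

/-- `M` is pure: there are a `𝕂[[1/t]]`-lattice `L` of full rank in `𝕂((1/t)) ⊗_{𝕂[t]} M` and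
positive integers `u`, `w` with `t^u L = σ^w L`. -/
def IsPure (σ : M →ₛₗ[polyTwistInv Fq 𝕂] M) : Prop :=
  ∃ L : Submodule (powerSeriesAtInfty 𝕂) (LaurentAtInfty 𝕂 ⊗[𝕂[X]] M),
    L.FG ∧ Submodule.span (LaurentAtInfty 𝕂) (L : Set (LaurentAtInfty 𝕂 ⊗[𝕂[X]] M)) = ⊤ ∧
    ∃ u w : ℕ, 0 < u ∧ 0 < w ∧
      (fun x : LaurentAtInfty 𝕂 ⊗[𝕂[X]] M => (X ^ u : 𝕂[X]) • x) '' (L : Set _) =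
        (laurentSigma σ)^[w] '' (L : Set _)

end DualTMotives

/-! ### Complex multiplication -/

section CM

variable {Fq : Type*} [Field Fq] [Fintype Fq] {𝕂 : Type*} [Field 𝕂] [Algebra Fq 𝕂] [IsAlgClosed 𝕂]
  {K : Type*} [Field K] [Algebra Fq K] [Algebra Fq[X] K] [IsScalarTower Fq Fq[X] K]
  {M : Type*} [AddCommGroup M] [Module 𝕂[X] M]

variable (Fq K) in
/-- `O_K`, the integral closure of `𝔽_q[t]` in `K`. -/
abbrev OK : Type _ := integralClosure Fq[X] K

/-- An `𝔽_q[t]`-algebra embedding `O_K → End_{𝕂[t,σ]}(M)`. -/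
structure OKEmbedding (K : Type*) [Field K] [Algebra Fq[X] K]
    (σ : M →ₛₗ[polyTwistInv Fq 𝕂] M) where
  toRingHom : OK Fq K →+* Module.End 𝕂[X] M
  injective : Function.Injective toRingHom
  map_polynomial : ∀ p : Fq[X], toRingHom (algebraMap Fq[X] (OK Fq K) p)
    = algebraMap 𝕂[X] (Module.End 𝕂[X] M) (p.map (algebraMap Fq 𝕂))
  commutes : ∀ (a : OK Fq K) (m : M), toRingHom a (σ m) = σ (toRingHom a m)

variable (Fq 𝕂 K) in
/-- The ring `O_𝐊 = 𝕂 ⊗_{𝔽_q} O_K`. -/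
abbrev BigO : Type _ := 𝕂 ⊗[Fq] OK Fq K

/-- The action of `O_𝐊` on `M` induced by an embedding `O_K → End(M)`: `(c ⊗ a) m = c (a m)`. -/
def OKEmbedding.action {σ : M →ₛₗ[polyTwistInv Fq 𝕂] M} (φ : OKEmbedding K σ) :
    BigO Fq 𝕂 K →+ Module.End 𝕂[X] M :=
  TensorProduct.liftAddHom
    { toFun := fun c =>
        { toFun := fun a => (C c : 𝕂[X]) • φ.toRingHom a
          map_zero' := by simp
          map_add' := fun _ _ => by simp }
      map_zero' := by ext; simp
      map_add' := fun _ _ => by ext; simp [add_smul] }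
    (fun r c a => by
      have h : r • a = algebraMap Fq[X] (OK Fq K) (C r) * a := by
        rw [← Algebra.smul_def]
        ext
        simp [← algebraMap_smul Fq[X] r]
      simp only [AddMonoidHom.coe_mk, ZeroHom.coe_mk]
      rw [h, map_mul, φ.map_polynomial, Polynomial.map_C, ← Algebra.smul_def, smul_smul,
        ← C_mul, Algebra.smul_def r c, mul_comm c])

/-- The inclusion `O_𝐊 → 𝐊`. -/
def bigOToFun : BigO Fq 𝕂 K →+* FunRing Fq 𝕂 K :=
  (algebraMap (𝕂 ⊗[Fq] K) (FunRing Fq 𝕂 K)).comp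
    (Algebra.TensorProduct.map (AlgHom.id Fq 𝕂)
      ((integralClosure Fq[X] K).val.restrictScalars Fq)).toRingHom

/-- The maximal ideal `𝔓_ξ` of `O_𝐊` corresponding to a point `ξ` of `𝐔 = Spec O_𝐊`: the elements
of `O_𝐊` that vanish at `ξ`. -/
def pointIdeal (ξ : ClosedPoint Fq 𝕂 K) : Ideal (BigO Fq 𝕂 K) :=
  Ideal.span {x | ξ.val (bigOToFun x) < 1}

/-- The ideal `𝔍_Ξ = ∏ 𝔓_ξ ^ m_ξ` for `Ξ = ∑ m_ξ ξ`. -/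
def typeIdeal (Ξ : ClosedPoint Fq 𝕂 K →₀ ℕ) : Ideal (BigO Fq 𝕂 K) :=
  Ξ.prod fun ξ m => pointIdeal ξ ^ m

/-- The subgroup `I · M` of `M` for an ideal `I` of `O_𝐊`. -/
def OKEmbedding.idealMul {σ : M →ₛₗ[polyTwistInv Fq 𝕂] M} (φ : OKEmbedding K σ)
    (I : Ideal (BigO Fq 𝕂 K)) : AddSubgroup M :=
  AddSubgroup.closure {y | ∃ x ∈ I, ∃ m : M, y = φ.action x m}

variable [Algebra (RatFunc Fq) K]

/-- `M` is (the underlying module of) a CM dual `t`-motive with generalized CM type `(K, Ξ)`: there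
are a divisor `W` of `𝐗_{(0)}` and an associated shtuka function `h` such that `M` is isomorphic,
as `𝕂[t,σ]`-module, to `M_{(W,h)} = Γ(𝐔, O(motiveDivisor))`, i.e. to the product over `0 ≤ i < ℓ` of
the modules `Γ(𝐔_{(i)}, O(-W^{(ℓ-i)} + ∑_{1 ≤ j ≤ i} Ξ_{(j)}^{(j-i)}))`, with
`σ (m_0, …, m_{ℓ-1}) = (h m_{ℓ-1}^{(-1)}, m_0^{(-1)}, …, m_{ℓ-2}^{(-1)})`. As `h` is extended by `1`
to the components other than `𝐗_{(0)}`, this action of `σ` is `m ↦ h m^{(-1)}` in `𝐊`. -/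
def IsCMWithType (abv : AbsoluteValue 𝕂 ℝ) (ι : ConstField Fq K →ₐ[Fq] 𝕂)
    (Ξ : ClosedPoint Fq 𝕂 K →₀ ℕ) (σ : M →ₛₗ[polyTwistInv Fq 𝕂] M) : Prop :=
  ∃ (W : Divisor Fq 𝕂 K) (h : FunRing Fq 𝕂 K), IsShtukaFunction abv ι Ξ W h ∧
    ∃ Θ : M ≃+ affineSections (motiveDivisor ι Ξ W),
      (∀ (c : 𝕂) (m : M), (Θ ((C c : 𝕂[X]) • m) : FunRing Fq 𝕂 K) = const Fq c * (Θ m : FunRing Fq 𝕂 K)) ∧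
      (∀ m : M, (Θ ((X : 𝕂[X]) • m) : FunRing Fq 𝕂 K) = tFun Fq 𝕂 K * (Θ m : FunRing Fq 𝕂 K)) ∧
      ∀ m : M, (Θ (σ m) : FunRing Fq 𝕂 K) = h * funTwist Fq 𝕂 K (-1) (Θ m : FunRing Fq 𝕂 K)

end CM

end CMMotive

end

noncomputable section

namespace CMMotive

/-! ### The ring `O_𝐊` -/

section BigORing

variable {Fq : Type*} [Field Fq] [Fintype Fq] {𝕂 : Type*} [Field 𝕂] [Algebra Fq 𝕂]
  {L : Type*} [Field L] [Algebra Fq L] [Algebra Fq[X] L] [Algebra (RatFunc Fq) L]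
  [IsScalarTower Fq Fq[X] L] [IsScalarTower Fq (RatFunc Fq) L] [IsScalarTower Fq[X] (RatFunc Fq) L]
  [FiniteDimensional (RatFunc Fq) L] [Algebra.IsSeparable (RatFunc Fq) L]

/-! The motive has rank one over the total ring of fractions 𝐊. It is therefore a fractional ideal
of 𝐊 on which σ acts as m ↦ f m^{(-1)} for a unit f, and the proof computes the divisor of f and
solves for W.

Embedding. The kernel of O_𝐊 → End(M) is stable under the inverse twist, since (t - θ)^N M ⊂ σM and
M is torsion free over 𝕂[t]. A nonzero ideal stable in this way contains some 1 ⊗ a with a ≠ 0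
(`exists_one_tmul_mem`), which is impossible because O_K acts faithfully; so O_𝐊 acts faithfully.
The same descent shows that O_𝐊 is reduced, hence some vector v has zero annihilator
(`exists_faithful_vector`). As M and O_𝐊 v have the same rank over 𝕂[t], the quotient is torsion,
and v ↦ 1 extends to an embedding M → 𝐊 (`Realization`). A further rescaling makes f equal to 1
outside 𝐗_{(0)} (`exists_normalizing_unit`), as is required of a shtuka function.

Affine part. The points of 𝐔 are the 𝕂-algebra homomorphisms O_𝐊 → 𝕂, and each of their kernels is
locally generated by one regular element. Consequently M = Γ(𝐔, O(D)) for a divisor D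
(`exists_attains`, `Attains.mem_iff`), and σM = 𝔍_Ξ M becomes ord_P f = D(P^{(1)}) - D(P) + Ξ(P)
(`Realization.val_mult`). With W = -D^{(-ℓ)} on the affine part of 𝐗_{(0)}, telescoping this
relation along ℓ twists gives the divisor equation there; telescoping along fewer twists identifies
D with the divisor of M_{(W,h)} on the other components.

Infinity. Here the equation prescribes W^{(ℓ)} - W, which is solvable exactly when the prescribed
function has sum zero on the Frobenius orbits (`exists_potential`). So the pole orders of f and the
coefficients of I_Ξ must have equal orbit sums. For f this is purity: σ^{wn} raises degrees in t by
un up to a bounded error. Counting dimensions gives w dim(M/σM) = u rank M with dim(M/σM) = deg Ξ,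
and the growth of valuations along the orbit of P then gives rank M times the sum of pole orders as
deg Ξ times the orbit length times the pole order of t (`Realization.orbit_sum_mult`).

For I_Ξ the CM hypotheses enter. Over the totally real field K⁺, the embeddings K⁺ → 𝕂 with t ↦ θ
correspond bijectively to the places above ∞. Since each such place has a unique extension to K, the
place induced by ∞̄_ξ is determined by the restriction of ν_ξ to K⁺. The constant weight of Ξ over
J_{K⁺} and the identity e f [K⁺ : 𝔽_q(t)] = [K : 𝔽_q(t)] then give the same orbit sum
(`IsCMField.orbit_sum_inftyDivisor`). -/

instance okIsFractionRing : IsFractionRing (OK Fq L) L :=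
  integralClosure.isFractionRing_of_finite_extension (RatFunc Fq) L

instance okFinite : Module.Finite Fq[X] (OK Fq L) :=
  have := IsIntegralClosure.isNoetherian Fq[X] (RatFunc Fq) L (OK Fq L)
  Module.IsNoetherian.finite _ _

instance okDedekind : IsDedekindDomain (OK Fq L) :=
  IsIntegralClosure.isDedekindDomain Fq[X] (RatFunc Fq) L _

theorem algebraMap_polynomial_injective : Function.Injective (algebraMap Fq[X] L) := by
  rw [IsScalarTower.algebraMap_eq Fq[X] (RatFunc Fq) L]
  exact (algebraMap (RatFunc Fq) L).injective.comp (IsFractionRing.injective Fq[X] (RatFunc Fq))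

instance okFaithful : FaithfulSMul Fq[X] (OK Fq L) := by
  rw [faithfulSMul_iff_algebraMap_injective]
  intro a b h
  exact algebraMap_polynomial_injective (L := L) (congrArg Subtype.val h)

instance okTorsionFree : Module.IsTorsionFree Fq[X] (OK Fq L) :=
  Module.isTorsionFree_iff_faithfulSMul.2 inferInstance

instance okFree : Module.Free Fq[X] (OK Fq L) := inferInstance

instance torsionFreePolynomial : Module.IsTorsionFree Fq[X] L :=
  Module.isTorsionFree_iff_faithfulSMul.2
    ((faithfulSMul_iff_algebraMap_injective _ _).2 algebraMap_polynomial_injective)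

theorem finrank_ok : Module.finrank Fq[X] (OK Fq L) = Module.finrank (RatFunc Fq) L :=
  (IsIntegralClosure.rank Fq[X] (RatFunc Fq) L (OK Fq L))

instance bigOPolyAlgebra : Algebra 𝕂[X] (BigO Fq 𝕂 L) :=
  (aeval ((1 : 𝕂) ⊗ₜ[Fq] algebraMap Fq[X] (OK Fq L) X)).toAlgebra

theorem algebraMap_bigO_X : algebraMap 𝕂[X] (BigO Fq 𝕂 L) X = 1 ⊗ₜ algebraMap Fq[X] (OK Fq L) X :=
  aeval_X _

theorem algebraMap_bigO_C (c : 𝕂) : algebraMap 𝕂[X] (BigO Fq 𝕂 L) (C c) = c ⊗ₜ 1 :=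
  aeval_C _ c

instance bigOTower : IsScalarTower 𝕂 𝕂[X] (BigO Fq 𝕂 L) :=
  IsScalarTower.of_algebraMap_eq fun c => (algebraMap_bigO_C c).symm

theorem algebraMap_bigO_map (p : Fq[X]) : algebraMap 𝕂[X] (BigO Fq 𝕂 L) (p.map (algebraMap Fq 𝕂))
    = 1 ⊗ₜ algebraMap Fq[X] (OK Fq L) p := by
  have h : ((algebraMap 𝕂[X] (BigO Fq 𝕂 L)).comp (mapRingHom (algebraMap Fq 𝕂)))
      = (Algebra.TensorProduct.includeRight : OK Fq L →ₐ[Fq] BigO Fq 𝕂 L).toRingHom.comp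
        (algebraMap Fq[X] (OK Fq L)) := by
    refine Polynomial.ringHom_ext (fun a => ?_) ?_
    · have e : algebraMap Fq[X] (OK Fq L) (C a) = algebraMap Fq (OK Fq L) a :=
        (IsScalarTower.algebraMap_apply Fq Fq[X] (OK Fq L) a).symm
      simp only [RingHom.comp_apply, coe_mapRingHom, map_C, algebraMap_bigO_C, e]
      simp [Algebra.algebraMap_eq_smul_one, TensorProduct.smul_tmul']
    · simp [algebraMap_bigO_X]
  exact DFunLike.congr_fun h p

-- By transitivity of base change O_𝐊 is the pushout 𝕂[t] ⊗_{𝔽_q[t]} O_L, so an 𝔽_q[t]-basis of O_L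
-- serves as a 𝕂[t]-basis.
attribute [local instance] Algebra.TensorProduct.rightAlgebra Polynomial.algebra in
theorem exists_bigO_basis :
    Nonempty (Module.Basis (Fin (Module.finrank (RatFunc Fq) L)) 𝕂[X] (BigO Fq 𝕂 L)) := by
  let b := Module.finBasis Fq[X] (OK Fq L)
  let _ : Algebra Fq[X] (BigO Fq 𝕂 L) :=
    ((algebraMap (OK Fq L) (BigO Fq 𝕂 L)).comp (algebraMap Fq[X] (OK Fq L))).toAlgebra
  have : IsScalarTower Fq[X] (OK Fq L) (BigO Fq 𝕂 L) := IsScalarTower.of_algebraMap_eq fun _ => rfl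
  have : IsScalarTower Fq[X] 𝕂[X] (BigO Fq 𝕂 L) := IsScalarTower.of_algebraMap_eq fun p =>
    (algebraMap_bigO_map p).symm
  have : IsScalarTower Fq 𝕂[X] (BigO Fq 𝕂 L) := IsScalarTower.of_algebraMap_eq fun a => by
    rw [IsScalarTower.algebraMap_apply Fq 𝕂 𝕂[X], IsScalarTower.algebraMap_apply Fq 𝕂 (BigO Fq 𝕂 L),
      IsScalarTower.algebraMap_apply 𝕂 𝕂[X] (BigO Fq 𝕂 L)]
  have h : Algebra.IsPushout Fq[X] (OK Fq L) 𝕂[X] (BigO Fq 𝕂 L) :=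
    (Algebra.IsPushout.comp_iff (R := Fq) (S := Fq[X]) (T := OK Fq L) (R' := 𝕂) (S' := 𝕂[X])
      (T' := BigO Fq 𝕂 L)).1 inferInstance
  have h2 := h.symm.out
  exact ⟨(h2.basis b).reindex (finCongr finrank_ok)⟩

instance bigOFree : Module.Free 𝕂[X] (BigO Fq 𝕂 L) :=
  Module.Free.of_basis (exists_bigO_basis (Fq := Fq) (𝕂 := 𝕂) (L := L)).some

instance bigOFinite : Module.Finite 𝕂[X] (BigO Fq 𝕂 L) :=
  Module.Finite.of_basis (exists_bigO_basis (Fq := Fq) (𝕂 := 𝕂) (L := L)).some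

theorem finrank_bigO : Module.finrank 𝕂[X] (BigO Fq 𝕂 L) = Module.finrank (RatFunc Fq) L := by
  simpa using Module.finrank_eq_card_basis (exists_bigO_basis (Fq := Fq) (𝕂 := 𝕂) (L := L)).some

instance bigONoetherian : IsNoetherianRing (BigO Fq 𝕂 L) :=
  isNoetherian_of_isNoetherianRing_of_finite 𝕂[X] _ |> fun h => isNoetherian_of_tower 𝕂[X] h

instance bigONontrivial : Nontrivial (BigO Fq 𝕂 L) := inferInstance

theorem algebraMap_bigO_injective : Function.Injective (algebraMap 𝕂[X] (BigO Fq 𝕂 L)) :=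
  FaithfulSMul.algebraMap_injective _ _

theorem algebraMap_bigO_mem_nonZeroDivisors {p : 𝕂[X]} (hp : p ≠ 0) :
    algebraMap 𝕂[X] (BigO Fq 𝕂 L) p ∈ nonZeroDivisors (BigO Fq 𝕂 L) := by
  rw [mem_nonZeroDivisors_iff_right]
  intro x hx
  rw [mul_comm, ← Algebra.smul_def] at hx
  exact (smul_eq_zero.1 hx).resolve_left hp

/-- Every regular element of `O_𝐊` divides a nonzero polynomial in `t`. -/
theorem exists_mul_eq_polynomial {b : BigO Fq 𝕂 L} (hb : b ∈ nonZeroDivisors (BigO Fq 𝕂 L)) :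
    ∃ p : 𝕂[X], p ≠ 0 ∧ ∃ b', b * b' = algebraMap 𝕂[X] _ p := by
  obtain ⟨f, hf, hfb⟩ := Algebra.IsIntegral.isIntegral (R := 𝕂[X]) b
  have hne : f ≠ 0 := hf.ne_zero
  -- Induction on the degree of an equation for b. A vanishing constant term allows b to be
  -- cancelled, because b is regular; a nonzero one is itself a multiple of b.
  have key : ∀ (n : ℕ) (f : 𝕂[X][X]), f.natDegree ≤ n → f ≠ 0 → aeval b f = 0 →
      ∃ p : 𝕂[X], p ≠ 0 ∧ ∃ b', b * b' = algebraMap 𝕂[X] _ p := by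
    intro n
    induction n with
    | zero =>
      intro f hn hf h0
      rw [eq_C_of_natDegree_le_zero hn, aeval_C] at h0
      refine absurd ?_ hf
      rw [eq_C_of_natDegree_le_zero hn, algebraMap_bigO_injective (h0.trans (map_zero _).symm), C_0]
    | succ n ih =>
      intro f hn hf h0
      have hdiv : b * aeval b f.divX + algebraMap 𝕂[X] _ (f.coeff 0) = 0 := by
        rw [← h0]
        conv_rhs => rw [← X_mul_divX_add f]
        rw [map_add, map_mul, aeval_X, aeval_C]
      by_cases hc : f.coeff 0 = 0
      · rw [hc, map_zero, add_zero, mul_comm] at hdiv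
        refine ih f.divX (by rw [natDegree_divX_eq_natDegree_tsub_one]; omega) ?_
          ((mem_nonZeroDivisors_iff_right.1 hb) _ hdiv)
        intro h
        apply hf
        rw [← X_mul_divX_add f, h, hc]
        simp
      · exact ⟨_, hc, -aeval b f.divX, by rw [mul_neg]; exact neg_eq_of_add_eq_zero_right hdiv⟩
  exact key _ f le_rfl hne hfb

/-- The inclusion of `O_𝐊` in `𝕂 ⊗ L`. -/
def bigOToTensor : BigO Fq 𝕂 L →ₐ[𝕂] 𝕂 ⊗[Fq] L :=
  Algebra.TensorProduct.map (AlgHom.id 𝕂 𝕂) ((integralClosure Fq[X] L).val.restrictScalars Fq)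

theorem bigOToTensor_injective : Function.Injective (bigOToTensor : BigO Fq 𝕂 L →ₐ[𝕂] 𝕂 ⊗[Fq] L) := by
  have := Module.Flat.lTensor_preserves_injective_linearMap (M := 𝕂)
    (((integralClosure Fq[X] L).val.restrictScalars Fq).toLinearMap) Subtype.val_injective
  exact this

theorem bigOToFun_apply (b : BigO Fq 𝕂 L) : bigOToFun b = algebraMap _ _ (bigOToTensor b) := rfl

theorem exists_denominator (y : 𝕂 ⊗[Fq] L) :
    ∃ d : OK Fq L, d ≠ 0 ∧ ∃ b : BigO Fq 𝕂 L, (1 ⊗ₜ (d : L)) * y = bigOToTensor b := by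
  induction y using TensorProduct.induction_on with
  | zero => exact ⟨1, one_ne_zero, 0, by simp⟩
  | tmul c a =>
    obtain ⟨x, d, hd, rfl⟩ := IsFractionRing.div_surjective (A := OK Fq L) a
    refine ⟨d, nonZeroDivisors.ne_zero hd, c ⊗ₜ x, ?_⟩
    have : (d : L) ≠ 0 := by simpa using nonZeroDivisors.ne_zero hd
    simp only [Algebra.TensorProduct.tmul_mul_tmul, one_mul, bigOToTensor, Algebra.TensorProduct.map_tmul]
    congr 1
    exact mul_div_cancel₀ _ this
  | add y z hy hz =>
    obtain ⟨d, hd, b, hb⟩ := hy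
    obtain ⟨e, he, c, hc⟩ := hz
    refine ⟨d * e, mul_ne_zero hd he, (1 ⊗ₜ e) * b + (1 ⊗ₜ d) * c, ?_⟩
    rw [map_add, map_mul, map_mul, ← hb, ← hc]
    have h1 : (bigOToTensor ((1 : 𝕂) ⊗ₜ[Fq] e)) = (1 : 𝕂) ⊗ₜ[Fq] (e : L) := by simp [bigOToTensor]
    have h2 : (bigOToTensor ((1 : 𝕂) ⊗ₜ[Fq] d)) = (1 : 𝕂) ⊗ₜ[Fq] (d : L) := by simp [bigOToTensor]
    have h3 : (1 : 𝕂) ⊗ₜ[Fq] ((d * e : OK Fq L) : L) = ((1 : 𝕂) ⊗ₜ[Fq] (d : L)) * ((1 : 𝕂) ⊗ₜ[Fq] (e : L)) := by simp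
    rw [h1, h2, h3]
    ring

theorem one_tmul_isUnit {d : L} (hd : d ≠ 0) : IsUnit ((1 : 𝕂) ⊗ₜ[Fq] d) :=
  IsUnit.of_mul_eq_one ((1 : 𝕂) ⊗ₜ[Fq] d⁻¹) (by
    simp [mul_inv_cancel₀ hd, Algebra.TensorProduct.one_def])

instance bigOFunAlgebra : Algebra (BigO Fq 𝕂 L) (FunRing Fq 𝕂 L) := bigOToFun.toAlgebra

theorem bigOToTensor_mem_nonZeroDivisors {b : BigO Fq 𝕂 L} :
    bigOToTensor b ∈ nonZeroDivisors (𝕂 ⊗[Fq] L) ↔ b ∈ nonZeroDivisors (BigO Fq 𝕂 L) := by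
  simp only [mem_nonZeroDivisors_iff_right]
  constructor
  · intro h x hx
    apply bigOToTensor_injective
    rw [map_zero]
    exact h _ (by rw [← map_mul, hx, map_zero])
  · intro h y hy
    obtain ⟨d, hd, c, hc⟩ := exists_denominator y
    have h1 : c = 0 := h _ (bigOToTensor_injective (by
      rw [map_mul, ← hc, mul_assoc, hy, mul_zero, map_zero]))
    rw [h1, map_zero] at hc
    exact ((one_tmul_isUnit (𝕂 := 𝕂) (Fq := Fq) (d := (d : L)) (by simpa using hd)).mul_right_eq_zero).1 hc

theorem one_tmul_regular {d : OK Fq L} (hd : d ≠ 0) :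
    (1 : 𝕂) ⊗ₜ[Fq] d ∈ nonZeroDivisors (BigO Fq 𝕂 L) := by
  rw [← bigOToTensor_mem_nonZeroDivisors]
  have : bigOToTensor ((1 : 𝕂) ⊗ₜ[Fq] d) = (1 : 𝕂) ⊗ₜ[Fq] (d : L) := by simp [bigOToTensor]
  rw [this]
  exact (one_tmul_isUnit (by simpa using hd)).mem_nonZeroDivisors

/-- Elements of 𝕂 ⊗ L acquire denominators 1 ⊗ d with d in O_L, and these are already units in 𝕂 ⊗
L; so both rings have the same total ring of fractions. Valuations of 𝐊 can therefore be studied on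
O_𝐊. -/
instance bigOIsFractionRing : IsFractionRing (BigO Fq 𝕂 L) (FunRing Fq 𝕂 L) where
  map_units := by
    rintro ⟨b, hb⟩
    change IsUnit (algebraMap (𝕂 ⊗[Fq] L) (FunRing Fq 𝕂 L) (bigOToTensor b))
    exact IsLocalization.map_units (FunRing Fq 𝕂 L) (⟨_, bigOToTensor_mem_nonZeroDivisors.2 hb⟩ :
      nonZeroDivisors (𝕂 ⊗[Fq] L))
  surj := by
    intro x
    obtain ⟨⟨y, z⟩, hyz⟩ := IsLocalization.surj (nonZeroDivisors (𝕂 ⊗[Fq] L)) x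
    obtain ⟨d, hd, b, hb⟩ := exists_denominator y
    obtain ⟨e, he, c, hc⟩ := exists_denominator (z : 𝕂 ⊗[Fq] L)
    have hd' : (1 : 𝕂) ⊗ₜ[Fq] (d : L) = bigOToTensor ((1 : 𝕂) ⊗ₜ[Fq] d) := by simp [bigOToTensor]
    have he' : (1 : 𝕂) ⊗ₜ[Fq] (e : L) = bigOToTensor ((1 : 𝕂) ⊗ₜ[Fq] e) := by simp [bigOToTensor]
    have hreg : (1 ⊗ₜ d) * c ∈ nonZeroDivisors (BigO Fq 𝕂 L) := by
      rw [← bigOToTensor_mem_nonZeroDivisors, map_mul, ← hc, ← hd']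
      exact mul_mem (one_tmul_isUnit (by simpa using hd)).mem_nonZeroDivisors
        (mul_mem (one_tmul_isUnit (by simpa using he)).mem_nonZeroDivisors z.2)
    have hyz' : x * algebraMap (𝕂 ⊗[Fq] L) (FunRing Fq 𝕂 L) z
        = algebraMap (𝕂 ⊗[Fq] L) (FunRing Fq 𝕂 L) y := hyz
    have key : x * algebraMap (𝕂 ⊗[Fq] L) (FunRing Fq 𝕂 L) (bigOToTensor ((1 ⊗ₜ d) * c))
        = algebraMap (𝕂 ⊗[Fq] L) (FunRing Fq 𝕂 L) (bigOToTensor ((1 ⊗ₜ e) * b)) := by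
      rw [map_mul bigOToTensor, map_mul bigOToTensor, ← hc, ← hb, ← hd', ← he']
      simp only [map_mul (algebraMap (𝕂 ⊗[Fq] L) (FunRing Fq 𝕂 L)), ← hyz']
      ring
    refine ⟨((1 ⊗ₜ e) * b, ⟨_, hreg⟩), ?_⟩
    exact key
  exists_of_eq := by
    intro x y h
    refine ⟨1, ?_⟩
    rw [bigOToTensor_injective (IsFractionRing.injective (𝕂 ⊗[Fq] L) (FunRing Fq 𝕂 L) h)]

end BigORing

/-! ### Valuations with a given center -/

section Center

variable {Fq : Type*} [Field Fq] {𝕂 : Type*} [Field 𝕂] [Algebra Fq 𝕂]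
  {B : Type*} [CommRing B] [Algebra 𝕂 B]

/-- The valuation `w` on a `𝕂`-algebra `B` is centered at the kernel of `χ : B → 𝕂`. -/
structure IsCentered (w : Valuation B ℤᵐ⁰) (χ : B →ₐ[𝕂] 𝕂) : Prop where
  eq_one : ∀ b, χ b ≠ 0 → w b = 1
  lt_one : ∀ b, χ b = 0 → w b < 1

/-- The kernel of `χ` is locally generated by the regular element `π`. -/
structure IsLocalParam (χ : B →ₐ[𝕂] 𝕂) (π : B) : Prop where
  regular : π ∈ nonZeroDivisors B
  map_eq_zero : χ π = 0
  exists_mul : ∀ b, χ b = 0 → ∃ u b', χ u ≠ 0 ∧ u * b = π * b'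

variable {w : Valuation B ℤᵐ⁰} {χ : B →ₐ[𝕂] 𝕂} {π : B}

theorem IsCentered.le_one (h : IsCentered w χ) (b : B) : w b ≤ 1 := by
  by_cases hb : χ b = 0
  · exact (h.lt_one b hb).le
  · exact (h.eq_one b hb).le

theorem IsCentered.lt_one_iff (h : IsCentered w χ) {b : B} : w b < 1 ↔ χ b = 0 :=
  ⟨fun hb => by_contra fun hc => hb.ne (h.eq_one b hc), h.lt_one b⟩

theorem IsCentered.eq_one_iff (h : IsCentered w χ) {b : B} : w b = 1 ↔ χ b ≠ 0 :=
  ⟨fun hb hc => (h.lt_one b hc).ne hb, h.eq_one b⟩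

/-- If every element lies, up to constants, in the center of `w`, then `w` is centered at `χ`. -/
theorem IsCentered.of_sub_lt_one (h0 : ∀ c : 𝕂, c ≠ 0 → w (algebraMap 𝕂 B c) = 1)
    (h : ∀ b, w (b - algebraMap 𝕂 B (χ b)) < 1) : IsCentered w χ where
  eq_one b hb := by
    have := Valuation.map_add_eq_of_lt_right w (x := b - algebraMap 𝕂 B (χ b))
      (y := algebraMap 𝕂 B (χ b)) (by rw [h0 _ hb]; exact h b)
    rwa [sub_add_cancel, h0 _ hb] at this
  lt_one b hb := by simpa [hb] using h b

/-- Divide b by π, locally at χ, as long as possible. As B need not be a domain, the division may go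
on forever for b ≠ 0; this happens when b vanishes on the component through the point. -/
theorem IsLocalParam.dichotomy (hπ : IsLocalParam χ π) (b : B) :
    (∃ k u u', χ u ≠ 0 ∧ χ u' ≠ 0 ∧ u * b = π ^ k * u') ∨
      ∀ k : ℕ, ∃ u b', χ u ≠ 0 ∧ u * b = π ^ k * b' := by
  by_cases h : ∃ k u u', χ u ≠ 0 ∧ χ u' ≠ 0 ∧ u * b = π ^ k * u'
  · exact Or.inl h
  · right
    intro k
    induction k with
    | zero => exact ⟨1, b, by simp, by simp⟩
    | succ k ih =>
      obtain ⟨u, b', hu, hb⟩ := ih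
      have hb' : χ b' = 0 := by
        by_contra hne
        exact h ⟨k, u, b', hu, hne, hb⟩
      obtain ⟨u', c, hu', hc⟩ := hπ.exists_mul b' hb'
      refine ⟨u' * u, c, by simp [hu, hu'], ?_⟩
      rw [mul_assoc, hb, mul_left_comm, hc]
      ring

theorem IsCentered.map_eq_pow (h : IsCentered w χ) {b u u' : B} {k : ℕ} (hu : χ u ≠ 0)
    (hu' : χ u' ≠ 0) (hb : u * b = π ^ k * u') : w b = w π ^ k := by
  have := congrArg w hb
  rwa [map_mul, map_mul, map_pow, h.eq_one u hu, h.eq_one u' hu', one_mul, mul_one] at this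

theorem IsCentered.map_le_pow (h : IsCentered w χ) {b u b' : B} {k : ℕ} (hu : χ u ≠ 0)
    (hb : u * b = π ^ k * b') : w b ≤ w π ^ k := by
  have := congrArg w hb
  rw [map_mul, map_mul, map_pow, h.eq_one u hu, one_mul] at this
  rw [this]
  exact mul_le_of_le_one_right' (h.le_one b')

theorem eq_zero_of_forall_le_pow {x y : ℤᵐ⁰} (hx : x < 1) (h : ∀ k : ℕ, y ≤ x ^ k) : y = 0 := by
  by_contra hy
  have hx0 : x ≠ 0 := by
    rintro rfl
    exact hy (le_antisymm (by simpa using h 1) zero_le)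
  obtain ⟨a, rfl⟩ : ∃ a : ℤ, x = WithZero.exp a := ⟨_, (WithZero.exp_log hx0).symm⟩
  obtain ⟨c, rfl⟩ : ∃ c : ℤ, y = WithZero.exp c := ⟨_, (WithZero.exp_log hy).symm⟩
  have ha : a ≤ -1 := by
    rw [← WithZero.exp_zero, WithZero.exp_lt_exp] at hx
    omega
  have := h (c.natAbs + 1)
  rw [← WithZero.exp_nsmul, WithZero.exp_le_exp] at this
  simp only [nsmul_eq_mul] at this
  push_cast at this
  nlinarith [abs_nonneg c, neg_abs_le c]

/-- Which alternative holds, and with which k, depends on χ and b only. Hence a valuation centered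
at χ is determined by its value at π. -/
theorem IsLocalParam.eq_pow_or_eq_zero (hπ : IsLocalParam χ π) (b : B) :
    (∃ k : ℕ, ∀ w : Valuation B ℤᵐ⁰, IsCentered w χ → w b = w π ^ k) ∨
      ∀ w : Valuation B ℤᵐ⁰, IsCentered w χ → w b = 0 := by
  rcases hπ.dichotomy b with ⟨k, u, u', hu, hu', hb⟩ | h
  · exact Or.inl ⟨k, fun w hw => hw.map_eq_pow hu hu' hb⟩
  · refine Or.inr fun w hw => eq_zero_of_forall_le_pow (hw.lt_one π hπ.map_eq_zero) fun k => ?_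
    obtain ⟨u, b', hu, hb⟩ := h k
    exact hw.map_le_pow hu hb

theorem exp_neg_one_pow (k : ℕ) : (WithZero.exp (-1 : ℤ) : ℤᵐ⁰) ^ k = WithZero.exp (-(k : ℤ)) := by
  rw [← WithZero.exp_nsmul]; simp

/-- An element of valuation at most `exp (-k)` is locally divisible by `π ^ k`. -/
theorem IsCentered.exists_mul_eq_pow (h : IsCentered w χ) (hπ : IsLocalParam χ π)
    (h1 : w π = WithZero.exp (-1)) {b : B} {k : ℕ} (hb : w b ≤ WithZero.exp (-(k : ℤ))) :
    ∃ u b', χ u ≠ 0 ∧ u * b = π ^ k * b' := by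
  rcases hπ.dichotomy b with ⟨l, u, u', hu, hu', hb'⟩ | h'
  · rw [h.map_eq_pow hu hu' hb', h1, exp_neg_one_pow, WithZero.exp_le_exp] at hb
    obtain ⟨m, rfl⟩ := Nat.exists_eq_add_of_le (show k ≤ l by omega)
    exact ⟨u, π ^ m * u', hu, by rw [hb', pow_add, mul_assoc]⟩
  · exact h' k

/-- `x` is locally divisible by `y` if its valuation is smaller. -/
theorem IsCentered.exists_mul_eq_mul (h : IsCentered w χ) (hπ : IsLocalParam χ π)
    (h1 : w π = WithZero.exp (-1)) {x y : B} (hy : w y ≠ 0) (hxy : w x ≤ w y) :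
    ∃ s a, χ s ≠ 0 ∧ s * x = a * y := by
  rcases hπ.dichotomy y with ⟨k, u, u', hu, hu', hyk⟩ | h'
  · rw [h.map_eq_pow hu hu' hyk, h1, exp_neg_one_pow] at hxy
    obtain ⟨v, x', hv, hx'⟩ := h.exists_mul_eq_pow hπ h1 hxy
    refine ⟨u' * v, u * x', by simp [hu', hv], ?_⟩
    linear_combination u' * hx' - x' * hyk
  · refine absurd (eq_zero_of_forall_le_pow (h.lt_one π hπ.map_eq_zero) fun k => ?_) hy
    obtain ⟨u, b', hu, hb⟩ := h' k
    exact h.map_le_pow hu hb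

end Center

/-! ### Discrete valuations from locally principal maximal ideals. -/

section LocalRing

variable {𝕂 : Type*} [Field 𝕂] {B : Type*} [CommRing B] [Algebra 𝕂 B] [IsNoetherianRing B]
  {F : Type*} [CommRing F] [Algebra B F] [IsFractionRing B F]
  {χ : B →ₐ[𝕂] 𝕂} {π : B}

/-- A valuation on the total ring of fractions `F` of a noetherian ring `B` is obtained from a
maximal ideal which is locally generated by a regular element. -/
theorem exists_valuation_of_isLocalParam (hπ : IsLocalParam χ π) :
    ∃ w : Valuation F ℤᵐ⁰, Function.Surjective w ∧ IsCentered (w.comap (algebraMap B F)) χ := by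
  let 𝔫 : Ideal B := RingHom.ker χ
  have hprime : 𝔫.IsPrime := RingHom.ker_isPrime χ
  let R := Localization.AtPrime 𝔫
  let ι := algebraMap B R
  have hreg : ∀ b ∈ nonZeroDivisors B, ι b ∈ nonZeroDivisors R := by
    intro b hb
    exact IsLocalization.map_nonZeroDivisors_le 𝔫.primeCompl R ⟨b, hb, rfl⟩
  have hπr : ι π ∈ nonZeroDivisors R := hreg _ hπ.regular
  have hmax : IsLocalRing.maximalIdeal R = Ideal.span {ι π} := by
    rw [← Localization.AtPrime.map_eq_maximalIdeal]
    apply le_antisymm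
    · rw [Ideal.map_le_iff_le_comap]
      intro b hb
      obtain ⟨u, b', hu, h⟩ := hπ.exists_mul b hb
      rw [Ideal.mem_comap, Ideal.mem_span_singleton]
      have hunit : IsUnit (ι u) := IsLocalization.map_units R (⟨u, hu⟩ : 𝔫.primeCompl)
      rw [← hunit.dvd_mul_left]
      exact ⟨ι b', by rw [← map_mul, ← map_mul, h]⟩
    · rw [Ideal.span_singleton_le_iff_mem]
      exact Ideal.mem_map_of_mem _ hπ.map_eq_zero
  have hπm : ¬ IsUnit (ι π) := fun h => by
    have : ι π ∈ IsLocalRing.maximalIdeal R := by rw [hmax]; exact Ideal.mem_span_singleton_self _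
    exact (IsLocalRing.mem_maximalIdeal _).1 this h
  -- By Krull's intersection theorem only finitely many powers of π divide x. That R is a domain is
  -- not known at this point and is deduced from the factorization.
  have hfac : ∀ x : R, x ≠ 0 → ∃ n : ℕ, ∃ u : Rˣ, x = ι π ^ n * u := by
    intro x hx
    have hex : ∃ n : ℕ, ¬ ι π ^ n ∣ x := by
      by_contra! hall
      apply hx
      have : x ∈ (⨅ i : ℕ, IsLocalRing.maximalIdeal R ^ i) := by
        rw [Ideal.mem_iInf]
        intro i
        rw [hmax, Ideal.span_singleton_pow, Ideal.mem_span_singleton]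
        exact hall i
      rwa [Ideal.iInf_pow_eq_bot_of_isLocalRing _ (IsLocalRing.maximalIdeal.isMaximal R).ne_top]
        at this
    classical
    have h0 : Nat.find hex ≠ 0 := by
      intro h
      have := Nat.find_spec hex
      rw [h] at this
      simp at this
    obtain ⟨n, hn⟩ := Nat.exists_eq_succ_of_ne_zero h0
    have hlt : ι π ^ n ∣ x := not_not.1 (Nat.find_min hex (by omega))
    obtain ⟨y, hy⟩ := hlt
    have hyu : IsUnit y := by
      by_contra hyn
      have : y ∈ IsLocalRing.maximalIdeal R := (IsLocalRing.mem_maximalIdeal _).2 hyn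
      rw [hmax, Ideal.mem_span_singleton] at this
      obtain ⟨z, hz⟩ := this
      apply Nat.find_spec hex
      rw [hn]
      exact ⟨z, by rw [hy, hz, Nat.succ_eq_add_one, pow_succ, mul_assoc]⟩
    exact ⟨n, hyu.unit, hy⟩
  have hdom : IsDomain R := by
    have : NoZeroDivisors R := ⟨fun {x y} hxy => by
      by_contra! hne
      obtain ⟨n, u, hu⟩ := hfac x hne.1
      obtain ⟨m, v, hv⟩ := hfac y hne.2
      have : ι π ^ (n + m) * (u * v) = 0 := by rw [← hxy, hu, hv]; ring
      have h2 : ι π ^ (n + m) = 0 := by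
        rwa [← Units.val_mul, Units.mul_left_eq_zero] at this
      exact one_ne_zero ((mem_nonZeroDivisors_iff_right.1 (pow_mem hπr (n + m))) 1
        (by rw [h2, mul_zero]))⟩
    exact NoZeroDivisors.to_isDomain R
  have hπ0 : ι π ≠ 0 := nonZeroDivisors.ne_zero hπr
  have hprim : Prime (ι π) := by
    rw [← Ideal.span_singleton_prime hπ0, ← hmax]
    exact (IsLocalRing.maximalIdeal.isMaximal R).isPrime
  have hdvr : IsDiscreteValuationRing R :=
    IsDiscreteValuationRing.ofHasUnitMulPowIrreducibleFactorization
      ⟨ι π, hprim.irreducible, fun {x} hx => by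
        obtain ⟨n, u, hu⟩ := hfac x hx
        exact ⟨n, u, hu.symm⟩⟩
  let E := FractionRing R
  let v := IsDiscreteValuationRing.maximalIdeal R
  -- Regular elements of B remain nonzero in R, so F maps to the fraction field of R. The kernel of
  -- this map becomes the support of the valuation and singles out a component.
  let g : F →+* E := IsLocalization.lift (M := nonZeroDivisors B) (S := F)
    (g := (algebraMap R E).comp ι) (fun y => by
      have : algebraMap R E (ι y) ≠ 0 := by
        simpa using nonZeroDivisors.ne_zero (hreg y y.2)
      exact this.isUnit)
  have hg : ∀ b, g (algebraMap B F b) = algebraMap R E (ι b) := fun b =>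
    IsLocalization.lift_eq _ b
  have hval : ∀ b, (v.valuation E).comap g (algebraMap B F b) = v.intValuation (ι b) := by
    intro b
    rw [Valuation.comap_apply, hg, v.valuation_of_algebraMap]
  refine ⟨(v.valuation E).comap g, ?_, ?_, ?_⟩
  · have hpv : v.intValuation (ι π) = WithZero.exp (-1) :=
      v.intValuation_singleton hπ0 hmax
    have hπu : IsUnit (algebraMap B F π) := IsLocalization.map_units F
      (⟨π, hπ.regular⟩ : nonZeroDivisors B)
    obtain ⟨p, hp⟩ := hπu
    intro x
    by_cases hx : x = 0
    · exact ⟨0, by rw [hx, map_zero]⟩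
    · refine ⟨((p ^ (-(WithZero.log x)) : Fˣ) : F), ?_⟩
      have h1 : ∀ n : ℤ, (v.valuation E).comap g ((p ^ n : Fˣ) : F) = WithZero.exp (-n) := by
        intro n
        have h2 := map_zpow (Units.map ((v.valuation E).comap g : F →* ℤᵐ⁰)) p n
        have h3 := congrArg Units.val h2
        rw [Units.coe_map, Units.val_zpow_eq_zpow_val, Units.coe_map] at h3
        refine h3.trans ?_
        have h4 : ((v.valuation E).comap g : F →* ℤᵐ⁰) (p : F) = WithZero.exp (-1) := by
          change (v.valuation E).comap g (p : F) = _
          rw [hp, hval, hpv]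
        rw [h4, ← WithZero.exp_zsmul]
        simp
      rw [h1, neg_neg, WithZero.exp_log hx]
  · intro b hb
    change (v.valuation E).comap g (algebraMap B F b) = 1
    rw [hval, v.intValuation_eq_one_iff]
    intro hmem
    have hunit : IsUnit (ι b) := IsLocalization.map_units R (⟨b, hb⟩ : 𝔫.primeCompl)
    exact (IsLocalRing.mem_maximalIdeal _).1 hmem hunit
  · intro b hb
    change (v.valuation E).comap g (algebraMap B F b) < 1
    rw [hval, v.intValuation_lt_one_iff_mem]
    change ι b ∈ IsLocalRing.maximalIdeal R
    rw [← Localization.AtPrime.map_eq_maximalIdeal]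
    exact Ideal.mem_map_of_mem _ hb

end LocalRing

/-! ### Closed points of `𝐔` -/

section Points

variable {Fq : Type*} [Field Fq] [Fintype Fq] {𝕂 : Type*} [Field 𝕂] [Algebra Fq 𝕂]
  {L : Type*} [Field L] [Algebra Fq L] [Algebra Fq[X] L] [Algebra (RatFunc Fq) L]
  [IsScalarTower Fq Fq[X] L] [IsScalarTower Fq (RatFunc Fq) L] [IsScalarTower Fq[X] (RatFunc Fq) L]
  [FiniteDimensional (RatFunc Fq) L] [Algebra.IsSeparable (RatFunc Fq) L]

theorem bigOToFun_const (c : 𝕂) :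
    bigOToFun (algebraMap 𝕂 (BigO Fq 𝕂 L) c) = (const Fq c : FunRing Fq 𝕂 L) := by
  rw [bigOToFun_apply, AlgHom.commutes]; rfl

theorem bigOToFun_fn (a : OK Fq L) :
    bigOToFun ((1 : 𝕂) ⊗ₜ[Fq] a) = (fn Fq (a : L) : FunRing Fq 𝕂 L) := by
  rw [bigOToFun_apply]; simp [bigOToTensor, fn]

theorem algebraMap_ratFunc_X : algebraMap (RatFunc Fq) L RatFunc.X = algebraMap Fq[X] L X := by
  rw [IsScalarTower.algebraMap_apply Fq[X] (RatFunc Fq) L, RatFunc.algebraMap_X]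

theorem bigOToFun_X : bigOToFun (algebraMap 𝕂[X] (BigO Fq 𝕂 L) X) = tFun Fq 𝕂 L := by
  rw [algebraMap_bigO_X, bigOToFun_fn, tFun, algebraMap_ratFunc_X]; rfl

theorem bigOToFun_isUnit {b : BigO Fq 𝕂 L} (hb : b ∈ nonZeroDivisors (BigO Fq 𝕂 L)) :
    IsUnit (bigOToFun b) :=
  IsLocalization.map_units (FunRing Fq 𝕂 L) (⟨b, hb⟩ : nonZeroDivisors (BigO Fq 𝕂 L))

theorem bigOToFun_injective : Function.Injective (bigOToFun : BigO Fq 𝕂 L → FunRing Fq 𝕂 L) :=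
  IsFractionRing.injective (BigO Fq 𝕂 L) (FunRing Fq 𝕂 L)

theorem exists_bigO_div (x : FunRing Fq 𝕂 L) : ∃ b s : BigO Fq 𝕂 L,
    s ∈ nonZeroDivisors (BigO Fq 𝕂 L) ∧ x * bigOToFun s = bigOToFun b := by
  obtain ⟨⟨b, s⟩, h⟩ := IsLocalization.surj (nonZeroDivisors (BigO Fq 𝕂 L)) x
  exact ⟨b, s, s.2, h⟩

/-- The restriction to `O_𝐊` of the valuation of a point. -/
def ClosedPoint.onO (P : ClosedPoint Fq 𝕂 L) : Valuation (BigO Fq 𝕂 L) ℤᵐ⁰ := P.val.comap bigOToFun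

theorem ClosedPoint.onO_apply (P : ClosedPoint Fq 𝕂 L) (b : BigO Fq 𝕂 L) :
    P.onO b = P.val (bigOToFun b) := rfl

theorem ClosedPoint.onO_const (P : ClosedPoint Fq 𝕂 L) {c : 𝕂} (hc : c ≠ 0) :
    P.onO (algebraMap 𝕂 _ c) = 1 := by
  rw [P.onO_apply, bigOToFun_const, P.trivial_on_const c hc]

theorem val_ne_zero_of_isUnit (P : ClosedPoint Fq 𝕂 L) {x : FunRing Fq 𝕂 L} (hx : IsUnit x) :
    P.val x ≠ 0 := (hx.map P.val).ne_zero

theorem ClosedPoint.ext_onO {P P' : ClosedPoint Fq 𝕂 L} (h : ∀ b, P.onO b = P'.onO b) : P = P' := by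
  ext x
  obtain ⟨b, s, hs, hx⟩ := exists_bigO_div x
  have h1 : P.val x * P.onO s = P.onO b := by rw [P.onO_apply, P.onO_apply, ← hx, map_mul]
  have h2 : P'.val x * P'.onO s = P'.onO b := by rw [P'.onO_apply, P'.onO_apply, ← hx, map_mul]
  rw [← h, ← h, ← h1] at h2
  exact (mul_right_cancel₀ (val_ne_zero_of_isUnit P (bigOToFun_isUnit hs)) h2).symm

variable [IsAlgClosed 𝕂]

/-- The valuation ring of P contains 𝕂 and t, and it is integrally closed, while O_𝐊 is integral
over 𝕂[t]. -/
theorem ClosedPoint.onO_le_one {P : ClosedPoint Fq 𝕂 L} (hP : P ∈ affinePart Fq 𝕂 L)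
    (b : BigO Fq 𝕂 L) : P.onO b ≤ 1 := by
  have hpoly : ∀ p : 𝕂[X], P.onO (algebraMap 𝕂[X] _ p) ≤ 1 := by
    intro p
    induction p using Polynomial.induction_on' with
    | add p q hp hq => rw [map_add]; exact Valuation.map_add_le _ hp hq
    | monomial n c =>
      rw [← C_mul_X_pow_eq_monomial, map_mul, map_pow, map_mul, map_pow]
      refine mul_le_one' ?_ (pow_le_one' ?_ n)
      · by_cases hc : c = 0
        · simp [hc]
        · rw [algebraMap_bigO_C]; exact (P.onO_const hc).le
      · rw [P.onO_apply, bigOToFun_X]; exact hP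
  obtain ⟨f, hf, hfb⟩ := Algebra.IsIntegral.isIntegral (R := 𝕂[X]) b
  let φ : 𝕂[X] →+* P.onO.integer := (algebraMap 𝕂[X] (BigO Fq 𝕂 L)).codRestrict _ hpoly
  have : IsIntegral P.onO.integer b := by
    refine ⟨f.map φ, hf.map φ, ?_⟩
    rw [eval₂_map]
    exact hfb
  exact Valuation.Integers.mem_of_integral (Valuation.integer.integers P.onO) this

/-- Otherwise every nonzero polynomial, being a product of linear factors over 𝕂, would have
valuation 1. An element of valuation strictly between 0 and 1 satisfies no equation over such
polynomials, so by integrality O_𝐊 would take only the values 0 and 1, and the valuation could not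
be surjective. -/
theorem ClosedPoint.exists_onO_lt_one {P : ClosedPoint Fq 𝕂 L} (hP : P ∈ affinePart Fq 𝕂 L) :
    ∃ c : 𝕂, P.onO (algebraMap 𝕂[X] _ (X - C c)) < 1 := by
  by_contra! hall
  have hone : ∀ p : 𝕂[X], p ≠ 0 → P.onO (algebraMap 𝕂[X] _ p) = 1 := by
    intro p hp
    have h := IsAlgClosed.splits p
    rw [h.eq_prod_roots, map_mul, map_mul, map_multiset_prod, map_multiset_prod, Multiset.map_map,
      Multiset.map_map, Multiset.prod_eq_one, mul_one]
    · rw [algebraMap_bigO_C]; exact P.onO_const (leadingCoeff_ne_zero.2 hp)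
    · intro x hx
      obtain ⟨c, _, rfl⟩ := Multiset.mem_map.1 hx
      exact le_antisymm (P.onO_le_one hP _) (hall c)
  have key : ∀ (n : ℕ) (f : 𝕂[X][X]) (b : BigO Fq 𝕂 L), P.onO b ≠ 0 → P.onO b < 1 →
      f.natDegree ≤ n → f ≠ 0 → P.onO (aeval b f) ≠ 0 := by
    intro n
    induction n with
    | zero =>
      intro f b hb hb1 hn hf
      rw [eq_C_of_natDegree_le_zero hn, aeval_C, hone]
      · exact one_ne_zero
      · intro h
        apply hf
        rw [eq_C_of_natDegree_le_zero hn, h, C_0]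
    | succ n ih =>
      intro f b hb hb1 hn hf
      rw [← X_mul_divX_add f, map_add, map_mul, aeval_X, aeval_C]
      by_cases hc : f.coeff 0 = 0
      · rw [hc, map_zero, add_zero, map_mul]
        refine mul_ne_zero hb (ih _ b hb hb1 (by rw [natDegree_divX_eq_natDegree_tsub_one]; omega) ?_)
        intro h
        apply hf
        rw [← X_mul_divX_add f, h, hc]
        simp
      · rw [Valuation.map_add_eq_of_lt_right]
        · rw [hone _ hc]; exact one_ne_zero
        · rw [hone _ hc, map_mul]
          exact lt_of_le_of_lt (mul_le_of_le_one_right' (P.onO_le_one hP _)) hb1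
  have hval : ∀ b : BigO Fq 𝕂 L, P.onO b ≠ 0 → P.onO b = 1 := by
    intro b hb
    by_contra hne
    obtain ⟨f, hf, hfb⟩ := Algebra.IsIntegral.isIntegral (R := 𝕂[X]) b
    refine key _ f b hb (lt_of_le_of_ne (P.onO_le_one hP b) hne) le_rfl hf.ne_zero ?_
    rw [aeval_def, hfb, map_zero]
  obtain ⟨x, hx⟩ := P.surjective (WithZero.exp (-1))
  obtain ⟨b, s, hs, hxb⟩ := exists_bigO_div x
  have h1 := congrArg P.val hxb
  rw [map_mul, hx, ← P.onO_apply, ← P.onO_apply,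
    hval s (val_ne_zero_of_isUnit P (bigOToFun_isUnit hs)), mul_one] at h1
  rw [hval b (by rw [← h1]; exact WithZero.exp_ne_zero)] at h1
  rw [← WithZero.exp_zero, WithZero.exp_inj] at h1
  omega

/-- The quotient by the ideal of elements of valuation less than 1 is integral over 𝕂[t]/(t - c) =
𝕂, hence equal to the algebraically closed field 𝕂. -/
theorem ClosedPoint.exists_center {P : ClosedPoint Fq 𝕂 L} (hP : P ∈ affinePart Fq 𝕂 L) :
    ∃ χ : BigO Fq 𝕂 L →ₐ[𝕂] 𝕂, IsCentered P.onO χ := by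
  obtain ⟨c, hc⟩ := P.exists_onO_lt_one hP
  let J : Ideal (BigO Fq 𝕂 L) :=
    { carrier := {b | P.onO b < 1}
      add_mem' := fun {_ _} ha hb => Valuation.map_add_lt P.onO ha hb
      zero_mem' := by simp
      smul_mem' := fun a b hb => by
        change P.onO (a * b) < 1
        rw [map_mul]
        exact lt_of_le_of_lt (mul_le_of_le_one_left' (P.onO_le_one hP a)) hb }
  have hJ : J.IsPrime := by
    refine ⟨?_, ?_⟩
    · rw [Ideal.ne_top_iff_one]
      change ¬ P.onO 1 < 1
      simp
    · intro a b hab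
      by_contra! h
      have ha : P.onO a = 1 := le_antisymm (P.onO_le_one hP a) (not_lt.1 h.1)
      have hb : P.onO b = 1 := le_antisymm (P.onO_le_one hP b) (not_lt.1 h.2)
      have : P.onO (a * b) < 1 := hab
      rw [map_mul, ha, hb] at this
      simp at this
  let Q := BigO Fq 𝕂 L ⧸ J
  have hcomp : (algebraMap 𝕂 Q).comp (evalRingHom c)
      = (Ideal.Quotient.mk J).comp (algebraMap 𝕂[X] (BigO Fq 𝕂 L)) := by
    refine Polynomial.ringHom_ext (fun a => ?_) ?_
    · simp only [RingHom.comp_apply, coe_evalRingHom, eval_C]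
      rw [algebraMap_bigO_C]; rfl
    · simp only [RingHom.comp_apply, coe_evalRingHom, eval_X]
      symm
      change Ideal.Quotient.mk J _ = Ideal.Quotient.mk J (algebraMap 𝕂 _ c)
      rw [Ideal.Quotient.eq]
      have : algebraMap 𝕂 (BigO Fq 𝕂 L) c = algebraMap 𝕂[X] _ (C c) := (algebraMap_bigO_C c).symm
      rw [this, ← map_sub]
      exact hc
  have hint : Algebra.IsIntegral 𝕂 Q := ⟨fun q => by
    obtain ⟨b, rfl⟩ := Ideal.Quotient.mk_surjective q
    obtain ⟨f, hf, hfb⟩ := Algebra.IsIntegral.isIntegral (R := 𝕂[X]) b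
    refine ⟨f.map (evalRingHom c), hf.map _, ?_⟩
    rw [eval₂_map, hcomp, ← hom_eval₂, hfb, map_zero]⟩
  have hbij := IsAlgClosed.algebraMap_bijective_of_isIntegral (k := 𝕂) (K := Q)
  let e : 𝕂 ≃ₐ[𝕂] Q := AlgEquiv.ofBijective (Algebra.ofId 𝕂 Q) hbij
  refine ⟨(e.symm : Q →ₐ[𝕂] 𝕂).comp (Ideal.Quotient.mkₐ 𝕂 J),
    IsCentered.of_sub_lt_one (fun c hc => P.onO_const hc) fun b => ?_⟩
  change b - algebraMap 𝕂 _ (e.symm (Ideal.Quotient.mk J b)) ∈ J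
  rw [← Ideal.Quotient.eq]
  exact (e.apply_symm_apply (Ideal.Quotient.mk J b)).symm

theorem ClosedPoint.mem_affinePart_of_isCentered {P : ClosedPoint Fq 𝕂 L} {χ : BigO Fq 𝕂 L →ₐ[𝕂] 𝕂}
    (h : IsCentered P.onO χ) : P ∈ affinePart Fq 𝕂 L := by
  change P.val _ ≤ 1
  rw [← bigOToFun_X]
  exact h.le_one _

end Points

/-! ### Local parameters -/

section LocalParams

variable {Fq : Type*} [Field Fq] [Fintype Fq] {𝕂 : Type*} [Field 𝕂] [Algebra Fq 𝕂]
  {L : Type*} [Field L] [Algebra Fq L] [Algebra Fq[X] L] [Algebra (RatFunc Fq) L]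
  [IsScalarTower Fq Fq[X] L] [IsScalarTower Fq (RatFunc Fq) L] [IsScalarTower Fq[X] (RatFunc Fq) L]
  [FiniteDimensional (RatFunc Fq) L] [Algebra.IsSeparable (RatFunc Fq) L]

/-- The restriction of `χ : O_𝐊 → 𝕂` to `O_L`. -/
def resHom (χ : BigO Fq 𝕂 L →ₐ[𝕂] 𝕂) : OK Fq L →ₐ[Fq] 𝕂 :=
  (χ.restrictScalars Fq).comp Algebra.TensorProduct.includeRight

theorem resHom_apply (χ : BigO Fq 𝕂 L →ₐ[𝕂] 𝕂) (a : OK Fq L) : resHom χ a = χ (1 ⊗ₜ a) := rfl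

/-- The extension of `ρ : O_L → 𝕂` to `O_𝐊`. -/
def extHom (ρ : OK Fq L →ₐ[Fq] 𝕂) : BigO Fq 𝕂 L →ₐ[𝕂] 𝕂 :=
  Algebra.TensorProduct.lift (AlgHom.id 𝕂 𝕂) ρ fun _ _ => mul_comm _ _

theorem extHom_tmul (ρ : OK Fq L →ₐ[Fq] 𝕂) (c : 𝕂) (a : OK Fq L) : extHom ρ (c ⊗ₜ a) = c * ρ a :=
  Algebra.TensorProduct.lift_tmul _ _ _ _ _

theorem resHom_extHom (ρ : OK Fq L →ₐ[Fq] 𝕂) : resHom (extHom ρ) = ρ := by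
  ext a; simp [resHom_apply, extHom_tmul]

theorem apply_tmul (χ : BigO Fq 𝕂 L →ₐ[𝕂] 𝕂) (c : 𝕂) (a : OK Fq L) :
    χ (c ⊗ₜ a) = c * resHom χ a := by
  have : c ⊗ₜ[Fq] a = c • ((1 : 𝕂) ⊗ₜ[Fq] a) := by simp [TensorProduct.smul_tmul']
  rw [this, map_smul, smul_eq_mul, resHom_apply]

theorem resHom_injective :
    Function.Injective (resHom : (BigO Fq 𝕂 L →ₐ[𝕂] 𝕂) → (OK Fq L →ₐ[Fq] 𝕂)) := by
  intro χ χ' h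
  refine AlgHom.ext fun b => ?_
  induction b using TensorProduct.induction_on with
  | zero => simp
  | tmul c a => rw [apply_tmul, apply_tmul, h]
  | add x y hx hy => rw [map_add, map_add, hx, hy]

/-- The kernel of χ is generated by the elements 1 ⊗ a - χ(1 ⊗ a), so local divisibility by π need
only be checked on them. -/
theorem IsLocalParam.of_generators {χ : BigO Fq 𝕂 L →ₐ[𝕂] 𝕂} {π : BigO Fq 𝕂 L}
    (hreg : π ∈ nonZeroDivisors (BigO Fq 𝕂 L)) (hz : χ π = 0)
    (h : ∀ a : OK Fq L, ∃ u b', χ u ≠ 0 ∧ u * (1 ⊗ₜ a - algebraMap 𝕂 _ (resHom χ a)) = π * b') :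
    IsLocalParam χ π := by
  refine ⟨hreg, hz, fun b hb => ?_⟩
  have key : ∀ b : BigO Fq 𝕂 L, ∃ u b', χ u ≠ 0 ∧ u * (b - algebraMap 𝕂 _ (χ b)) = π * b' := by
    intro b
    induction b using TensorProduct.induction_on with
    | zero => exact ⟨1, 0, by simp, by simp⟩
    | tmul c a =>
      obtain ⟨u, b', hu, h'⟩ := h a
      refine ⟨u, algebraMap 𝕂 _ c * b', hu, ?_⟩
      have h1 : c ⊗ₜ[Fq] a = algebraMap 𝕂 (BigO Fq 𝕂 L) c * (1 ⊗ₜ a) := by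
        simp [Algebra.TensorProduct.algebraMap_apply]
      rw [apply_tmul, map_mul, h1, ← mul_sub, mul_left_comm, h', mul_left_comm]
    | add x y hx hy =>
      obtain ⟨u, a, hu, hua⟩ := hx
      obtain ⟨v, b, hv, hvb⟩ := hy
      refine ⟨u * v, v * a + u * b, by simp [hu, hv], ?_⟩
      rw [map_add, map_add]
      linear_combination v * hua + u * hvb
  simpa [hb] using key b

theorem exists_factor {f : 𝕂[X]} {c : 𝕂} (h0 : f.eval c = 0) (h1 : f.derivative.eval c ≠ 0) :
    ∃ g : 𝕂[X], f = (X - C c) * g ∧ g.eval c ≠ 0 := by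
  obtain ⟨g, rfl⟩ := dvd_iff_isRoot.2 h0
  refine ⟨g, rfl, fun hg => h1 ?_⟩
  simp [derivative_mul, hg]

/-- At a generic point the difference of `t` and its value is a local parameter. -/
theorem isLocalParam_of_injective {χ : BigO Fq 𝕂 L →ₐ[𝕂] 𝕂} (hχ : Function.Injective (resHom χ)) :
    IsLocalParam χ (algebraMap 𝕂[X] (BigO Fq 𝕂 L) (X - C (resHom χ (algebraMap Fq[X] _ X)))) := by
  set θ := resHom χ (algebraMap Fq[X] _ X) with hθ
  set π := algebraMap 𝕂[X] (BigO Fq 𝕂 L) (X - C θ) with hπ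
  have hCalg : ∀ c : 𝕂, algebraMap 𝕂[X] (BigO Fq 𝕂 L) (C c) = algebraMap 𝕂 _ c := algebraMap_bigO_C
  refine IsLocalParam.of_generators
    (algebraMap_bigO_mem_nonZeroDivisors (X_sub_C_ne_zero _)) ?_ fun a => ?_
  · rw [hπ, map_sub, hCalg, map_sub, AlgHom.commutes, algebraMap_bigO_X, ← resHom_apply]
    simp [hθ]
  · set f := minpoly Fq[X] a with hf
    have haint : IsIntegral Fq[X] a := Algebra.IsIntegral.isIntegral a
    have hder : aeval a f.derivative ≠ 0 := by
      have hsep := (Algebra.IsSeparable.isSeparable (RatFunc Fq) (a : L)).aeval_derivative_ne_zero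
        (x := (a : L)) (minpoly.aeval (RatFunc Fq) (a : L))
      have hmin := minpoly.isIntegrallyClosed_eq_field_fractions (RatFunc Fq) L haint
      intro h
      apply hsep
      change aeval (algebraMap (OK Fq L) L a) (minpoly (RatFunc Fq) (algebraMap (OK Fq L) L a)).derivative = 0
      rw [hmin, derivative_map, aeval_map_algebraMap, aeval_algebraMap_apply, h, map_zero]
    let ψ : Fq[X] →+* 𝕂 := (resHom χ : OK Fq L →+* 𝕂).comp (algebraMap Fq[X] (OK Fq L))
    have hev : ∀ p : Fq[X][X], (p.map ψ).eval (resHom χ a) = resHom χ (aeval a p) := by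
      intro p
      rw [eval_map, aeval_def]
      exact (hom_eval₂ p (algebraMap Fq[X] (OK Fq L)) (resHom χ : OK Fq L →+* 𝕂) a).symm
    -- Since K is separable and χ is injective on O_L, χ(a) is a simple root of the image of f over
    -- 𝕂. Modulo π = t - θ the relation f(a) = 0 therefore becomes (a - χ(a)) g(a) = 0 with g(a) a
    -- unit at χ.
    obtain ⟨g, hfg, hg⟩ := exists_factor (f := f.map ψ) (c := resHom χ a)
      (by rw [hev, minpoly.aeval, map_zero])
      (by rw [derivative_map, hev]; exact fun h => hder (hχ (h.trans (map_zero _).symm)))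
    let Q := BigO Fq 𝕂 L ⧸ Ideal.span {π}
    let incl : OK Fq L →+* BigO Fq 𝕂 L := (Algebra.TensorProduct.includeRight : OK Fq L →ₐ[Fq] BigO Fq 𝕂 L)
    have hcomp : (Ideal.Quotient.mk (Ideal.span {π})).comp (incl.comp (algebraMap Fq[X] (OK Fq L)))
        = ((Ideal.Quotient.mk (Ideal.span {π})).comp (algebraMap 𝕂 (BigO Fq 𝕂 L))).comp ψ := by
      refine Polynomial.ringHom_ext (fun c => ?_) ?_
      · have e : algebraMap Fq[X] (OK Fq L) (C c) = algebraMap Fq (OK Fq L) c :=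
          (IsScalarTower.algebraMap_apply Fq Fq[X] (OK Fq L) c).symm
        simp only [RingHom.comp_apply, ψ, incl, RingHom.coe_coe, e, AlgHom.commutes]
        rw [IsScalarTower.algebraMap_apply Fq 𝕂 (BigO Fq 𝕂 L)]
      · simp only [RingHom.comp_apply]
        rw [Ideal.Quotient.eq, Ideal.mem_span_singleton]
        refine dvd_of_eq ?_
        rw [hπ, map_sub, hCalg, algebraMap_bigO_X]
        rfl
    refine ⟨aeval ((1 : 𝕂) ⊗ₜ[Fq] a) g, ?_⟩
    have hmem : aeval ((1 : 𝕂) ⊗ₜ[Fq] a) g * (1 ⊗ₜ a - algebraMap 𝕂 _ (resHom χ a))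
        ∈ Ideal.span {π} := by
      have h1 : aeval ((1 : 𝕂) ⊗ₜ[Fq] a) g * (1 ⊗ₜ a - algebraMap 𝕂 _ (resHom χ a))
          = eval₂ (algebraMap 𝕂 (BigO Fq 𝕂 L)) ((1 : 𝕂) ⊗ₜ[Fq] a) (f.map ψ) := by
        rw [hfg, ← aeval_def, map_mul, mul_comm]
        simp
      rw [h1, ← Ideal.Quotient.eq_zero_iff_mem, hom_eval₂, eval₂_map, ← hcomp, ← RingHom.comp_assoc]
      have h2 := hom_eval₂ f (algebraMap Fq[X] (OK Fq L))
        ((Ideal.Quotient.mk (Ideal.span {π})).comp incl) a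
      rw [← aeval_def, minpoly.aeval, map_zero] at h2
      exact h2.symm
    obtain ⟨b', hb'⟩ := Ideal.mem_span_singleton.1 hmem
    refine ⟨b', ?_, hb'⟩
    have h3 : χ (aeval ((1 : 𝕂) ⊗ₜ[Fq] a) g) = g.eval (resHom χ a) := by
      rw [← aeval_algHom_apply, resHom_apply, coe_aeval_eq_eval]
    rw [h3]
    exact hg

theorem isIntegral_apply_of_isIntegral_X (ρ : OK Fq L →ₐ[Fq] 𝕂)
    (h : IsIntegral Fq (ρ (algebraMap Fq[X] _ X))) (a : OK Fq L) : IsIntegral Fq (ρ a) := by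
  let A := integralClosure Fq 𝕂
  obtain ⟨f, hf, hfa⟩ := Algebra.IsIntegral.isIntegral (R := Fq[X]) a
  let ψ : Fq[X] →ₐ[Fq] A := aeval ⟨_, h⟩
  have hψ : (algebraMap A 𝕂).comp (ψ : Fq[X] →+* A)
      = (ρ : OK Fq L →+* 𝕂).comp (algebraMap Fq[X] (OK Fq L)) := by
    refine Polynomial.ringHom_ext (fun c => ?_) ?_
    · have e : algebraMap Fq[X] (OK Fq L) (C c) = algebraMap Fq (OK Fq L) c :=
        (IsScalarTower.algebraMap_apply Fq Fq[X] (OK Fq L) c).symm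
      simp only [RingHom.comp_apply, RingHom.coe_coe, e, AlgHom.commutes]
      simp [ψ]
    · simp [ψ]
  have : IsIntegral A (ρ a) := by
    refine ⟨f.map (ψ : Fq[X] →+* A), hf.map _, ?_⟩
    rw [eval₂_map, hψ]
    have := hom_eval₂ f (algebraMap Fq[X] (OK Fq L)) (ρ : OK Fq L →+* 𝕂) a
    rw [hfa, map_zero] at this
    exact this.symm
  exact isIntegral_trans (R := Fq) (A := A) _ this

/-- A nonzero ideal of O_L contains a nonzero polynomial in t, so ρ(t) is algebraic over 𝔽_q, and
the remaining values are integral over 𝔽_q[ρ(t)]. -/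
theorem isIntegral_of_ker_ne_bot {ρ : OK Fq L →ₐ[Fq] 𝕂} (h : RingHom.ker ρ ≠ ⊥) (a : OK Fq L) :
    IsIntegral Fq (ρ a) := by
  apply isIntegral_apply_of_isIntegral_X
  obtain ⟨x, hx, hx0⟩ := Submodule.exists_mem_ne_zero_of_ne_bot h
  have := Ideal.comap_ne_bot_of_integral_mem (R := Fq[X]) hx0 hx (Algebra.IsIntegral.isIntegral x)
  obtain ⟨p, hp, hp0⟩ := Submodule.exists_mem_ne_zero_of_ne_bot this
  have hρ : ρ (algebraMap Fq[X] _ p) = aeval (ρ (algebraMap Fq[X] _ X)) p := by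
    let φ : Fq[X] →ₐ[Fq] 𝕂 := ρ.comp (IsScalarTower.toAlgHom Fq Fq[X] (OK Fq L))
    have : φ = aeval (ρ (algebraMap Fq[X] _ X)) := by ext; simp [φ]
    exact DFunLike.congr_fun this p
  refine IsAlgebraic.isIntegral ⟨p, hp0, ?_⟩
  rw [← hρ]
  exact hp

/-- At a point lying over a maximal ideal `𝔭` of `O_L`, any element of `𝔭` not in `𝔭 ^ 2` is a local
parameter. -/
theorem isLocalParam_of_ker {χ : BigO Fq 𝕂 L →ₐ[𝕂] 𝕂} (hbot : RingHom.ker (resHom χ) ≠ ⊥)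
    {ϖ : OK Fq L} (h1 : ϖ ∈ RingHom.ker (resHom χ)) (h2 : ϖ ∉ RingHom.ker (resHom χ) ^ 2) :
    IsLocalParam χ (1 ⊗ₜ ϖ) := by
  set p := RingHom.ker (resHom χ)
  have hϖ : ϖ ≠ 0 := fun h => h2 (h ▸ zero_mem _)
  -- Write (ϖ) = 𝔭 J with J not contained in 𝔭. An element s of J outside 𝔭 is a unit at χ and
  -- carries 𝔭 into (ϖ).
  obtain ⟨J, hJ⟩ := Ideal.dvd_span_singleton.2 h1
  have hJp : ¬ J ≤ p := fun h => h2 (by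
    have : Ideal.span {ϖ} ≤ p ^ 2 := by rw [hJ, pow_two]; exact Ideal.mul_mono_right h
    exact this (Ideal.mem_span_singleton_self _))
  obtain ⟨s, hsJ, hsp⟩ := SetLike.not_le_iff_exists.1 hJp
  refine IsLocalParam.of_generators (one_tmul_regular hϖ) h1 fun a => ?_
  have hint := isIntegral_of_ker_ne_bot hbot a
  set f := minpoly Fq (resHom χ a)
  -- The residue field is algebraic over the perfect field 𝔽_q, so χ(a) is a simple root of its
  -- minimal polynomial and the cofactor g does not vanish there.
  have hsep : f.Separable := PerfectField.separable_of_irreducible (minpoly.irreducible hint)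
  obtain ⟨g, hfg, hg⟩ := exists_factor (f := f.map (algebraMap Fq 𝕂)) (c := resHom χ a)
    (by rw [eval_map_algebraMap, minpoly.aeval])
    (by
      rw [derivative_map, eval_map_algebraMap]
      exact hsep.aeval_derivative_ne_zero (minpoly.aeval _ _))
  have hfa : aeval a f ∈ p := by
    change resHom χ (aeval a f) = 0
    rw [← aeval_algHom_apply, minpoly.aeval]
  have hmul : s * aeval a f ∈ Ideal.span {ϖ} := by
    rw [hJ, mul_comm s]
    exact Ideal.mul_mem_mul hfa hsJ
  obtain ⟨z, hz⟩ := Ideal.mem_span_singleton.1 hmul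
  refine ⟨(1 ⊗ₜ s) * aeval ((1 : 𝕂) ⊗ₜ[Fq] a) g, 1 ⊗ₜ z, ?_, ?_⟩
  · rw [map_mul, ← aeval_algHom_apply, ← resHom_apply, ← resHom_apply, coe_aeval_eq_eval]
    exact mul_ne_zero hsp hg
  · have h3 : aeval ((1 : 𝕂) ⊗ₜ[Fq] a) g * (1 ⊗ₜ a - algebraMap 𝕂 _ (resHom χ a))
        = 1 ⊗ₜ (aeval a f) := by
      have h4 : aeval ((1 : 𝕂) ⊗ₜ[Fq] a) (f.map (algebraMap Fq 𝕂)) = (1 : 𝕂) ⊗ₜ[Fq] (aeval a f) := by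
        rw [aeval_map_algebraMap]
        exact aeval_algHom_apply (Algebra.TensorProduct.includeRight : OK Fq L →ₐ[Fq] BigO Fq 𝕂 L) a f
      rw [← h4, hfg, map_mul, mul_comm]
      simp
    rw [mul_assoc, h3, Algebra.TensorProduct.tmul_mul_tmul, Algebra.TensorProduct.tmul_mul_tmul, hz]

theorem exists_mem_ker_not_mem_sq {χ : BigO Fq 𝕂 L →ₐ[𝕂] 𝕂} (hbot : RingHom.ker (resHom χ) ≠ ⊥) :
    ∃ ϖ ∈ RingHom.ker (resHom χ), ϖ ∉ RingHom.ker (resHom χ) ^ 2 := by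
  have hp : (RingHom.ker (resHom χ)).IsPrime := RingHom.ker_isPrime _
  exact SetLike.exists_of_lt (by
    simpa using Ideal.pow_right_strictAnti (RingHom.ker (resHom χ)) hbot hp.ne_top one_lt_two)

theorem exists_isLocalParam (χ : BigO Fq 𝕂 L →ₐ[𝕂] 𝕂) : ∃ π, IsLocalParam χ π := by
  by_cases h : RingHom.ker (resHom χ) = ⊥
  · exact ⟨_, isLocalParam_of_injective ((RingHom.injective_iff_ker_eq_bot _).2 h)⟩
  · obtain ⟨ϖ, h1, h2⟩ := exists_mem_ker_not_mem_sq h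
    exact ⟨_, isLocalParam_of_ker h h1 h2⟩

/-- Each maximal ideal of `O_𝐊` is the center of a point. -/
theorem exists_point (χ : BigO Fq 𝕂 L →ₐ[𝕂] 𝕂) : ∃ P : ClosedPoint Fq 𝕂 L, IsCentered P.onO χ := by
  obtain ⟨π, hπ⟩ := exists_isLocalParam χ
  obtain ⟨w, hw, hc⟩ := exists_valuation_of_isLocalParam (F := FunRing Fq 𝕂 L) hπ
  refine ⟨⟨w, hw, fun c h => ?_⟩, hc⟩
  rw [← bigOToFun_const]
  exact hc.eq_one (algebraMap 𝕂 _ c) (by rw [AlgHom.commutes]; exact h)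

/-- Every nonzero value on O_𝐊 is a power of the value at π. Since exp(-1) is a quotient of two such
values, the exponent of the value at π divides 1. -/
theorem val_localParam {P : ClosedPoint Fq 𝕂 L} {χ : BigO Fq 𝕂 L →ₐ[𝕂] 𝕂} (h : IsCentered P.onO χ)
    {π : BigO Fq 𝕂 L} (hπ : IsLocalParam χ π) : P.onO π = WithZero.exp (-1) := by
  obtain ⟨x, hx⟩ := P.surjective (WithZero.exp (-1))
  obtain ⟨b, s, hs, hxb⟩ := exists_bigO_div x
  have h1 := congrArg P.val hxb
  rw [map_mul, hx, ← P.onO_apply, ← P.onO_apply] at h1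
  have hs0 : P.onO s ≠ 0 := val_ne_zero_of_isUnit P (bigOToFun_isUnit hs)
  have hb0 : P.onO b ≠ 0 := by rw [← h1]; exact mul_ne_zero WithZero.exp_ne_zero hs0
  have hπ0 : P.onO π ≠ 0 := val_ne_zero_of_isUnit P (bigOToFun_isUnit hπ.regular)
  rcases hπ.eq_pow_or_eq_zero s with ⟨k, hk⟩ | hk
  · rcases hπ.eq_pow_or_eq_zero b with ⟨l, hl⟩ | hl
    · rw [hk _ h, hl _ h] at h1
      obtain ⟨m, hm⟩ : ∃ m : ℤ, P.onO π = WithZero.exp m := ⟨_, (WithZero.exp_log hπ0).symm⟩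
      have hm0 : m < 0 := by
        have := h.lt_one π hπ.map_eq_zero
        rwa [hm, ← WithZero.exp_zero, WithZero.exp_lt_exp] at this
      rw [hm, ← WithZero.exp_nsmul, ← WithZero.exp_nsmul, ← WithZero.exp_add, WithZero.exp_inj,
        nsmul_eq_mul, nsmul_eq_mul] at h1
      have hdvd : m ∣ 1 := ⟨k - l, by linear_combination -h1⟩
      rcases Int.isUnit_iff.1 (isUnit_of_dvd_one hdvd) with h2 | h2
      · omega
      · rw [hm, h2]
    · exact absurd (hl _ h) hb0
  · exact absurd (hk _ h) hs0

/-- Together with `exists_point` and `ClosedPoint.exists_center` this identifies the points of 𝐔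
with the 𝕂-algebra homomorphisms O_𝐊 → 𝕂. -/
theorem eq_of_isCentered {P P' : ClosedPoint Fq 𝕂 L} {χ : BigO Fq 𝕂 L →ₐ[𝕂] 𝕂}
    (h : IsCentered P.onO χ) (h' : IsCentered P'.onO χ) : P = P' := by
  obtain ⟨π, hπ⟩ := exists_isLocalParam χ
  refine ClosedPoint.ext_onO fun b => ?_
  rcases hπ.eq_pow_or_eq_zero b with ⟨k, hk⟩ | hk
  · rw [hk _ h, hk _ h', val_localParam h hπ, val_localParam h' hπ]
  · rw [hk _ h, hk _ h']

theorem exists_mul_eq_mul_fun {P : ClosedPoint Fq 𝕂 L} {χ : BigO Fq 𝕂 L →ₐ[𝕂] 𝕂}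
    (h : IsCentered P.onO χ) {x y : FunRing Fq 𝕂 L} (hy : P.val y ≠ 0) (hxy : P.val x ≤ P.val y) :
    ∃ s a : BigO Fq 𝕂 L, χ s ≠ 0 ∧ bigOToFun s * x = bigOToFun a * y := by
  obtain ⟨π, hπ⟩ := exists_isLocalParam χ
  obtain ⟨b, s, hs, hb⟩ := exists_bigO_div x
  obtain ⟨c, s', hs', hc⟩ := exists_bigO_div y
  have e1 : P.onO (b * s') = P.val x * (P.onO s * P.onO s') := by
    rw [map_mul, P.onO_apply b, ← hb, map_mul, ← P.onO_apply, mul_assoc]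
  have e2 : P.onO (c * s) = P.val y * (P.onO s * P.onO s') := by
    rw [map_mul, P.onO_apply c, ← hc, map_mul, ← P.onO_apply, mul_assoc, mul_comm (P.onO s')]
  have hs0 : P.onO s ≠ 0 := val_ne_zero_of_isUnit P (bigOToFun_isUnit hs)
  have hs0' : P.onO s' ≠ 0 := val_ne_zero_of_isUnit P (bigOToFun_isUnit hs')
  obtain ⟨u, a, hu, hua⟩ := h.exists_mul_eq_mul hπ (val_localParam h hπ) (x := b * s') (y := c * s)
    (by rw [e2]; exact mul_ne_zero hy (mul_ne_zero hs0 hs0'))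
    (by rw [e1, e2]; exact mul_le_mul_left hxy _)
  refine ⟨u, a, hu, ?_⟩
  have h1 := congrArg bigOToFun hua
  simp only [map_mul, ← hb, ← hc] at h1
  refine ((bigOToFun_isUnit hs).mul (bigOToFun_isUnit hs')).mul_right_cancel ?_
  linear_combination h1

end LocalParams

/-! ### Finiteness of zeros and poles on 𝐔. -/

section Finiteness

variable {Fq : Type*} [Field Fq] [Fintype Fq] {𝕂 : Type*} [Field 𝕂] [Algebra Fq 𝕂] [IsAlgClosed 𝕂]
  {L : Type*} [Field L] [Algebra Fq L] [Algebra Fq[X] L] [Algebra (RatFunc Fq) L]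
  [IsScalarTower Fq Fq[X] L] [IsScalarTower Fq (RatFunc Fq) L] [IsScalarTower Fq[X] (RatFunc Fq) L]
  [FiniteDimensional (RatFunc Fq) L] [Algebra.IsSeparable (RatFunc Fq) L]

/-- Such a homomorphism sends t to a root of p and each basis element to a root of its integral
equation specialized there, and it is determined by these values. -/
theorem finite_centers {p : 𝕂[X]} (hp : p ≠ 0) :
    {χ : BigO Fq 𝕂 L →ₐ[𝕂] 𝕂 | χ (algebraMap 𝕂[X] _ p) = 0}.Finite := by
  let b := (exists_bigO_basis (Fq := Fq) (𝕂 := 𝕂) (L := L)).some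
  choose f hf hfb using fun i => Algebra.IsIntegral.isIntegral (R := 𝕂[X]) (b i)
  have hX : ∀ (χ : BigO Fq 𝕂 L →ₐ[𝕂] 𝕂), (χ : BigO Fq 𝕂 L →+* 𝕂).comp (algebraMap 𝕂[X] _)
      = evalRingHom (χ (algebraMap 𝕂[X] _ X)) := by
    intro χ
    refine Polynomial.ringHom_ext (fun c => ?_) ?_
    · simp only [RingHom.comp_apply, algebraMap_bigO_C, RingHom.coe_coe]
      rw [apply_tmul]; simp
    · simp
  let S : Fin (Module.finrank (RatFunc Fq) L) → Set 𝕂 := fun i =>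
    ⋃ c ∈ {c | p.IsRoot c}, {z | ((f i).map (evalRingHom c)).IsRoot z}
  have hS : ∀ i, (S i).Finite := fun i => by
    refine Set.Finite.biUnion (finite_setOfPred_isRoot hp) fun c _ => finite_setOfPred_isRoot ((hf i).map _).ne_zero
  refine Set.Finite.of_finite_image (f := fun χ => (χ (algebraMap 𝕂[X] _ X), fun i => χ (b i)))
    (((finite_setOfPred_isRoot hp).prod (Set.Finite.pi' hS)).subset ?_) ?_
  · rintro _ ⟨χ, hχ, rfl⟩
    have hroot : p.IsRoot (χ (algebraMap 𝕂[X] _ X)) := by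
      have := DFunLike.congr_fun (hX χ) p
      simp only [RingHom.comp_apply, RingHom.coe_coe, coe_evalRingHom] at this
      exact this.symm.trans hχ
    refine ⟨hroot, fun i => ?_⟩
    refine Set.mem_biUnion hroot ?_
    change eval _ _ = 0
    rw [eval_map, ← hX]
    have := hom_eval₂ (f i) (algebraMap 𝕂[X] (BigO Fq 𝕂 L)) (χ : BigO Fq 𝕂 L →+* 𝕂) (b i)
    rw [hfb, map_zero] at this
    exact this.symm
  · intro χ _ χ' _ h
    simp only [Prod.mk.injEq] at h
    refine AlgHom.ext fun x => ?_
    rw [← b.sum_repr x]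
    have h1 := congrFun h.2
    have h2 : ∀ q, χ (algebraMap 𝕂[X] _ q) = χ' (algebraMap 𝕂[X] _ q) := fun q => by
      have e1 := DFunLike.congr_fun (hX χ) q
      have e2 := DFunLike.congr_fun (hX χ') q
      rw [h.1] at e1
      exact e1.trans e2.symm
    simp only [map_sum, Algebra.smul_def, map_mul, h1, h2]

theorem finite_onO_lt_one {b : BigO Fq 𝕂 L} (hb : b ∈ nonZeroDivisors (BigO Fq 𝕂 L)) :
    {P ∈ affinePart Fq 𝕂 L | P.onO b < 1}.Finite := by
  obtain ⟨p, hp, b', hb'⟩ := exists_mul_eq_polynomial hb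
  choose pt hpt using exists_point (Fq := Fq) (𝕂 := 𝕂) (L := L)
  refine ((finite_centers hp).image pt).subset ?_
  rintro P ⟨hP, h1⟩
  obtain ⟨χ, hχ⟩ := P.exists_center hP
  refine ⟨χ, ?_, eq_of_isCentered (hpt χ) hχ⟩
  change χ _ = 0
  rw [← hχ.lt_one_iff, ← hb', map_mul]
  exact lt_of_le_of_lt (mul_le_of_le_one_right' (hχ.le_one _)) h1

theorem finite_one_lt_val (x : FunRing Fq 𝕂 L) : {P ∈ affinePart Fq 𝕂 L | 1 < P.val x}.Finite := by
  obtain ⟨b, s, hs, hxb⟩ := exists_bigO_div x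
  refine (finite_onO_lt_one hs).subset fun P ⟨hP, h1⟩ => ⟨hP, ?_⟩
  by_contra hcon
  have hs1 : P.onO s = 1 := le_antisymm (P.onO_le_one hP s) (not_lt.1 hcon)
  have := congrArg P.val hxb
  rw [map_mul, ← P.onO_apply, ← P.onO_apply, hs1, mul_one] at this
  exact absurd h1 (not_lt.2 (this ▸ P.onO_le_one hP b))

theorem finite_val_ne_one {x : FunRing Fq 𝕂 L} (hx : IsUnit x) :
    {P ∈ affinePart Fq 𝕂 L | P.val x ≠ 1}.Finite := by
  obtain ⟨x, rfl⟩ := hx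
  refine ((finite_one_lt_val (x : FunRing Fq 𝕂 L)).union
    (finite_one_lt_val ((x⁻¹ : (FunRing Fq 𝕂 L)ˣ) : FunRing Fq 𝕂 L))).subset ?_
  rintro P ⟨hP, h1⟩
  rcases lt_or_gt_of_ne h1 with h | h
  · right
    refine ⟨hP, ?_⟩
    have hmul : P.val x * P.val ((x⁻¹ : (FunRing Fq 𝕂 L)ˣ) : FunRing Fq 𝕂 L) = 1 := by
      rw [← map_mul, Units.mul_inv, map_one]
    by_contra hle
    have := mul_le_of_le_one_right' (a := P.val (x : FunRing Fq 𝕂 L)) (not_lt.1 hle)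
    rw [hmul] at this
    exact absurd h (not_lt.2 this)
  · exact Or.inl ⟨hP, h⟩

end Finiteness

/-! ### Frobenius twists -/

section Twist

variable {Fq : Type*} [Field Fq] [Fintype Fq] {𝕂 : Type*} [Field 𝕂] [Algebra Fq 𝕂]
  {L : Type*} [Field L] [Algebra Fq L]

theorem funRing_ringHom_ext {S : Type*} [CommRing S] {f g : FunRing Fq 𝕂 L →+* S}
    (hc : ∀ c : 𝕂, f (const Fq c) = g (const Fq c)) (hf : ∀ a : L, f (fn Fq a) = g (fn Fq a)) :
    f = g := by
  refine IsLocalization.ringHom_ext (nonZeroDivisors (𝕂 ⊗[Fq] L)) (RingHom.ext fun y => ?_)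
  induction y using TensorProduct.induction_on with
  | zero => simp
  | tmul c a =>
    have : c ⊗ₜ[Fq] a = (c ⊗ₜ[Fq] (1 : L)) * ((1 : 𝕂) ⊗ₜ[Fq] a) := by simp
    rw [this, map_mul, map_mul]
    exact congrArg₂ (· * ·) (hc c) (hf a)
  | add x y hx hy => rw [map_add, map_add, hx, hy]

theorem scalarAut_fn (g : 𝕂 ≃ₐ[Fq] 𝕂) (a : L) :
    scalarAut Fq 𝕂 L g (fn Fq a) = fn Fq a := by
  simp [scalarAut, fn]

theorem const_mul (c d : 𝕂) : (const Fq (c * d) : FunRing Fq 𝕂 L) = const Fq c * const Fq d := by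
  simp [const, ← map_mul]

theorem const_add (c d : 𝕂) : (const Fq (c + d) : FunRing Fq 𝕂 L) = const Fq c + const Fq d := by
  simp [const, ← map_add, TensorProduct.add_tmul]

theorem const_one : (const Fq (1 : 𝕂) : FunRing Fq 𝕂 L) = 1 := by
  simp [const, ← Algebra.TensorProduct.one_def]

theorem const_zero : (const Fq (0 : 𝕂) : FunRing Fq 𝕂 L) = 0 := by simp [const]

/-- `const` as a ring homomorphism. -/
def constHom : 𝕂 →+* FunRing Fq 𝕂 L where
  toFun := const Fq
  map_one' := const_one
  map_mul' := const_mul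
  map_zero' := const_zero
  map_add' := const_add

/-- `fn` as a ring homomorphism. -/
def fnHom : L →+* FunRing Fq 𝕂 L :=
  (algebraMap (𝕂 ⊗[Fq] L) (FunRing Fq 𝕂 L)).comp
    (Algebra.TensorProduct.includeRight : L →ₐ[Fq] 𝕂 ⊗[Fq] L).toRingHom

theorem fnHom_apply (a : L) : (fnHom a : FunRing Fq 𝕂 L) = fn Fq a := rfl

theorem constHom_apply (c : 𝕂) : (constHom c : FunRing Fq 𝕂 L) = const Fq c := rfl

theorem const_algebraMap (c : Fq) :
    (const Fq (algebraMap Fq 𝕂 c) : FunRing Fq 𝕂 L) = fn Fq (algebraMap Fq L c) := by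
  simp only [const, fn]
  congr 1
  rw [Algebra.algebraMap_eq_smul_one, Algebra.algebraMap_eq_smul_one, TensorProduct.smul_tmul]

theorem smul_funRing_eq (c : 𝕂) (x : FunRing Fq 𝕂 L) : c • x = const Fq c * x := by
  rw [Algebra.smul_def, IsScalarTower.algebraMap_apply 𝕂 (𝕂 ⊗[Fq] L) (FunRing Fq 𝕂 L)]
  rfl

variable [IsAlgClosed 𝕂]

theorem funTwist_sub (n : ℤ) (x y : FunRing Fq 𝕂 L) :
    funTwist Fq 𝕂 L n (x - y) = funTwist Fq 𝕂 L n x - funTwist Fq 𝕂 L n y :=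
  RingHom.map_sub (funTwist Fq 𝕂 L n).toRingHom x y

theorem funTwist_mul (n : ℤ) (x y : FunRing Fq 𝕂 L) :
    funTwist Fq 𝕂 L n (x * y) = funTwist Fq 𝕂 L n x * funTwist Fq 𝕂 L n y :=
  (funTwist Fq 𝕂 L n).map_mul x y

theorem funTwist_const (n : ℤ) (c : 𝕂) :
    funTwist Fq 𝕂 L n (const Fq c) = const Fq ((frob Fq 𝕂 ^ n) c) := scalarAut_const ..

theorem funTwist_fn (n : ℤ) (a : L) : funTwist Fq 𝕂 L n (fn Fq a) = fn Fq a := scalarAut_fn ..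

theorem funTwist_tFun [Algebra (RatFunc Fq) L] (n : ℤ) :
    funTwist Fq 𝕂 L n (tFun Fq 𝕂 L) = tFun Fq 𝕂 L := funTwist_fn ..

theorem funTwist_add (m n : ℤ) (x : FunRing Fq 𝕂 L) :
    funTwist Fq 𝕂 L m (funTwist Fq 𝕂 L n x) = funTwist Fq 𝕂 L (m + n) x := by
  have : ((funTwist Fq 𝕂 L m).toRingHom).comp (funTwist Fq 𝕂 L n).toRingHom
      = (funTwist Fq 𝕂 L (m + n)).toRingHom := by
    refine funRing_ringHom_ext (fun c => ?_) fun a => ?_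
    · change funTwist Fq 𝕂 L m (funTwist Fq 𝕂 L n _) = funTwist Fq 𝕂 L (m + n) _
      rw [funTwist_const, funTwist_const, funTwist_const, zpow_add]; rfl
    · change funTwist Fq 𝕂 L m (funTwist Fq 𝕂 L n _) = funTwist Fq 𝕂 L (m + n) _
      rw [funTwist_fn, funTwist_fn, funTwist_fn]
  exact DFunLike.congr_fun this x

theorem funTwist_zero (x : FunRing Fq 𝕂 L) : funTwist Fq 𝕂 L 0 x = x := by
  apply (funTwist Fq 𝕂 L 0).injective
  rw [funTwist_add, add_zero]

theorem ClosedPoint.twist_val (n : ℤ) (P : ClosedPoint Fq 𝕂 L) (x : FunRing Fq 𝕂 L) :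
    (P.twist n).val x = P.val (funTwist Fq 𝕂 L (-n) x) := rfl

theorem ClosedPoint.twist_twist (m n : ℤ) (P : ClosedPoint Fq 𝕂 L) :
    (P.twist m).twist n = P.twist (m + n) := by
  ext x
  rw [twist_val, twist_val, twist_val, funTwist_add, neg_add]

theorem ClosedPoint.twist_zero (P : ClosedPoint Fq 𝕂 L) : P.twist 0 = P := by
  ext x
  rw [twist_val, neg_zero, funTwist_zero]

theorem ClosedPoint.twist_injective (n : ℤ) :
    Function.Injective (ClosedPoint.twist (Fq := Fq) (𝕂 := 𝕂) (L := L) n) := by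
  intro P Q h
  have := congrArg (ClosedPoint.twist (-n)) h
  simpa [twist_twist, twist_zero] using this

theorem twistDiv_apply (n : ℤ) (D : Divisor Fq 𝕂 L) (P : ClosedPoint Fq 𝕂 L) :
    twistDiv n D P = D (P.twist (-n)) := by
  have : P = (P.twist (-n)).twist n := by rw [ClosedPoint.twist_twist, neg_add_cancel, P.twist_zero]
  conv_lhs => rw [this]
  exact Finsupp.mapDomain_apply (ClosedPoint.twist_injective n) D _

theorem twist_mem_affinePart [Algebra (RatFunc Fq) L] {n : ℤ} {P : ClosedPoint Fq 𝕂 L} :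
    P.twist n ∈ affinePart Fq 𝕂 L ↔ P ∈ affinePart Fq 𝕂 L := by
  change (P.twist n).val _ ≤ 1 ↔ P.val _ ≤ 1
  rw [ClosedPoint.twist_val, funTwist_tFun]

/-- As functions the constants ε of L are fixed by twisting, while the scalars ε^{1/q^i} are raised
to the power q^n; so a twist by n lowers the index of the component by n. -/
theorem twist_mem_component {ι : ConstField Fq L →ₐ[Fq] 𝕂} {i j : ℕ} {n : ℤ}
    (h : (j : ℤ) = i - n) {P : ClosedPoint Fq 𝕂 L} :
    P.twist n ∈ component ι j ↔ P ∈ component ι i := by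
  change (∀ ε, _) ↔ (∀ ε, _)
  refine forall_congr' fun ε => ?_
  rw [ClosedPoint.twist_val, funTwist_sub, funTwist_fn, funTwist_const, ← AlgEquiv.mul_apply, ← zpow_add, h]
  have : -n + -((i : ℤ) - n) = -i := by ring
  rw [this]

end Twist

/-! ### Sections over the affine part -/

section Sections

variable {Fq : Type*} [Field Fq] [Fintype Fq] {𝕂 : Type*} [Field 𝕂] [Algebra Fq 𝕂] [IsAlgClosed 𝕂]
  {L : Type*} [Field L] [Algebra Fq L] [Algebra Fq[X] L] [Algebra (RatFunc Fq) L]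
  [IsScalarTower Fq Fq[X] L] [IsScalarTower Fq (RatFunc Fq) L] [IsScalarTower Fq[X] (RatFunc Fq) L]
  [FiniteDimensional (RatFunc Fq) L] [Algebra.IsSeparable (RatFunc Fq) L]

theorem bigO_smul_eq (b : BigO Fq 𝕂 L) (x : FunRing Fq 𝕂 L) : b • x = bigOToFun b * x := rfl

theorem bigOToFun_mul_mem {N : Submodule (BigO Fq 𝕂 L) (FunRing Fq 𝕂 L)} (b : BigO Fq 𝕂 L)
    {x : FunRing Fq 𝕂 L} (hx : x ∈ N) : bigOToFun b * x ∈ N := N.smul_mem b hx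

theorem mem_affineSections {D : Divisor Fq 𝕂 L} {x : FunRing Fq 𝕂 L} :
    x ∈ affineSections D ↔ ∀ P ∈ affinePart Fq 𝕂 L, P.val x ≤ WithZero.exp (D P) := Iff.rfl

/-- The Nullstellensatz for the finitely generated 𝕂-algebra O_𝐊. -/
theorem exists_hom_of_isMaximal (𝔫 : Ideal (BigO Fq 𝕂 L)) [h𝔫 : 𝔫.IsMaximal] :
    ∃ χ : BigO Fq 𝕂 L →ₐ[𝕂] 𝕂, ∀ b, χ b = 0 ↔ b ∈ 𝔫 := by
  have hft : Algebra.FiniteType 𝕂 (BigO Fq 𝕂 L) :=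
    Algebra.FiniteType.trans (S := 𝕂[X]) inferInstance inferInstance
  have hft' : Algebra.FiniteType 𝕂 (BigO Fq 𝕂 L ⧸ 𝔫) :=
    hft.of_surjective (Ideal.Quotient.mkₐ 𝕂 𝔫) (Ideal.Quotient.mkₐ_surjective 𝕂 𝔫)
  let _ : Field (BigO Fq 𝕂 L ⧸ 𝔫) := Ideal.Quotient.field 𝔫
  have hfin : Module.Finite 𝕂 (BigO Fq 𝕂 L ⧸ 𝔫) := finite_of_finite_type_of_isJacobsonRing _ _
  have hint : Algebra.IsIntegral 𝕂 (BigO Fq 𝕂 L ⧸ 𝔫) := Algebra.IsIntegral.of_finite _ _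
  have hbij := IsAlgClosed.algebraMap_bijective_of_isIntegral (k := 𝕂) (K := BigO Fq 𝕂 L ⧸ 𝔫)
  let e : 𝕂 ≃ₐ[𝕂] (BigO Fq 𝕂 L ⧸ 𝔫) := AlgEquiv.ofBijective (Algebra.ofId 𝕂 _) hbij
  refine ⟨(e.symm : _ →ₐ[𝕂] 𝕂).comp (Ideal.Quotient.mkₐ 𝕂 𝔫), fun b => ?_⟩
  change e.symm (Ideal.Quotient.mk 𝔫 b) = 0 ↔ _
  rw [map_eq_zero_iff _ e.symm.injective, Ideal.Quotient.eq_zero_iff_mem]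

/-- The divisor `D` is attained by the submodule `N` of `𝐊`: `exp (D P)` is the maximum of the
valuation at `P` on `N`, for every point `P` of `𝐔`. -/
def Attains (N : Submodule (BigO Fq 𝕂 L) (FunRing Fq 𝕂 L)) (D : Divisor Fq 𝕂 L) : Prop :=
  ∀ P ∈ affinePart Fq 𝕂 L, (∀ m ∈ N, P.val m ≤ WithZero.exp (D P)) ∧
    ∃ m ∈ N, P.val m = WithZero.exp (D P)

/-- For a section x, the ideal of all b with b x ∈ N lies in no maximal ideal: at each point x is
locally a multiple of an element of N with the largest valuation. Submodules attaining a divisor are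
thus recovered from it. -/
theorem Attains.mem_iff {N : Submodule (BigO Fq 𝕂 L) (FunRing Fq 𝕂 L)} {D : Divisor Fq 𝕂 L}
    (h : Attains N D) {x : FunRing Fq 𝕂 L} : x ∈ N ↔ x ∈ affineSections D := by
  refine ⟨fun hx P hP => (h P hP).1 x hx, fun hx => ?_⟩
  let I : Ideal (BigO Fq 𝕂 L) :=
    { carrier := {b | bigOToFun b * x ∈ N}
      add_mem' := fun {a b} ha hb => by
        change bigOToFun (a + b) * x ∈ N
        rw [map_add, add_mul]; exact N.add_mem ha hb
      zero_mem' := by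
        change bigOToFun (0 : BigO Fq 𝕂 L) * x ∈ N
        rw [map_zero, zero_mul]; exact N.zero_mem
      smul_mem' := fun a b hb => by
        change bigOToFun (a * b) * x ∈ N
        rw [map_mul, mul_assoc]; exact bigOToFun_mul_mem a hb }
  by_cases hI : I = ⊤
  · have : (1 : BigO Fq 𝕂 L) ∈ I := hI ▸ Submodule.mem_top
    change bigOToFun (1 : BigO Fq 𝕂 L) * x ∈ N at this
    rwa [map_one, one_mul] at this
  · exfalso
    obtain ⟨𝔫, h𝔫, hle⟩ := Ideal.exists_le_maximal I hI
    obtain ⟨χ, hχ⟩ := exists_hom_of_isMaximal 𝔫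
    obtain ⟨P, hP⟩ := exists_point χ
    have hPU := P.mem_affinePart_of_isCentered hP
    obtain ⟨m, hm, hval⟩ := (h P hPU).2
    obtain ⟨s, a, hs, hsa⟩ := exists_mul_eq_mul_fun hP (x := x) (y := m)
      (by rw [hval]; exact WithZero.exp_ne_zero) (by rw [hval]; exact hx P hPU)
    apply hs
    rw [hχ]
    apply hle
    change bigOToFun s * x ∈ N
    rw [hsa]
    exact bigOToFun_mul_mem a hm

/-- The maximum at P is reached on a finite set of generators. The unit g prevents this maximum from
being 0, and both the points where g has valuation other than 1 and the poles of the generators are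
finite in number, so D has finite support. -/
theorem exists_attains {N : Submodule (BigO Fq 𝕂 L) (FunRing Fq 𝕂 L)} (hN : N.FG)
    {g : FunRing Fq 𝕂 L} (hg : IsUnit g) (hgN : g ∈ N) :
    ∃ D : Divisor Fq 𝕂 L, Attains N D ∧ ∀ P ∈ D.support, P ∈ affinePart Fq 𝕂 L := by
  obtain ⟨S, hS⟩ := hN
  have hbound : ∀ P ∈ affinePart Fq 𝕂 L, ∀ c : ℤᵐ⁰, (∀ s ∈ S, P.val s ≤ c) → ∀ m ∈ N, P.val m ≤ c := by
    intro P hP c hc m hm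
    rw [← hS] at hm
    induction hm using Submodule.span_induction with
    | mem x hx => exact hc x hx
    | zero => simp
    | add x y _ _ hx hy => exact P.val.map_add_le hx hy
    | smul a x _ hx =>
      rw [bigO_smul_eq, map_mul]
      exact (mul_le_of_le_one_left' (P.onO_le_one hP a)).trans hx
  have hSN : ∀ s ∈ S, s ∈ N := fun s hs => hS ▸ Submodule.subset_span hs
  have hSne : S.Nonempty := by
    by_contra hne
    rw [Finset.not_nonempty_iff_eq_empty] at hne
    rw [hne] at hS
    simp only [Finset.coe_empty, Submodule.span_empty] at hS
    rw [← hS, Submodule.mem_bot] at hgN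
    rw [hgN] at hg
    obtain ⟨χ, -⟩ := exists_hom_of_isMaximal (Fq := Fq) (𝕂 := 𝕂) (L := L)
      (Ideal.exists_maximal (BigO Fq 𝕂 L)).choose (h𝔫 := (Ideal.exists_maximal _).choose_spec)
    obtain ⟨P, -⟩ := exists_point χ
    exact val_ne_zero_of_isUnit P hg (map_zero _)
  have hex : ∀ P : ClosedPoint Fq 𝕂 L, ∃ d : ℤ, P ∈ affinePart Fq 𝕂 L →
      (∀ m ∈ N, P.val m ≤ WithZero.exp d) ∧ ∃ s ∈ S, P.val s = WithZero.exp d := by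
    intro P
    by_cases hP : P ∈ affinePart Fq 𝕂 L
    · obtain ⟨s, hs, hmax⟩ := S.exists_max_image P.val hSne
      have hb := hbound P hP (P.val s) hmax
      have hs0 : P.val s ≠ 0 := fun h0 =>
        val_ne_zero_of_isUnit P hg (le_antisymm (h0 ▸ hb g hgN) zero_le)
      refine ⟨WithZero.log (P.val s), fun _ => ?_⟩
      rw [WithZero.exp_log hs0]
      exact ⟨hb, s, hs, rfl⟩
    · exact ⟨0, fun h => absurd h hP⟩
  choose d hd using hex
  classical
  let F : ClosedPoint Fq 𝕂 L → ℤ := fun P => if P ∈ affinePart Fq 𝕂 L then d P else 0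
  have hfin : (Function.support F).Finite := by
    refine ((finite_val_ne_one hg).union (S.finite_toSet.biUnion fun s _ => finite_one_lt_val s)).subset ?_
    intro P hP
    by_cases hPU : P ∈ affinePart Fq 𝕂 L
    · have hdP : d P ≠ 0 := by simpa [F, hPU] using hP
      obtain ⟨hb, s, hs, hsP⟩ := hd P hPU
      by_cases h1 : P.val g = 1
      · right
        refine Set.mem_biUnion hs ⟨hPU, ?_⟩
        have := hb g hgN
        rw [h1, ← WithZero.exp_zero, WithZero.exp_le_exp] at this
        rw [hsP, ← WithZero.exp_zero, WithZero.exp_lt_exp]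
        omega
      · exact Or.inl ⟨hPU, h1⟩
    · exact absurd (by simp [F, hPU]) hP
  refine ⟨Finsupp.ofSupportFinite F hfin, fun P hP => ?_, fun P hP => ?_⟩
  · have : Finsupp.ofSupportFinite F hfin P = d P := by simp [Finsupp.ofSupportFinite_coe, F, hP]
    rw [this]
    obtain ⟨hb, s, hs, hsP⟩ := hd P hP
    exact ⟨hb, s, hSN s hs, hsP⟩
  · by_contra hne
    have : Finsupp.ofSupportFinite F hfin P = 0 := by simp [Finsupp.ofSupportFinite_coe, F, hne]
    exact (Finsupp.mem_support_iff.1 hP) this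

end Sections

/-! ### Frobenius descent for ideals of `O_𝐊` -/

section Descent

variable {Fq : Type*} [Field Fq] [Fintype Fq] {𝕂 : Type*} [Field 𝕂] [Algebra Fq 𝕂]

theorem mem_range_of_pow_card_eq {x : 𝕂} (hx : x ^ Fintype.card Fq = x) :
    x ∈ Set.range (algebraMap Fq 𝕂) := by
  classical
  have hne : (X ^ Fintype.card Fq - X : 𝕂[X]) ≠ 0 := FiniteField.X_pow_card_sub_X_ne_zero 𝕂
    Fintype.one_lt_card
  have h1 : Finset.univ.image (algebraMap Fq 𝕂) ⊆ (X ^ Fintype.card Fq - X : 𝕂[X]).roots.toFinset := by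
    intro y hy
    obtain ⟨a, -, rfl⟩ := Finset.mem_image.1 hy
    rw [Multiset.mem_toFinset, mem_roots hne]
    simp [← map_pow, FiniteField.pow_card]
  have h2 : (X ^ Fintype.card Fq - X : 𝕂[X]).roots.toFinset.card ≤ (Finset.univ.image (algebraMap Fq 𝕂)).card := by
    rw [Finset.card_image_of_injective _ (algebraMap Fq 𝕂).injective, Finset.card_univ]
    refine (Multiset.toFinset_card_le _).trans ((card_roots' _).trans ?_)
    rw [FiniteField.X_pow_card_sub_X_natDegree_eq 𝕂 Fintype.one_lt_card]
  have h3 := Finset.eq_of_subset_of_card_le h1 h2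
  have h4 : x ∈ (X ^ Fintype.card Fq - X : 𝕂[X]).roots.toFinset := by
    rw [Multiset.mem_toFinset, mem_roots hne]
    simp [hx]
  rw [← h3] at h4
  obtain ⟨a, -, h⟩ := Finset.mem_image.1 h4
  exact ⟨a, h⟩

variable [IsAlgClosed 𝕂]

theorem frob_apply (x : 𝕂) : frob Fq 𝕂 x = x ^ Fintype.card Fq := rfl

variable {L : Type*} [Field L] [Algebra Fq L] [Algebra Fq[X] L] [IsScalarTower Fq Fq[X] L]

/-- The inverse Frobenius twist on `O_𝐊`. -/
def bigOTwistInv : BigO Fq 𝕂 L ≃ₐ[Fq] BigO Fq 𝕂 L :=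
  Algebra.TensorProduct.congr (frob Fq 𝕂).symm AlgEquiv.refl

theorem bigOTwistInv_tmul (c : 𝕂) (a : OK Fq L) :
    bigOTwistInv (c ⊗ₜ[Fq] a) = (frob Fq 𝕂).symm c ⊗ₜ a := rfl

/-- Artin's argument of minimal support. Among the nonzero elements of I take one with the fewest
coordinates in an 𝔽_q-basis of O_L, and scale one coordinate to 1. Its inverse twist minus itself
has fewer coordinates, hence is zero, so all coordinates are fixed by Frobenius and lie in 𝔽_q. -/
theorem exists_one_tmul_mem {I : Ideal (BigO Fq 𝕂 L)} (hI : ∀ b ∈ I, bigOTwistInv b ∈ I)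
    (hne : I ≠ ⊥) : ∃ a : OK Fq L, a ≠ 0 ∧ 1 ⊗ₜ a ∈ I := by
  let e := Module.Free.chooseBasis Fq (OK Fq L)
  let E := Algebra.TensorProduct.basis 𝕂 e
  have hrepr : ∀ (b : BigO Fq 𝕂 L) i, E.repr (bigOTwistInv b) i = (frob Fq 𝕂).symm (E.repr b i) := by
    intro b i
    induction b using TensorProduct.induction_on with
    | zero => simp
    | tmul c a =>
      rw [bigOTwistInv_tmul, Algebra.TensorProduct.basis_repr_tmul,
        Algebra.TensorProduct.basis_repr_tmul]
      simp
    | add x y hx hy => simp only [map_add, Finsupp.add_apply, hx, hy]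
  obtain ⟨b₀, hb₀, hb₀0⟩ := Submodule.exists_mem_ne_zero_of_ne_bot hne
  obtain ⟨b, ⟨hbI, hb0⟩, hmin⟩ := exists_minimalFor_of_wellFoundedLT
    (fun b : BigO Fq 𝕂 L => b ∈ I ∧ b ≠ 0) (fun b => (E.repr b).support.card) ⟨b₀, hb₀, hb₀0⟩
  obtain ⟨i₀, hi₀⟩ : ∃ i, E.repr b i ≠ 0 := by
    by_contra! h
    exact hb0 (E.repr.injective (by rw [map_zero]; exact Finsupp.ext h))
  set c := (E.repr b i₀)⁻¹ with hc
  have hc0 : c ≠ 0 := inv_ne_zero hi₀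
  set b' : BigO Fq 𝕂 L := c • b with hb'
  have hb'I : b' ∈ I := by
    rw [hb', Algebra.smul_def]
    exact I.mul_mem_left _ hbI
  have hr : ∀ i, E.repr b' i = c * E.repr b i := fun i => by rw [hb', map_smul]; rfl
  have hone : E.repr b' i₀ = 1 := by rw [hr, hc, inv_mul_cancel₀ hi₀]
  have hzero : bigOTwistInv b' - b' = 0 := by
    by_contra hne0
    have hle := hmin (j := bigOTwistInv b' - b') ⟨I.sub_mem (hI _ hb'I) hb'I, hne0⟩
    have hsub : (E.repr (bigOTwistInv b' - b')).support ⊂ (E.repr b).support := by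
      refine Finset.ssubset_iff_subset_ne.2 ⟨fun i hi => ?_, fun heq => ?_⟩
      · rw [Finsupp.mem_support_iff] at hi ⊢
        intro h0
        apply hi
        rw [map_sub, Finsupp.sub_apply, hrepr, hr, h0]
        simp
      · have : i₀ ∈ (E.repr (bigOTwistInv b' - b')).support := by
          rw [heq]; exact Finsupp.mem_support_iff.2 hi₀
        rw [Finsupp.mem_support_iff] at this
        apply this
        rw [map_sub, Finsupp.sub_apply, hrepr, hone]
        simp
    have hlt := Finset.card_lt_card hsub
    exact absurd (hle hlt.le) (not_le.2 hlt)
  have hfix : ∀ i, E.repr b' i ∈ Set.range (algebraMap Fq 𝕂) := by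
    intro i
    apply mem_range_of_pow_card_eq
    rw [← frob_apply]
    have := hrepr b' i
    rw [sub_eq_zero.1 hzero] at this
    conv_lhs => rw [this]
    simp
  choose d hd using hfix
  refine ⟨∑ i ∈ (E.repr b').support, d i • e i, ?_, ?_⟩
  · intro h0
    have h1 := congrArg (fun a => e.repr a i₀) h0
    have hmem : i₀ ∈ (E.repr b').support := Finsupp.mem_support_iff.2 (by rw [hone]; exact one_ne_zero)
    simp [map_sum, Finsupp.finsetSum_apply, Finsupp.single_apply, hone] at h1
    have := hd i₀
    rw [h1, map_zero, hone] at this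
    exact one_ne_zero this.symm
  · have : (1 : 𝕂) ⊗ₜ[Fq] (∑ i ∈ (E.repr b').support, d i • e i) = b' := by
      conv_rhs => rw [← E.linearCombination_repr b', Finsupp.linearCombination_apply, Finsupp.sum]
      rw [TensorProduct.tmul_sum]
      refine Finset.sum_congr rfl fun i _ => ?_
      rw [Algebra.TensorProduct.basis_apply, ← hd i, TensorProduct.smul_tmul', TensorProduct.tmul_smul,
        TensorProduct.smul_tmul', Algebra.algebraMap_eq_smul_one]
      simp
    rw [this]
    exact hb'I

/-- The nilradical is stable under twisting, so if nonzero it would contain some 1 ⊗ a with a ≠ 0;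
but O_L is a domain. -/
theorem bigO_isReduced : IsReduced (BigO Fq 𝕂 L) := by
  rw [← nilradical_eq_bot_iff]
  by_contra hne
  obtain ⟨a, ha0, ha⟩ := exists_one_tmul_mem (fun b hb => by
    rw [mem_nilradical] at hb ⊢
    exact hb.map bigOTwistInv) hne
  rw [mem_nilradical] at ha
  obtain ⟨n, hn⟩ := ha
  rw [Algebra.TensorProduct.tmul_pow, one_pow] at hn
  have h1 : a ^ n = 0 := by
    have hinj : Function.Injective (Algebra.TensorProduct.includeRight : OK Fq L →ₐ[Fq] 𝕂 ⊗[Fq] OK Fq L) :=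
      Algebra.TensorProduct.includeRight_injective (algebraMap Fq 𝕂).injective
    exact hinj (hn.trans (map_zero _).symm)
  exact ha0 (IsReduced.eq_zero a ⟨n, h1⟩)

end Descent

/-! ### Faithful vectors -/

/-- For each minimal prime 𝔮 some vector has its annihilator inside 𝔮, since otherwise a product of
annihilators of generators would be an element outside 𝔮 killing N. These vectors are glued with
elements e_𝔮 that avoid 𝔮 but lie in all other minimal primes; in a reduced ring the minimal primes
intersect in 0. -/
theorem exists_faithful_vector {R N : Type*} [CommRing R] [IsNoetherianRing R] [IsReduced R]
    [AddCommGroup N] [Module R N] [Module.Finite R N] (hfaith : ∀ r : R, (∀ m : N, r • m = 0) → r = 0) :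
    ∃ v : N, ∀ r : R, r • v = 0 → r = 0 := by
  classical
  have hfin : (minimalPrimes R).Finite := minimalPrimes.finite_of_isNoetherianRing R
  have hinf : ∀ r : R, (∀ 𝔮 ∈ minimalPrimes R, r ∈ 𝔮) → r = 0 := by
    intro r hr
    have h1 : r ∈ (⊥ : Ideal R).radical := by
      rw [← Ideal.sInf_minimalPrimes, Ideal.mem_sInf]
      exact fun {I} hI => hr I hI
    obtain ⟨n, hn⟩ := h1
    exact (IsReduced.eq_zero r ⟨n, hn⟩)
  have hprime : ∀ 𝔮 ∈ minimalPrimes R, 𝔮.IsPrime := fun 𝔮 h => h.1.1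
  obtain ⟨S, hS⟩ := Module.Finite.fg_top (R := R) (M := N)
  have hv : ∀ 𝔮 ∈ minimalPrimes R, ∃ m : N, ∀ r : R, r • m = 0 → r ∈ 𝔮 := by
    intro 𝔮 h𝔮
    have := hprime 𝔮 h𝔮
    by_contra! hcon
    choose r hr hr𝔮 using hcon
    have hprod : ∏ m ∈ S, r m ∉ 𝔮 := fun h => by
      obtain ⟨m, _, hm⟩ := (Ideal.IsPrime.prod_mem_iff).1 h
      exact hr𝔮 m hm
    apply hprod
    rw [hfaith (∏ m ∈ S, r m)]
    · exact 𝔮.zero_mem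
    · intro m
      have hm : m ∈ Submodule.span R (S : Set N) := hS ▸ Submodule.mem_top
      induction hm using Submodule.span_induction with
      | mem x hx =>
        rw [← Finset.prod_erase_mul S r hx, mul_smul, hr, smul_zero]
      | zero => simp
      | add x y _ _ hx hy => rw [smul_add, hx, hy, add_zero]
      | smul a x _ hx => rw [smul_comm, hx, smul_zero]
  have he : ∀ 𝔮 ∈ minimalPrimes R, ∃ e : R, e ∉ 𝔮 ∧ ∀ 𝔮' ∈ minimalPrimes R, 𝔮' ≠ 𝔮 → e ∈ 𝔮' := by
    intro 𝔮 h𝔮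
    have := hprime 𝔮 h𝔮
    have hnot : ¬ (hfin.toFinset.erase 𝔮).inf id ≤ 𝔮 := by
      intro hle
      obtain ⟨𝔮', h1, h2⟩ := (Ideal.IsPrime.inf_le' inferInstance).1 hle
      rw [Finset.mem_erase, Set.Finite.mem_toFinset] at h1
      exact h1.1 (le_antisymm h2 (h𝔮.2 h1.2.1 h2))
    obtain ⟨e, he1, he2⟩ := SetLike.not_le_iff_exists.1 hnot
    refine ⟨e, he2, fun 𝔮' h' hne => ?_⟩
    have : (hfin.toFinset.erase 𝔮).inf id ≤ 𝔮' :=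
      Finset.inf_le (f := id) (Finset.mem_erase.2 ⟨hne, hfin.mem_toFinset.2 h'⟩)
    exact this he1
  choose! v hv using hv
  choose! e he1 he2 using he
  refine ⟨∑ 𝔮 ∈ hfin.toFinset, e 𝔮 • v 𝔮, fun r hr => hinf r fun 𝔮 h𝔮 => ?_⟩
  have := hprime 𝔮 h𝔮
  -- Multiplying the relation by e_𝔮 removes all other terms, because e_𝔮 e_𝔮' lies in every minimal
  -- prime when 𝔮 ≠ 𝔮'.
  have h1 : (r * e 𝔮 * e 𝔮) • v 𝔮 = 0 := by
    have h2 := congrArg (fun m => e 𝔮 • m) hr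
    simp only [smul_zero, Finset.smul_sum, smul_smul] at h2
    rw [Finset.sum_eq_single 𝔮] at h2
    · rw [← h2]; congr 1; ring
    · intro 𝔮' h' hne
      rw [hfin.mem_toFinset] at h'
      have : e 𝔮 * (r * e 𝔮') = 0 := by
        refine hinf _ fun 𝔭 h𝔭 => ?_
        by_cases h3 : 𝔭 = 𝔮
        · have h4 : e 𝔮' ∈ 𝔭 := he2 𝔮' h' 𝔭 h𝔭 (by rw [h3]; exact hne.symm)
          exact 𝔭.mul_mem_left _ (𝔭.mul_mem_left _ h4)
        · exact 𝔭.mul_mem_right _ (he2 𝔮 h𝔮 𝔭 h𝔭 h3)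
      rw [this, zero_smul]
    · intro h'
      exact absurd (hfin.mem_toFinset.2 h𝔮) h'
  have h2 := hv 𝔮 h𝔮 _ h1
  exact (((hprime 𝔮 h𝔮).mem_or_mem h2).resolve_right (he1 𝔮 h𝔮) |>
    (hprime 𝔮 h𝔮).mem_or_mem).resolve_right (he1 𝔮 h𝔮)

/-! ### Realizing a motive inside `𝐊` -/

section Realization

variable {Fq : Type*} [Field Fq] [Fintype Fq] {𝕂 : Type*} [Field 𝕂] [Algebra Fq 𝕂] [IsAlgClosed 𝕂]
  {L : Type*} [Field L] [Algebra Fq L] [Algebra Fq[X] L] [Algebra (RatFunc Fq) L]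
  [IsScalarTower Fq Fq[X] L] [IsScalarTower Fq (RatFunc Fq) L] [IsScalarTower Fq[X] (RatFunc Fq) L]
  [FiniteDimensional (RatFunc Fq) L] [Algebra.IsSeparable (RatFunc Fq) L]
  {M : Type*} [AddCommGroup M] [Module 𝕂[X] M] {σ : M →ₛₗ[polyTwistInv Fq 𝕂] M}

theorem OKEmbedding.action_tmul (φ : OKEmbedding L σ) (c : 𝕂) (a : OK Fq L) :
    φ.action (c ⊗ₜ a) = (C c : 𝕂[X]) • φ.toRingHom a := rfl

theorem OKEmbedding.action_mul (φ : OKEmbedding L σ) (x y : BigO Fq 𝕂 L) :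
    φ.action (x * y) = φ.action x * φ.action y := by
  induction x using TensorProduct.induction_on with
  | zero => simp
  | add x x' hx hx' => rw [add_mul, map_add, hx, hx', map_add, add_mul]
  | tmul c a =>
    induction y using TensorProduct.induction_on with
    | zero => simp
    | add y y' hy hy' => rw [mul_add, map_add, hy, hy', map_add, mul_add]
    | tmul d b =>
      rw [Algebra.TensorProduct.tmul_mul_tmul, action_tmul, action_tmul, action_tmul, C_mul,
        map_mul φ.toRingHom, smul_mul_smul_comm]

/-- The action of `O_𝐊` on `M`, as a ring homomorphism. -/
def OKEmbedding.actionHom (φ : OKEmbedding L σ) : BigO Fq 𝕂 L →+* Module.End 𝕂[X] M :=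
  { φ.action with
    map_one' := by
      change φ.action 1 = 1
      rw [Algebra.TensorProduct.one_def, φ.action_tmul, C_1, one_smul, map_one]
    map_mul' := φ.action_mul }

theorem OKEmbedding.actionHom_apply (φ : OKEmbedding L σ) (b : BigO Fq 𝕂 L) :
    φ.actionHom b = φ.action b := rfl

theorem OKEmbedding.action_algebraMap (φ : OKEmbedding L σ) (p : 𝕂[X]) (m : M) :
    φ.action (algebraMap 𝕂[X] (BigO Fq 𝕂 L) p) m = p • m := by
  have : φ.actionHom.comp (algebraMap 𝕂[X] (BigO Fq 𝕂 L)) = algebraMap 𝕂[X] (Module.End 𝕂[X] M) := by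
    refine Polynomial.ringHom_ext (fun c => ?_) ?_
    · rw [RingHom.comp_apply, algebraMap_bigO_C, φ.actionHom_apply, φ.action_tmul, map_one,
        Algebra.algebraMap_eq_smul_one]
    · rw [RingHom.comp_apply, algebraMap_bigO_X, φ.actionHom_apply, φ.action_tmul,
        φ.map_polynomial, C_1, one_smul, map_X]
  exact congrArg (· m) (DFunLike.congr_fun this p)

theorem OKEmbedding.sigma_action (φ : OKEmbedding L σ) (b : BigO Fq 𝕂 L) (m : M) :
    σ (φ.action b m) = φ.action (bigOTwistInv b) (σ m) := by
  induction b using TensorProduct.induction_on with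
  | zero => simp
  | add x y hx hy => simp only [map_add, LinearMap.add_apply, hx, hy]
  | tmul c a =>
    rw [bigOTwistInv_tmul, φ.action_tmul, φ.action_tmul, LinearMap.smul_apply, LinearMap.smul_apply,
      LinearMap.map_smulₛₗ, φ.commutes]
    congr 1
    simp [polyTwistInv]

theorem bigOToFun_twistInv (b : BigO Fq 𝕂 L) :
    bigOToFun (bigOTwistInv b) = funTwist Fq 𝕂 L (-1) (bigOToFun b) := by
  induction b using TensorProduct.induction_on with
  | zero => rw [map_zero, map_zero]; exact ((funTwist Fq 𝕂 L (-1)).map_zero).symm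
  | add x y hx hy =>
    rw [map_add, map_add bigOToFun, hx, hy, map_add bigOToFun]
    exact ((funTwist Fq 𝕂 L (-1)).map_add _ _).symm
  | tmul c a =>
    rw [bigOTwistInv_tmul]
    have h : ∀ c : 𝕂, bigOToFun (c ⊗ₜ[Fq] a) = (const Fq c * fn Fq (a : L) : FunRing Fq 𝕂 L) := by
      intro c
      rw [← bigOToFun_const, ← bigOToFun_fn, ← map_mul]
      simp
    rw [h, h, funTwist_mul, funTwist_const, funTwist_fn]
    simp

/-- If b kills M, its inverse twist kills σM and so (t - θ)^N M, hence also M, which is torsion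
free. The kernel is therefore stable under twisting, and descent would put a nonzero element of O_L
into it. -/
theorem OKEmbedding.eq_zero_of_action_eq_zero (φ : OKEmbedding L σ) {θ : 𝕂} (hM : IsDualTMotive θ σ)
    {b : BigO Fq 𝕂 L} (hb : φ.action b = 0) : b = 0 := by
  have := hM.free
  have := hM.finite
  by_contra hb0
  have hne : RingHom.ker φ.actionHom ≠ ⊥ := fun h => hb0 (by
    rw [← Submodule.mem_bot (R := BigO Fq 𝕂 L), ← h]; exact hb)
  obtain ⟨N, hN⟩ := hM.torsion
  obtain ⟨a, ha0, ha⟩ := exists_one_tmul_mem (fun b hb => by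
    change φ.action _ = 0
    have hb : φ.action b = 0 := hb
    refine LinearMap.ext fun m => ?_
    obtain ⟨m', hm'⟩ := hN m
    have h1 : (X - C θ) ^ N • φ.action (bigOTwistInv b) m = 0 := by
      rw [← LinearMap.map_smul, ← hm', ← φ.sigma_action, hb]
      simp
    exact (smul_eq_zero.1 h1).resolve_left (pow_ne_zero _ (X_sub_C_ne_zero θ))) hne
  apply ha0
  apply φ.injective
  have ha : φ.action (1 ⊗ₜ a) = 0 := ha
  rwa [φ.action_tmul, C_1, one_smul, ← φ.toRingHom.map_zero] at ha

theorem OKEmbedding.exists_faithful_vector (φ : OKEmbedding L σ) {θ : 𝕂} (hM : IsDualTMotive θ σ) :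
    ∃ v : M, ∀ b, φ.action b v = 0 → b = 0 := by
  have := hM.finite
  have := bigO_isReduced (Fq := Fq) (𝕂 := 𝕂) (L := L)
  let _ : Module (BigO Fq 𝕂 L) M := Module.compHom M φ.actionHom
  have hsm : ∀ (b : BigO Fq 𝕂 L) (m : M), b • m = φ.action b m := fun _ _ => rfl
  have : IsScalarTower 𝕂[X] (BigO Fq 𝕂 L) M := IsScalarTower.of_algebraMap_smul fun p m => by
    rw [hsm, φ.action_algebraMap]
  have : Module.Finite (BigO Fq 𝕂 L) M := Module.Finite.of_restrictScalars_finite 𝕂[X] _ _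
  obtain ⟨v, hv⟩ := CMMotive.exists_faithful_vector (R := BigO Fq 𝕂 L) (N := M) fun b hb =>
    φ.eq_zero_of_action_eq_zero hM (LinearMap.ext hb)
  exact ⟨v, hv⟩

/-- The submodule O_𝐊 v is free over 𝕂[t] of rank [L : 𝔽_q(t)], the rank of M, so the quotient is
torsion. -/
theorem OKEmbedding.exists_smul_eq_action (φ : OKEmbedding L σ) {θ : 𝕂} (hM : IsDualTMotive θ σ)
    (hrank : Module.finrank 𝕂[X] M = Module.finrank (RatFunc Fq) L) {v : M}
    (hv : ∀ b, φ.action b v = 0 → b = 0) (m : M) :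
    ∃ p : 𝕂[X], p ≠ 0 ∧ ∃ b, p • m = φ.action b v := by
  have := hM.finite
  have := hM.free
  let F : BigO Fq 𝕂 L →ₗ[𝕂[X]] M :=
    { toFun := fun b => φ.action b v
      map_add' := fun x y => by simp
      map_smul' := fun p b => by
        rw [Algebra.smul_def, φ.action_mul, RingHom.id_apply, ← φ.action_algebraMap p]
        rfl }
  have hF : Function.Injective F := (injective_iff_map_eq_zero F).2 hv
  have h1 : Module.finrank 𝕂[X] (LinearMap.range F) = Module.finrank 𝕂[X] M := by
    rw [LinearMap.finrank_range_of_inj hF, finrank_bigO, hrank]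
  have h2 : Module.finrank 𝕂[X] (M ⧸ LinearMap.range F) = 0 := by
    have := Submodule.finrank_quotient_add_finrank (LinearMap.range F)
    omega
  rw [Module.finrank_eq_zero_iff_isTorsion] at h2
  obtain ⟨⟨p, hp⟩, hpm⟩ := @h2 (Submodule.Quotient.mk m)
  refine ⟨p, nonZeroDivisors.ne_zero hp, ?_⟩
  have h3 : (Submodule.Quotient.mk (p • m) : M ⧸ LinearMap.range F) = 0 := hpm
  rw [Submodule.Quotient.mk_eq_zero] at h3
  obtain ⟨b, hb⟩ := h3
  exact ⟨b, hb.symm⟩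

/-- A realization of `M` as an `O_𝐊`-submodule of `𝐊` on which `σ` is `m ↦ f m^{(-1)}`. -/
structure Realization (φ : OKEmbedding L σ) where
  toHom : M →+ FunRing Fq 𝕂 L
  mult : FunRing Fq 𝕂 L
  injective : Function.Injective toHom
  map_action : ∀ b m, toHom (φ.action b m) = bigOToFun b * toHom m
  map_sigma : ∀ m, toHom (σ m) = mult * funTwist Fq 𝕂 L (-1) (toHom m)
  isUnit_mult : IsUnit mult
  exists_unit : ∃ v, IsUnit (toHom v)

theorem bigOToFun_algebraMap_isUnit {p : 𝕂[X]} (hp : p ≠ 0) :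
    IsUnit (bigOToFun (algebraMap 𝕂[X] (BigO Fq 𝕂 L) p)) :=
  bigOToFun_isUnit (algebraMap_bigO_mem_nonZeroDivisors hp)

-- The element m with p m = b v is sent to b/p in 𝐊. Everything else is independence of the choice
-- of p and b, which follows from the faithfulness of v.
set_option maxHeartbeats 1000000 in
theorem OKEmbedding.exists_embedding (φ : OKEmbedding L σ) {θ : 𝕂} (hM : IsDualTMotive θ σ)
    (hrank : Module.finrank 𝕂[X] M = Module.finrank (RatFunc Fq) L) :
    ∃ (Θ : M →+ FunRing Fq 𝕂 L) (v : M), (∀ b m, Θ (φ.action b m) = bigOToFun b * Θ m) ∧ Θ v = 1 ∧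
      ∀ m, ∃ p : 𝕂[X], p ≠ 0 ∧ ∃ b, p • m = φ.action b v := by
  obtain ⟨v, hv⟩ := φ.exists_faithful_vector hM
  have hinj : ∀ b b', φ.action b v = φ.action b' v → b = b' := fun b b' h => by
    rw [← sub_eq_zero]
    exact hv _ (by rw [map_sub, LinearMap.sub_apply, h, sub_self])
  choose p hp0 b hb using φ.exists_smul_eq_action hM hrank hv
  have hu : ∀ m, IsUnit (bigOToFun (algebraMap 𝕂[X] (BigO Fq 𝕂 L) (p m))) := fun m =>
    bigOToFun_algebraMap_isUnit (hp0 m)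
  have hex : ∀ m : M, ∃ x, bigOToFun (algebraMap 𝕂[X] (BigO Fq 𝕂 L) (p m)) * x = bigOToFun (b m) :=
    fun m => ⟨↑(hu m).unit⁻¹ * bigOToFun (b m), by rw [← mul_assoc, IsUnit.mul_val_inv, one_mul]⟩
  choose Θ hΘ using hex
  have key : ∀ m a c, φ.action a m = φ.action c v → bigOToFun a * Θ m = bigOToFun c := by
    intro m a c h
    apply (hu m).mul_left_cancel
    rw [mul_left_comm, hΘ, ← map_mul, ← map_mul]
    congr 1
    apply hinj
    rw [φ.action_mul, φ.action_mul, Module.End.mul_apply, Module.End.mul_apply, φ.action_algebraMap,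
      ← h, ← hb, map_smul]
  have key' : ∀ m x, bigOToFun (algebraMap 𝕂[X] (BigO Fq 𝕂 L) (p m)) * x = bigOToFun (b m) → x = Θ m := by
    intro m x hx
    apply (hu m).mul_left_cancel
    rw [hx, hΘ]
  let Θ' : M →+ FunRing Fq 𝕂 L :=
    { toFun := Θ
      map_zero' := by
        symm
        apply key'
        rw [mul_zero, ← map_zero bigOToFun]
        congr 1
        apply hinj
        rw [← hb, map_zero]; simp
      map_add' := fun m n => by
        have h := key (m + n) (algebraMap 𝕂[X] (BigO Fq 𝕂 L) (p m * p n))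
          (algebraMap 𝕂[X] _ (p n) * b m + algebraMap 𝕂[X] _ (p m) * b n) (by
            rw [φ.action_algebraMap, map_add, φ.action_mul, φ.action_mul, LinearMap.add_apply,
              Module.End.mul_apply, Module.End.mul_apply, ← hb, ← hb, φ.action_algebraMap,
              φ.action_algebraMap, smul_add, mul_smul, mul_smul, smul_comm (p m) (p n) m])
        apply (bigOToFun_algebraMap_isUnit (mul_ne_zero (hp0 m) (hp0 n))).mul_left_cancel
        rw [h, map_add bigOToFun, map_mul bigOToFun, map_mul bigOToFun, ← hΘ, ← hΘ,
          map_mul (algebraMap 𝕂[X] (BigO Fq 𝕂 L)), map_mul bigOToFun]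
        ring }
  have hact : ∀ b m, Θ' (φ.action b m) = bigOToFun b * Θ' m := by
    intro c m
    apply (bigOToFun_algebraMap_isUnit (L := L) (Fq := Fq) (hp0 m)).mul_left_cancel
    have h := key (φ.action c m) (algebraMap 𝕂[X] (BigO Fq 𝕂 L) (p m)) (c * b m) (by
      rw [φ.action_algebraMap, φ.action_mul, Module.End.mul_apply, ← hb, LinearMap.map_smul])
    rw [map_mul bigOToFun, ← hΘ] at h
    exact h.trans (mul_left_comm _ _ _)
  have hv1 : Θ' v = 1 := by
    have := key v 1 1 rfl
    rwa [map_one, one_mul] at this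
  exact ⟨Θ', v, hact, hv1, fun m => ⟨p m, hp0 m, b m, hb m⟩⟩

/-- As v ↦ 1, semilinearity forces the multiplier to be the image of σv. It is a unit because (t -
θ)^N v, whose image is a unit, lies in σM. -/
theorem OKEmbedding.nonempty_realization (φ : OKEmbedding L σ) {θ : 𝕂} (hM : IsDualTMotive θ σ)
    (hrank : Module.finrank 𝕂[X] M = Module.finrank (RatFunc Fq) L) : Nonempty (Realization φ) := by
  have := hM.free
  obtain ⟨Θ', v, hact, hv1, hex⟩ := φ.exists_embedding hM hrank
  choose p hp0 b hb using hex
  have hu : ∀ m, IsUnit (bigOToFun (algebraMap 𝕂[X] (BigO Fq 𝕂 L) (p m))) := fun m =>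
    bigOToFun_algebraMap_isUnit (hp0 m)
  have hΘ : ∀ m, bigOToFun (algebraMap 𝕂[X] (BigO Fq 𝕂 L) (p m)) * Θ' m = bigOToFun (b m) := by
    intro m
    rw [← hact, φ.action_algebraMap, hb, hact, hv1, mul_one]
  have hinjΘ : Function.Injective Θ' := by
    rw [injective_iff_map_eq_zero]
    intro m hm
    have h1 := hΘ m
    rw [hm, mul_zero] at h1
    have h2 : b m = 0 := bigOToFun_injective (by rw [← h1, map_zero])
    have h3 := hb m
    rw [h2, map_zero, LinearMap.zero_apply] at h3
    exact (smul_eq_zero.1 h3).resolve_left (hp0 m)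
  have hsig : ∀ m, Θ' (σ m) = Θ' (σ v) * funTwist Fq 𝕂 L (-1) (Θ' m) := by
    intro m
    have hu' : IsUnit (funTwist Fq 𝕂 L (-1) (bigOToFun (algebraMap 𝕂[X] (BigO Fq 𝕂 L) (p m)))) :=
      (hu m).map (funTwist Fq 𝕂 L (-1)).toRingHom
    apply hu'.mul_left_cancel
    rw [mul_left_comm, ← funTwist_mul, hΘ, ← bigOToFun_twistInv,
      ← bigOToFun_twistInv, ← hact, ← φ.sigma_action, φ.action_algebraMap, hb, φ.sigma_action, hact,
      mul_comm]
  have hunit : IsUnit (Θ' (σ v)) := by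
    obtain ⟨N, hN⟩ := hM.torsion
    obtain ⟨m', hm'⟩ := hN v
    have h1 : IsUnit (Θ' (σ m')) := by
      rw [hm', ← φ.action_algebraMap, hact, hv1, mul_one]
      exact bigOToFun_algebraMap_isUnit (pow_ne_zero _ (X_sub_C_ne_zero θ))
    rw [hsig] at h1
    exact isUnit_of_mul_isUnit_left h1
  exact ⟨⟨Θ', Θ' (σ v), hinjΘ, hact, hsig, hunit, v, hv1 ▸ isUnit_one⟩⟩

namespace Realization

variable {φ : OKEmbedding L σ}

/-- Multiplying a realization by a unit of `𝐊`. -/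
def rescale (R : Realization φ) (g : (FunRing Fq 𝕂 L)ˣ) : Realization φ where
  toHom := (AddMonoidHom.mulLeft (g : FunRing Fq 𝕂 L)).comp R.toHom
  mult := g * R.mult * funTwist Fq 𝕂 L (-1) (↑g⁻¹ : FunRing Fq 𝕂 L)
  injective := fun x y h => R.injective (g.isUnit.mul_left_cancel h)
  map_action b m := by
    change (g : FunRing Fq 𝕂 L) * R.toHom _ = _ * (g * R.toHom m)
    rw [R.map_action, mul_left_comm]
  map_sigma m := by
    change (g : FunRing Fq 𝕂 L) * R.toHom _ = _ * funTwist Fq 𝕂 L (-1) (g * R.toHom m)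
    rw [R.map_sigma, funTwist_mul, mul_assoc (_ * R.mult), ← mul_assoc (funTwist _ _ _ _ _),
      ← funTwist_mul, Units.inv_mul, show funTwist Fq 𝕂 L (-1) 1 = 1 from
      (funTwist Fq 𝕂 L (-1)).map_one, one_mul, mul_assoc]
  isUnit_mult := (g.isUnit.mul R.isUnit_mult).mul ((g⁻¹).isUnit.map (funTwist Fq 𝕂 L (-1)).toRingHom)
  exists_unit := by
    obtain ⟨v, hv⟩ := R.exists_unit
    exact ⟨v, g.isUnit.mul hv⟩

variable (R : Realization φ)

theorem map_smul (p : 𝕂[X]) (m : M) :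
    R.toHom (p • m) = bigOToFun (algebraMap 𝕂[X] (BigO Fq 𝕂 L) p) * R.toHom m := by
  rw [← φ.action_algebraMap, R.map_action]

/-- The image of `M`, as an `O_𝐊`-submodule of `𝐊`. -/
def image : Submodule (BigO Fq 𝕂 L) (FunRing Fq 𝕂 L) where
  carrier := Set.range R.toHom
  add_mem' := by
    rintro _ _ ⟨x, rfl⟩ ⟨y, rfl⟩
    exact ⟨x + y, map_add _ _ _⟩
  zero_mem' := ⟨0, map_zero _⟩
  smul_mem' := by
    rintro b _ ⟨x, rfl⟩
    exact ⟨φ.action b x, R.map_action b x⟩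

theorem image_fg [Module.Finite 𝕂[X] M] : R.image.FG := by
  obtain ⟨S, hS⟩ := Module.Finite.fg_top (R := 𝕂[X]) (M := M)
  classical
  refine ⟨S.image R.toHom, le_antisymm ?_ ?_⟩
  · rw [Submodule.span_le]
    intro x hx
    obtain ⟨s, -, rfl⟩ := Finset.mem_image.1 (Finset.mem_coe.1 hx)
    exact ⟨s, rfl⟩
  · rintro _ ⟨m, rfl⟩
    have hm : m ∈ Submodule.span 𝕂[X] (S : Set M) := hS ▸ Submodule.mem_top
    induction hm using Submodule.span_induction with
    | mem x hx => exact Submodule.subset_span (Finset.mem_coe.2 (Finset.mem_image_of_mem _ hx))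
    | zero => rw [map_zero]; exact Submodule.zero_mem _
    | add x y _ _ hx hy => rw [map_add]; exact Submodule.add_mem _ hx hy
    | smul p x _ hx => rw [R.map_smul]; exact bigOToFun_mul_mem _ hx

end Realization

end Realization

/-! ### The constant field and the components of `𝐗` -/

section Components

variable {Fq : Type*} [Field Fq] [Fintype Fq] {𝕂 : Type*} [Field 𝕂] [Algebra Fq 𝕂] [IsAlgClosed 𝕂]
  {L : Type*} [Field L] [Algebra Fq L] [Algebra Fq[X] L] [Algebra (RatFunc Fq) L]
  [IsScalarTower Fq Fq[X] L] [IsScalarTower Fq (RatFunc Fq) L] [IsScalarTower Fq[X] (RatFunc Fq) L]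
  [FiniteDimensional (RatFunc Fq) L] [Algebra.IsSeparable (RatFunc Fq) L]

theorem exists_hom_map_X_eq (c : 𝕂) : ∃ χ : BigO Fq 𝕂 L →ₐ[𝕂] 𝕂, χ (algebraMap 𝕂[X] _ X) = c := by
  have hint : Algebra.IsIntegral 𝕂[X] (BigO Fq 𝕂 L) := Algebra.IsIntegral.of_finite _ _
  have hmax : (Ideal.span {(X - C c : 𝕂[X])}).IsMaximal :=
    PrincipalIdealRing.isMaximal_of_irreducible (irreducible_X_sub_C c)
  obtain ⟨𝔫, h𝔫, hcomap⟩ := Ideal.exists_ideal_over_maximal_of_isIntegral (S := BigO Fq 𝕂 L)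
    (Ideal.span {(X - C c : 𝕂[X])}) (by
      rw [(RingHom.injective_iff_ker_eq_bot _).1 algebraMap_bigO_injective]; exact bot_le)
  obtain ⟨χ, hχ⟩ := exists_hom_of_isMaximal 𝔫
  refine ⟨χ, ?_⟩
  have h1 : (X - C c : 𝕂[X]) ∈ 𝔫.comap (algebraMap 𝕂[X] (BigO Fq 𝕂 L)) := by
    rw [hcomap]; exact Ideal.mem_span_singleton_self _
  rw [Ideal.mem_comap, ← hχ, map_sub, map_sub, algebraMap_bigO_C] at h1
  have h2 : χ (c ⊗ₜ 1) = c := χ.commutes c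
  rw [h2] at h1
  exact sub_eq_zero.1 h1

/-- O_𝐊 is a reduced Jacobson ring, so a numerator that vanishes at all maximal ideals is zero. This
reduces identities in 𝐊 to identities on each component. -/
theorem eq_zero_of_forall_val_eq_zero {x : FunRing Fq 𝕂 L} (h : ∀ P : ClosedPoint Fq 𝕂 L, P.val x = 0) :
    x = 0 := by
  obtain ⟨b, s, hs, hbs⟩ := exists_bigO_div x
  have hft : Algebra.FiniteType 𝕂 (BigO Fq 𝕂 L) :=
    Algebra.FiniteType.trans (S := 𝕂[X]) inferInstance inferInstance
  have hjac : IsJacobsonRing (BigO Fq 𝕂 L) := isJacobsonRing_of_finiteType (A := 𝕂)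
  have hred := bigO_isReduced (Fq := Fq) (𝕂 := 𝕂) (L := L)
  have hb : b = 0 := by
    have h1 : b ∈ (⊥ : Ideal (BigO Fq 𝕂 L)).jacobson := by
      rw [Ideal.jacobson, Ideal.mem_sInf]
      rintro 𝔫 ⟨-, h𝔫⟩
      obtain ⟨χ, hχ⟩ := exists_hom_of_isMaximal 𝔫
      rw [← hχ]
      obtain ⟨P, hP⟩ := exists_point χ
      rw [← hP.lt_one_iff, P.onO_apply, ← hbs, map_mul, h P, zero_mul]
      exact zero_lt_one
    rw [IsJacobsonRing.out inferInstance ((Ideal.isRadical_bot_iff).2 hred)] at h1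
    exact h1
  rw [hb, map_zero] at hbs
  exact (bigOToFun_isUnit hs).mul_right_cancel (by rw [hbs, zero_mul])

/-- Constants are integral. -/
def constToOK : ConstField Fq L →ₐ[Fq] OK Fq L where
  toFun ε := ⟨ε, ((mem_algebraicClosure_iff'.1 ε.2).tower_top : IsIntegral Fq[X] (ε : L))⟩
  map_one' := rfl
  map_mul' _ _ := rfl
  map_zero' := rfl
  map_add' _ _ := rfl
  commutes' c := by
    ext
    rfl

theorem finiteDimensional_range_of_map_X_eq_zero {ρ : OK Fq L →ₐ[Fq] 𝕂}
    (h : ρ (algebraMap Fq[X] _ X) = 0) : FiniteDimensional Fq ρ.range := by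
  obtain ⟨S, hS⟩ := Module.Finite.fg_top (R := Fq[X]) (M := OK Fq L)
  have hp : ∀ p : Fq[X], ρ (algebraMap Fq[X] _ p) = algebraMap Fq 𝕂 (p.coeff 0) := by
    intro p
    have : (ρ.comp (IsScalarTower.toAlgHom Fq Fq[X] (OK Fq L))) =
        (Algebra.ofId Fq 𝕂).comp (aeval (0 : Fq)) := by
      ext
      simpa using h
    have h2 := DFunLike.congr_fun this p
    simp only [AlgHom.comp_apply, IsScalarTower.toAlgHom_apply] at h2
    rw [h2, coeff_zero_eq_aeval_zero]
    rfl
  have hle : Subalgebra.toSubmodule ρ.range ≤ Submodule.span Fq (ρ '' (S : Set (OK Fq L))) := by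
    rintro _ ⟨a, rfl⟩
    have ha : a ∈ Submodule.span Fq[X] (S : Set (OK Fq L)) := hS ▸ Submodule.mem_top
    change ρ a ∈ _
    induction ha using Submodule.span_induction with
    | mem x hx => exact Submodule.subset_span (Set.mem_image_of_mem _ hx)
    | zero => rw [map_zero]; exact Submodule.zero_mem _
    | add x y _ _ hx hy => rw [map_add]; exact Submodule.add_mem _ hx hy
    | smul p x _ hx =>
      rw [Algebra.smul_def, map_mul, hp, ← Algebra.smul_def]
      exact Submodule.smul_mem _ _ hx
  have : FiniteDimensional Fq (Submodule.span Fq (ρ '' (S : Set (OK Fq L)))) :=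
    FiniteDimensional.span_of_finite Fq (S.finite_toSet.image _)
  exact Submodule.finiteDimensional_of_le hle

/-- The constant field embeds into the residue field of a place above t = 0, which is finite over
𝔽_q. The place is found by using an algebraic closure of 𝔽_q as the field of scalars. -/
instance constField_finite : FiniteDimensional Fq (ConstField Fq L) := by
  obtain ⟨χ, hχ⟩ := exists_hom_map_X_eq (Fq := Fq) (L := L) (0 : AlgebraicClosure Fq)
  have h0 : resHom χ (algebraMap Fq[X] _ X) = 0 := by
    rw [resHom_apply, ← algebraMap_bigO_X, hχ]
  have := finiteDimensional_range_of_map_X_eq_zero h0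
  let F : ConstField Fq L →ₐ[Fq] (resHom χ).range := (resHom χ).rangeRestrict.comp constToOK
  exact FiniteDimensional.of_injective F.toLinearMap F.toRingHom.injective

instance finite_constField : Finite (ConstField Fq L) := Module.finite_of_finite Fq

variable (ι : ConstField Fq L →ₐ[Fq] 𝕂)

theorem constDegree_pos : 0 < constDegree Fq L :=
  Module.finrank_pos

theorem frob_pow_apply (n : ℕ) (x : 𝕂) : (frob Fq 𝕂 ^ n) x = x ^ Fintype.card Fq ^ n := by
  induction n generalizing x with
  | zero => simp
  | succ n ih => rw [pow_succ, AlgEquiv.mul_apply, ih, frob_apply, ← pow_mul, pow_succ']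

theorem natCard_constField : Nat.card (ConstField Fq L) = Fintype.card Fq ^ constDegree Fq L := by
  rw [Module.natCard_eq_pow_finrank (K := Fq), Nat.card_eq_fintype_card]
  rfl

theorem frob_constDegree (ε : ConstField Fq L) : (frob Fq 𝕂 ^ constDegree Fq L) (ι ε) = ι ε := by
  let _ := Fintype.ofFinite (ConstField Fq L)
  rw [frob_pow_apply, ← natCard_constField, Nat.card_eq_fintype_card, ← map_pow, FiniteField.pow_card]

theorem frob_zpow_constDegree (n : ℤ) (ε : ConstField Fq L) :
    (frob Fq 𝕂 ^ (n - constDegree Fq L)) (ι ε) = (frob Fq 𝕂 ^ n) (ι ε) := by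
  conv_rhs => rw [← sub_add_cancel n (constDegree Fq L : ℤ), zpow_add, AlgEquiv.mul_apply, zpow_natCast,
    frob_constDegree]

theorem component_constDegree : component ι (constDegree Fq L) = component ι 0 := by
  ext P
  change (∀ ε, _) ↔ (∀ ε, _)
  refine forall_congr' fun ε => ?_
  have := frob_zpow_constDegree ι 0 ε
  rw [zero_sub] at this
  simp only [this, Nat.cast_zero, neg_zero]

/-- A generator of the constant field. -/
theorem exists_constGenerator : ∃ ε₀ : ConstField Fq L, ∀ ε, ε ≠ 0 → ∃ n : ℕ, ε = ε₀ ^ n := by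
  obtain ⟨g, hg⟩ := IsCyclic.exists_monoid_generator (α := (ConstField Fq L)ˣ)
  refine ⟨g, fun ε hε => ?_⟩
  obtain ⟨n, hn⟩ := hg (Units.mk0 ε hε)
  exact ⟨n, by rw [← Units.val_pow_eq_pow_val]; exact congrArg Units.val hn.symm⟩

/-- If ε₀ were fixed by the q^d-power map with 0 < d < ℓ, so would be all q^ℓ constants, and X^{q^d}
- X would have too many roots. -/
theorem eq_of_frob_constGenerator {ε₀ : ConstField Fq L} (hε₀ : ∀ ε, ε ≠ 0 → ∃ n : ℕ, ε = ε₀ ^ n)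
    {i j : ℕ} (hi : i < constDegree Fq L) (hj : j < constDegree Fq L)
    (h : (frob Fq 𝕂 ^ (-(i : ℤ))) (ι ε₀) = (frob Fq 𝕂 ^ (-(j : ℤ))) (ι ε₀)) : i = j := by
  wlog hij : i ≤ j generalizing i j
  · exact (this hj hi h.symm (le_of_not_ge hij)).symm
  let _ := Fintype.ofFinite (ConstField Fq L)
  obtain ⟨d, rfl⟩ := Nat.exists_eq_add_of_le hij
  have h1 : (frob Fq 𝕂 ^ d) (ι ε₀) = ι ε₀ := by
    have h2 := congrArg (frob Fq 𝕂 ^ ((i + d : ℕ) : ℤ)) h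
    rw [← AlgEquiv.mul_apply, ← AlgEquiv.mul_apply, ← zpow_add, ← zpow_add] at h2
    simpa using h2
  have h3 : ∀ ε : ConstField Fq L, ε ^ Fintype.card Fq ^ d = ε := by
    intro ε
    apply ι.toRingHom.injective
    change ι _ = ι _
    rw [map_pow, ← frob_pow_apply]
    by_cases hε : ε = 0
    · simp [hε]
    · obtain ⟨n, rfl⟩ := hε₀ ε hε
      rw [map_pow, map_pow, h1]
  by_contra hne
  have hd : d ≠ 0 := by omega
  have hlt : 1 < Fintype.card Fq ^ d := Nat.one_lt_pow hd Fintype.one_lt_card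
  have hcard : Fintype.card (ConstField Fq L) ≤ Fintype.card Fq ^ d := by
    classical
    have hne0 : (X ^ Fintype.card Fq ^ d - X : (ConstField Fq L)[X]) ≠ 0 :=
      FiniteField.X_pow_card_sub_X_ne_zero _ hlt
    calc Fintype.card (ConstField Fq L) = (Finset.univ : Finset (ConstField Fq L)).card := rfl
      _ ≤ (X ^ Fintype.card Fq ^ d - X : (ConstField Fq L)[X]).roots.toFinset.card := by
        refine Finset.card_le_card fun ε _ => ?_
        rw [Multiset.mem_toFinset, mem_roots hne0]
        simp [h3]
      _ ≤ _ := (Multiset.toFinset_card_le _).trans ((card_roots' _).trans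
        (FiniteField.X_pow_card_sub_X_natDegree_eq _ hlt).le)
  rw [← Nat.card_eq_fintype_card, natCard_constField] at hcard
  have := (Nat.pow_le_pow_iff_right (Fintype.one_lt_card (α := Fq))).1 hcard
  omega

theorem component_disjoint {i j : ℕ} (hi : i < constDegree Fq L) (hj : j < constDegree Fq L)
    {P : ClosedPoint Fq 𝕂 L} (hPi : P ∈ component ι i) (hPj : P ∈ component ι j) : i = j := by
  obtain ⟨ε₀, hε₀⟩ := exists_constGenerator (Fq := Fq) (L := L)
  refine eq_of_frob_constGenerator ι hε₀ hi hj ?_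
  by_contra hne
  have h1 := P.trivial_on_const _ (sub_ne_zero.2 hne)
  have h2 : P.val (const Fq ((frob Fq 𝕂 ^ (-(i : ℤ))) (ι ε₀) - (frob Fq 𝕂 ^ (-(j : ℤ))) (ι ε₀))) ≤ 0 := by
    rw [← constHom_apply, map_sub, constHom_apply, constHom_apply,
      ← sub_sub_sub_cancel_left _ _ (fn Fq (ε₀ : L))]
    exact P.val.map_sub_le (hPj ε₀).le (hPi ε₀).le
  rw [h1] at h2
  exact absurd h2 (by simp)

/-- The polynomial ∏ (X - ε^{1/q^i}) is permuted into itself by Frobenius, so its coefficients lie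
in 𝔽_q. It kills the image of ε in 𝕂, hence ε in the constant field, hence the function ε. -/
theorem prod_sub_frob_eq_zero (ε : ConstField Fq L) :
    ∏ i ∈ Finset.range (constDegree Fq L),
      (fn Fq (ε : L) - const Fq ((frob Fq 𝕂 ^ (-(i : ℤ))) (ι ε)) : FunRing Fq 𝕂 L) = 0 := by
  set G : 𝕂[X] := ∏ i ∈ Finset.range (constDegree Fq L), (X - C ((frob Fq 𝕂 ^ (-(i : ℤ))) (ι ε))) with hG
  have hfix : G.map ((frob Fq 𝕂).symm : 𝕂 →+* 𝕂) = G := by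
    have hmap : ∀ i : ℕ, (X - C ((frob Fq 𝕂 ^ (-(i : ℤ))) (ι ε))).map ((frob Fq 𝕂).symm : 𝕂 →+* 𝕂)
        = X - C ((frob Fq 𝕂 ^ (-((i + 1 : ℕ) : ℤ))) (ι ε)) := by
      intro i
      rw [Polynomial.map_sub, map_X, map_C]
      congr 2
      change (frob Fq 𝕂)⁻¹ _ = _
      rw [← AlgEquiv.mul_apply, ← zpow_neg_one, ← zpow_add]
      congr 2
      push_cast; ring
    obtain ⟨n, hn⟩ := Nat.exists_eq_succ_of_ne_zero (constDegree_pos (Fq := Fq) (L := L)).ne'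
    rw [hG, Polynomial.map_prod, Finset.prod_congr rfl fun i _ => hmap i, hn, Finset.prod_range_succ,
      Finset.prod_range_succ', ← Nat.succ_eq_add_one, ← hn]
    congr 3
    have := frob_zpow_constDegree ι 0 ε
    rw [zero_sub] at this
    rw [this, Nat.cast_zero, neg_zero]
  have hlift : G ∈ Polynomial.lifts (algebraMap Fq 𝕂) := by
    rw [lifts_iff_coeff_lifts]
    intro n
    apply mem_range_of_pow_card_eq
    rw [← frob_apply]
    have := congrArg (fun p => p.coeff n) hfix
    simp only [coeff_map] at this
    nth_rewrite 1 [← this]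
    exact (frob Fq 𝕂).apply_symm_apply _
  obtain ⟨G₀, hG₀⟩ := (mem_lifts _).1 hlift
  have hroot : aeval (ε : L) G₀ = 0 := by
    have h1 : aeval (ι ε) G₀ = 0 := by
      rw [aeval_def, ← eval_map, hG₀, hG, eval_prod]
      refine Finset.prod_eq_zero (Finset.mem_range.2 (constDegree_pos)) ?_
      simp
    have h2 : ι (aeval ε G₀) = ι 0 := by rw [map_zero, ← aeval_algHom_apply, h1]
    have h3 : aeval ε G₀ = 0 := ι.toRingHom.injective h2
    have h4 := aeval_algHom_apply (ConstField Fq L).val ε G₀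
    rw [h3, map_zero] at h4
    exact h4
  have h5 : G.eval₂ (constHom : 𝕂 →+* FunRing Fq 𝕂 L) (fn Fq (ε : L)) = 0 := by
    rw [← hG₀, eval₂_map]
    have : (constHom : 𝕂 →+* FunRing Fq 𝕂 L).comp (algebraMap Fq 𝕂) = fnHom.comp (algebraMap Fq L) :=
      RingHom.ext fun c => const_algebraMap c
    rw [this, ← fnHom_apply, ← hom_eval₂, ← aeval_def, hroot, map_zero]
  rw [hG, eval₂_finsetProd] at h5
  rw [← h5]
  exact Finset.prod_congr rfl fun i _ => by simp [constHom_apply]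

theorem mem_component_of_constGenerator {ε₀ : ConstField Fq L}
    (hε₀ : ∀ ε, ε ≠ 0 → ∃ n : ℕ, ε = ε₀ ^ n) {i : ℕ} {P : ClosedPoint Fq 𝕂 L}
    (h : P.val (fn Fq (ε₀ : L) - const Fq ((frob Fq 𝕂 ^ (-(i : ℤ))) (ι ε₀))) = 0) :
    P ∈ component ι i := by
  intro ε
  by_cases hε : ε = 0
  · rw [hε, map_zero, map_zero, const_zero, ← fnHom_apply, ZeroMemClass.coe_zero, map_zero, sub_zero,
      map_zero]
  · obtain ⟨n, rfl⟩ := hε₀ ε hε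
    have h1 : (fn Fq ((ε₀ ^ n : ConstField Fq L) : L)
        - const Fq ((frob Fq 𝕂 ^ (-(i : ℤ))) (ι (ε₀ ^ n))) : FunRing Fq 𝕂 L)
        = fn Fq (ε₀ : L) ^ n - const Fq ((frob Fq 𝕂 ^ (-(i : ℤ))) (ι ε₀)) ^ n := by
      rw [map_pow, map_pow, SubmonoidClass.coe_pow, ← fnHom_apply, ← fnHom_apply, ← constHom_apply,
        ← constHom_apply, map_pow, map_pow]
    rw [h1]
    obtain ⟨y, hy⟩ := sub_dvd_pow_sub_pow (fn Fq (ε₀ : L) : FunRing Fq 𝕂 L)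
      (const Fq ((frob Fq 𝕂 ^ (-(i : ℤ))) (ι ε₀))) n
    rw [hy, map_mul, h, zero_mul]

/-- The support of a valuation is prime, so one factor of the vanishing product ∏ (ε₀ - ε₀^{1/q^i})
lies in it. -/
theorem exists_mem_component (P : ClosedPoint Fq 𝕂 L) : ∃ i < constDegree Fq L, P ∈ component ι i := by
  obtain ⟨ε₀, hε₀⟩ := exists_constGenerator (Fq := Fq) (L := L)
  have h := congrArg P.val (prod_sub_frob_eq_zero ι ε₀)
  rw [map_zero, map_prod, Finset.prod_eq_zero_iff] at h
  obtain ⟨i, hi, h⟩ := h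
  exact ⟨i, Finset.mem_range.1 hi, mem_component_of_constGenerator ι hε₀ h⟩

/-- Functions that are `1` on one component and `0` on the others. -/
theorem exists_componentIndicator : ∃ E : ℕ → FunRing Fq 𝕂 L, ∀ i < constDegree Fq L,
    ∀ P : ClosedPoint Fq 𝕂 L, (P ∈ component ι i → P.val (E i - 1) = 0) ∧
      ∀ j < constDegree Fq L, j ≠ i → P ∈ component ι j → P.val (E i) = 0 := by
  obtain ⟨ε₀, hε₀⟩ := exists_constGenerator (Fq := Fq) (L := L)
  let c : ℕ → 𝕂 := fun i => (frob Fq 𝕂 ^ (-(i : ℤ))) (ι ε₀)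
  let d : ℕ → 𝕂 := fun i => ∏ j ∈ (Finset.range (constDegree Fq L)).erase i, (c i - c j)
  -- Lagrange interpolation at the distinct conjugates c i of the generator ε₀.
  refine ⟨fun i => const Fq (d i)⁻¹ * ∏ j ∈ (Finset.range (constDegree Fq L)).erase i,
    (fn Fq (ε₀ : L) - const Fq (c j)), fun i hi P => ⟨fun hP => ?_, fun j hj hne hP => ?_⟩⟩
  · have hd : d i ≠ 0 := Finset.prod_ne_zero_iff.2 fun j hj => by
      rw [Finset.mem_erase, Finset.mem_range] at hj
      exact sub_ne_zero.2 fun h => hj.1 (eq_of_frob_constGenerator ι hε₀ hj.2 hi h.symm)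
    -- Computing modulo the support of the valuation is computing on the component of P, where the
    -- function ε₀ equals the scalar c i.
    let q := Ideal.Quotient.mk P.val.supp
    have h1 : q (fn Fq (ε₀ : L)) = q (const Fq (c i)) := by
      rw [Ideal.Quotient.eq, Valuation.mem_supp_iff]
      exact hP ε₀
    rw [← Valuation.mem_supp_iff, ← Ideal.Quotient.eq]
    change q _ = q _
    rw [map_mul, map_prod]
    simp only [map_sub, h1]
    simp only [← map_sub, ← map_prod, ← map_mul, ← constHom_apply]
    change q (constHom ((d i)⁻¹ * d i)) = _
    rw [inv_mul_cancel₀ hd, map_one]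
  · rw [map_mul, map_prod, Finset.prod_eq_zero (Finset.mem_erase.2 ⟨hne, Finset.mem_range.2 hj⟩)
      (hP ε₀), mul_zero]

end Components

/-! ### Making the multiplier trivial outside 𝐗_{(0)}. -/

section Normalize

variable {Fq : Type*} [Field Fq] [Fintype Fq] {𝕂 : Type*} [Field 𝕂] [Algebra Fq 𝕂] [IsAlgClosed 𝕂]
  {L : Type*} [Field L] [Algebra Fq L] [Algebra Fq[X] L] [Algebra (RatFunc Fq) L]
  [IsScalarTower Fq Fq[X] L] [IsScalarTower Fq (RatFunc Fq) L] [IsScalarTower Fq[X] (RatFunc Fq) L]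
  [FiniteDimensional (RatFunc Fq) L] [Algebra.IsSeparable (RatFunc Fq) L]
  {M : Type*} [AddCommGroup M] [Module 𝕂[X] M] {σ : M →ₛₗ[polyTwistInv Fq 𝕂] M}

theorem map_sum_indicator {R S : Type*} [CommRing R] [CommRing S] (q : R →+* S) {s : Finset ℕ}
    {E a : ℕ → R} {i : ℕ} (hi : i ∈ s) (h1 : q (E i) = 1) (h0 : ∀ j ∈ s, j ≠ i → q (E j) = 0) :
    q (∑ j ∈ s, E j * a j) = q (a i) := by
  rw [map_sum, Finset.sum_eq_single_of_mem i hi fun j hj hne => by rw [map_mul, h0 j hj hne, zero_mul],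
    map_mul, h1, one_mul]

/-- The units `f⁻¹ (f^{(-1)})⁻¹ ⋯ (f^{(1-i)})⁻¹`. -/
def twistProd (f : (FunRing Fq 𝕂 L)ˣ) : ℕ → (FunRing Fq 𝕂 L)ˣ
  | 0 => 1
  | i + 1 => f⁻¹ * Units.map ((funTwist Fq 𝕂 L (-1)).toRingHom : _ →* _) (twistProd f i)

/-- The requirement is g f = g^{(-1)} on 𝐗_{(i)} for 0 < i < ℓ. The value of g^{(-1)} on 𝐗_{(i)}
comes from g on 𝐗_{(i-1)}, so starting from g = 1 on 𝐗_{(0)} the values are determined recursively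
by `twistProd`; no condition is left over on 𝐗_{(0)}. -/
theorem exists_normalizing_unit (ι : ConstField Fq L →ₐ[Fq] 𝕂) {f : FunRing Fq 𝕂 L} (hf : IsUnit f) :
    ∃ g : (FunRing Fq 𝕂 L)ˣ, ∀ P ∉ component ι 0,
      P.val (g * f * funTwist Fq 𝕂 L (-1) (↑g⁻¹ : FunRing Fq 𝕂 L) - 1) = 0 := by
  obtain ⟨f, rfl⟩ := hf
  obtain ⟨E, hE⟩ := exists_componentIndicator (𝕂 := 𝕂) ι
  let G : (ℕ → FunRing Fq 𝕂 L) → FunRing Fq 𝕂 L := fun a =>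
    ∑ i ∈ Finset.range (constDegree Fq L), E i * a i
  have hG : ∀ a, ∀ i < constDegree Fq L, ∀ P ∈ component ι i,
      Ideal.Quotient.mk P.val.supp (G a) = Ideal.Quotient.mk P.val.supp (a i) := by
    intro a i hi P hP
    refine map_sum_indicator _ (Finset.mem_range.2 hi) ?_ fun j hj hne => ?_
    · rw [← map_one (Ideal.Quotient.mk P.val.supp), Ideal.Quotient.eq, Valuation.mem_supp_iff]
      exact (hE i hi P).1 hP
    · rw [Ideal.Quotient.eq_zero_iff_mem, Valuation.mem_supp_iff]
      exact (hE j (Finset.mem_range.1 hj) P).2 i hi hne.symm hP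
  let g₁ := G fun i => (twistProd f i : FunRing Fq 𝕂 L)
  let g₂ := G fun i => (↑(twistProd f i)⁻¹ : FunRing Fq 𝕂 L)
  have hg : g₁ * g₂ = 1 := by
    rw [← sub_eq_zero]
    refine eq_zero_of_forall_val_eq_zero fun P => ?_
    obtain ⟨i, hi, hP⟩ := exists_mem_component ι P
    rw [← Valuation.mem_supp_iff, ← Ideal.Quotient.eq, map_mul, hG _ i hi P hP, hG _ i hi P hP,
      ← map_mul, Units.mul_inv]
  refine ⟨⟨g₁, g₂, hg, by rw [mul_comm, hg]⟩, fun P hP => ?_⟩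
  change P.val (g₁ * f * funTwist Fq 𝕂 L (-1) g₂ - 1) = 0
  obtain ⟨i, hi, hPi⟩ := exists_mem_component ι P
  obtain ⟨k, rfl⟩ : ∃ k, i = k + 1 := Nat.exists_eq_succ_of_ne_zero fun h => hP (h ▸ hPi)
  have hP' : P.twist 1 ∈ component ι k := (twist_mem_component (by push_cast; ring)).2 hPi
  have h1 : Ideal.Quotient.mk P.val.supp (funTwist Fq 𝕂 L (-1) g₂) =
      Ideal.Quotient.mk P.val.supp (funTwist Fq 𝕂 L (-1) (↑(twistProd f k)⁻¹ : FunRing Fq 𝕂 L)) := by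
    rw [Ideal.Quotient.eq, Valuation.mem_supp_iff, ← funTwist_sub, ← P.twist_val 1,
      ← Valuation.mem_supp_iff, ← Ideal.Quotient.eq]
    exact hG _ k (by omega) _ hP'
  rw [← Valuation.mem_supp_iff, ← Ideal.Quotient.eq, map_mul, h1, map_mul, hG _ _ hi P hPi, ← map_mul,
    ← map_mul]
  congr 1
  have h2 : (twistProd f (k + 1) : FunRing Fq 𝕂 L)
      = ↑f⁻¹ * funTwist Fq 𝕂 L (-1) (twistProd f k : FunRing Fq 𝕂 L) := rfl
  rw [h2, mul_assoc, mul_assoc, mul_left_comm (funTwist _ _ _ _ _), ← funTwist_mul, Units.mul_inv,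
    ← mul_assoc, Units.inv_mul, one_mul]
  exact (funTwist Fq 𝕂 L (-1)).map_one

end Normalize

/-! ### Codimension -/

section Codim

variable {F E : Type*} [Field F] [AddCommGroup E] [Module F E]

/-- `B ≤ A` has codimension `d` in `A`, tested on large finite dimensional subspaces. -/
def HasCodim (A B : Submodule F E) (d : ℕ) : Prop :=
  B ≤ A ∧ ∃ V₀ : Submodule F E, FiniteDimensional F V₀ ∧ ∀ V : Submodule F E, FiniteDimensional F V →
    V₀ ≤ V → Module.finrank F (V ⊓ A : Submodule F E) = Module.finrank F (V ⊓ B : Submodule F E) + d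

theorem HasCodim.refl (A : Submodule F E) : HasCodim A A 0 :=
  ⟨le_rfl, ⊥, inferInstance, fun _ _ _ => rfl⟩

theorem HasCodim.trans {A B C : Submodule F E} {d e : ℕ} (h : HasCodim A B d) (h' : HasCodim B C e) :
    HasCodim A C (d + e) := by
  obtain ⟨h1, V, hV, h2⟩ := h
  obtain ⟨h1', V', hV', h2'⟩ := h'
  refine ⟨h1'.trans h1, V ⊔ V', inferInstance, fun U hU hle => ?_⟩
  rw [h2 U hU (le_sup_left.trans hle), h2' U hU (le_sup_right.trans hle)]
  ring

theorem HasCodim.of_singleton {A B : Submodule F E} (hle : B ≤ A) {x : E} (hxA : x ∈ A) (hxB : x ∉ B)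
    (h : ∀ a ∈ A, ∃ c : F, a - c • x ∈ B) : HasCodim A B 1 := by
  refine ⟨hle, F ∙ x, inferInstance, fun V hV hV0 => ?_⟩
  have hxV : x ∈ V := hV0 (Submodule.mem_span_singleton_self x)
  have hx0 : x ≠ 0 := fun h0 => hxB (h0 ▸ B.zero_mem)
  have hsup : (V ⊓ B) ⊔ F ∙ x = V ⊓ A := by
    refine le_antisymm (sup_le (inf_le_inf_left V hle) ?_) fun a ha => ?_
    · rw [Submodule.span_singleton_le_iff_mem]
      exact ⟨hxV, hxA⟩
    · obtain ⟨c, hc⟩ := h a ha.2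
      have : a = (a - c • x) + c • x := by abel
      rw [this]
      exact Submodule.add_mem_sup ⟨V.sub_mem ha.1 (V.smul_mem c hxV), hc⟩
        (Submodule.smul_mem _ c (Submodule.mem_span_singleton_self x))
  have hinf : (V ⊓ B) ⊓ F ∙ x = ⊥ := by
    rw [Submodule.eq_bot_iff]
    rintro y ⟨⟨-, hyB⟩, hy⟩
    obtain ⟨c, rfl⟩ := Submodule.mem_span_singleton.1 hy
    by_cases hc : c = 0
    · rw [hc, zero_smul]
    · exact absurd ((B.smul_mem_iff hc).1 hyB) hxB
  have := Submodule.finrank_sup_add_finrank_inf_eq (V ⊓ B) (F ∙ x)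
  rw [hsup, hinf, finrank_bot, finrank_span_singleton hx0, add_zero] at this
  exact this

end Codim

/-! ### Multiplying modules of sections by ideals -/

section IdealMul

variable {Fq : Type*} [Field Fq] [Fintype Fq] {𝕂 : Type*} [Field 𝕂] [Algebra Fq 𝕂] [IsAlgClosed 𝕂]
  {L : Type*} [Field L] [Algebra Fq L] [Algebra Fq[X] L] [Algebra (RatFunc Fq) L]
  [IsScalarTower Fq Fq[X] L] [IsScalarTower Fq (RatFunc Fq) L] [IsScalarTower Fq[X] (RatFunc Fq) L]
  [FiniteDimensional (RatFunc Fq) L] [Algebra.IsSeparable (RatFunc Fq) L]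

/-- An `O_𝐊`-submodule of `𝐊`, as a `𝕂`-subspace. -/
def overK (N : Submodule (BigO Fq 𝕂 L) (FunRing Fq 𝕂 L)) : Submodule 𝕂 (FunRing Fq 𝕂 L) where
  carrier := N
  add_mem' := N.add_mem
  zero_mem' := N.zero_mem
  smul_mem' c x hx := by
    rw [smul_funRing_eq, ← bigOToFun_const]
    exact bigOToFun_mul_mem _ hx

theorem mem_overK {N : Submodule (BigO Fq 𝕂 L) (FunRing Fq 𝕂 L)} {x : FunRing Fq 𝕂 L} :
    x ∈ overK N ↔ x ∈ N := Iff.rfl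

theorem ideal_pow_zero_smul {B E : Type*} [CommRing B] [AddCommGroup E] [Module B E] (I : Ideal B)
    (N : Submodule B E) : I ^ 0 • N = N := by
  rw [pow_zero, Ideal.one_eq_top, Submodule.top_smul]

theorem ideal_pow_succ_smul {B E : Type*} [CommRing B] [AddCommGroup E] [Module B E] (I : Ideal B)
    (n : ℕ) (N : Submodule B E) : I ^ (n + 1) • N = I • I ^ n • N := by
  rw [pow_succ', mul_smul]

theorem ideal_mul_smul {B E : Type*} [CommRing B] [AddCommGroup E] [Module B E] (I J : Ideal B)
    (N : Submodule B E) : (I * J) • N = I • J • N := mul_smul ..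

theorem typeIdeal_zero_smul (N : Submodule (BigO Fq 𝕂 L) (FunRing Fq 𝕂 L)) :
    typeIdeal (0 : ClosedPoint Fq 𝕂 L →₀ ℕ) • N = N := by
  have h : typeIdeal (0 : ClosedPoint Fq 𝕂 L →₀ ℕ) = ⊤ := by
    rw [← Ideal.one_eq_top]
    exact Finsupp.prod_zero_index
  rw [h, Submodule.top_smul]

theorem typeIdeal_single_add_smul (ξ : ClosedPoint Fq 𝕂 L) (m : ℕ) (Ξ : ClosedPoint Fq 𝕂 L →₀ ℕ)
    (N : Submodule (BigO Fq 𝕂 L) (FunRing Fq 𝕂 L)) :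
    typeIdeal (Finsupp.single ξ m + Ξ) • N = pointIdeal ξ ^ m • typeIdeal Ξ • N := by
  classical
  have h : typeIdeal (Finsupp.single ξ m + Ξ) = pointIdeal ξ ^ m * typeIdeal Ξ := by
    refine (Finsupp.prod_add_index' (fun _ => pow_zero _) (fun _ _ _ => pow_add _ _ _)).trans ?_
    refine congrArg (· * typeIdeal Ξ) ?_
    exact Finsupp.prod_single_index (pow_zero _)
  rw [h]
  exact ideal_mul_smul _ _ _

theorem toDivisor_apply (Ξ : ClosedPoint Fq 𝕂 L →₀ ℕ) (P : ClosedPoint Fq 𝕂 L) :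
    toDivisor Ξ P = Ξ P := rfl

theorem mem_pointIdeal {ξ : ClosedPoint Fq 𝕂 L} (hξ : ξ ∈ affinePart Fq 𝕂 L) {b : BigO Fq 𝕂 L} :
    b ∈ pointIdeal ξ ↔ ξ.onO b < 1 := by
  refine ⟨fun h => ?_, fun h => Ideal.subset_span h⟩
  induction h using Submodule.span_induction with
  | mem x hx => exact hx
  | zero => rw [map_zero]; exact zero_lt_one
  | add x y _ _ hx hy => exact ξ.onO.map_add_lt hx hy
  | smul a x _ hx =>
    rw [smul_eq_mul, map_mul]
    exact (mul_le_of_le_one_left' (ξ.onO_le_one hξ a)).trans_lt hx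

theorem exists_mem_pointIdeal_self {ξ : ClosedPoint Fq 𝕂 L} (hξ : ξ ∈ affinePart Fq 𝕂 L) :
    ∃ b ∈ pointIdeal ξ, ξ.onO b = WithZero.exp (-1) := by
  obtain ⟨χ, hχ⟩ := ξ.exists_center hξ
  obtain ⟨π, hπ⟩ := exists_isLocalParam χ
  have := val_localParam hχ hπ
  refine ⟨π, (mem_pointIdeal hξ).2 ?_, this⟩
  rw [this, ← WithZero.exp_zero, WithZero.exp_lt_exp]
  norm_num

theorem exists_mem_pointIdeal {ξ P : ClosedPoint Fq 𝕂 L} (hξ : ξ ∈ affinePart Fq 𝕂 L)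
    (hP : P ∈ affinePart Fq 𝕂 L) (hne : P ≠ ξ) : ∃ b ∈ pointIdeal ξ, P.onO b = 1 := by
  obtain ⟨χ, hχ⟩ := ξ.exists_center hξ
  obtain ⟨χ', hχ'⟩ := P.exists_center hP
  have hχne : χ' ≠ χ := fun h => hne (eq_of_isCentered (h ▸ hχ') hχ)
  obtain ⟨b, hb⟩ : ∃ b, χ' b ≠ χ b := by
    by_contra! h
    exact hχne (AlgHom.ext h)
  refine ⟨b - algebraMap 𝕂 _ (χ b), (mem_pointIdeal hξ).2 (hχ.lt_one_iff.2 ?_), hχ'.eq_one_iff.2 ?_⟩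
  · rw [map_sub, AlgHom.commutes, Algebra.algebraMap_self_apply, sub_self]
  · rw [map_sub, AlgHom.commutes, Algebra.algebraMap_self_apply]
    exact sub_ne_zero.2 hb

theorem lt_exp_iff_le {x : ℤᵐ⁰} {d : ℤ} : x < WithZero.exp d ↔ x ≤ WithZero.exp (d - 1) := by
  by_cases hx : x = 0
  · simp [hx, WithZero.exp_pos]
  · rw [← WithZero.exp_log hx, WithZero.exp_lt_exp, WithZero.exp_le_exp]
    omega

/-- At ξ an element of maximal valuation is multiplied by a local parameter; at any other point it
is multiplied by an element of 𝔓_ξ that is a unit there. -/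
theorem Attains.pointIdeal_smul {N : Submodule (BigO Fq 𝕂 L) (FunRing Fq 𝕂 L)} {D : Divisor Fq 𝕂 L}
    (h : Attains N D) {ξ : ClosedPoint Fq 𝕂 L} (hξ : ξ ∈ affinePart Fq 𝕂 L) :
    Attains (pointIdeal ξ • N) (D - Finsupp.single ξ 1) := by
  classical
  intro P hP
  by_cases hPξ : P = ξ
  · subst hPξ
    rw [Finsupp.sub_apply, Finsupp.single_eq_same]
    refine ⟨fun x hx => ?_, ?_⟩
    · refine Submodule.smul_induction_on hx (fun b hb m hm => ?_) fun x y hx hy => P.val.map_add_le hx hy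
      rw [bigO_smul_eq, map_mul, sub_eq_add_neg, add_comm, WithZero.exp_add]
      have h1 := (mem_pointIdeal hP).1 hb
      rw [← WithZero.exp_zero, lt_exp_iff_le, zero_sub] at h1
      exact mul_le_mul' h1 ((h P hP).1 m hm)
    · obtain ⟨b, hb, hb1⟩ := exists_mem_pointIdeal_self hP
      obtain ⟨m, hm, hm1⟩ := (h P hP).2
      refine ⟨b • m, Submodule.smul_mem_smul hb hm, ?_⟩
      rw [bigO_smul_eq, map_mul, ← P.onO_apply, hb1, hm1, ← WithZero.exp_add]
      congr 1; ring
  · rw [Finsupp.sub_apply, Finsupp.single_eq_of_ne (by simpa using hPξ), sub_zero]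
    refine ⟨fun x hx => (h P hP).1 x (Submodule.smul_le_right hx), ?_⟩
    obtain ⟨b, hb, hb1⟩ := exists_mem_pointIdeal hξ hP hPξ
    obtain ⟨m, hm, hm1⟩ := (h P hP).2
    refine ⟨b • m, Submodule.smul_mem_smul hb hm, ?_⟩
    rw [bigO_smul_eq, map_mul, ← P.onO_apply, hb1, hm1, one_mul]

theorem Attains.mem_pointIdeal_smul_iff {N : Submodule (BigO Fq 𝕂 L) (FunRing Fq 𝕂 L)}
    {D : Divisor Fq 𝕂 L} (h : Attains N D) {ξ : ClosedPoint Fq 𝕂 L} (hξ : ξ ∈ affinePart Fq 𝕂 L)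
    {x : FunRing Fq 𝕂 L} (hx : x ∈ N) : x ∈ pointIdeal ξ • N ↔ ξ.val x < WithZero.exp (D ξ) := by
  classical
  rw [(h.pointIdeal_smul hξ).mem_iff, mem_affineSections, lt_exp_iff_le]
  refine ⟨fun hx' => ?_, fun hx' P hP => ?_⟩
  · have := hx' ξ hξ
    rwa [Finsupp.sub_apply, Finsupp.single_eq_same] at this
  · by_cases hPξ : P = ξ
    · subst hPξ
      rwa [Finsupp.sub_apply, Finsupp.single_eq_same]
    · rw [Finsupp.sub_apply, Finsupp.single_eq_of_ne (by simpa using hPξ), sub_zero]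
      exact (h P hP).1 x hx

/-- The residue field at ξ is 𝕂, and c is the value of x/m at ξ. -/
theorem exists_const_val_sub_lt {ξ : ClosedPoint Fq 𝕂 L} (hξ : ξ ∈ affinePart Fq 𝕂 L)
    {x m : FunRing Fq 𝕂 L} (hm : ξ.val m ≠ 0) (hx : ξ.val x ≤ ξ.val m) :
    ∃ c : 𝕂, ξ.val (x - const Fq c * m) < ξ.val m := by
  obtain ⟨χ, hχ⟩ := ξ.exists_center hξ
  obtain ⟨s, a, hs, hsa⟩ := exists_mul_eq_mul_fun hχ hm hx
  refine ⟨χ a / χ s, ?_⟩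
  have h1 : bigOToFun s * (x - const Fq (χ a / χ s) * m)
      = bigOToFun (a - algebraMap 𝕂 _ (χ a / χ s) * s) * m := by
    rw [mul_sub, hsa, map_sub bigOToFun, map_mul bigOToFun, bigOToFun_const, sub_mul, mul_left_comm,
      mul_assoc]
  have h2 := congrArg ξ.val h1
  rw [map_mul, map_mul, ← ξ.onO_apply, hχ.eq_one_iff.2 hs, one_mul, ← ξ.onO_apply] at h2
  rw [h2]
  have h3 : ξ.onO (a - algebraMap 𝕂 _ (χ a / χ s) * s) < 1 := by
    rw [hχ.lt_one_iff, map_sub, map_mul, AlgHom.commutes, Algebra.algebraMap_self_apply,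
      div_mul_cancel₀ _ hs, sub_self]
  exact (mul_lt_mul_of_pos_right h3 (zero_lt_iff.2 hm)).trans_eq (one_mul _)

/-- The quotient of N by 𝔓_ξ N is the line over the residue field 𝕂 spanned by an element of maximal
valuation at ξ. -/
theorem Attains.hasCodim_pointIdeal {N : Submodule (BigO Fq 𝕂 L) (FunRing Fq 𝕂 L)} {D : Divisor Fq 𝕂 L}
    (h : Attains N D) {ξ : ClosedPoint Fq 𝕂 L} (hξ : ξ ∈ affinePart Fq 𝕂 L) :
    HasCodim (overK N) (overK (pointIdeal ξ • N)) 1 := by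
  obtain ⟨m, hm, hm1⟩ := (h ξ hξ).2
  refine HasCodim.of_singleton (x := m) (fun x hx => ?_) hm (fun hmI => ?_) fun x hx => ?_
  · exact Submodule.smul_le_right (N := N) hx
  · exact absurd hm1 ((h.mem_pointIdeal_smul_iff hξ hm).1 hmI).ne
  · obtain ⟨c, hc⟩ := exists_const_val_sub_lt hξ (x := x) (m := m)
      (by rw [hm1]; exact WithZero.exp_ne_zero) (by rw [hm1]; exact (h ξ hξ).1 x hx)
    refine ⟨c, ?_⟩
    rw [mem_overK, h.mem_pointIdeal_smul_iff hξ ((overK N).sub_mem hx ((overK N).smul_mem c hm)),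
      smul_funRing_eq, ← hm1]
    exact hc

/-- The degree of an effective divisor. -/
def degree (Ξ : ClosedPoint Fq 𝕂 L →₀ ℕ) : ℕ := Ξ.sum fun _ m => m

/-- The case of one point is iterated over Ξ with multiplicities. The second part will give the
dimension of M/σM as deg Ξ. -/
theorem Attains.typeIdeal_smul {N : Submodule (BigO Fq 𝕂 L) (FunRing Fq 𝕂 L)} {D : Divisor Fq 𝕂 L}
    (h : Attains N D) {Ξ : ClosedPoint Fq 𝕂 L →₀ ℕ} (hΞ : ∀ ξ ∈ Ξ.support, ξ ∈ affinePart Fq 𝕂 L) :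
    Attains (typeIdeal Ξ • N) (D - toDivisor Ξ) ∧
      HasCodim (overK N) (overK (typeIdeal Ξ • N)) (degree Ξ) := by
  classical
  have hpow : ∀ ξ ∈ affinePart Fq 𝕂 L, ∀ m : ℕ, ∀ N' D', Attains N' D' →
      Attains (pointIdeal ξ ^ m • N') (D' - Finsupp.single ξ (m : ℤ)) ∧
      HasCodim (overK N') (overK (pointIdeal ξ ^ m • N')) m := by
    intro ξ hξ m N' D' h'
    induction m with
    | zero =>
      have e : pointIdeal ξ ^ 0 • N' = N' := ideal_pow_zero_smul _ _
      rw [e, Nat.cast_zero, Finsupp.single_zero, sub_zero]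
      exact ⟨h', HasCodim.refl _⟩
    | succ m ih =>
      have e : pointIdeal ξ ^ (m + 1) • N' = pointIdeal ξ • pointIdeal ξ ^ m • N' :=
        ideal_pow_succ_smul _ _ _
      rw [e]
      refine ⟨?_, ih.2.trans (ih.1.hasCodim_pointIdeal hξ)⟩
      have := ih.1.pointIdeal_smul hξ
      rwa [sub_sub, ← Finsupp.single_add] at this
  induction Ξ using Finsupp.induction with
  | zero =>
    have h1 : toDivisor (0 : ClosedPoint Fq 𝕂 L →₀ ℕ) = 0 := by
      ext P
      exact Nat.cast_zero
    rw [h1, typeIdeal_zero_smul, sub_zero]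
    exact ⟨h, HasCodim.refl _⟩
  | single_add ξ m Ξ' hξ hm ih =>
    have hs : ξ ∈ affinePart Fq 𝕂 L := hΞ ξ (by
      rw [Finsupp.support_single_add hξ hm]; exact Finset.mem_cons_self _ _)
    have hs' : ∀ η ∈ Ξ'.support, η ∈ affinePart Fq 𝕂 L := fun η hη => hΞ η (by
      rw [Finsupp.support_single_add hξ hm]; exact Finset.mem_cons_of_mem hη)
    obtain ⟨h1, h2⟩ := ih hs'
    have h4 : degree (Finsupp.single ξ m + Ξ') = degree Ξ' + m := by
      rw [degree, Finsupp.sum_add_index' (fun _ => rfl) (fun _ _ _ => rfl),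
        Finsupp.sum_single_index rfl, add_comm]
      rfl
    have h5 : D - toDivisor (Finsupp.single ξ m + Ξ') = D - toDivisor Ξ' - Finsupp.single ξ (m : ℤ) := by
      ext P
      simp only [Finsupp.sub_apply, toDivisor_apply, Finsupp.add_apply, Finsupp.single_apply]
      split_ifs <;> push_cast <;> ring
    rw [typeIdeal_single_add_smul, h4, h5]
    obtain ⟨h6, h7⟩ := hpow ξ hs m _ _ h1
    exact ⟨h6, h2.trans h7⟩

end IdealMul

/-! ### The order of the multiplier at the points of 𝐔. -/

section DivMult

variable {Fq : Type*} [Field Fq] [Fintype Fq] {𝕂 : Type*} [Field 𝕂] [Algebra Fq 𝕂] [IsAlgClosed 𝕂]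
  {L : Type*} [Field L] [Algebra Fq L] [Algebra Fq[X] L] [Algebra (RatFunc Fq) L]
  [IsScalarTower Fq Fq[X] L] [IsScalarTower Fq (RatFunc Fq) L] [IsScalarTower Fq[X] (RatFunc Fq) L]
  [FiniteDimensional (RatFunc Fq) L] [Algebra.IsSeparable (RatFunc Fq) L]
  {M : Type*} [AddCommGroup M] [Module 𝕂[X] M] {σ : M →ₛₗ[polyTwistInv Fq 𝕂] M} {φ : OKEmbedding L σ}

theorem mem_affinePart_of_mem_pointsAbove {θ : 𝕂} {P : ClosedPoint Fq 𝕂 L}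
    (h : P ∈ pointsAbove Fq L θ) : P ∈ affinePart Fq 𝕂 L := by
  have h' : P.val (tFun Fq 𝕂 L - const Fq θ) < 1 := h
  have hc : P.val (const Fq θ) ≤ 1 := by
    by_cases h0 : θ = 0
    · rw [h0, const_zero, map_zero]; exact zero_le
    · exact (P.trivial_on_const θ h0).le
  change P.val (tFun Fq 𝕂 L) ≤ 1
  rw [← sub_add_cancel (tFun Fq 𝕂 L) (const Fq θ)]
  exact P.val.map_add_le h'.le hc

theorem Realization.mem_idealMul (R : Realization φ) (I : Ideal (BigO Fq 𝕂 L)) (m : M) :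
    m ∈ φ.idealMul I ↔ R.toHom m ∈ I • R.image := by
  constructor
  · intro h
    induction h using AddSubgroup.closure_induction with
    | mem x hx =>
      obtain ⟨b, hb, m, rfl⟩ := hx
      rw [R.map_action]
      exact Submodule.smul_mem_smul hb ⟨m, rfl⟩
    | zero => rw [map_zero]; exact Submodule.zero_mem _
    | add x y _ _ hx hy => rw [map_add]; exact Submodule.add_mem _ hx hy
    | neg x _ hx => rw [map_neg]; exact Submodule.neg_mem _ hx
  · have key : ∀ x ∈ I • R.image, ∃ m ∈ φ.idealMul I, R.toHom m = x := by
      intro x hx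
      refine Submodule.smul_induction_on hx ?_ ?_
      · rintro b hb _ ⟨m, rfl⟩
        exact ⟨φ.action b m, AddSubgroup.subset_closure ⟨b, hb, m, rfl⟩, R.map_action b m⟩
      · rintro _ _ ⟨m, hm, rfl⟩ ⟨m', hm', rfl⟩
        exact ⟨m + m', AddSubgroup.add_mem _ hm hm', map_add _ _ _⟩
    intro h
    obtain ⟨m', hm', h'⟩ := key _ h
    rwa [← R.injective h']

theorem Realization.mem_range_sigma_iff (R : Realization φ) {Ξ : ClosedPoint Fq 𝕂 L →₀ ℕ}
    (hσ : (σ.toAddMonoidHom.range : Set M) = φ.idealMul (typeIdeal Ξ)) (m : M) :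
    (∃ m', σ m' = m) ↔ R.toHom m ∈ typeIdeal Ξ • R.image := by
  rw [← R.mem_idealMul, ← SetLike.mem_coe, ← hσ]
  rfl

/-- The largest valuation at P on σM is computed twice: from σM = f M^{(-1)} it is that of f times
exp(D(P^{(1)})), and from σM = 𝔍_Ξ M it is exp(D(P) - Ξ(P)). -/
theorem Realization.val_mult (R : Realization φ) {Ξ : ClosedPoint Fq 𝕂 L →₀ ℕ}
    (hΞ : ∀ ξ ∈ Ξ.support, ξ ∈ affinePart Fq 𝕂 L)
    (hσ : (σ.toAddMonoidHom.range : Set M) = φ.idealMul (typeIdeal Ξ)) {D : Divisor Fq 𝕂 L}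
    (hD : Attains R.image D) {P : ClosedPoint Fq 𝕂 L} (hP : P ∈ affinePart Fq 𝕂 L) :
    P.val R.mult = WithZero.exp (D P - Ξ P - D (P.twist 1)) := by
  have hP1 : P.twist 1 ∈ affinePart Fq 𝕂 L := twist_mem_affinePart.2 hP
  have hne := val_ne_zero_of_isUnit P R.isUnit_mult
  obtain ⟨h1, -⟩ := hD.typeIdeal_smul hΞ
  obtain ⟨hle, x, hx, hx1⟩ := h1 P hP
  obtain ⟨hle', _, ⟨m, rfl⟩, hm1⟩ := hD _ hP1
  have hval : ∀ m, P.val (R.toHom (σ m)) = P.val R.mult * (P.twist 1).val (R.toHom m) := by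
    intro m
    rw [R.map_sigma, map_mul, P.twist_val]
  have e1 : P.val R.mult * WithZero.exp (D (P.twist 1)) ≤ WithZero.exp (D P - Ξ P) := by
    rw [← hm1, ← hval]
    exact hle _ ((R.mem_range_sigma_iff hσ _).1 ⟨m, rfl⟩)
  have e2 : WithZero.exp (D P - Ξ P) ≤ P.val R.mult * WithZero.exp (D (P.twist 1)) := by
    have hx' : x ∈ R.image := Submodule.smul_le_right hx
    obtain ⟨m', rfl⟩ := hx'
    obtain ⟨m'', rfl⟩ := (R.mem_range_sigma_iff hσ _).2 hx
    have hx2 : WithZero.exp (D P - Ξ P) = P.val (R.toHom (σ m'')) := hx1.symm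
    rw [hx2, hval]
    exact mul_le_mul_right (hle' _ ⟨m'', rfl⟩) _
  rw [WithZero.exp_sub, ← le_antisymm e1 e2, mul_div_assoc, div_self WithZero.exp_ne_zero, mul_one]

end DivMult

/-! ### The degree filtration of a free `F[X]`-module -/

section Filtration

variable {F : Type*} [Field F] {M : Type*} [AddCommGroup M] [Module F[X] M] [Module F M]
  [IsScalarTower F F[X] M] {r : ℕ} (b : Module.Basis (Fin r) F[X] M)

/-- The elements of `M` whose coordinates have degree less than `k`. -/
def filtration (k : ℕ) : Submodule F M where
  carrier := {m | ∀ i, b.repr m i ∈ degreeLT F k}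
  add_mem' := fun {x y} hx hy i => by
    rw [map_add, Finsupp.add_apply]
    exact (degreeLT F k).add_mem (hx i) (hy i)
  zero_mem' := fun i => by
    rw [map_zero, Finsupp.zero_apply]
    exact (degreeLT F k).zero_mem
  smul_mem' := fun c x hx i => by
    have : b.repr (c • x) i = c • b.repr x i := by
      rw [← algebraMap_smul F[X] c x, map_smul, Finsupp.smul_apply, algebraMap_smul]
    rw [this]
    exact (degreeLT F k).smul_mem c (hx i)

variable {b}

theorem mem_filtration {k : ℕ} {m : M} : m ∈ filtration b k ↔ ∀ i, (b.repr m i).degree < k :=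
  forall_congr' fun _ => mem_degreeLT

theorem filtration_mono {k l : ℕ} (h : k ≤ l) : filtration b k ≤ filtration b l := fun _ hm i =>
  degreeLT_mono h (hm i)

variable (b) in
/-- The coordinates of the elements of the filtration. -/
def filtrationEquiv (k : ℕ) : filtration b k ≃ₗ[F] (Fin r → degreeLT F k) where
  toFun m i := ⟨b.repr m i, m.2 i⟩
  map_add' x y := by
    ext i : 2
    simp
  map_smul' c x := by
    ext i : 2
    simp [← algebraMap_smul F[X] c (x : M), smul_eq_C_mul]
  invFun f := ⟨b.equivFun.symm fun i => (f i : F[X]), fun i => by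
    rw [← b.equivFun_apply, LinearEquiv.apply_symm_apply]
    exact (f i).2⟩
  left_inv x := by
    ext
    exact b.equivFun.symm_apply_apply (x : M)
  right_inv f := by
    ext i : 2
    change b.equivFun (b.equivFun.symm fun i => (f i : F[X])) i = _
    rw [LinearEquiv.apply_symm_apply]

instance filtration_finite (k : ℕ) : FiniteDimensional F (filtration b k) :=
  have : FiniteDimensional F (degreeLT F k) := Module.Finite.equiv (degreeLTEquiv F k).symm
  Module.Finite.equiv (filtrationEquiv b k).symm

theorem finrank_filtration (k : ℕ) : Module.finrank F (filtration b k) = r * k := by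
  have : FiniteDimensional F (degreeLT F k) := Module.Finite.equiv (degreeLTEquiv F k).symm
  rw [(filtrationEquiv b k).finrank_eq, Module.finrank_pi_fintype]
  simp [(degreeLTEquiv F k).finrank_eq]

variable (b) in
theorem exists_mem_filtration (m : M) : ∃ k, m ∈ filtration b k := by
  refine ⟨(Finset.univ.sup fun i => (b.repr m i).natDegree) + 1, mem_filtration.2 fun i => ?_⟩
  refine degree_le_natDegree.trans_lt ?_
  have := Finset.le_sup (f := fun i => (b.repr m i).natDegree) (Finset.mem_univ i)
  exact_mod_cast Nat.lt_succ_of_le this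

variable (b) in
theorem exists_le_filtration (V : Submodule F M) [hV : FiniteDimensional F V] :
    ∃ k, V ≤ filtration b k := by
  obtain ⟨S, hS⟩ := (Submodule.fg_iff_finiteDimensional V).2 hV
  choose k hk using exists_mem_filtration b
  refine ⟨S.sup k, ?_⟩
  rw [← hS, Submodule.span_le]
  exact fun x hx => filtration_mono (Finset.le_sup hx) (hk x)

end Filtration

/-! ### Semilinear injections -/

section Semilinear

variable {F : Type*} [Field F] {M : Type*} [AddCommGroup M] [Module F M] {τ : F ≃+* F}
  {s : M →ₛₗ[(τ : F →+* F)] M}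

theorem finrank_map_semilinear (hs : Function.Injective s) (V : Submodule F M) :
    Module.finrank F (V.map s) = Module.finrank F V := by
  have := RingHomInvPair.of_ringEquiv τ
  have := RingHomInvPair.of_ringEquiv τ.symm
  have e := Submodule.equivMapOfInjective (σ₂₁ := (τ.symm : F →+* F)) s hs V
  refine congrArg Cardinal.toNat ?_
  exact (rank_eq_of_equiv_equiv τ e.toAddEquiv τ.bijective fun c v => e.map_smulₛₗ c v).symm

theorem finite_of_map_semilinear (hs : Function.Injective s) (V : Submodule F M)
    (h : FiniteDimensional F (V.map s)) : FiniteDimensional F V := by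
  have := RingHomInvPair.of_ringEquiv τ
  have := RingHomInvPair.of_ringEquiv τ.symm
  have e := Submodule.equivMapOfInjective (σ₂₁ := (τ.symm : F →+* F)) s hs V
  exact Module.Finite.of_surjective e.symm.toLinearMap e.symm.surjective

theorem HasCodim.map_semilinear (hs : Function.Injective s) {A B : Submodule F M} {d : ℕ}
    (h : HasCodim A B d) : HasCodim (A.map s) (B.map s) d := by
  obtain ⟨hle, V₀, hV₀, h⟩ := h
  refine ⟨Submodule.map_mono hle, V₀.map s, inferInstance, fun V hV hV0 => ?_⟩
  have hinf : ∀ C : Submodule F M, V ⊓ C.map s = (V.comap s ⊓ C).map s := by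
    intro C
    ext x
    constructor
    · rintro ⟨hx, y, hy, rfl⟩
      exact ⟨y, ⟨hx, hy⟩, rfl⟩
    · rintro ⟨y, ⟨hy, hyC⟩, rfl⟩
      exact ⟨hy, y, hyC, rfl⟩
  have hfin : FiniteDimensional F (V.comap s) := by
    refine finite_of_map_semilinear hs _ ?_
    exact Submodule.finiteDimensional_of_le (Submodule.map_comap_le s V)
  rw [hinf, hinf, finrank_map_semilinear hs, finrank_map_semilinear hs]
  exact h _ hfin (Submodule.map_le_iff_le_comap.1 hV0)

theorem mem_iterate_map (n : ℕ) (V : Submodule F M) (x : M) :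
    x ∈ (Submodule.map s)^[n] V ↔ ∃ v ∈ V, s^[n] v = x := by
  induction n generalizing x with
  | zero => simp
  | succ n ih =>
    rw [Function.iterate_succ_apply', Submodule.mem_map]
    constructor
    · rintro ⟨y, hy, rfl⟩
      obtain ⟨v, hv, rfl⟩ := (ih y).1 hy
      exact ⟨v, hv, Function.iterate_succ_apply' _ _ _⟩
    · rintro ⟨v, hv, rfl⟩
      exact ⟨s^[n] v, (ih _).2 ⟨v, hv, rfl⟩, (Function.iterate_succ_apply' _ _ _).symm⟩

theorem finrank_iterate_map (hs : Function.Injective s) (n : ℕ) (V : Submodule F M) :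
    Module.finrank F ((Submodule.map s)^[n] V : Submodule F M) = Module.finrank F V := by
  induction n with
  | zero => rfl
  | succ n ih => rw [Function.iterate_succ_apply', finrank_map_semilinear hs, ih]

theorem finite_iterate_map (n : ℕ) (V : Submodule F M) [hV : FiniteDimensional F V] :
    FiniteDimensional F ((Submodule.map s)^[n] V : Submodule F M) := by
  induction n with
  | zero => exact hV
  | succ n ih => rw [Function.iterate_succ_apply']; infer_instance

theorem HasCodim.iterate (hs : Function.Injective s) {d : ℕ} (h : HasCodim ⊤ ((⊤ : Submodule F M).map s) d)
    (n : ℕ) : HasCodim ⊤ ((Submodule.map s)^[n] ⊤) (n * d) := by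
  have hstep : ∀ n, HasCodim ((Submodule.map s)^[n] ⊤) ((Submodule.map s)^[n + 1] ⊤) d := by
    intro n
    induction n with
    | zero => exact h
    | succ n ih =>
      rw [Function.iterate_succ_apply', Function.iterate_succ_apply' _ (n + 1)]
      exact ih.map_semilinear hs
  induction n with
  | zero => rw [zero_mul]; exact HasCodim.refl _
  | succ n ih => rw [Nat.succ_mul]; exact ih.trans (hstep n)

/-- If `s ^ (w n)` raises degrees by `u n`, up to a bounded error, then the codimension `d` of the
image of `s` satisfies `w d = r u`. -/
theorem mul_codim_eq_rank_mul [Module F[X] M] [IsScalarTower F F[X] M] (hs : Function.Injective s)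
    {d : ℕ} (h : HasCodim ⊤ ((⊤ : Submodule F M).map s) d) {r : ℕ} {b : Module.Basis (Fin r) F[X] M}
    {u w c : ℕ}
    (h₁ : ∀ n k m, m ∈ filtration b k → s^[w * n] m ∈ filtration b (k + u * n + c))
    (h₂ : ∀ n k m, s^[w * n] m ∈ filtration b (k + u * n) → m ∈ filtration b (k + c)) :
    w * d = r * u := by
  -- Let M_j denote the filtration, of dimension r j. For large k, the space M_j ∩ s^{wn}M has
  -- codimension wnd in M_j. It is contained in s^{wn} M_{k+c} for j = k + un, and contains s^{wn}
  -- M_k for j = k + un + c.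
  have key : ∀ n : ℕ, r * u * n ≤ r * c + w * d * n ∧ w * d * n ≤ r * u * n + r * c := by
    intro n
    obtain ⟨-, V₀, hV₀, hdim⟩ := h.iterate hs (w * n)
    obtain ⟨k, hk⟩ := exists_le_filtration b V₀
    constructor
    · have e1 := hdim (filtration b (k + u * n)) inferInstance
        (hk.trans (filtration_mono (Nat.le_add_right _ _)))
      rw [inf_top_eq, finrank_filtration] at e1
      have e2 : filtration b (k + u * n) ⊓ (Submodule.map s)^[w * n] ⊤
          ≤ (Submodule.map s)^[w * n] (filtration b (k + c)) := by
        rintro x ⟨hx, hx'⟩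
        obtain ⟨v, -, rfl⟩ := (mem_iterate_map _ _ _).1 hx'
        exact (mem_iterate_map _ _ _).2 ⟨v, h₂ n k v hx, rfl⟩
      have := finite_iterate_map (s := s) (w * n) (filtration b (k + c))
      have e3 := Submodule.finrank_mono e2
      rw [finrank_iterate_map hs, finrank_filtration] at e3
      nlinarith
    · have e1 := hdim (filtration b (k + u * n + c)) inferInstance
        (hk.trans (filtration_mono ((Nat.le_add_right _ _).trans (Nat.le_add_right _ _))))
      rw [inf_top_eq, finrank_filtration] at e1
      have e2 : (Submodule.map s)^[w * n] (filtration b k)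
          ≤ filtration b (k + u * n + c) ⊓ (Submodule.map s)^[w * n] ⊤ := by
        intro x hx
        obtain ⟨v, hv, rfl⟩ := (mem_iterate_map _ _ _).1 hx
        exact ⟨h₁ n k v hv, (mem_iterate_map _ _ _).2 ⟨v, trivial, rfl⟩⟩
      have e3 := Submodule.finrank_mono e2
      rw [finrank_iterate_map hs, finrank_filtration] at e3
      nlinarith
  -- The difference of w d and r u, multiplied by n, is bounded by r c for all n; n = r c + 1 forces
  -- it to vanish.
  obtain ⟨h3, h4⟩ := key (r * c + 1)
  rcases lt_trichotomy (w * d) (r * u) with hlt | heq | hlt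
  · nlinarith
  · exact heq
  · nlinarith

end Semilinear

/-! ### Laurent series in `1/t` -/

section Laurent

variable {𝕂 : Type*} [Field 𝕂]

/-- The coefficient of `t ^ (-n)`. -/
def laurentCoeff (f : LaurentAtInfty 𝕂) (n : ℤ) : 𝕂 := HahnSeries.coeff (Γ := ℤ) (R := 𝕂) f n

variable (𝕂) in
/-- The element `t` of `𝕂((1/t))`. -/
def laurentT : LaurentAtInfty 𝕂 := algebraMap 𝕂[X] (LaurentAtInfty 𝕂) X

theorem laurentT_eq : laurentT 𝕂 = (HahnSeries.single (-1 : ℤ) (1 : 𝕂) : LaurentSeries 𝕂) :=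
  eval₂_X (S := LaurentSeries 𝕂) HahnSeries.C (HahnSeries.single (-1 : ℤ) 1)

theorem laurentT_ne_zero : laurentT 𝕂 ≠ 0 := by
  rw [laurentT_eq]
  exact HahnSeries.single_ne_zero one_ne_zero

theorem laurentCoeff_T_mul (f : LaurentAtInfty 𝕂) (n : ℤ) :
    laurentCoeff (laurentT 𝕂 * f) n = laurentCoeff f (n + 1) := by
  rw [laurentT_eq]
  have := HahnSeries.coeff_single_mul_add (Γ := ℤ) (r := (1 : 𝕂)) (x := f) (a := n + 1) (b := -1)
  rw [one_mul, add_neg_cancel_right] at this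
  exact this

theorem laurentCoeff_T_zpow_mul (k : ℤ) (f : LaurentAtInfty 𝕂) (n : ℤ) :
    laurentCoeff (laurentT 𝕂 ^ k * f) n = laurentCoeff f (n + k) := by
  induction k generalizing n with
  | zero => rw [zpow_zero, one_mul, add_zero]
  | succ k ih =>
    rw [zpow_add_one₀ laurentT_ne_zero, mul_comm (_ ^ _), mul_assoc, laurentCoeff_T_mul, ih]
    congr 1; ring
  | pred k ih =>
    have h := ih (n - 1)
    rw [← sub_add_cancel (-(k : ℤ)) 1, zpow_add_one₀ laurentT_ne_zero, mul_comm (_ ^ _), mul_assoc,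
      laurentCoeff_T_mul, sub_add_cancel, sub_add_cancel] at h
    rw [h]
    congr 1; ring

theorem mem_powerSeriesAtInfty {f : LaurentAtInfty 𝕂} :
    f ∈ powerSeriesAtInfty 𝕂 ↔ ∀ n < 0, laurentCoeff f n = 0 := by
  constructor
  · rintro ⟨p, rfl⟩ n hn
    exact HahnSeries.embDomain_of_notMem_range fun ⟨m, hm⟩ => by
      change (m : ℤ) = n at hm
      omega
  · intro h
    refine ⟨PowerSeries.mk fun n => laurentCoeff f n, ?_⟩
    refine HahnSeries.ext (funext fun n => ?_)
    rcases lt_or_ge n 0 with hn | hn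
    · refine Eq.trans ?_ (h n hn).symm
      exact HahnSeries.embDomain_of_notMem_range fun ⟨m, hm⟩ => by
        change (m : ℤ) = n at hm
        omega
    · obtain ⟨m, rfl⟩ := Int.eq_ofNat_of_zero_le hn
      refine (HahnSeries.ofPowerSeries_apply_coeff _ m).trans ?_
      rw [PowerSeries.coeff_mk]
      rfl

theorem exists_zpow_mul_mem (f : LaurentAtInfty 𝕂) :
    ∃ k : ℕ, laurentT 𝕂 ^ (-(k : ℤ)) * f ∈ powerSeriesAtInfty 𝕂 := by
  refine ⟨(HahnSeries.order (Γ := ℤ) (R := 𝕂) f).natAbs, mem_powerSeriesAtInfty.2 fun n hn => ?_⟩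
  rw [laurentCoeff_T_zpow_mul]
  refine HahnSeries.coeff_eq_zero_of_lt_order ?_
  omega

theorem zpow_mem_powerSeriesAtInfty {k : ℤ} (hk : k ≤ 0) : laurentT 𝕂 ^ k ∈ powerSeriesAtInfty 𝕂 := by
  rw [mem_powerSeriesAtInfty]
  intro n hn
  rw [← mul_one (laurentT 𝕂 ^ k), laurentCoeff_T_zpow_mul]
  change HahnSeries.coeff (1 : LaurentSeries 𝕂) (n + k) = 0
  rw [HahnSeries.coeff_one, if_neg (by omega)]

theorem laurentCoeff_algebraMap (p : 𝕂[X]) (n : ℤ) :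
    laurentCoeff (algebraMap 𝕂[X] (LaurentAtInfty 𝕂) p) n = if n ≤ 0 then p.coeff n.natAbs else 0 := by
  induction p using Polynomial.induction_on' with
  | add p q hp hq =>
    rw [map_add]
    change laurentCoeff (algebraMap 𝕂[X] (LaurentAtInfty 𝕂) p) n
      + laurentCoeff (algebraMap 𝕂[X] (LaurentAtInfty 𝕂) q) n = _
    rw [hp, hq, coeff_add]
    split_ifs <;> simp
  | monomial k a =>
    have h1 : algebraMap 𝕂[X] (LaurentAtInfty 𝕂) (monomial k a)
        = laurentT 𝕂 ^ (k : ℤ) * (show LaurentAtInfty 𝕂 from (HahnSeries.C a : LaurentSeries 𝕂)) := by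
      rw [← C_mul_X_pow_eq_monomial, map_mul, map_pow, mul_comm, zpow_natCast]
      congr 1
      exact eval₂_C (S := LaurentSeries 𝕂) HahnSeries.C (HahnSeries.single (-1 : ℤ) 1)
    rw [h1, laurentCoeff_T_zpow_mul, coeff_monomial]
    change HahnSeries.coeff (HahnSeries.C a : LaurentSeries 𝕂) (n + k) = _
    rw [HahnSeries.C_apply, HahnSeries.coeff_single]
    split_ifs <;> first | rfl | omega

/-- Strict inequality of degrees, as in `degreeLT`, accounts for the exponent 1 - k in place of -k.
-/
theorem zpow_mul_algebraMap_mem_iff (k : ℕ) (p : 𝕂[X]) :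
    laurentT 𝕂 ^ (1 - (k : ℤ)) * algebraMap 𝕂[X] (LaurentAtInfty 𝕂) p ∈ powerSeriesAtInfty 𝕂
      ↔ p.degree < k := by
  rw [mem_powerSeriesAtInfty, degree_lt_iff_coeff_zero]
  constructor
  · intro h m hm
    have := h (k - m - 1) (by omega)
    rw [laurentCoeff_T_zpow_mul, laurentCoeff_algebraMap, if_pos (by omega)] at this
    rw [← this]
    congr 1; omega
  · intro h n hn
    rw [laurentCoeff_T_zpow_mul, laurentCoeff_algebraMap]
    split_ifs
    · exact h _ (by omega)
    · rfl

end Laurent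

/-! ### Consequences of purity -/

section Purity

variable {Fq : Type*} [Field Fq] [Fintype Fq] {𝕂 : Type*} [Field 𝕂] [Algebra Fq 𝕂] [IsAlgClosed 𝕂]
  {M : Type*} [AddCommGroup M] [Module 𝕂[X] M] {σ : M →ₛₗ[polyTwistInv Fq 𝕂] M}
  {r : ℕ} (b : Module.Basis (Fin r) 𝕂[X] M)

theorem laurentSigma_tmul (f : LaurentAtInfty 𝕂) (m : M) :
    laurentSigma σ (f ⊗ₜ m) = laurentTwistInv Fq 𝕂 f ⊗ₜ σ m := rfl

theorem laurentSigma_smul (f : LaurentAtInfty 𝕂) (x : LaurentAtInfty 𝕂 ⊗[𝕂[X]] M) :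
    laurentSigma σ (f • x) = laurentTwistInv Fq 𝕂 f • laurentSigma σ x := by
  induction x using TensorProduct.induction_on with
  | zero => simp
  | tmul g m =>
    rw [smul_tmul', laurentSigma_tmul, laurentSigma_tmul, smul_tmul', smul_eq_mul, smul_eq_mul, map_mul]
  | add x y hx hy => rw [smul_add, map_add, hx, hy, map_add, smul_add]

theorem laurentTwistInv_T : laurentTwistInv Fq 𝕂 (laurentT 𝕂) = laurentT 𝕂 := by
  rw [laurentT, laurentTwistInv_algebraMap]
  congr 1
  exact Polynomial.map_X _

theorem laurentSigma_iterate_zpow_smul (n : ℕ) (k : ℤ) (x : LaurentAtInfty 𝕂 ⊗[𝕂[X]] M) :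
    (laurentSigma σ)^[n] (laurentT 𝕂 ^ k • x) = laurentT 𝕂 ^ k • (laurentSigma σ)^[n] x := by
  induction n with
  | zero => rfl
  | succ n ih =>
    rw [Function.iterate_succ_apply', ih, laurentSigma_smul, map_zpow₀, laurentTwistInv_T,
      Function.iterate_succ_apply']

theorem laurentSigma_iterate_one_tmul (n : ℕ) (m : M) :
    (laurentSigma σ)^[n] (1 ⊗ₜ m) = 1 ⊗ₜ σ^[n] m := by
  induction n with
  | zero => rfl
  | succ n ih =>
    rw [Function.iterate_succ_apply', ih, laurentSigma_tmul, map_one, Function.iterate_succ_apply']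

/-- The images of a basis span, since their span contains each (t - θ)^N e_j. By counting they are
linearly independent, and the twist of coefficients is injective. -/
theorem laurentSigma_injective {θ : 𝕂} (hM : IsDualTMotive θ σ) :
    Function.Injective (laurentSigma σ) := by
  have := hM.free
  have := hM.finite
  let b := Module.finBasis 𝕂[X] M
  let B := Algebra.TensorProduct.basis (LaurentAtInfty 𝕂) b
  have hB : ∀ i, B i = 1 ⊗ₜ b i := fun i => Algebra.TensorProduct.basis_apply ..
  have hexp : ∀ x, laurentSigma σ x = ∑ i, laurentTwistInv Fq 𝕂 (B.repr x i) • laurentSigma σ (B i) := by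
    intro x
    conv_lhs => rw [← B.sum_repr x]
    rw [map_sum]
    exact Finset.sum_congr rfl fun i _ => laurentSigma_smul _ _
  obtain ⟨N, hN⟩ := hM.torsion
  have hspan : ⊤ ≤ Submodule.span (LaurentAtInfty 𝕂) (Set.range fun i => laurentSigma σ (B i)) := by
    have hmem : ∀ x, laurentSigma σ x ∈
        Submodule.span (LaurentAtInfty 𝕂) (Set.range fun i => laurentSigma σ (B i)) := by
      intro x
      rw [hexp]
      exact Submodule.sum_mem _ fun i _ => Submodule.smul_mem _ _ (Submodule.subset_span ⟨i, rfl⟩)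
    rw [← B.span_eq, Submodule.span_le]
    rintro _ ⟨j, rfl⟩
    obtain ⟨m', hm'⟩ := hN (b j)
    have h1 := hmem (1 ⊗ₜ m')
    rw [laurentSigma_tmul, hm', map_one, tmul_smul, ← hB, ← algebraMap_smul (LaurentAtInfty 𝕂)] at h1
    refine (Submodule.smul_mem_iff _ ?_).1 h1
    intro h0
    have h2 : Function.Injective (algebraMap 𝕂[X] (LaurentAtInfty 𝕂)) := by
      rw [injective_iff_map_eq_zero]
      intro p hp
      ext n
      have := laurentCoeff_algebraMap p (-n)
      rw [hp, if_pos (by omega), Int.natAbs_neg, Int.natAbs_natCast] at this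
      rw [← this]
      rfl
    exact pow_ne_zero N (X_sub_C_ne_zero θ) (h2 (h0.trans (map_zero _).symm))
  have hli := linearIndependent_of_top_le_span_of_card_eq_finrank hspan
    (Module.finrank_eq_card_basis B).symm
  rw [injective_iff_map_eq_zero]
  intro x hx
  rw [hexp] at hx
  have h3 := Fintype.linearIndependent_iff.1 hli _ hx
  apply B.ext_elem
  intro i
  have h4 := h3 i
  rw [map_eq_zero] at h4
  rw [h4, map_zero, Finsupp.zero_apply]

variable {b} [Module 𝕂 M] [IsScalarTower 𝕂 𝕂[X] M]

theorem mem_filtration_iff_laurent {k : ℕ} {m : M} : m ∈ filtration b k ↔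
    ∀ i, laurentT 𝕂 ^ (1 - (k : ℤ)) * (Algebra.TensorProduct.basis (LaurentAtInfty 𝕂) b).repr (1 ⊗ₜ m) i
      ∈ powerSeriesAtInfty 𝕂 := by
  rw [mem_filtration]
  refine forall_congr' fun i => ?_
  rw [Algebra.TensorProduct.basis_repr_tmul, Finsupp.smul_apply, Finsupp.mapRange_apply, one_smul,
    zpow_mul_algebraMap_mem_iff]

-- The lattice Λ lies between two multiples, by powers of t, of the standard lattice of the basis,
-- with exponents controlled by a₁ and a₂. As σ^{wn} Λ = t^{un} Λ, the map σ^{wn} shifts the degree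
-- filtration by un up to the error c = a₁ + a₂, which does not depend on n.
variable (b) in
theorem IsPure.exists_bounds {θ : 𝕂} (hM : IsDualTMotive θ σ) (h : IsPure σ) :
    ∃ u w c : ℕ, 0 < u ∧ 0 < w ∧
      (∀ n k m, m ∈ filtration b k → σ^[w * n] m ∈ filtration b (k + u * n + c)) ∧
      ∀ n k m, σ^[w * n] m ∈ filtration b (k + u * n) → m ∈ filtration b (k + c) := by
  obtain ⟨Λ, hfg, hspan, u, w, hu, hw, heq⟩ := h
  let B := Algebra.TensorProduct.basis (LaurentAtInfty 𝕂) b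
  let T := laurentT 𝕂
  have hT0 : T ≠ 0 := laurentT_ne_zero
  have hsmul : ∀ f ∈ powerSeriesAtInfty 𝕂, ∀ x ∈ Λ, f • x ∈ Λ := fun f hf x hx => Λ.smul_mem ⟨f, hf⟩ hx
  -- `Λ` is contained in a multiple of the standard lattice
  obtain ⟨a₁, ha₁⟩ : ∃ a₁ : ℕ, ∀ x ∈ Λ, ∀ i, T ^ (-(a₁ : ℤ)) * B.repr x i ∈ powerSeriesAtInfty 𝕂 := by
    obtain ⟨S, hS⟩ := hfg
    choose k hk using exists_zpow_mul_mem (𝕂 := 𝕂)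
    let a := S.sup fun x => Finset.univ.sup fun i => k (B.repr x i)
    refine ⟨a, fun x hx i => ?_⟩
    rw [← hS] at hx
    induction hx using Submodule.span_induction with
    | mem x hx =>
      have h1 : k (B.repr x i) ≤ a := (Finset.le_sup (f := fun i => k (B.repr x i)) (Finset.mem_univ i)).trans
        (Finset.le_sup (f := fun x => Finset.univ.sup fun i => k (B.repr x i)) hx)
      have h2 : T ^ (-(a : ℤ)) = T ^ ((k (B.repr x i) : ℤ) - a) * T ^ (-(k (B.repr x i) : ℤ)) := by
        rw [← zpow_add₀ hT0]; congr 1; ring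
      rw [h2, mul_assoc]
      exact Subring.mul_mem _ (zpow_mem_powerSeriesAtInfty (by omega)) (hk _)
    | zero => rw [map_zero, Finsupp.zero_apply, mul_zero]; exact Subring.zero_mem _
    | add x y _ _ hx hy => rw [map_add, Finsupp.add_apply, mul_add]; exact Subring.add_mem _ hx hy
    | smul f x _ hx =>
      have h1 : B.repr (f • x) i = (f : LaurentAtInfty 𝕂) * B.repr x i := by
        change B.repr ((f : LaurentAtInfty 𝕂) • x) i = _
        rw [map_smul, Finsupp.smul_apply, smul_eq_mul]
      rw [h1, mul_left_comm]
      exact Subring.mul_mem _ f.2 hx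
  -- `Λ` contains a multiple of the standard lattice
  have hmono : ∀ {a a' : ℕ} {x}, a ≤ a' → T ^ (-(a : ℤ)) • x ∈ Λ → T ^ (-(a' : ℤ)) • x ∈ Λ := by
    intro a a' x haa' hx
    have h2 : T ^ (-(a' : ℤ)) = T ^ ((a : ℤ) - a') * T ^ (-(a : ℤ)) := by
      rw [← zpow_add₀ hT0]; congr 1; ring
    rw [h2, mul_smul]
    exact hsmul _ (zpow_mem_powerSeriesAtInfty (by omega)) _ hx
  have hex : ∀ x, ∃ a : ℕ, T ^ (-(a : ℤ)) • x ∈ Λ := by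
    intro x
    have hx : x ∈ Submodule.span (LaurentAtInfty 𝕂) (Λ : Set (LaurentAtInfty 𝕂 ⊗[𝕂[X]] M)) :=
      hspan ▸ Submodule.mem_top
    induction hx using Submodule.span_induction with
    | mem x hx => exact ⟨0, by simpa using hx⟩
    | zero => exact ⟨0, by rw [smul_zero]; exact Λ.zero_mem⟩
    | add x y _ _ hx hy =>
      obtain ⟨a, ha⟩ := hx
      obtain ⟨a', ha'⟩ := hy
      refine ⟨max a a', ?_⟩
      rw [smul_add]
      exact Λ.add_mem (hmono (le_max_left _ _) ha) (hmono (le_max_right _ _) ha')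
    | smul f x _ hx =>
      obtain ⟨a, ha⟩ := hx
      obtain ⟨k, hk⟩ := exists_zpow_mul_mem f
      refine ⟨k + a, ?_⟩
      have h2 : T ^ (-((k + a : ℕ) : ℤ)) • f • x = (T ^ (-(k : ℤ)) * f) • T ^ (-(a : ℤ)) • x := by
        rw [smul_smul, smul_smul, mul_right_comm, ← zpow_add₀ hT0]
        congr 3; push_cast; ring
      rw [h2]
      exact hsmul _ hk _ ha
  obtain ⟨a₂, ha₂⟩ : ∃ a₂ : ℕ, ∀ i, T ^ (-(a₂ : ℤ)) • B i ∈ Λ := by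
    choose a ha using fun i => hex (B i)
    exact ⟨Finset.univ.sup a, fun i => hmono (Finset.le_sup (Finset.mem_univ i)) (ha i)⟩
  have hstd : ∀ (k : ℤ) x, (∀ i, T ^ (-k) * B.repr x i ∈ powerSeriesAtInfty 𝕂) → T ^ (-(k + a₂)) • x ∈ Λ := by
    intro k x hx
    have h1 : T ^ (-(k + a₂)) • x = ∑ i, (T ^ (-k) * B.repr x i) • T ^ (-(a₂ : ℤ)) • B i := by
      conv_lhs => rw [← B.sum_repr x]
      rw [Finset.smul_sum]
      refine Finset.sum_congr rfl fun i _ => ?_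
      rw [smul_smul, smul_smul, mul_right_comm, ← zpow_add₀ hT0]
      congr 3; ring
    rw [h1]
    exact Λ.sum_mem fun i _ => hsmul _ (hx i) _ (ha₂ i)
  have hiter : ∀ n : ℕ, (∀ x ∈ Λ, ∃ y ∈ Λ, (laurentSigma σ)^[w * n] x = T ^ ((u * n : ℕ) : ℤ) • y) ∧
      ∀ y ∈ Λ, ∃ x ∈ Λ, (laurentSigma σ)^[w * n] x = T ^ ((u * n : ℕ) : ℤ) • y := by
    have hXu : ∀ y : LaurentAtInfty 𝕂 ⊗[𝕂[X]] M, (X ^ u : 𝕂[X]) • y = T ^ (u : ℤ) • y := by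
      intro y
      rw [← algebraMap_smul (LaurentAtInfty 𝕂), map_pow, zpow_natCast]; rfl
    have hstep : ∀ n : ℕ, ∀ x y, (laurentSigma σ)^[w * n] x = T ^ ((u * n : ℕ) : ℤ) • y → ∀ y',
        (laurentSigma σ)^[w] y = T ^ (u : ℤ) • y' →
        (laurentSigma σ)^[w * (n + 1)] x = T ^ ((u * (n + 1) : ℕ) : ℤ) • y' := by
      intro n x y h1 y' h2
      rw [mul_add, mul_one, add_comm, Function.iterate_add_apply, h1, laurentSigma_iterate_zpow_smul, h2,
        smul_smul, ← zpow_add₀ hT0, mul_add, mul_one, Nat.cast_add]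
    intro n
    induction n with
    | zero => exact ⟨fun x hx => ⟨x, hx, by simp⟩, fun x hx => ⟨x, hx, by simp⟩⟩
    | succ n ih =>
      constructor
      · intro x hx
        obtain ⟨y, hy, h1⟩ := ih.1 x hx
        obtain ⟨y', hy', h2⟩ : (laurentSigma σ)^[w] y ∈
            (fun x : LaurentAtInfty 𝕂 ⊗[𝕂[X]] M => (X ^ u : 𝕂[X]) • x) '' (Λ : Set _) := by
          rw [heq]
          exact Set.mem_image_of_mem _ hy
        exact ⟨y', hy', hstep n x y h1 y' (by rw [← hXu]; exact h2.symm)⟩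
      · intro y' hy'
        obtain ⟨y, hy, h2⟩ : (X ^ u : 𝕂[X]) • y' ∈ (laurentSigma σ)^[w] '' (Λ : Set _) :=
          heq ▸ ⟨y', hy', rfl⟩
        obtain ⟨x, hx, h1⟩ := ih.2 y hy
        exact ⟨x, hx, hstep n x y h1 y' (by rw [← hXu]; exact h2)⟩
  -- Elements of t^k Λ have coordinates of degree at most k + a₁, and membership in the filtration
  -- of index l asks for degree at most l - 1.
  have hmemf : ∀ (k : ℤ) (l : ℕ) (m : M), k + a₁ ≤ l - 1 → (∃ y ∈ Λ, 1 ⊗ₜ m = T ^ k • y) →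
      m ∈ filtration b l := by
    rintro k l m hkl ⟨y, hy, hym⟩
    rw [mem_filtration_iff_laurent]
    intro i
    rw [hym]
    change laurentT 𝕂 ^ (1 - (l : ℤ)) * B.repr (T ^ k • y) i ∈ _
    rw [map_smul, Finsupp.smul_apply, smul_eq_mul, ← mul_assoc]
    have h2 : laurentT 𝕂 ^ (1 - (l : ℤ)) * T ^ k = T ^ (1 - (l : ℤ) + k + a₁) * T ^ (-(a₁ : ℤ)) := by
      rw [← zpow_add₀ hT0, ← zpow_add₀ hT0]; congr 1; ring
    rw [h2, mul_assoc]
    exact Subring.mul_mem _ (zpow_mem_powerSeriesAtInfty (by omega)) (ha₁ y hy i)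
  have hfmem : ∀ (k : ℕ) (m : M), m ∈ filtration b k → ∃ y ∈ Λ, 1 ⊗ₜ m = T ^ ((k : ℤ) - 1 + a₂) • y := by
    intro k m hm
    rw [mem_filtration_iff_laurent] at hm
    refine ⟨_, hstd ((k : ℤ) - 1) (1 ⊗ₜ m) fun i => ?_, ?_⟩
    · rw [neg_sub]; exact hm i
    · rw [smul_smul, ← zpow_add₀ hT0, add_neg_cancel, zpow_zero, one_smul]
  refine ⟨u, w, a₁ + a₂, hu, hw, fun n k m hm => ?_, fun n k m hm => ?_⟩
  · obtain ⟨y, hy, hym⟩ := hfmem k m hm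
    obtain ⟨y', hy', h1⟩ := (hiter n).1 y hy
    refine hmemf ((k : ℤ) - 1 + a₂ + (u * n : ℕ)) _ _ (by push_cast; omega) ⟨y', hy', ?_⟩
    rw [← laurentSigma_iterate_one_tmul, hym, laurentSigma_iterate_zpow_smul, h1, smul_smul,
      ← zpow_add₀ hT0]
  · obtain ⟨y, hy, hym⟩ := hfmem _ _ hm
    obtain ⟨x, hx, h1⟩ := (hiter n).2 y hy
    refine hmemf ((k : ℤ) - 1 + a₂) _ _ (by push_cast; omega) ⟨x, hx, ?_⟩
    apply (laurentSigma_injective hM).iterate (w * n)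
    rw [laurentSigma_iterate_one_tmul, hym, laurentSigma_iterate_zpow_smul, h1, smul_smul,
      ← zpow_add₀ hT0]
    congr 2; push_cast; ring

end Purity

/-! ### The multiplier at infinity -/

section AtInfinity

variable {Fq : Type*} [Field Fq] [Fintype Fq] {𝕂 : Type*} [Field 𝕂] [Algebra Fq 𝕂] [IsAlgClosed 𝕂]
  {L : Type*} [Field L] [Algebra Fq L] [Algebra Fq[X] L] [Algebra (RatFunc Fq) L]
  [IsScalarTower Fq Fq[X] L] [IsScalarTower Fq (RatFunc Fq) L] [IsScalarTower Fq[X] (RatFunc Fq) L]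
  [FiniteDimensional (RatFunc Fq) L] [Algebra.IsSeparable (RatFunc Fq) L]
  {M : Type*} [AddCommGroup M] [Module 𝕂[X] M] {σ : M →ₛₗ[polyTwistInv Fq 𝕂] M} {φ : OKEmbedding L σ}

/-- A subspace V of the source is tested through f(V) + V₀. Once V contains the preimage of V₀, this
sum meets the range of f in f(V). -/
theorem HasCodim.comap {F E E' : Type*} [Field F] [AddCommGroup E] [Module F E] [AddCommGroup E']
    [Module F E'] {f : E →ₗ[F] E'} (hf : Function.Injective f) {B : Submodule F E'} {d : ℕ}
    (h : HasCodim (LinearMap.range f) B d) : HasCodim ⊤ (B.comap f) d := by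
  obtain ⟨hle, V₀, hV₀, h⟩ := h
  refine ⟨le_top, V₀.comap f, ?_, fun V hV hV0 => ?_⟩
  · have hfin : FiniteDimensional F (V₀.comap f |>.map f) :=
      Submodule.finiteDimensional_of_le (Submodule.map_comap_le _ _)
    exact Module.Finite.equiv (Submodule.equivMapOfInjective f hf (V₀.comap f)).symm
  · have hinf : ∀ C : Submodule F E', C ≤ LinearMap.range f → Module.finrank F (V ⊓ C.comap f : Submodule F E)
        = Module.finrank F ((V.map f ⊔ V₀) ⊓ C : Submodule F E') := by
      intro C hC
      have hmap : (V ⊓ C.comap f).map f = (V.map f ⊔ V₀) ⊓ C := by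
        refine le_antisymm ?_ ?_
        · rintro _ ⟨v, ⟨hv, hvC⟩, rfl⟩
          exact ⟨Submodule.mem_sup_left (Submodule.mem_map_of_mem hv), hvC⟩
        · rintro x ⟨hx, hxC⟩
          obtain ⟨_, ⟨v, hv, rfl⟩, y, hy, rfl⟩ := Submodule.mem_sup.1 hx
          obtain ⟨z, hz⟩ := hC hxC
          have hy' : y = f (z - v) := by rw [map_sub, hz]; abel
          have hzv : z - v ∈ V := hV0 (by rw [Submodule.mem_comap, ← hy']; exact hy)
          refine ⟨z, ⟨?_, ?_⟩, hz⟩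
          · have := V.add_mem hzv hv
            rwa [sub_add_cancel] at this
          · rw [SetLike.mem_coe, Submodule.mem_comap, hz]; exact hxC
      rw [← hmap]
      exact LinearEquiv.finrank_eq (Submodule.equivMapOfInjective f hf (V ⊓ C.comap f))
    have h1 := h (V.map f ⊔ V₀) inferInstance le_sup_right
    rw [← hinf _ le_rfl, ← hinf B hle] at h1
    have htop : (LinearMap.range f).comap f = ⊤ := by
      ext x
      simp
    rwa [htop] at h1

/-- At infinity t has valuation greater than 1 and nonzero constants have valuation 1, so the
leading term dominates. -/
theorem val_bigOToFun_poly {P : ClosedPoint Fq 𝕂 L} (hP : P ∉ affinePart Fq 𝕂 L) {p : 𝕂[X]} (hp : p ≠ 0) :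
    P.val (bigOToFun (algebraMap 𝕂[X] (BigO Fq 𝕂 L) p))
      = WithZero.exp (WithZero.log (P.val (tFun Fq 𝕂 L)) * p.natDegree) := by
  have ht1 : 1 < P.val (tFun Fq 𝕂 L) := not_le.1 hP
  have hC : ∀ c : 𝕂, c ≠ 0 → P.val (bigOToFun (algebraMap 𝕂[X] (BigO Fq 𝕂 L) (C c))) = 1 := by
    intro c hc
    rw [algebraMap_bigO_C]
    exact P.onO_const hc
  induction hn : p.natDegree generalizing p with
  | zero =>
    rw [natDegree_eq_zero] at hn
    obtain ⟨c, rfl⟩ := hn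
    rw [hC c (fun h => hp (by rw [h, C_0])), Nat.cast_zero, mul_zero, WithZero.exp_zero]
  | succ n ih =>
    have hq : p.divX.natDegree = n := by rw [natDegree_divX_eq_natDegree_tsub_one, hn, Nat.add_sub_cancel]
    have hq0 : p.divX ≠ 0 := by
      rw [Ne, divX_eq_zero_iff]
      intro h
      rw [h, natDegree_C] at hn
      omega
    have h1 : P.val (bigOToFun (algebraMap 𝕂[X] (BigO Fq 𝕂 L) (p.divX * X)))
        = WithZero.exp (WithZero.log (P.val (tFun Fq 𝕂 L)) * (n + 1 : ℕ)) := by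
      rw [map_mul, map_mul bigOToFun, map_mul, ih hq0 hq, bigOToFun_X, Nat.cast_add, Nat.cast_one,
        mul_add, mul_one, WithZero.exp_add, WithZero.exp_log (zero_lt_one.trans ht1).ne']
    have hlog : 0 < WithZero.log (P.val (tFun Fq 𝕂 L)) := by
      rw [← WithZero.exp_lt_exp, WithZero.exp_log (zero_lt_one.trans ht1).ne', WithZero.exp_zero]
      exact ht1
    have h2 : P.val (bigOToFun (algebraMap 𝕂[X] (BigO Fq 𝕂 L) (C (p.coeff 0))))
        < P.val (bigOToFun (algebraMap 𝕂[X] (BigO Fq 𝕂 L) (p.divX * X))) := by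
      have h3 : P.val (bigOToFun (algebraMap 𝕂[X] (BigO Fq 𝕂 L) (C (p.coeff 0)))) ≤ 1 := by
        by_cases h0 : p.coeff 0 = 0
        · rw [h0, C_0, map_zero, map_zero, map_zero]; exact zero_le
        · exact (hC _ h0).le
      refine h3.trans_lt ?_
      rw [h1, ← WithZero.exp_zero, WithZero.exp_lt_exp]
      positivity
    conv_lhs => rw [← divX_mul_X_add p, map_add, map_add bigOToFun]
    rw [Valuation.map_add_eq_of_lt_left _ h2, h1]

theorem Realization.sigma_injective (R : Realization φ) : Function.Injective σ := by
  rw [injective_iff_map_eq_zero]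
  intro m hm
  have h1 := R.map_sigma m
  rw [hm, map_zero] at h1
  have h2 : funTwist Fq 𝕂 L (-1) (R.toHom m) = 0 := R.isUnit_mult.mul_left_cancel (by rw [← h1, mul_zero])
  have h3 : R.toHom m = 0 := (funTwist Fq 𝕂 L (-1)).injective (h2.trans (funTwist Fq 𝕂 L (-1)).map_zero.symm)
  exact R.injective (h3.trans (map_zero _).symm)

theorem Realization.val_iterate_sigma (R : Realization φ) (P : ClosedPoint Fq 𝕂 L) (n : ℕ) (m : M) :
    P.val (R.toHom (σ^[n] m)) = WithZero.exp (∑ i ∈ Finset.range n, WithZero.log ((P.twist i).val R.mult))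
      * (P.twist n).val (R.toHom m) := by
  induction n generalizing m with
  | zero => simp [P.twist_zero]
  | succ n ih =>
    rw [Function.iterate_succ_apply, ih, R.map_sigma, map_mul, ← ClosedPoint.twist_val 1,
      ClosedPoint.twist_twist, Finset.sum_range_succ, WithZero.exp_add,
      WithZero.exp_log (val_ne_zero_of_isUnit _ R.isUnit_mult), mul_assoc, Nat.cast_add, Nat.cast_one]

theorem exists_iterate_sigma_eq_smul {θ : 𝕂} (hM : IsDualTMotive θ σ) (n : ℕ) (m : M) :
    ∃ Δ : 𝕂[X], Δ ≠ 0 ∧ ∃ m', σ^[n] m' = Δ • m := by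
  obtain ⟨N, hN⟩ := hM.torsion
  induction n generalizing m with
  | zero => exact ⟨1, one_ne_zero, m, by simp⟩
  | succ n ih =>
    obtain ⟨m₁, hm₁⟩ := hN m
    obtain ⟨Δ, hΔ, m₂, hm₂⟩ := ih m₁
    refine ⟨polyTwistInv Fq 𝕂 Δ * (X - C θ) ^ N, mul_ne_zero ?_ (pow_ne_zero _ (X_sub_C_ne_zero θ)), m₂, ?_⟩
    · exact fun h => hΔ (Polynomial.map_injective _ (RingHom.injective _) (h.trans (Polynomial.map_zero _).symm))
    · rw [Function.iterate_succ_apply', hm₂, LinearMap.map_smulₛₗ, hm₁, mul_smul]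

theorem smul_mem_filtration [Module 𝕂 M] [IsScalarTower 𝕂 𝕂[X] M] {r : ℕ}
    {b : Module.Basis (Fin r) 𝕂[X] M} {k : ℕ} {m : M} (hm : m ∈ filtration b k) (p : 𝕂[X]) :
    p • m ∈ filtration b (k + p.natDegree) := by
  rw [mem_filtration] at hm ⊢
  intro i
  rw [map_smul, Finsupp.smul_apply, smul_eq_mul]
  by_cases h0 : b.repr m i = 0
  · rw [h0, mul_zero, degree_zero]
    exact WithBot.bot_lt_coe _
  · refine (degree_mul_le _ _).trans_lt ?_
    have h1 := hm i
    rw [degree_eq_natDegree h0] at h1 ⊢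
    have h1' : (b.repr m i).natDegree < k := by exact_mod_cast h1
    refine (add_le_add_left degree_le_natDegree _).trans_lt ?_
    rw [← WithBot.coe_natCast, ← WithBot.coe_natCast, ← WithBot.coe_natCast, ← WithBot.coe_add, WithBot.coe_lt_coe]
    push_cast
    omega

theorem Realization.exists_val_le (R : Realization φ) [Module 𝕂 M] [IsScalarTower 𝕂 𝕂[X] M] {r : ℕ}
    (b : Module.Basis (Fin r) 𝕂[X] M) {P : ClosedPoint Fq 𝕂 L} (hP : P ∉ affinePart Fq 𝕂 L) :
    ∃ c : ℤ, ∀ k, ∀ m ∈ filtration b k,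
      P.val (R.toHom m) ≤ WithZero.exp (c + WithZero.log (P.val (tFun Fq 𝕂 L)) * k) := by
  have ht1 : 1 < P.val (tFun Fq 𝕂 L) := not_le.1 hP
  have hlog : 0 < WithZero.log (P.val (tFun Fq 𝕂 L)) := by
    rw [← WithZero.exp_lt_exp, WithZero.exp_log (zero_lt_one.trans ht1).ne', WithZero.exp_zero]
    exact ht1
  have hc : ∀ i, ∃ c : ℕ, P.val (R.toHom (b i)) ≤ WithZero.exp (c : ℤ) := by
    intro i
    by_cases h0 : P.val (R.toHom (b i)) = 0
    · exact ⟨0, by rw [h0]; exact zero_le⟩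
    · refine ⟨(WithZero.log (P.val (R.toHom (b i)))).natAbs, ?_⟩
      rw [← WithZero.exp_log h0, WithZero.exp_le_exp, WithZero.log_exp]
      exact Int.le_natAbs
  choose c hc using hc
  refine ⟨(Finset.univ.sup c : ℕ), fun k m hm => ?_⟩
  conv_lhs => rw [← b.sum_repr m, map_sum]
  refine P.val.map_sum_le fun i _ => ?_
  rw [R.map_smul, map_mul, add_comm, WithZero.exp_add]
  refine mul_le_mul' ?_ ((hc i).trans ?_)
  · by_cases h0 : b.repr m i = 0
    · rw [h0, map_zero, map_zero, map_zero]; exact zero_le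
    · rw [val_bigOToFun_poly hP h0, WithZero.exp_le_exp]
      have h1 := mem_filtration.1 hm i
      rw [degree_eq_natDegree h0] at h1
      have h1' : (b.repr m i).natDegree < k := by exact_mod_cast h1
      exact mul_le_mul_of_nonneg_left (by exact_mod_cast h1'.le) hlog.le
  · rw [WithZero.exp_le_exp]
    exact_mod_cast Finset.le_sup (Finset.mem_univ i)

theorem sum_range_mul_of_periodic {a : ℕ → ℤ} {f : ℕ} (h : ∀ i, a (i + f) = a i) (n : ℕ) :
    ∑ i ∈ Finset.range (n * f), a i = n * ∑ i ∈ Finset.range f, a i := by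
  have h' : ∀ n i, a (n * f + i) = a i := by
    intro n i
    induction n with
    | zero => simp
    | succ n ih => rw [Nat.succ_mul, add_right_comm, h, ih]
  induction n with
  | zero => simp
  | succ n ih =>
    rw [Nat.succ_mul, Finset.sum_range_add, ih, Finset.sum_congr rfl fun i _ => h' n i]
    push_cast; ring

theorem ClosedPoint.twist_mul {P : ClosedPoint Fq 𝕂 L} {f : ℕ} (h : P.twist f = P) (n : ℕ) :
    P.twist ((n * f : ℕ) : ℤ) = P := by
  induction n with
  | zero => simp [P.twist_zero]
  | succ n ih => rw [Nat.succ_mul, Nat.cast_add, ← P.twist_twist, ih, h]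

theorem le_of_forall_mul_le {x y c d : ℤ} (h : ∀ n : ℕ, n * x + c ≤ d + n * y) : x ≤ y := by
  by_contra! hlt
  have := h (d - c + 1).toNat
  have h1 : d - c + 1 ≤ ((d - c + 1).toNat : ℤ) := Int.self_le_toNat _
  have h2 : (0 : ℤ) ≤ ((d - c + 1).toNat : ℤ) := by positivity
  nlinarith

/-- The map σ^{wfn} multiplies the valuation at P by exp(n w S), where S is the orbit sum, while
purity says that it raises degrees by ufn up to a bounded error. Comparing growth as n varies gives
both inequalities. -/
theorem Realization.orbit_sum_of_bounds (R : Realization φ) {θ : 𝕂} (hM : IsDualTMotive θ σ)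
    [Module 𝕂 M] [IsScalarTower 𝕂 𝕂[X] M] {r : ℕ} {b : Module.Basis (Fin r) 𝕂[X] M} {u w c : ℕ}
    (h₁ : ∀ n k m, m ∈ filtration b k → σ^[w * n] m ∈ filtration b (k + u * n + c))
    (h₂ : ∀ n k m, σ^[w * n] m ∈ filtration b (k + u * n) → m ∈ filtration b (k + c))
    {P : ClosedPoint Fq 𝕂 L} (hP : P ∉ affinePart Fq 𝕂 L) {f : ℕ} (hf : P.twist f = P) :
    w * ∑ i ∈ Finset.range f, WithZero.log ((P.twist i).val R.mult)
      = u * f * WithZero.log (P.val (tFun Fq 𝕂 L)) := by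
  obtain ⟨C, hC⟩ := R.exists_val_le b hP
  obtain ⟨v, hv⟩ := R.exists_unit
  obtain ⟨k, hk⟩ := exists_mem_filtration b v
  have hv0 := val_ne_zero_of_isUnit P hv
  set S := ∑ i ∈ Finset.range f, WithZero.log ((P.twist i).val R.mult) with hS
  set l := WithZero.log (P.val (tFun Fq 𝕂 L)) with hl
  set a := WithZero.log (P.val (R.toHom v)) with ha
  have hva : P.val (R.toHom v) = WithZero.exp a := (WithZero.exp_log hv0).symm
  have hval : ∀ n m, P.val (R.toHom (σ^[w * (f * n)] m))
      = WithZero.exp ((n : ℤ) * (w * S)) * P.val (R.toHom m) := by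
    intro n m
    have e : w * (f * n) = (w * n) * f := by ring
    rw [R.val_iterate_sigma, e, P.twist_mul hf, sum_range_mul_of_periodic]
    · congr 2; push_cast; ring
    · intro i
      have h1 : P.twist ((i + f : ℕ) : ℤ) = P.twist i := by
        rw [Nat.cast_add, add_comm, ← P.twist_twist, hf]
      rw [h1]
  refine le_antisymm ?_ ?_
  · refine le_of_forall_mul_le (c := a) (d := C + l * (k + c)) fun n => ?_
    have h := hC _ _ (h₁ (f * n) k v hk)
    rw [hval, hva, ← WithZero.exp_add, WithZero.exp_le_exp] at h
    refine h.trans (le_of_eq ?_)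
    push_cast; ring
  · refine le_of_forall_mul_le (c := a) (d := C + l * (k + c)) fun n => ?_
    -- The image of σ^{wfn} need not contain t^{ufn} v, only a multiple of it by some Δ. Although Δ
    -- varies with n, its degree enters both sides of the final estimate and cancels.
    obtain ⟨Δ, hΔ, m', hm'⟩ := exists_iterate_sigma_eq_smul hM (w * (f * n)) ((X ^ (u * (f * n)) : 𝕂[X]) • v)
    have hmem : Δ • (X ^ (u * (f * n)) : 𝕂[X]) • v ∈ filtration b (k + Δ.natDegree + u * (f * n)) := by
      have := smul_mem_filtration (smul_mem_filtration hk (X ^ (u * (f * n)) : 𝕂[X])) Δ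
      rw [natDegree_X_pow] at this
      rwa [add_right_comm]
    rw [← hm'] at hmem
    have h := hC _ _ (h₂ _ _ _ hmem)
    have h3 : P.val (R.toHom _) = P.val (R.toHom _) := congrArg (fun x => P.val (R.toHom x)) hm'
    rw [hval, R.map_smul, R.map_smul, map_mul, map_mul, val_bigOToFun_poly hP hΔ,
      val_bigOToFun_poly hP (pow_ne_zero _ X_ne_zero), hva, natDegree_X_pow, ← hl, ← WithZero.exp_add,
      ← WithZero.exp_add] at h3
    have h4 : WithZero.exp (l * Δ.natDegree + (l * (u * (f * n) : ℕ) + a)) ≤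
        WithZero.exp ((n : ℤ) * (w * S)) * WithZero.exp (C + l * (k + Δ.natDegree + c : ℕ)) := by
      rw [← h3]
      exact mul_le_mul_right h _
    rw [← WithZero.exp_add, WithZero.exp_le_exp] at h4
    push_cast at h4
    nlinarith

/-- The orbit sums of the orders of the multiplier at the points at infinity. -/
theorem Realization.orbit_sum_mult (R : Realization φ) {θ : 𝕂} (hM : IsDualTMotive θ σ)
    (hrank : Module.finrank 𝕂[X] M = Module.finrank (RatFunc Fq) L) (hpure : IsPure σ)
    {Ξ : ClosedPoint Fq 𝕂 L →₀ ℕ} (hΞ : ∀ ξ ∈ Ξ.support, ξ ∈ affinePart Fq 𝕂 L)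
    (hσ : (σ.toAddMonoidHom.range : Set M) = φ.idealMul (typeIdeal Ξ))
    {P : ClosedPoint Fq 𝕂 L} (hP : P ∉ affinePart Fq 𝕂 L) {f : ℕ} (hf : P.twist f = P) :
    Module.finrank (RatFunc Fq) L * ∑ i ∈ Finset.range f, WithZero.log ((P.twist i).val R.mult)
      = degree Ξ * f * WithZero.log (P.val (tFun Fq 𝕂 L)) := by
  have := hM.finite
  have := hM.free
  let _ : Module 𝕂 M := Module.compHom M (C : 𝕂 →+* 𝕂[X])
  have hsm : ∀ (c : 𝕂) (m : M), c • m = (C c : 𝕂[X]) • m := fun _ _ => rfl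
  have : IsScalarTower 𝕂 𝕂[X] M := IsScalarTower.of_algebraMap_smul fun c m => rfl
  let b := Module.finBasis 𝕂[X] M
  obtain ⟨u, w, c, hu, hw, h₁, h₂⟩ := hpure.exists_bounds b hM
  let τ : 𝕂 ≃+* 𝕂 := (frob Fq 𝕂).symm.toRingEquiv
  let s : M →ₛₗ[(τ : 𝕂 →+* 𝕂)] M :=
    { toFun := σ
      map_add' := σ.map_add
      map_smul' := fun c m => by
        rw [hsm, hsm, LinearMap.map_smulₛₗ]
        congr 1
        exact Polynomial.map_C _ }
  let Θ : M →ₗ[𝕂] FunRing Fq 𝕂 L :=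
    { toFun := R.toHom
      map_add' := R.toHom.map_add
      map_smul' := fun c m => by
        rw [hsm, R.map_smul, algebraMap_bigO_C, RingHom.id_apply, smul_funRing_eq]
        exact congrArg (· * R.toHom m) (bigOToFun_const c) }
  obtain ⟨v, hv⟩ := R.exists_unit
  obtain ⟨D, hD, -⟩ := exists_attains R.image_fg hv ⟨v, rfl⟩
  -- The codimension of σM = 𝔍_Ξ M in M is computed inside 𝐊 and transported to M.
  have hcod : HasCodim ⊤ ((⊤ : Submodule 𝕂 M).map s) (degree Ξ) := by
    have h1 := (hD.typeIdeal_smul hΞ).2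
    have h2 : overK R.image = LinearMap.range Θ := by
      ext x
      rfl
    rw [h2] at h1
    have h3 := h1.comap R.injective
    have h4 : (⊤ : Submodule 𝕂 M).map s = (overK (typeIdeal Ξ • R.image)).comap Θ := by
      ext m
      rw [Submodule.mem_comap, mem_overK]
      refine Iff.trans ?_ (R.mem_range_sigma_iff hσ m)
      exact ⟨fun ⟨x, _, hx⟩ => ⟨x, hx⟩, fun ⟨x, hx⟩ => ⟨x, trivial, hx⟩⟩
    rw [h4]
    exact h3
  -- The relation w deg Ξ = r u eliminates the slope u/w of the pure lattice from the orbit sum.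
  have hdeg := mul_codim_eq_rank_mul (s := s) R.sigma_injective hcod h₁ h₂
  have horb := R.orbit_sum_of_bounds hM h₁ h₂ hP hf
  rw [hrank] at hdeg
  have hdeg' : (w : ℤ) * degree Ξ = Module.finrank (RatFunc Fq) L * u := by exact_mod_cast hdeg
  have hw' : (w : ℤ) ≠ 0 := by exact_mod_cast hw.ne'
  apply mul_left_cancel₀ hw'
  rw [mul_left_comm, horb, ← mul_assoc, ← mul_assoc, ← hdeg', ← mul_assoc, ← mul_assoc]

end AtInfinity

/-! ### Places of `L` and points of `𝐗` above `t = 0` -/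

section Places

open IsDedekindDomain

variable {Fq : Type*} [Field Fq] [Fintype Fq]
  {L : Type*} [Field L] [Algebra Fq L] [Algebra Fq[X] L] [Algebra (RatFunc Fq) L]
  [IsScalarTower Fq Fq[X] L] [IsScalarTower Fq (RatFunc Fq) L] [IsScalarTower Fq[X] (RatFunc Fq) L]
  [FiniteDimensional (RatFunc Fq) L] [Algebra.IsSeparable (RatFunc Fq) L]
  {Γ : Type*} [LinearOrderedCommGroupWithZero Γ]

theorem valuation_eq_one_of_pow_eq_one {R : Type*} [Ring R] (v : Valuation R Γ) {x : R} {n : ℕ}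
    (hn : n ≠ 0) (h : x ^ n = 1) : v x = 1 := by
  have h1 := congrArg v h
  rw [map_pow, map_one] at h1
  exact (pow_eq_one_iff_of_nonneg zero_le hn).1 h1

theorem valuation_algebraMap_eq_one {R : Type*} [Ring R] [Algebra Fq R] (v : Valuation R Γ) {c : Fq}
    (hc : c ≠ 0) : v (algebraMap Fq R c) = 1 := by
  have h : (Fintype.card Fq - 1) ≠ 0 := by
    have := Fintype.one_lt_card (α := Fq); omega
  exact valuation_eq_one_of_pow_eq_one v h (by
    rw [← map_pow, FiniteField.pow_card_sub_one_eq_one c hc, map_one])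

theorem valuation_algebraMap_le_one {R : Type*} [Ring R] [Algebra Fq R] (v : Valuation R Γ) (c : Fq) :
    v (algebraMap Fq R c) ≤ 1 := by
  by_cases hc : c = 0
  · simp [hc]
  · exact (valuation_algebraMap_eq_one v hc).le

theorem valuation_polynomial_le_one (v : Valuation L Γ) (hX : v (algebraMap Fq[X] L X) ≤ 1) (p : Fq[X]) :
    v (algebraMap Fq[X] L p) ≤ 1 := by
  induction p using Polynomial.induction_on' with
  | add p q hp hq => rw [map_add]; exact Valuation.map_add_le _ hp hq
  | monomial n c =>
    rw [← C_mul_X_pow_eq_monomial, map_mul, map_pow, map_mul, map_pow]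
    have : algebraMap Fq[X] L (C c) = algebraMap Fq L c := by
      rw [IsScalarTower.algebraMap_apply Fq Fq[X] L]; rfl
    rw [this]
    exact mul_le_one' (valuation_algebraMap_le_one v c) (pow_le_one₀ zero_le hX)

theorem valuation_ok_le_one (v : Valuation L Γ) (hX : v (algebraMap Fq[X] L X) ≤ 1) (a : OK Fq L) :
    v (a : L) ≤ 1 := by
  let f : Fq[X] →+* v.integer := (algebraMap Fq[X] L).codRestrict v.integer
    (valuation_polynomial_le_one v hX)
  obtain ⟨g, hg, hga⟩ := a.2
  have : IsIntegral v.integer (a : L) := ⟨g.map f, hg.map f, by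
    rw [eval₂_map]; exact hga⟩
  exact (Valuation.integer.integers v).mem_of_integral this

/-- A valuation of `L` centered above `t = 0` belongs to a prime ideal of `O_L`. -/
theorem exists_isEquiv_valuation (v : Valuation L Γ) (hX : v (algebraMap Fq[X] L X) < 1) :
    ∃ p : HeightOneSpectrum (OK Fq L), v.IsEquiv (p.valuation L) := by
  have hle := valuation_ok_le_one v hX.le
  let I : Ideal (OK Fq L) :=
    { carrier := {a | v (a : L) < 1}
      add_mem' := fun {a b} ha hb => by
        simpa using Valuation.map_add_lt v ha hb
      zero_mem' := by simp
      smul_mem' := fun c x hx => by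
        change v ((c * x : OK Fq L) : L) < 1
        rw [MulMemClass.coe_mul, map_mul]
        exact lt_of_le_of_lt (mul_le_of_le_one_left' (hle c)) hx }
  have hI : ∀ a, a ∈ I ↔ v (a : L) < 1 := fun a => Iff.rfl
  have hprime : I.IsPrime := by
    refine ⟨?_, fun {a b} hab => ?_⟩
    · rw [Ne, Ideal.eq_top_iff_one, hI]; simp
    · by_contra! hcon
      rw [hI, hI, not_lt, not_lt] at hcon
      rw [hI, MulMemClass.coe_mul, map_mul, le_antisymm (hle a) hcon.1, le_antisymm (hle b) hcon.2] at hab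
      simp at hab
  have hne : I ≠ ⊥ := by
    intro h
    have h1 : algebraMap Fq[X] (OK Fq L) X ∈ I := hX
    rw [h, Ideal.mem_bot] at h1
    exact X_ne_zero (algebraMap_polynomial_injective (L := L) (by
      rw [IsScalarTower.algebraMap_apply Fq[X] (OK Fq L) L, h1, map_zero, map_zero]))
  let p : HeightOneSpectrum (OK Fq L) := ⟨I, hprime, hne⟩
  have hunit : ∀ d : p.asIdeal.primeCompl, v ((d : OK Fq L) : L) = 1 := fun d =>
    le_antisymm (hle _) (not_lt.1 d.2)
  have hunit' : ∀ d : p.asIdeal.primeCompl, p.valuation L ((d : OK Fq L) : L) = 1 := fun d =>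
    p.valuation_eq_one_iff_notMem.2 d.2
  refine ⟨p, Valuation.isEquiv_of_val_le_one fun x => ?_⟩
  obtain ⟨n, d, h | h⟩ := p.exists_primeCompl_mul_eq_or_mul_eq x
  · have h1 := congrArg v h
    have h2 := congrArg (p.valuation L) h
    rw [map_mul] at h1 h2
    have e1 := hunit d
    have e2 := hunit' d
    have e3 := hle n
    have e4 := p.valuation_le_one (K := L) n
    change v x * v ((d : OK Fq L) : L) = v (n : L) at h1
    change p.valuation L x * p.valuation L ((d : OK Fq L) : L) = _ at h2
    rw [e1, mul_one] at h1
    rw [e2, mul_one] at h2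
    rw [h1, h2]
    exact ⟨fun _ => e4, fun _ => e3⟩
  · have h1 := congrArg v h
    have h2 := congrArg (p.valuation L) h
    rw [map_mul] at h1 h2
    have e1 := hunit d
    have e2 := hunit' d
    change v x * v (n : L) = v ((d : OK Fq L) : L) at h1
    change p.valuation L x * p.valuation L (n : L) = p.valuation L ((d : OK Fq L) : L) at h2
    rw [e1] at h1
    rw [e2] at h2
    have key : v (n : L) < 1 ↔ p.valuation L (n : L) < 1 := (p.valuation_lt_one_iff_mem n).symm
    have n1 : v (n : L) ≠ 0 := by rintro h0; rw [h0] at h1; simp at h1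
    have n2 : p.valuation L (n : L) ≠ 0 := by rintro h0; rw [h0] at h2; simp at h2
    rw [eq_inv_of_mul_eq_one_left h1, eq_inv_of_mul_eq_one_left h2, inv_le_one₀ (zero_lt_iff.2 n1),
      inv_le_one₀ (zero_lt_iff.2 n2), ← not_lt, ← not_lt, key]

theorem mem_asIdeal_iff_of_isEquiv {v : Valuation L Γ} {p : HeightOneSpectrum (OK Fq L)}
    (h : v.IsEquiv (p.valuation L)) (a : OK Fq L) : a ∈ p.asIdeal ↔ v (a : L) < 1 := by
  rw [h.lt_one_iff_lt_one]
  exact (p.valuation_lt_one_iff_mem a).symm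

variable {𝕂 : Type*} [Field 𝕂] [Algebra Fq 𝕂] [IsAlgClosed 𝕂]

/-- The valuation of `L` induced by a point of `𝐗`. -/
def ClosedPoint.restrict (P : ClosedPoint Fq 𝕂 L) : Valuation L ℤᵐ⁰ := P.val.comap fnHom

theorem ClosedPoint.restrict_apply (P : ClosedPoint Fq 𝕂 L) (a : L) : P.restrict a = P.val (fn Fq a) := rfl

theorem ClosedPoint.onO_one_tmul (P : ClosedPoint Fq 𝕂 L) (a : OK Fq L) :
    P.onO (1 ⊗ₜ a) = P.restrict a := by
  rw [P.onO_apply, bigOToFun_fn]; rfl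

theorem ClosedPoint.restrict_twist (P : ClosedPoint Fq 𝕂 L) (n : ℤ) :
    (P.twist n).restrict = P.restrict := by
  ext a
  rw [restrict_apply, restrict_apply, twist_val, funTwist_fn]

theorem ClosedPoint.restrict_X (P : ClosedPoint Fq 𝕂 L) :
    P.restrict (algebraMap Fq[X] L X) = P.val (tFun Fq 𝕂 L) := by
  rw [P.restrict_apply, tFun, algebraMap_ratFunc_X]

/-- The residue field homomorphism of a point above `t = 0`, with its kernel. -/
theorem ClosedPoint.exists_center_of_lt_one {P : ClosedPoint Fq 𝕂 L} (hP : P.val (tFun Fq 𝕂 L) < 1) :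
    ∃ (p : HeightOneSpectrum (OK Fq L)) (χ : BigO Fq 𝕂 L →ₐ[𝕂] 𝕂), IsCentered P.onO χ ∧
      RingHom.ker (resHom χ) = p.asIdeal ∧ P.restrict = p.valuation L := by
  obtain ⟨χ, hχ⟩ := P.exists_center (show P ∈ affinePart Fq 𝕂 L from hP.le)
  obtain ⟨p, hp⟩ := exists_isEquiv_valuation P.restrict (by rw [P.restrict_X]; exact hP)
  have hker : RingHom.ker (resHom χ) = p.asIdeal := by
    ext a
    rw [mem_asIdeal_iff_of_isEquiv hp, ← P.onO_one_tmul, hχ.lt_one_iff]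
    rfl
  refine ⟨p, χ, hχ, hker, ?_⟩
  -- An element of 𝔭 outside 𝔭² is a uniformizer both for 𝔭 and at P, as extending the constants is
  -- unramified. This turns equivalence of the two valuations into equality.
  obtain ⟨ϖ, h1, h2⟩ := exists_mem_ker_not_mem_sq (χ := χ) (by rw [hker]; exact p.ne_bot)
  have hloc := val_localParam hχ (isLocalParam_of_ker (by rw [hker]; exact p.ne_bot) h1 h2)
  rw [P.onO_one_tmul] at hloc
  have hϖ : p.valuation L (ϖ : L) = WithZero.exp (-1) := by
    have e : p.valuation L (ϖ : L) = p.intValuation ϖ := p.valuation_of_algebraMap ϖ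
    rw [hker] at h1 h2
    have l1 : p.intValuation ϖ ≤ WithZero.exp (-((1 : ℕ) : ℤ)) :=
      (p.intValuation_le_pow_iff_mem ϖ 1).2 (by simpa using h1)
    have l2 : ¬ p.intValuation ϖ ≤ WithZero.exp (-((2 : ℕ) : ℤ)) := fun h =>
      h2 ((p.intValuation_le_pow_iff_mem ϖ 2).1 h)
    rw [e]
    have h0 : p.intValuation ϖ ≠ 0 := p.intValuation_ne_zero ϖ (by rintro rfl; exact h2 (zero_mem _))
    obtain ⟨k, hk⟩ : ∃ k : ℤ, p.intValuation ϖ = WithZero.exp k := ⟨_, (WithZero.exp_log h0).symm⟩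
    rw [hk, WithZero.exp_le_exp] at l1 l2
    rw [hk]
    congr 1
    push_cast at l1 l2
    omega
  ext x
  by_cases hx : x = 0
  · simp [hx]
  have hx0 : p.valuation L x ≠ 0 := (Valuation.ne_zero_iff _).2 hx
  obtain ⟨k, hk⟩ : ∃ k : ℤ, p.valuation L x = WithZero.exp k := ⟨_, (WithZero.exp_log hx0).symm⟩
  have h3 : p.valuation L x = p.valuation L ((ϖ : L) ^ (-k)) := by
    rw [hk, map_zpow₀, hϖ, ← WithZero.exp_zsmul]; simp
  rw [h3, hp.eq_iff.2 h3, map_zpow₀, map_zpow₀, hloc, hϖ]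

end Places

/-! ### Frobenius orbits -/

section Orbits

open IsDedekindDomain

variable {Fq : Type*} [Field Fq] [Fintype Fq]
  {L : Type*} [Field L] [Algebra Fq L] [Algebra Fq[X] L] [Algebra (RatFunc Fq) L]
  [IsScalarTower Fq Fq[X] L] [IsScalarTower Fq (RatFunc Fq) L] [IsScalarTower Fq[X] (RatFunc Fq) L]
  [FiniteDimensional (RatFunc Fq) L] [Algebra.IsSeparable (RatFunc Fq) L]
  {𝕂 : Type*} [Field 𝕂] [Algebra Fq 𝕂] [IsAlgClosed 𝕂]

/-- Two embeddings of a finite field differ by a unique power of the Frobenius. -/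
theorem existsUnique_frob_pow {k : Type*} [Field k] [Algebra Fq k] [FiniteDimensional Fq k]
    (ι ι' : k →ₐ[Fq] 𝕂) :
    ∃! i : Fin (Module.finrank Fq k), ∀ x, ι' x = (frob Fq 𝕂 ^ (i : ℕ)) (ι x) := by
  have hfin : Finite k := Module.finite_of_finite Fq
  have hcomm : ∀ (i : ℕ) x, (frob Fq 𝕂 ^ i) (ι x) = ι ((FiniteField.frobeniusAlgHom Fq k ^ i) x) := by
    intro i x
    rw [frob_pow_apply, AlgHom.coe_pow, FiniteField.coe_frobeniusAlgHom, pow_iterate, map_pow]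
  let F : Fin (Module.finrank Fq k) → (k →ₐ[Fq] 𝕂) := fun i =>
    ι.comp (FiniteField.frobeniusAlgHom Fq k ^ (i : ℕ))
  have hF : Function.Injective F := by
    intro i j hij
    refine (FiniteField.bijective_frobeniusAlgHom_pow Fq k).1 (AlgHom.ext fun x => ?_)
    exact ι.toRingHom.injective (DFunLike.congr_fun hij x)
  have hbij : Function.Bijective F := by
    rw [Fintype.bijective_iff_injective_and_card]
    exact ⟨hF, by rw [Fintype.card_fin, AlgHom.card]⟩
  obtain ⟨i, hi⟩ := hbij.2 ι'
  refine ⟨i, fun x => ?_, fun j hj => hF ?_⟩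
  · rw [hcomm, ← hi]; rfl
  · rw [hi]
    refine AlgHom.ext fun x => ?_
    rw [hj, hcomm]; rfl

theorem frob_pow_finrank {k : Type*} [Field k] [Algebra Fq k] [FiniteDimensional Fq k]
    (ι : k →ₐ[Fq] 𝕂) (x : k) : (frob Fq 𝕂 ^ Module.finrank Fq k) (ι x) = ι x := by
  have hfin : Finite k := Module.finite_of_finite Fq
  let _ := Fintype.ofFinite k
  rw [frob_pow_apply, ← Module.card_eq_pow_finrank (K := Fq) (V := k), ← map_pow, FiniteField.pow_card]

/-- The residue homomorphism of a twisted point. -/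
theorem isCentered_twist {P P' : ClosedPoint Fq 𝕂 L} {χ χ' : BigO Fq 𝕂 L →ₐ[𝕂] 𝕂}
    (h : IsCentered P.onO χ) (h' : IsCentered P'.onO χ') (n : ℕ) :
    P.twist n = P' ↔ ∀ a, resHom χ' a = (frob Fq 𝕂 ^ n) (resHom χ a) := by
  have key : ∀ (a : OK Fq L), (P.twist n).val (fn Fq (a : L) - const Fq ((frob Fq 𝕂 ^ n) (resHom χ a))) < 1 := by
    intro a
    rw [ClosedPoint.twist_val, funTwist_sub, funTwist_fn, funTwist_const]
    have : (frob Fq 𝕂 ^ (-(n : ℤ))) ((frob Fq 𝕂 ^ n) (resHom χ a)) = resHom χ a := by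
      rw [← zpow_natCast, ← AlgEquiv.mul_apply, ← zpow_add]; simp
    rw [this, ← bigOToFun_fn, ← bigOToFun_const, ← map_sub, ← P.onO_apply, h.lt_one_iff, map_sub,
      AlgHom.commutes, resHom_apply]
    exact sub_self _
  constructor
  · rintro rfl a
    have h1 := key a
    rw [← bigOToFun_fn, ← bigOToFun_const, ← map_sub, ← ClosedPoint.onO_apply, h'.lt_one_iff, map_sub,
      AlgHom.commutes, ← resHom_apply, sub_eq_zero] at h1
    exact h1
  · intro hall
    have hP : P ∈ affinePart Fq 𝕂 L := P.mem_affinePart_of_isCentered h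
    obtain ⟨χ₁, h₁⟩ := (P.twist n).exists_center (twist_mem_affinePart.2 hP)
    have : χ₁ = χ' := by
      apply resHom_injective
      ext a
      have h1 := key a
      rw [← bigOToFun_fn, ← bigOToFun_const, ← map_sub, ← ClosedPoint.onO_apply, h₁.lt_one_iff, map_sub,
        AlgHom.commutes, ← resHom_apply, sub_eq_zero] at h1
      rw [hall, h1]; rfl
    exact eq_of_isCentered h₁ (this ▸ h')

/-- The points inducing a given place form one Frobenius orbit, of length the degree of the place. -/
theorem ClosedPoint.existsUnique_twist {P P' : ClosedPoint Fq 𝕂 L} {p : HeightOneSpectrum (OK Fq L)}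
    (hP : P.val (tFun Fq 𝕂 L) < 1) (hp : P.restrict.IsEquiv (p.valuation L))
    (hp' : P'.restrict.IsEquiv (p.valuation L)) :
    P.twist (Module.finrank Fq (OK Fq L ⧸ p.asIdeal)) = P ∧
    ∃! i : Fin (Module.finrank Fq (OK Fq L ⧸ p.asIdeal)), P.twist (i : ℕ) = P' := by
  have hP' : P'.val (tFun Fq 𝕂 L) < 1 := by
    rw [← P'.restrict_X, hp'.lt_one_iff_lt_one, ← hp.lt_one_iff_lt_one, P.restrict_X]; exact hP
  obtain ⟨p₁, χ, hχ, hk, hr⟩ := P.exists_center_of_lt_one hP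
  obtain ⟨p₂, χ', hχ', hk', hr'⟩ := P'.exists_center_of_lt_one hP'
  obtain rfl : p₁ = p := HeightOneSpectrum.eq_of_valuation_isEquiv_valuation (K := L) (hr ▸ hp)
  obtain rfl : p₂ = p₁ := HeightOneSpectrum.eq_of_valuation_isEquiv_valuation (K := L) (hr' ▸ hp')
  have hmax : p₂.asIdeal.IsMaximal := p₂.isMaximal
  let _ := Ideal.Quotient.field p₂.asIdeal
  -- Points inducing 𝔭 correspond to embeddings of the finite field O_L/𝔭 into 𝕂, and twisting
  -- composes these with Frobenius.
  let ι : (OK Fq L ⧸ p₂.asIdeal) →ₐ[Fq] 𝕂 := Ideal.Quotient.liftₐ p₂.asIdeal (resHom χ)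
    (fun a ha => by rw [← hk] at ha; exact ha)
  let ι' : (OK Fq L ⧸ p₂.asIdeal) →ₐ[Fq] 𝕂 := Ideal.Quotient.liftₐ p₂.asIdeal (resHom χ')
    (fun a ha => by rw [← hk'] at ha; exact ha)
  have hX0 : resHom χ (algebraMap Fq[X] _ X) = 0 := by
    have : algebraMap Fq[X] (OK Fq L) X ∈ p₂.asIdeal := by
      rw [mem_asIdeal_iff_of_isEquiv hp]
      have := P.restrict_X
      exact this ▸ hP
    rw [← hk] at this; exact this
  have hfd := finiteDimensional_range_of_map_X_eq_zero hX0
  have hrange : ∀ x, ι x ∈ (resHom χ).range := by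
    intro x
    obtain ⟨a, rfl⟩ := Ideal.Quotient.mk_surjective x
    exact ⟨a, rfl⟩
  have : FiniteDimensional Fq (OK Fq L ⧸ p₂.asIdeal) :=
    FiniteDimensional.of_injective ((ι.codRestrict _ hrange).toLinearMap) (fun x y hxy =>
      ι.toRingHom.injective (congrArg Subtype.val hxy))
  have hmk : ∀ n : ℕ, (∀ x, ι' x = (frob Fq 𝕂 ^ n) (ι x)) ↔
      ∀ a, resHom χ' a = (frob Fq 𝕂 ^ n) (resHom χ a) := fun n =>
    ⟨fun h a => h (Ideal.Quotient.mk _ a), fun h x => by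
      obtain ⟨a, rfl⟩ := Ideal.Quotient.mk_surjective x
      exact h a⟩
  refine ⟨(isCentered_twist hχ hχ _).2 fun a => (frob_pow_finrank ι (Ideal.Quotient.mk _ a)).symm, ?_⟩
  obtain ⟨i, hi, hu⟩ := existsUnique_frob_pow ι ι'
  exact ⟨i, (isCentered_twist hχ hχ' _).2 ((hmk i).1 hi), fun j hj =>
    hu j ((hmk j).2 ((isCentered_twist hχ hχ' _).1 hj))⟩

end Orbits

/-! ### Ramification above `t = 0` -/

section Ramification

open IsDedekindDomain

variable {Fq : Type*} [Field Fq] [Fintype Fq]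
  {L : Type*} [Field L] [Algebra Fq L] [Algebra Fq[X] L] [Algebra (RatFunc Fq) L]
  [IsScalarTower Fq Fq[X] L] [IsScalarTower Fq (RatFunc Fq) L] [IsScalarTower Fq[X] (RatFunc Fq) L]
  [FiniteDimensional (RatFunc Fq) L] [Algebra.IsSeparable (RatFunc Fq) L]

variable (Fq) in
theorem span_X_isMaximal : (Ideal.span {(X : Fq[X])}).IsMaximal :=
  PrincipalIdealRing.isMaximal_of_irreducible irreducible_X

variable (Fq) in
theorem span_X_ne_bot : Ideal.span {(X : Fq[X])} ≠ ⊥ := by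
  rw [Ne, Ideal.span_singleton_eq_bot]; exact X_ne_zero

theorem mem_iff_liesOver {p : Ideal (OK Fq L)} [hp : p.IsPrime] :
    algebraMap Fq[X] (OK Fq L) X ∈ p ↔ p.LiesOver (Ideal.span {(X : Fq[X])}) := by
  have hmax := span_X_isMaximal Fq
  constructor
  · intro h
    refine ⟨hmax.eq_of_le (Ideal.IsPrime.under Fq[X] p).ne_top ?_⟩
    rw [Ideal.span_singleton_le_iff_mem]
    exact h
  · intro h
    have : (X : Fq[X]) ∈ p.under Fq[X] := by
      rw [← h.over]; exact Ideal.mem_span_singleton_self _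
    exact this

variable (Fq L) in
/-- The primes of `O_L` above `t = 0`. -/
def zeroPrimes : Set (HeightOneSpectrum (OK Fq L)) :=
  {p | algebraMap Fq[X] (OK Fq L) X ∈ p.asIdeal}

theorem zeroPrimes.liesOver {p : HeightOneSpectrum (OK Fq L)} (hp : p ∈ zeroPrimes Fq L) :
    p.asIdeal.LiesOver (Ideal.span {(X : Fq[X])}) :=
  have := p.isPrime
  mem_iff_liesOver.1 hp

/-- The ramification index above `t = 0`. -/
def ramIdx (p : HeightOneSpectrum (OK Fq L)) : ℕ :=
  Ideal.ramificationIdx' (Ideal.span {(X : Fq[X])}) p.asIdeal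

theorem valuation_X_eq (p : HeightOneSpectrum (OK Fq L)) :
    p.valuation L (algebraMap Fq[X] L X) = WithZero.exp (-(ramIdx p : ℤ)) := by
  have h0 : algebraMap Fq[X] (OK Fq L) X ≠ 0 := by
    intro h
    exact X_ne_zero (algebraMap_polynomial_injective (L := L) (by
      rw [IsScalarTower.algebraMap_apply Fq[X] (OK Fq L) L, h, map_zero, map_zero]))
  have hmap : Ideal.map (algebraMap Fq[X] (OK Fq L)) (Ideal.span {X})
      = Ideal.span {algebraMap Fq[X] (OK Fq L) X} := by
    rw [Ideal.map_span, Set.image_singleton]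
  have e : p.valuation L (algebraMap Fq[X] L X) = p.intValuation (algebraMap Fq[X] (OK Fq L) X) := by
    rw [IsScalarTower.algebraMap_apply Fq[X] (OK Fq L) L]
    exact p.valuation_of_algebraMap _
  have h1 : p.intValuation (algebraMap Fq[X] (OK Fq L) X) ≠ 0 := p.intValuation_ne_zero _ h0
  have h2 := p.intValuation_le_one (algebraMap Fq[X] (OK Fq L) X)
  obtain ⟨k, hk⟩ : ∃ k : ℤ, p.intValuation (algebraMap Fq[X] (OK Fq L) X) = WithZero.exp k :=
    ⟨_, (WithZero.exp_log h1).symm⟩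
  rw [hk, ← WithZero.exp_zero, WithZero.exp_le_exp] at h2
  obtain ⟨n, rfl⟩ : ∃ n : ℕ, k = -n := ⟨k.natAbs, by omega⟩
  have h3 : ramIdx p = n := by
    refine Ideal.ramificationIdx'_spec ?_ ?_
    · rw [hmap, Ideal.span_singleton_le_iff_mem, ← p.intValuation_le_pow_iff_mem, hk]
    · rw [hmap, Ideal.span_singleton_le_iff_mem, ← p.intValuation_le_pow_iff_mem, hk,
        WithZero.exp_le_exp]
      push_cast
      omega
  rw [e, hk, h3]

theorem finrank_residue_eq {p : HeightOneSpectrum (OK Fq L)} (hp : p ∈ zeroPrimes Fq L) :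
    Ideal.inertiaDeg' (Ideal.span {(X : Fq[X])}) p.asIdeal = Module.finrank Fq (OK Fq L ⧸ p.asIdeal) := by
  have := zeroPrimes.liesOver hp
  rw [Ideal.inertiaDeg'_algebraMap]
  have hbij : Function.Bijective ((Ideal.Quotient.mk (Ideal.span {(X : Fq[X])})).comp (C : Fq →+* Fq[X])) := by
    have hmax := span_X_isMaximal Fq
    refine ⟨RingHom.injective _, fun x => ?_⟩
    obtain ⟨f, rfl⟩ := Ideal.Quotient.mk_surjective x
    refine ⟨f.coeff 0, ?_⟩
    rw [RingHom.comp_apply, Ideal.Quotient.eq, ← neg_sub, Ideal.neg_mem_iff, Ideal.mem_span_singleton,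
      X_dvd_iff]
    simp
  refine (Algebra.finrank_eq_of_equiv_equiv (RingEquiv.ofBijective _ hbij) (RingEquiv.refl _) ?_).symm
  ext c
  change algebraMap (Fq[X] ⧸ Ideal.span {(X : Fq[X])}) (OK Fq L ⧸ p.asIdeal)
    (Ideal.Quotient.mk (Ideal.span {(X : Fq[X])}) (C c)) = _
  rw [Ideal.Quotient.algebraMap_mk_of_liesOver]
  exact congrArg (Ideal.Quotient.mk p.asIdeal) (IsScalarTower.algebraMap_apply Fq Fq[X] (OK Fq L) c).symm

theorem zeroPrimes_coe_image :
    HeightOneSpectrum.asIdeal '' zeroPrimes Fq L =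
      (IsDedekindDomain.primesOverFinset (Ideal.span {(X : Fq[X])}) (OK Fq L) : Set (Ideal (OK Fq L))) := by
  have hmax := span_X_isMaximal Fq
  ext I
  rw [SetLike.mem_coe, IsDedekindDomain.mem_primesOverFinset_iff (span_X_ne_bot Fq)]
  constructor
  · rintro ⟨p, hp, rfl⟩
    exact ⟨p.isPrime, zeroPrimes.liesOver hp⟩
  · rintro ⟨h1, h2⟩
    refine ⟨⟨I, h1, Ideal.ne_bot_of_liesOver_of_ne_bot (span_X_ne_bot Fq) I⟩, ?_, rfl⟩
    exact mem_iff_liesOver.2 h2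

theorem heightOne_asIdeal_injective {R : Type*} [CommRing R] :
    Function.Injective (HeightOneSpectrum.asIdeal (R := R)) := fun _ _ h => HeightOneSpectrum.ext h

theorem zeroPrimes_finite : (zeroPrimes Fq L).Finite := by
  refine Set.Finite.of_finite_image ?_ heightOne_asIdeal_injective.injOn
  rw [zeroPrimes_coe_image]
  exact Finset.finite_toSet _

theorem sum_ramIdx_mul_finrank :
    ∑ p ∈ (zeroPrimes_finite (Fq := Fq) (L := L)).toFinset, ramIdx p * Module.finrank Fq (OK Fq L ⧸ p.asIdeal)
      = Module.finrank (RatFunc Fq) L := by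
  have hmax := span_X_isMaximal Fq
  rw [← Ideal.sum_ramification_inertia (OK Fq L) (RatFunc Fq) L (span_X_ne_bot Fq)]
  refine Finset.sum_nbij HeightOneSpectrum.asIdeal ?_ heightOne_asIdeal_injective.injOn ?_ ?_
  · intro p hp
    have := zeroPrimes_coe_image (Fq := Fq) (L := L)
    have h2 : p.asIdeal ∈ HeightOneSpectrum.asIdeal '' zeroPrimes Fq L := ⟨p, by simpa using hp, rfl⟩
    rw [this] at h2
    exact h2
  · rw [Set.Finite.coe_toFinset, ← zeroPrimes_coe_image]
    exact fun _ h => h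
  · intro p hp
    rw [← finrank_residue_eq (by simpa using hp)]
    rfl

theorem ramIdx_pos {p : HeightOneSpectrum (OK Fq L)} (hp : p ∈ zeroPrimes Fq L) : 0 < ramIdx p := by
  have h : p.valuation L (algebraMap Fq[X] L X) < 1 := by
    rw [IsScalarTower.algebraMap_apply Fq[X] (OK Fq L) L]
    exact (p.valuation_lt_one_iff_mem _).2 hp
  rw [valuation_X_eq, ← WithZero.exp_zero, WithZero.exp_lt_exp] at h
  omega

theorem finrank_residue_pos {p : HeightOneSpectrum (OK Fq L)} (hp : p ∈ zeroPrimes Fq L) :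
    0 < Module.finrank Fq (OK Fq L ⧸ p.asIdeal) := by
  have := zeroPrimes.liesOver hp
  have hmax := span_X_isMaximal Fq
  rw [← finrank_residue_eq hp]
  exact Ideal.inertiaDeg'_pos (Ideal.span {(X : Fq[X])}) p.asIdeal

/-- If there are as many primes above `t = 0` as the degree, then `t = 0` splits completely. -/
theorem split_of_finrank_le (h : Module.finrank (RatFunc Fq) L ≤ (zeroPrimes Fq L).ncard) :
    (zeroPrimes Fq L).ncard = Module.finrank (RatFunc Fq) L ∧ ∀ p ∈ zeroPrimes Fq L,
      ramIdx p = 1 ∧ Module.finrank Fq (OK Fq L ⧸ p.asIdeal) = 1 := by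
  rw [Set.ncard_eq_toFinset_card _ (zeroPrimes_finite (Fq := Fq) (L := L))] at h ⊢
  have hsum := sum_ramIdx_mul_finrank (Fq := Fq) (L := L)
  have h1 : ∀ p ∈ (zeroPrimes_finite (Fq := Fq) (L := L)).toFinset,
      1 ≤ ramIdx p * Module.finrank Fq (OK Fq L ⧸ p.asIdeal) := fun p hp =>
    Nat.mul_pos (ramIdx_pos (by simpa using hp)) (finrank_residue_pos (by simpa using hp))
  -- All terms of ∑ e f = [L : 𝔽_q(t)] are at least 1 and there are at least as many terms as the
  -- total, so each of them equals 1.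
  have h2 := Finset.sum_le_sum h1
  rw [hsum, Finset.sum_const, smul_eq_mul, mul_one] at h2
  refine ⟨le_antisymm h2 h, fun p hp => ?_⟩
  have h3 := (Finset.sum_eq_sum_iff_of_le h1).1 (by
    rw [hsum, Finset.sum_const, smul_eq_mul, mul_one]; exact le_antisymm h2 h) p (by simpa using hp)
  exact ⟨Nat.eq_one_of_mul_eq_one_right h3.symm, Nat.eq_one_of_mul_eq_one_left h3.symm⟩

variable {L' : Type*} [Field L'] [Algebra Fq L'] [Algebra Fq[X] L'] [Algebra (RatFunc Fq) L']
  [IsScalarTower Fq Fq[X] L'] [IsScalarTower Fq (RatFunc Fq) L'] [IsScalarTower Fq[X] (RatFunc Fq) L']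
  [FiniteDimensional (RatFunc Fq) L'] [Algebra.IsSeparable (RatFunc Fq) L']
  [Algebra L L'] [IsScalarTower (RatFunc Fq) L L']

/-- A prime of `L'` above a split prime of `L` which is the only one above it has local degree
`[L' : L]`. -/
theorem ramIdx_mul_finrank_of_unique {p : HeightOneSpectrum (OK Fq L)}
    {p' : HeightOneSpectrum (OK Fq L')} (hp : p ∈ zeroPrimes Fq L)
    (he : ramIdx p = 1) (hf : Module.finrank Fq (OK Fq L ⧸ p.asIdeal) = 1)
    (hover : ∀ p'' : HeightOneSpectrum (OK Fq L'),
      ((p''.valuation L').comap (algebraMap L L')).IsEquiv (p.valuation L) ↔ p'' = p') :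
    ramIdx p' * Module.finrank Fq (OK Fq L' ⧸ p'.asIdeal) = Module.finrank L L' := by
  have htow : IsScalarTower Fq[X] L L' := IsScalarTower.of_algebraMap_eq fun x => by
    rw [IsScalarTower.algebraMap_apply Fq[X] (RatFunc Fq) L', IsScalarTower.algebraMap_apply Fq[X] (RatFunc Fq) L,
      ← IsScalarTower.algebraMap_apply (RatFunc Fq) L L']
  let g : OK Fq L →ₐ[Fq[X]] OK Fq L' := (IsScalarTower.toAlgHom Fq[X] L L').mapIntegralClosure
  let _ : Algebra (OK Fq L) (OK Fq L') := g.toRingHom.toAlgebra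
  have hg : ∀ a : OK Fq L, ((algebraMap (OK Fq L) (OK Fq L') a : OK Fq L') : L') = algebraMap L L' a :=
    fun a => rfl
  have t1 : IsScalarTower Fq[X] (OK Fq L) (OK Fq L') := IsScalarTower.of_algebraMap_eq fun x =>
    (g.commutes x).symm
  have t2 : IsScalarTower (OK Fq L) (OK Fq L') L' := IsScalarTower.of_algebraMap_eq fun x => rfl
  have t3 : Module.Finite (OK Fq L) (OK Fq L') := Module.Finite.of_restrictScalars_finite Fq[X] _ _
  have t4 : FaithfulSMul (OK Fq L) (OK Fq L') := by
    rw [faithfulSMul_iff_algebraMap_injective]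
    intro a b hab
    exact Subtype.ext ((algebraMap L L').injective (congrArg Subtype.val hab))
  have t5 : Module.IsTorsionFree (OK Fq L) (OK Fq L') := inferInstance
  have hpmax : p.asIdeal.IsMaximal := p.isMaximal
  have hXmax := span_X_isMaximal Fq
  have hmem : ∀ p'' : HeightOneSpectrum (OK Fq L'), p''.asIdeal.LiesOver p.asIdeal ↔
      ((p''.valuation L').comap (algebraMap L L')).IsEquiv (p.valuation L) := by
    intro p''
    have hval : ∀ a : OK Fq L, a ∈ p''.asIdeal.under (OK Fq L) ↔ p''.valuation L' (algebraMap L L' a) < 1 := by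
      intro a
      rw [← hg]
      exact (p''.valuation_lt_one_iff_mem (K := L') _).symm
    constructor
    · intro h
      have hX : ((p''.valuation L').comap (algebraMap L L')) (algebraMap Fq[X] L X) < 1 := by
        have h1 : algebraMap Fq[X] (OK Fq L) X ∈ p''.asIdeal.under (OK Fq L) := by rw [← h.over]; exact hp
        rw [hval] at h1
        exact h1
      obtain ⟨p₁, h₁⟩ := exists_isEquiv_valuation _ hX
      have : p₁ = p := by
        refine HeightOneSpectrum.ext (Ideal.ext fun a => ?_)
        rw [mem_asIdeal_iff_of_isEquiv h₁, h.over, hval]; rfl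
      exact this ▸ h₁
    · intro h
      refine ⟨Ideal.ext fun a => ?_⟩
      rw [hval, mem_asIdeal_iff_of_isEquiv h]; rfl
  have hp' : p'.asIdeal.LiesOver p.asIdeal := (hmem p').2 ((hover p').2 rfl)
  have hset : IsDedekindDomain.primesOverFinset p.asIdeal (OK Fq L') = {p'.asIdeal} := by
    ext I
    rw [IsDedekindDomain.mem_primesOverFinset_iff p.ne_bot, Finset.mem_singleton]
    constructor
    · rintro ⟨h1, h2⟩
      have h3 := (hover ⟨I, h1, Ideal.ne_bot_of_liesOver_of_ne_bot p.ne_bot I⟩).1 ((hmem _).1 h2)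
      rw [← h3]
    · rintro rfl
      exact ⟨p'.isPrime, hp'⟩
  -- A single prime above 𝔭 leaves one term in the sum of e f. Both indices over t = 0 are
  -- multiplicative in towers, and those of 𝔭 are 1.
  have hsum := Ideal.sum_ramification_inertia (OK Fq L') L L' p.ne_bot
  rw [hset, Finset.sum_singleton] at hsum
  have hpX := zeroPrimes.liesOver hp
  have hp'prime := p'.isPrime
  have hp'X : p' ∈ zeroPrimes Fq L' := by
    refine mem_iff_liesOver.2 ?_
    exact Ideal.LiesOver.trans p'.asIdeal p.asIdeal _
  have e1 : ramIdx p' = ramIdx p * Ideal.ramificationIdx' p.asIdeal p'.asIdeal :=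
    Ideal.ramificationIdx'_algebra_tower' (Ideal.span {(X : Fq[X])}) p.asIdeal p'.asIdeal
  have e2 := Ideal.inertiaDeg'_algebra_tower (Ideal.span {(X : Fq[X])}) p.asIdeal p'.asIdeal
  rw [finrank_residue_eq hp, finrank_residue_eq hp'X] at e2
  rw [e1, e2, he, hf, one_mul, one_mul, hsum]

end Ramification

/-! ### Reduction of embeddings -/

section Reduction

open IsDedekindDomain

variable {Fq : Type*} [Field Fq] [Fintype Fq] {𝕂 : Type*} [Field 𝕂] [Algebra Fq 𝕂] [IsAlgClosed 𝕂]
  {L : Type*} [Field L] [Algebra Fq L] [Algebra Fq[X] L] [Algebra (RatFunc Fq) L]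
  [IsScalarTower Fq Fq[X] L] [IsScalarTower Fq (RatFunc Fq) L] [IsScalarTower Fq[X] (RatFunc Fq) L]
  [FiniteDimensional (RatFunc Fq) L] [Algebra.IsSeparable (RatFunc Fq) L]
  {Γ : Type*} [LinearOrderedCommGroupWithZero Γ]

theorem valuation_aeval_le_one {R : Type*} [CommRing R] [Algebra Fq R] (w : Valuation R Γ) {x : R} (hx : w x ≤ 1)
    (g : Fq[X]) : w (aeval x g) ≤ 1 := by
  induction g using Polynomial.induction_on' with
  | add p q hp hq => rw [map_add]; exact Valuation.map_add_le _ hp hq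
  | monomial n c =>
    rw [aeval_monomial, map_mul, map_pow]
    exact mul_le_one' (valuation_algebraMap_le_one w c) (pow_le_one₀ zero_le hx)

/-- The constant coefficient of the minimal polynomial of a nonzero c is a nonzero element of 𝔽_q,
hence of valuation 1, whereas the remaining terms would have valuation less than 1. So lifts of
residues to 𝔽̄_q are unique. -/
theorem eq_zero_of_isAlgebraic_of_lt_one (w : Valuation 𝕂 Γ) {c : 𝕂} (hc : IsAlgebraic Fq c)
    (h : w c < 1) : c = 0 := by
  by_contra h0
  have hint : IsIntegral Fq c := hc.isIntegral
  have h1 : (minpoly Fq c).coeff 0 ≠ 0 := minpoly.coeff_zero_ne_zero hint h0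
  have h2 : aeval c (minpoly Fq c) = 0 := minpoly.aeval Fq c
  rw [← divX_mul_X_add (minpoly Fq c), map_add, map_mul, aeval_X, aeval_C] at h2
  have h3 : w (aeval c (minpoly Fq c).divX * c) < 1 := by
    rw [map_mul]
    exact lt_of_le_of_lt (mul_le_of_le_one_left' (valuation_aeval_le_one w h.le _)) h
  rw [eq_neg_of_add_eq_zero_left h2, Valuation.map_neg, valuation_algebraMap_eq_one w h1] at h3
  exact lt_irrefl _ h3

theorem coe_algebraMap_ok (r : Fq) : ((algebraMap Fq (OK Fq L) r : OK Fq L) : L) = algebraMap Fq L r := by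
  rw [Algebra.algebraMap_eq_smul_one, Algebra.algebraMap_eq_smul_one]; rfl

theorem finiteDimensional_residue {p : HeightOneSpectrum (OK Fq L)} (hp : p ∈ zeroPrimes Fq L) :
    FiniteDimensional Fq (OK Fq L ⧸ p.asIdeal) :=
  FiniteDimensional.of_finrank_pos (finrank_residue_pos hp)

theorem mem_zeroPrimes_of_isEquiv {v : Valuation L Γ} {p : HeightOneSpectrum (OK Fq L)}
    (h : v.IsEquiv (p.valuation L)) (hX : v (algebraMap Fq[X] L X) < 1) : p ∈ zeroPrimes Fq L :=
  (mem_asIdeal_iff_of_isEquiv h _).2 hX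

variable {w : Valuation 𝕂 Γ} {ν : L →ₐ[Fq] 𝕂}

/-- The class of a in the finite residue field is killed by a monic polynomial over 𝔽_q. Splitting
that polynomial over 𝕂, one of the factors ν(a) - c must have valuation less than 1. -/
theorem exists_isAlgebraic_sub_lt_one (hX : w (ν (algebraMap Fq[X] L X)) < 1) (a : OK Fq L) :
    ∃ c : 𝕂, IsAlgebraic Fq c ∧ w (ν a - c) < 1 := by
  obtain ⟨p, hp⟩ := exists_isEquiv_valuation (w.comap (ν : L →+* 𝕂)) hX
  have hfd := finiteDimensional_residue (mem_zeroPrimes_of_isEquiv hp hX)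
  have hint : IsIntegral Fq (Ideal.Quotient.mk p.asIdeal a) := Algebra.IsIntegral.isIntegral _
  obtain ⟨g, hg, hga⟩ := hint
  have h1 : aeval a g ∈ p.asIdeal := by
    rw [← Ideal.Quotient.eq_zero_iff_mem]
    change Ideal.Quotient.mkₐ Fq p.asIdeal _ = 0
    rw [← aeval_algHom_apply]
    exact hga
  rw [mem_asIdeal_iff_of_isEquiv hp] at h1
  have h2 : ((aeval a g : OK Fq L) : L) = aeval (a : L) g := by
    have := aeval_algHom_apply ((integralClosure Fq[X] L).val.restrictScalars Fq) a g
    exact this.symm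
  change w (ν ((aeval a g : OK Fq L) : L)) < 1 at h1
  rw [h2, ← aeval_algHom_apply, aeval_def, ← eval_map] at h1
  have hs := IsAlgClosed.splits (g.map (algebraMap Fq 𝕂))
  rw [hs.eq_prod_roots, (hg.map _).leadingCoeff, C_1, one_mul, eval_multiset_prod, map_multiset_prod,
    Multiset.map_map, Multiset.map_map] at h1
  by_contra! hcon
  refine absurd h1 (not_lt.2 (Multiset.one_le_prod_of_one_le ?_))
  intro x hx
  rw [Multiset.mem_map] at hx
  obtain ⟨c, hc, rfl⟩ := hx
  simp only [Function.comp_apply, eval_sub, eval_X, eval_C]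
  refine hcon c ⟨g, hg.ne_zero, ?_⟩
  have := (mem_roots'.1 hc).2
  rwa [IsRoot, eval_map, ← aeval_def] at this

/-- The reduction of an embedding `ν : L → 𝕂` at the maximal ideal of the valuation ring of `𝕂`. -/
theorem exists_reduction (hX : w (ν (algebraMap Fq[X] L X)) < 1) :
    ∃ ρ : OK Fq L →ₐ[Fq] 𝕂, ∀ a, IsAlgebraic Fq (ρ a) ∧ w (ν a - ρ a) < 1 := by
  choose ρ hρ hlt using exists_isAlgebraic_sub_lt_one hX
  -- The chosen lift is unique; compatibility of ρ with sums, products and scalars follows from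
  -- this.
  have huniq : ∀ (a : OK Fq L) (c : 𝕂), IsAlgebraic Fq c → w (ν a - c) < 1 → ρ a = c := by
    intro a c hc h
    refine sub_eq_zero.1 (eq_zero_of_isAlgebraic_of_lt_one w ((hρ a).sub hc) ?_)
    have := Valuation.map_sub_lt w h (hlt a)
    rwa [sub_sub_sub_cancel_left] at this
  have hle : ∀ a : OK Fq L, w (ν a) ≤ 1 := fun a =>
    valuation_ok_le_one (w.comap (ν : L →+* 𝕂)) hX.le a
  have hρle : ∀ a, w (ρ a) ≤ 1 := by
    intro a
    have := Valuation.map_sub_le w (hle a) (hlt a).le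
    rwa [sub_sub_cancel] at this
  have hscal : ∀ r : Fq, ρ (algebraMap Fq (OK Fq L) r) = algebraMap Fq 𝕂 r := fun r =>
    huniq _ _ (isAlgebraic_algebraMap r) (by
      have : ν ((algebraMap Fq (OK Fq L) r : OK Fq L) : L) = algebraMap Fq 𝕂 r := by
        rw [coe_algebraMap_ok, AlgHom.commutes]
      rw [this]; simp)
  refine ⟨{ toFun := ρ, map_one' := ?_, map_mul' := fun a b => ?_, map_zero' := ?_,
            map_add' := fun a b => ?_, commutes' := hscal }, fun a => ⟨hρ a, hlt a⟩⟩
  · simpa using hscal 1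
  · refine huniq _ _ ((hρ a).mul (hρ b)) ?_
    have e : ν ((a * b : OK Fq L) : L) - ρ a * ρ b = ν a * (ν b - ρ b) + (ν a - ρ a) * ρ b := by
      rw [MulMemClass.coe_mul, map_mul]; ring
    rw [e]
    refine Valuation.map_add_lt w ?_ ?_
    · rw [map_mul]; exact lt_of_le_of_lt (mul_le_of_le_one_left' (hle a)) (hlt b)
    · rw [map_mul]; exact lt_of_le_of_lt (mul_le_of_le_one_right' (hρle b)) (hlt a)
  · simpa using hscal 0
  · refine huniq _ _ ((hρ a).add (hρ b)) ?_
    have e : ν ((a + b : OK Fq L) : L) - (ρ a + ρ b) = (ν a - ρ a) + (ν b - ρ b) := by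
      rw [AddMemClass.coe_add, map_add]; ring
    rw [e]
    exact Valuation.map_add_lt w (hlt a) (hlt b)

/-- `P` is the point to which the embedding `ν` reduces. -/
def IsReductionPoint (w : Valuation 𝕂 Γ) (ν : L →ₐ[Fq] 𝕂) (P : ClosedPoint Fq 𝕂 L) : Prop :=
  ∀ (a : L) (c : 𝕂), IsAlgebraic Fq c → w (ν a - c) < 1 → P.val (fn Fq a - const Fq c) < 1

theorem IsReductionPoint.val_tFun_lt_one {P : ClosedPoint Fq 𝕂 L} (h : IsReductionPoint w ν P)
    (hX : w (ν (algebraMap Fq[X] L X)) < 1) : P.val (tFun Fq 𝕂 L) < 1 := by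
  have := h (algebraMap Fq[X] L X) 0 isAlgebraic_zero (by simpa using hX)
  rwa [const_zero, sub_zero, ← ClosedPoint.restrict_apply, P.restrict_X] at this

/-- Both valuations belong to primes of O_L, and both primes are the kernel of the reduction ρ of ν.
-/
theorem IsReductionPoint.isEquiv {P : ClosedPoint Fq 𝕂 L} (h : IsReductionPoint w ν P)
    (hX : w (ν (algebraMap Fq[X] L X)) < 1) : P.restrict.IsEquiv (w.comap (ν : L →+* 𝕂)) := by
  obtain ⟨p, hp⟩ := exists_isEquiv_valuation (w.comap (ν : L →+* 𝕂)) hX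
  obtain ⟨p', hp'⟩ := exists_isEquiv_valuation P.restrict (by
    rw [P.restrict_X]; exact h.val_tFun_lt_one hX)
  obtain ⟨ρ, hρ⟩ := exists_reduction hX
  have : p' = p := by
    refine HeightOneSpectrum.ext (Ideal.ext fun a => ?_)
    rw [mem_asIdeal_iff_of_isEquiv hp', mem_asIdeal_iff_of_isEquiv hp]
    have h1 := h a (ρ a) (hρ a).1 (hρ a).2
    by_cases h0 : ρ a = 0
    · rw [h0, const_zero, sub_zero] at h1
      have h2 := (hρ a).2
      rw [h0, sub_zero] at h2
      exact ⟨fun _ => h2, fun _ => h1⟩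
    · have hw : w (ρ a) = 1 := by
        refine le_antisymm ?_ (not_lt.1 fun h => h0 (eq_zero_of_isAlgebraic_of_lt_one w (hρ a).1 h))
        have := Valuation.map_sub_le w (valuation_ok_le_one (w.comap (ν : L →+* 𝕂)) hX.le a) (hρ a).2.le
        change w (ν a - (ν a - ρ a)) ≤ 1 at this
        rwa [sub_sub_cancel] at this
      have e1 : P.val (fn Fq (a : L)) = 1 := by
        have := P.val.map_add_eq_of_lt_right (x := fn Fq (a : L) - const Fq (ρ a)) (y := const Fq (ρ a))
          (by rw [P.trivial_on_const _ h0]; exact h1)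
        rwa [sub_add_cancel, P.trivial_on_const _ h0] at this
      have e2 : w (ν a) = 1 := by
        have := w.map_add_eq_of_lt_right (x := ν a - ρ a) (y := ρ a) (by rw [hw]; exact (hρ a).2)
        rwa [sub_add_cancel, hw] at this
      change P.val (fn Fq (a : L)) < 1 ↔ w (ν a) < 1
      rw [e1, e2]
      simp
  exact hp'.trans (this ▸ hp.symm)

/-- The point centered at the 𝕂-linear extension of ρ works for O_L by construction. Any other a
that is integral at the place is written x/s with s a unit there, and the congruence for a follows
from those for x and s. -/
theorem exists_isReductionPoint (hX : w (ν (algebraMap Fq[X] L X)) < 1) :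
    ∃ P : ClosedPoint Fq 𝕂 L, IsReductionPoint w ν P := by
  obtain ⟨ρ, hρ⟩ := exists_reduction hX
  obtain ⟨P, hP⟩ := exists_point (extHom ρ)
  have hval : ∀ a : OK Fq L, P.val (fn Fq (a : L) - const Fq (ρ a)) < 1 := by
    intro a
    rw [← bigOToFun_fn, ← bigOToFun_const, ← map_sub, ← P.onO_apply, hP.lt_one_iff, map_sub,
      AlgHom.commutes, extHom_tmul, one_mul]
    exact sub_self _
  obtain ⟨p, hp⟩ := exists_isEquiv_valuation (w.comap (ν : L →+* 𝕂)) hX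
  refine ⟨P, fun a c hc h => ?_⟩
  have hwc : w c ≤ 1 := by
    by_cases h0 : c = 0
    · simp [h0]
    by_contra! hcon
    have := eq_zero_of_isAlgebraic_of_lt_one w hc.inv (by
      rw [map_inv₀]; exact inv_lt_one_of_one_lt₀ hcon)
    exact h0 (inv_eq_zero.1 this)
  have hwa : w (ν a) ≤ 1 := by
    have := Valuation.map_add_le w h.le hwc
    rwa [sub_add_cancel] at this
  obtain ⟨x, s, hxs⟩ := p.exists_primeCompl_mul_eq_of_integer a (hp.le_one_iff_le_one.1 hwa)
  change a * ((s : OK Fq L) : L) = (x : L) at hxs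
  have hs : ρ (s : OK Fq L) ≠ 0 := by
    intro h0
    apply s.2
    refine (mem_asIdeal_iff_of_isEquiv hp _).2 ?_
    have := (hρ (s : OK Fq L)).2
    rwa [h0, sub_zero] at this
  have hx : ρ x = c * ρ (s : OK Fq L) := by
    refine sub_eq_zero.1 (eq_zero_of_isAlgebraic_of_lt_one w ((hρ x).1.sub (hc.mul (hρ _).1)) ?_)
    have e : ρ x - c * ρ (s : OK Fq L)
        = (ν a - c) * ν (s : OK Fq L) + c * (ν (s : OK Fq L) - ρ (s : OK Fq L)) - (ν x - ρ x) := by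
      rw [← hxs, map_mul]; ring
    rw [e]
    refine Valuation.map_sub_lt w (Valuation.map_add_lt w ?_ ?_) (hρ x).2
    · rw [map_mul]
      exact lt_of_le_of_lt (mul_le_of_le_one_right'
        (valuation_ok_le_one (w.comap (ν : L →+* 𝕂)) hX.le (s : OK Fq L))) h
    · rw [map_mul]
      exact lt_of_le_of_lt (mul_le_of_le_one_left' hwc) (hρ _).2
  have hs1 : P.val (fn Fq ((s : OK Fq L) : L)) = 1 := by
    have := P.val.map_add_eq_of_lt_right (x := fn Fq ((s : OK Fq L) : L) - const Fq (ρ (s : OK Fq L)))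
      (y := const Fq (ρ (s : OK Fq L))) (by rw [P.trivial_on_const _ hs]; exact hval _)
    rwa [sub_add_cancel, P.trivial_on_const _ hs] at this
  have e : (fn Fq a - const Fq c) * fn Fq ((s : OK Fq L) : L) = (fn Fq (x : L) - const Fq (ρ x))
      - const Fq c * (fn Fq ((s : OK Fq L) : L) - const Fq (ρ (s : OK Fq L))) := by
    have e1 : (fn Fq (x : L) : FunRing Fq 𝕂 L) = fn Fq a * fn Fq ((s : OK Fq L) : L) := by
      rw [← hxs, ← fnHom_apply, ← fnHom_apply, ← fnHom_apply, map_mul]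
    rw [hx, const_mul, e1]
    ring
  have h1 : P.val ((fn Fq a - const Fq c) * fn Fq ((s : OK Fq L) : L)) < 1 := by
    rw [e]
    refine Valuation.map_sub_lt _ (hval x) ?_
    rw [map_mul]
    refine lt_of_le_of_lt (mul_le_of_le_one_left' ?_) (hval _)
    by_cases h0 : c = 0
    · rw [h0, const_zero, map_zero]; exact zero_le
    · exact (P.trivial_on_const c h0).le
  rwa [map_mul, hs1, mul_one] at h1

theorem exists_valuation_sub_algebraMap_le {p : HeightOneSpectrum (OK Fq L)}
    (hf : Module.finrank Fq (OK Fq L ⧸ p.asIdeal) = 1) {y : L} (hy : p.valuation L y ≤ 1) :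
    ∃ c : Fq, p.valuation L (y - algebraMap Fq L c) ≤ WithZero.exp (-1) := by
  obtain ⟨x, s, hxs⟩ := p.exists_primeCompl_mul_eq_of_integer y hy
  change y * ((s : OK Fq L) : L) = (x : L) at hxs
  have hc : ∀ a : OK Fq L, ∃ c : Fq, a - algebraMap Fq _ c ∈ p.asIdeal := by
    intro a
    have hmax := p.isMaximal
    let _ := Ideal.Quotient.field p.asIdeal
    obtain ⟨c, hc⟩ := (finrank_eq_one_iff_of_nonzero' (1 : OK Fq L ⧸ p.asIdeal) one_ne_zero).1 hf
      (Ideal.Quotient.mk _ a)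
    refine ⟨c, ?_⟩
    rw [← Ideal.Quotient.eq, ← hc, Algebra.smul_def, mul_one]
    rfl
  obtain ⟨cx, hcx⟩ := hc x
  obtain ⟨cs, hcs⟩ := hc s
  have hcs0 : cs ≠ 0 := by
    rintro rfl
    exact s.2 (by simpa using hcs)
  refine ⟨cx / cs, ?_⟩
  have hs1 : p.valuation L ((s : OK Fq L) : L) = 1 := p.valuation_eq_one_iff_notMem.2 s.2
  have hmem : x - algebraMap Fq (OK Fq L) (cx / cs) * (s : OK Fq L) ∈ p.asIdeal := by
    have e : x - algebraMap Fq (OK Fq L) (cx / cs) * (s : OK Fq L) = (x - algebraMap Fq _ cx)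
        - algebraMap Fq (OK Fq L) (cx / cs) * ((s : OK Fq L) - algebraMap Fq _ cs) := by
      rw [mul_sub, ← map_mul, div_mul_cancel₀ _ hcs0]; ring
    rw [e]
    exact Ideal.sub_mem _ hcx (Ideal.mul_mem_left _ _ hcs)
  have h1 : p.valuation L ((y - algebraMap Fq L (cx / cs)) * ((s : OK Fq L) : L)) < 1 := by
    have e : (y - algebraMap Fq L (cx / cs)) * ((s : OK Fq L) : L)
        = ((x - algebraMap Fq (OK Fq L) (cx / cs) * (s : OK Fq L) : OK Fq L) : L) := by
      rw [AddSubgroupClass.coe_sub, MulMemClass.coe_mul, ← hxs, sub_mul, coe_algebraMap_ok]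
    rw [e]
    exact (p.valuation_lt_one_iff_mem (K := L) _).2 hmem
  rw [map_mul, hs1, mul_one, ← WithZero.exp_zero] at h1
  exact (lt_exp_iff_le (d := 0)).1 h1

/-- Embeddings inducing the same split place are equal. -/
theorem algHom_eq_of_isEquiv {w : Valuation 𝕂 ℝ≥0} {ν ν' : L →ₐ[Fq] 𝕂}
    {p : HeightOneSpectrum (OK Fq L)} (he : ramIdx p = 1)
    (hf : Module.finrank Fq (OK Fq L ⧸ p.asIdeal) = 1)
    (hX : w (ν (algebraMap Fq[X] L X)) < 1)
    (hνX : ν (algebraMap Fq[X] L X) = ν' (algebraMap Fq[X] L X))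
    (h : (w.comap (ν : L →+* 𝕂)).IsEquiv (p.valuation L))
    (h' : (w.comap (ν' : L →+* 𝕂)).IsEquiv (p.valuation L)) : ν = ν' := by
  have hXv : p.valuation L (algebraMap Fq[X] L X) = WithZero.exp (-1) := by
    rw [valuation_X_eq, he]; rfl
  have hX0 : algebraMap Fq[X] L X ≠ 0 := by
    intro h0; rw [h0, map_zero] at hXv; exact WithZero.exp_ne_zero hXv.symm
  have hres := fun (y : L) => exists_valuation_sub_algebraMap_le hf (y := y)
  have hnu : ∀ c : Fq, ν (algebraMap Fq L c) = ν' (algebraMap Fq L c) := fun c => by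
    rw [AlgHom.commutes, AlgHom.commutes]
  -- At a split place t is a uniformizer with residue field 𝔽_q, so every integral a is approximated
  -- to order n by a polynomial in t over 𝔽_q. Both embeddings agree on such polynomials, and the
  -- error is at most w(ν t)^n, which tends to 0 in ℝ≥0.
  have happrox : ∀ (n : ℕ) (a : L), p.valuation L a ≤ 1 → ∃ g : L, ν g = ν' g ∧
      p.valuation L (a - g) ≤ p.valuation L (algebraMap Fq[X] L X ^ n) := by
    intro n
    induction n with
    | zero => intro a ha; exact ⟨0, by simp, by simpa using ha⟩
    | succ n ih =>
      intro a ha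
      obtain ⟨g, hg, hag⟩ := ih a ha
      have hne : p.valuation L (algebraMap Fq[X] L X ^ n) ≠ 0 := by
        rw [Valuation.ne_zero_iff]; exact pow_ne_zero _ hX0
      obtain ⟨c, hc⟩ := hres ((a - g) / algebraMap Fq[X] L X ^ n) (by
        rw [map_div₀]; exact div_le_one_of_le₀ hag zero_le)
      refine ⟨g + algebraMap Fq L c * algebraMap Fq[X] L X ^ n, ?_, ?_⟩
      · rw [map_add, map_add, map_mul, map_mul, map_pow, map_pow, hnu, hg, hνX]
      · have e : a - (g + algebraMap Fq L c * algebraMap Fq[X] L X ^ n)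
            = ((a - g) / algebraMap Fq[X] L X ^ n - algebraMap Fq L c) * algebraMap Fq[X] L X ^ n := by
          rw [sub_mul, div_mul_cancel₀ _ (pow_ne_zero _ hX0)]; ring
        rw [e, pow_succ', map_mul, map_mul, hXv]
        exact mul_le_mul_left hc _
  have hle : ∀ a : L, p.valuation L a ≤ 1 → ν a = ν' a := by
    intro a ha
    have hbound : ∀ n : ℕ, w (ν a - ν' a) ≤ w (ν (algebraMap Fq[X] L X)) ^ n := by
      intro n
      obtain ⟨g, hg, hag⟩ := happrox n a ha
      have e : ν a - ν' a = ν (a - g) - ν' (a - g) := by rw [map_sub, map_sub, hg]; ring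
      rw [e]
      refine Valuation.map_sub_le w ?_ ?_
      · have := (h _ _).2 hag
        change w (ν (a - g)) ≤ w (ν (_ ^ n)) at this
        rwa [map_pow, map_pow] at this
      · have := (h' _ _).2 hag
        change w (ν' (a - g)) ≤ w (ν' (_ ^ n)) at this
        rwa [map_pow, map_pow, ← hνX] at this
    have hlim := tendsto_pow_atTop_nhds_zero_of_lt_one (r := w (ν (algebraMap Fq[X] L X))) zero_le hX
    have h0 : w (ν a - ν' a) ≤ 0 := ge_of_tendsto' hlim hbound
    rw [nonpos_iff_eq_zero, Valuation.zero_iff] at h0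
    exact sub_eq_zero.1 h0
  ext a
  rcases le_total (p.valuation L a) 1 with ha | ha
  · exact hle a ha
  · have h1 := hle a⁻¹ (by rw [map_inv₀]; exact inv_le_one_of_one_le₀ ha)
    rw [map_inv₀, map_inv₀] at h1
    exact inv_injective h1

end Reduction

/-! ### Evaluation of functions at the points above `t = θ` -/

section Evaluation

variable {Fq : Type*} [Field Fq] [Fintype Fq] {𝕂 : Type*} [Field 𝕂] [Algebra Fq 𝕂] [IsAlgClosed 𝕂]
  {L : Type*} [Field L] [Algebra Fq L] [Algebra Fq[X] L] [Algebra (RatFunc Fq) L]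
  [IsScalarTower Fq Fq[X] L] [IsScalarTower Fq (RatFunc Fq) L] [IsScalarTower Fq[X] (RatFunc Fq) L]
  [FiniteDimensional (RatFunc Fq) L] [Algebra.IsSeparable (RatFunc Fq) L]

/-- `ν` is the evaluation of functions on `X` at the point `ξ`. -/
def IsEval (ξ : ClosedPoint Fq 𝕂 L) (ν : L →ₐ[Fq] 𝕂) : Prop :=
  ∀ a : L, ξ.val (fn Fq a - const Fq (ν a)) < 1

theorem const_eq_of_val_lt_one {P : ClosedPoint Fq 𝕂 L} {x : FunRing Fq 𝕂 L} {c c' : 𝕂}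
    (h : P.val (x - const Fq c) < 1) (h' : P.val (x - const Fq c') < 1) : c = c' := by
  by_contra hne
  have h1 := Valuation.map_sub_lt P.val h' h
  rw [sub_sub_sub_cancel_left, ← constHom_apply, ← constHom_apply, ← map_sub, constHom_apply,
    P.trivial_on_const _ (sub_ne_zero.2 hne)] at h1
  exact lt_irrefl _ h1

theorem IsEval.unique {ξ : ClosedPoint Fq 𝕂 L} {ν ν' : L →ₐ[Fq] 𝕂} (h : IsEval ξ ν) (h' : IsEval ξ ν') :
    ν = ν' :=
  AlgHom.ext fun a => const_eq_of_val_lt_one (h a) (h' a)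

/-- The restriction of an embedding of `L` to `O_L`. -/
def onOK (ν : L →ₐ[Fq] 𝕂) : OK Fq L →ₐ[Fq] 𝕂 :=
  ν.comp ((integralClosure Fq[X] L).val.restrictScalars Fq)

theorem onOK_apply (ν : L →ₐ[Fq] 𝕂) (a : OK Fq L) : onOK ν a = ν a := rfl

theorem onOK_injective (ν : L →ₐ[Fq] 𝕂) : Function.Injective (onOK ν) :=
  ν.toRingHom.injective.comp Subtype.val_injective

theorem isCentered_of_forall_tmul {w : Valuation (BigO Fq 𝕂 L) ℤᵐ⁰} {ρ : OK Fq L →ₐ[Fq] 𝕂}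
    (h0 : ∀ c : 𝕂, c ≠ 0 → w (algebraMap 𝕂 _ c) = 1)
    (h : ∀ a : OK Fq L, w (1 ⊗ₜ a - algebraMap 𝕂 _ (ρ a)) < 1) : IsCentered w (extHom ρ) := by
  refine IsCentered.of_sub_lt_one h0 fun b => ?_
  induction b using TensorProduct.induction_on with
  | zero => simp
  | tmul c a =>
    have e : c ⊗ₜ[Fq] a - algebraMap 𝕂 (BigO Fq 𝕂 L) (extHom ρ (c ⊗ₜ a))
        = algebraMap 𝕂 _ c * (1 ⊗ₜ a - algebraMap 𝕂 _ (ρ a)) := by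
      rw [extHom_tmul, map_mul, mul_sub]
      congr 1
      rw [Algebra.TensorProduct.algebraMap_apply, Algebra.TensorProduct.tmul_mul_tmul]
      simp
    rw [e, map_mul]
    refine lt_of_le_of_lt (mul_le_of_le_one_left' ?_) (h a)
    by_cases hc : c = 0
    · rw [hc, map_zero, map_zero]; exact zero_le
    · exact (h0 c hc).le
  | add x y hx hy =>
    rw [map_add, map_add, add_sub_add_comm]
    exact Valuation.map_add_lt w hx hy

theorem IsEval.isCentered {ξ : ClosedPoint Fq 𝕂 L} {ν : L →ₐ[Fq] 𝕂} (h : IsEval ξ ν) :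
    IsCentered ξ.onO (extHom (onOK ν)) := by
  refine isCentered_of_forall_tmul (fun c hc => ξ.onO_const hc) fun a => ?_
  rw [ξ.onO_apply, map_sub, bigOToFun_fn, bigOToFun_const]
  exact h a

theorem isEval_of_isCentered {ξ : ClosedPoint Fq 𝕂 L} {ν : L →ₐ[Fq] 𝕂}
    (h : IsCentered ξ.onO (extHom (onOK ν))) : IsEval ξ ν := by
  have hO : ∀ a : OK Fq L, ξ.val (fn Fq (a : L) - const Fq (ν a)) < 1 := by
    intro a
    rw [← bigOToFun_fn, ← bigOToFun_const, ← map_sub, ← ξ.onO_apply, h.lt_one_iff, map_sub,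
      AlgHom.commutes, extHom_tmul, one_mul, onOK_apply]
    exact sub_self _
  intro a
  obtain ⟨x, s, hs, hxs⟩ := IsFractionRing.div_surjective (A := OK Fq L) a
  have hs0 : s ≠ 0 := nonZeroDivisors.ne_zero hs
  have hsL : (s : L) ≠ 0 := fun h0 => hs0 (Subtype.ext h0)
  have hνs : ν s ≠ 0 := (map_ne_zero ν).2 hsL
  have hxs' : a * (s : L) = x := by
    rw [← hxs]; exact div_mul_cancel₀ _ hsL
  have hs1 : ξ.val (fn Fq (s : L)) = 1 := by
    have := ξ.val.map_add_eq_of_lt_right (x := fn Fq (s : L) - const Fq (ν s)) (y := const Fq (ν s))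
      (by rw [ξ.trivial_on_const _ hνs]; exact hO s)
    rwa [sub_add_cancel, ξ.trivial_on_const _ hνs] at this
  have e : (fn Fq a - const Fq (ν a)) * fn Fq (s : L) = (fn Fq (x : L) - const Fq (ν x))
      - const Fq (ν a) * (fn Fq (s : L) - const Fq (ν s)) := by
    rw [← hxs', map_mul, const_mul, ← fnHom_apply, ← fnHom_apply, ← fnHom_apply, map_mul]
    ring
  have h1 : ξ.val ((fn Fq a - const Fq (ν a)) * fn Fq (s : L)) < 1 := by
    rw [e]
    refine Valuation.map_sub_lt _ (hO x) ?_
    rw [map_mul]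
    refine lt_of_le_of_lt (mul_le_of_le_one_left' ?_) (hO s)
    by_cases h0 : ν a = 0
    · rw [h0, const_zero, map_zero]; exact zero_le
    · exact (ξ.trivial_on_const _ h0).le
  rwa [map_mul, hs1, mul_one] at h1

theorem exists_isEval (ν : L →ₐ[Fq] 𝕂) : ∃ ξ : ClosedPoint Fq 𝕂 L, IsEval ξ ν := by
  obtain ⟨ξ, hξ⟩ := exists_point (extHom (onOK ν))
  exact ⟨ξ, isEval_of_isCentered hξ⟩

theorem IsEval.mem_pointsAbove {ξ : ClosedPoint Fq 𝕂 L} {ν : L →ₐ[Fq] 𝕂} (h : IsEval ξ ν) {θ : 𝕂}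
    (hθ : ν (algebraMap Fq[X] L X) = θ) : ξ ∈ pointsAbove Fq L θ := by
  have := h (algebraMap Fq[X] L X)
  rw [hθ] at this
  change ξ.val (tFun Fq 𝕂 L - const Fq θ) < 1
  rwa [tFun, algebraMap_ratFunc_X]

/-- Since θ is transcendental, the residue map at ξ is injective on O_L: a nonzero kernel would make
the image of t algebraic over 𝔽_q. Hence it extends to L. -/
theorem exists_isEval_of_mem_pointsAbove {θ : 𝕂} (hθ : Transcendental Fq θ) {ξ : ClosedPoint Fq 𝕂 L}
    (hξ : ξ ∈ pointsAbove Fq L θ) : ∃ ν : L →ₐ[Fq] 𝕂, ν (algebraMap Fq[X] L X) = θ ∧ IsEval ξ ν := by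
  obtain ⟨χ, hχ⟩ := ξ.exists_center (mem_affinePart_of_mem_pointsAbove hξ)
  have hX : resHom χ (algebraMap Fq[X] _ X) = θ := by
    have h1 : ξ.val (tFun Fq 𝕂 L - const Fq θ) < 1 := hξ
    rw [← bigOToFun_X, ← bigOToFun_const, ← map_sub, ← ξ.onO_apply, hχ.lt_one_iff, map_sub,
      AlgHom.commutes, algebraMap_bigO_X, ← resHom_apply, sub_eq_zero] at h1
    exact h1
  have hinj : Function.Injective (resHom χ) := by
    rw [RingHom.injective_iff_ker_eq_bot]
    by_contra hne
    have := isIntegral_of_ker_ne_bot hne (algebraMap Fq[X] _ X)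
    rw [hX] at this
    exact hθ this.isAlgebraic
  let ν : L →ₐ[Fq] 𝕂 := IsFractionRing.liftAlgHom (K := L) hinj
  have hν : ∀ a : OK Fq L, ν a = resHom χ a := fun a =>
    IsFractionRing.lift_algebraMap (K := L) hinj a
  refine ⟨ν, ?_, isEval_of_isCentered ?_⟩
  · rw [IsScalarTower.algebraMap_apply Fq[X] (OK Fq L) L]
    exact (hν _).trans hX
  · have : extHom (onOK ν) = χ := resHom_injective (by
      rw [resHom_extHom]
      exact AlgHom.ext hν)
    rw [this]; exact hχ

end Evaluation

/-! ### Projection of points above t = θ as restriction of embeddings. -/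

section LiesOver

variable {Fq : Type*} [Field Fq] [Fintype Fq] {𝕂 : Type*} [Field 𝕂] [Algebra Fq 𝕂] [IsAlgClosed 𝕂]
  {L : Type*} [Field L] [Algebra Fq L] [Algebra Fq[X] L] [Algebra (RatFunc Fq) L]
  [IsScalarTower Fq Fq[X] L] [IsScalarTower Fq (RatFunc Fq) L] [IsScalarTower Fq[X] (RatFunc Fq) L]
  [FiniteDimensional (RatFunc Fq) L] [Algebra.IsSeparable (RatFunc Fq) L]
  {L' : Type*} [Field L'] [Algebra Fq L'] [Algebra Fq[X] L'] [Algebra (RatFunc Fq) L']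
  [IsScalarTower Fq Fq[X] L'] [IsScalarTower Fq (RatFunc Fq) L'] [IsScalarTower Fq[X] (RatFunc Fq) L']
  [FiniteDimensional (RatFunc Fq) L'] [Algebra.IsSeparable (RatFunc Fq) L']

theorem IsEval.val_localParam {ξ : ClosedPoint Fq 𝕂 L} {ν : L →ₐ[Fq] 𝕂} (h : IsEval ξ ν) :
    ξ.val (fn Fq (algebraMap Fq[X] L X) - const Fq (ν (algebraMap Fq[X] L X))) = WithZero.exp (-1) := by
  have hinj : Function.Injective (resHom (extHom (onOK ν))) := by
    rw [resHom_extHom]; exact onOK_injective ν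
  have h1 := CMMotive.val_localParam h.isCentered (isLocalParam_of_injective hinj)
  rw [resHom_extHom, map_sub, ξ.onO_apply, map_sub, algebraMap_bigO_X, algebraMap_bigO_C, bigOToFun_fn] at h1
  have e : bigOToFun ((onOK ν (algebraMap Fq[X] (OK Fq L) X)) ⊗ₜ[Fq] (1 : OK Fq L))
      = (const Fq (onOK ν (algebraMap Fq[X] (OK Fq L) X)) : FunRing Fq 𝕂 L) := bigOToFun_const _
  rw [e] at h1
  exact h1

theorem isCentered_comap_bigOToTensor {μ : L →ₐ[Fq] 𝕂} {v : Valuation (𝕂 ⊗[Fq] L) ℤᵐ⁰}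
    (h0 : ∀ c : 𝕂, c ≠ 0 → v (c ⊗ₜ 1) = 1) (h1 : ∀ a : L, v (1 ⊗ₜ a - μ a ⊗ₜ 1) < 1) :
    IsCentered (v.comap (bigOToTensor : BigO Fq 𝕂 L →ₐ[𝕂] 𝕂 ⊗[Fq] L).toRingHom) (extHom (onOK μ)) := by
  refine isCentered_of_forall_tmul (fun c hc => ?_) fun a => ?_
  · change v (bigOToTensor _) = 1
    rw [AlgHom.commutes]
    exact h0 c hc
  · change v (bigOToTensor _) < 1
    rw [map_sub, AlgHom.commutes]
    exact h1 a

/-- A valuation on `𝕂 ⊗ L` centered at an embedding `μ` is determined by `μ` if it is normalized at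
`t - μ t`. -/
theorem valuation_eq_of_forall_lt_one {μ : L →ₐ[Fq] 𝕂} {v₁ v₂ : Valuation (𝕂 ⊗[Fq] L) ℤᵐ⁰}
    (hc₁ : ∀ c : 𝕂, c ≠ 0 → v₁ (c ⊗ₜ 1) = 1) (h₁ : ∀ a : L, v₁ (1 ⊗ₜ a - μ a ⊗ₜ 1) < 1)
    (hc₂ : ∀ c : 𝕂, c ≠ 0 → v₂ (c ⊗ₜ 1) = 1) (h₂ : ∀ a : L, v₂ (1 ⊗ₜ a - μ a ⊗ₜ 1) < 1)
    (hX : v₁ (1 ⊗ₜ (algebraMap Fq[X] L X) - μ (algebraMap Fq[X] L X) ⊗ₜ 1)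
      = v₂ (1 ⊗ₜ (algebraMap Fq[X] L X) - μ (algebraMap Fq[X] L X) ⊗ₜ 1)) : v₁ = v₂ := by
  have hcen₁ := isCentered_comap_bigOToTensor hc₁ h₁
  have hcen₂ := isCentered_comap_bigOToTensor hc₂ h₂
  have hinj : Function.Injective (resHom (extHom (onOK μ))) := by
    rw [resHom_extHom]; exact onOK_injective μ
  have hloc := isLocalParam_of_injective hinj
  have hπ : bigOToTensor (algebraMap 𝕂[X] (BigO Fq 𝕂 L)
      (X - C (resHom (extHom (onOK μ)) (algebraMap Fq[X] _ X))))
      = 1 ⊗ₜ (algebraMap Fq[X] L X) - μ (algebraMap Fq[X] L X) ⊗ₜ 1 := by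
    rw [map_sub, map_sub, algebraMap_bigO_X, algebraMap_bigO_C, resHom_extHom]
    simp [bigOToTensor, onOK]
  rw [← hπ] at hX
  have hb : ∀ b : BigO Fq 𝕂 L, v₁ (bigOToTensor b) = v₂ (bigOToTensor b) := by
    intro b
    rcases hloc.eq_pow_or_eq_zero b with ⟨k, hk⟩ | hk
    · refine (hk _ hcen₁).trans (Eq.trans ?_ (hk _ hcen₂).symm)
      exact congrArg (· ^ k) hX
    · exact (hk _ hcen₁).trans (hk _ hcen₂).symm
  ext y
  obtain ⟨d, hd, b, hdb⟩ := exists_denominator y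
  have e₁ := congrArg v₁ hdb
  have e₂ := congrArg v₂ hdb
  have e₃ : v₁ (1 ⊗ₜ (d : L)) = v₂ (1 ⊗ₜ (d : L)) := by
    have := hb (1 ⊗ₜ d)
    simpa [bigOToTensor] using this
  have hd0 : v₂ (1 ⊗ₜ (d : L)) ≠ 0 := by
    have hu : IsUnit ((1 : 𝕂) ⊗ₜ[Fq] (d : L)) := one_tmul_isUnit (by simpa using hd)
    exact (hu.map v₂).ne_zero
  rw [map_mul, e₃, hb, ← e₂, map_mul] at e₁
  exact mul_left_cancel₀ hd0 e₁

/-- Evaluation embeddings determine the centers. If these are compatible, t minus its value is a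
local parameter both at ξ and at Q, so the two valuations on 𝕂 ⊗ L are even equal. -/
theorem isEquiv_comap_iff (j : L →ₐ[Fq] L') (hj : j (algebraMap Fq[X] L X) = algebraMap Fq[X] L' X)
    {ξ : ClosedPoint Fq 𝕂 L'} {Q : ClosedPoint Fq 𝕂 L} {ν : L' →ₐ[Fq] 𝕂} {μ : L →ₐ[Fq] 𝕂}
    (hξ : IsEval ξ ν) (hQ : IsEval Q μ) :
    (ξ.val.comap ((algebraMap (𝕂 ⊗[Fq] L') (FunRing Fq 𝕂 L')).comp
      (Algebra.TensorProduct.map (AlgHom.id Fq 𝕂) j).toRingHom)).IsEquiv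
      (Q.val.comap (algebraMap (𝕂 ⊗[Fq] L) (FunRing Fq 𝕂 L))) ↔ ν.comp j = μ := by
  set i : 𝕂 ⊗[Fq] L →+* FunRing Fq 𝕂 L' := (algebraMap (𝕂 ⊗[Fq] L') (FunRing Fq 𝕂 L')).comp
    (Algebra.TensorProduct.map (AlgHom.id Fq 𝕂) j).toRingHom with hi
  set v₁ : Valuation (𝕂 ⊗[Fq] L) ℤᵐ⁰ := ξ.val.comap i with hv₁
  set v₂ : Valuation (𝕂 ⊗[Fq] L) ℤᵐ⁰ := Q.val.comap (algebraMap (𝕂 ⊗[Fq] L) (FunRing Fq 𝕂 L)) with hv₂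
  have hi1 : ∀ a : L, i (1 ⊗ₜ a) = fn Fq (j a) := fun a => by simp [i, fn]
  have hi2 : ∀ c : 𝕂, i (c ⊗ₜ 1) = const Fq c := fun c => by simp [i, const]
  have h₁ : ∀ (c : 𝕂) (a : L), v₁ (1 ⊗ₜ a - c ⊗ₜ 1) = ξ.val (fn Fq (j a) - const Fq c) := by
    intro c a
    rw [← hi1, ← hi2, ← map_sub i]
    rfl
  have h₂ : ∀ (c : 𝕂) (a : L), v₂ (1 ⊗ₜ a - c ⊗ₜ 1) = Q.val (fn Fq a - const Fq c) := by
    intro c a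
    change Q.val (algebraMap (𝕂 ⊗[Fq] L) (FunRing Fq 𝕂 L) _) = _
    rw [map_sub (algebraMap (𝕂 ⊗[Fq] L) (FunRing Fq 𝕂 L))]
    rfl
  have hc₁ : ∀ c : 𝕂, c ≠ 0 → v₁ (c ⊗ₜ 1) = 1 := by
    intro c hc
    rw [← ξ.trivial_on_const c hc, ← hi2]
    rfl
  have hc₂ : ∀ c : 𝕂, c ≠ 0 → v₂ (c ⊗ₜ 1) = 1 := fun c hc => Q.trivial_on_const c hc
  constructor
  · intro h
    refine AlgHom.ext fun a => ?_
    have h1 := hQ a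
    rw [← h₂, ← h.lt_one_iff_lt_one, h₁] at h1
    exact const_eq_of_val_lt_one (hξ (j a)) h1
  · intro h
    have hμ : ∀ a : L, ν (j a) = μ a := fun a => DFunLike.congr_fun h a
    refine Valuation.IsEquiv.of_eq (valuation_eq_of_forall_lt_one (μ := μ) hc₁ (fun a => ?_) hc₂ (fun a => ?_) ?_)
    · rw [h₁, ← hμ]; exact hξ _
    · rw [h₂]; exact hQ _
    · rw [h₁, h₂, ← hμ, hj, hξ.val_localParam, ← hj, hμ, hQ.val_localParam]

variable {K : Type*} [Field K] [Algebra Fq K] [Algebra Fq[X] K] [Algebra (RatFunc Fq) K]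
  [IsScalarTower Fq Fq[X] K] [IsScalarTower Fq (RatFunc Fq) K] [IsScalarTower Fq[X] (RatFunc Fq) K]
  (Kp : IntermediateField (RatFunc Fq) K)

instance subfieldTower : IsScalarTower Fq Fq[X] Kp :=
  IsScalarTower.of_algebraMap_eq fun x => Subtype.ext (IsScalarTower.algebraMap_apply Fq Fq[X] K x)

instance subfieldTowerPoly : IsScalarTower Fq[X] (RatFunc Fq) Kp :=
  IsScalarTower.of_algebraMap_eq fun x => Subtype.ext (IsScalarTower.algebraMap_apply Fq[X] (RatFunc Fq) K x)

instance subfieldTowerRat : IsScalarTower Fq (RatFunc Fq) Kp :=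
  IsScalarTower.of_algebraMap_eq fun x => Subtype.ext (IsScalarTower.algebraMap_apply Fq (RatFunc Fq) K x)

variable [FiniteDimensional (RatFunc Fq) K] [Algebra.IsSeparable (RatFunc Fq) K]

/-- The restriction of an embedding of `K` to `Kp`. -/
def onSubfield (ν : K →ₐ[Fq] 𝕂) : Kp →ₐ[Fq] 𝕂 :=
  ν.comp (Kp.val.restrictScalars Fq)

variable {Kp}

theorem liesOver_iff {ξ : ClosedPoint Fq 𝕂 K} {Q : ClosedPoint Fq 𝕂 Kp} {ν : K →ₐ[Fq] 𝕂} {μ : Kp →ₐ[Fq] 𝕂}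
    (hξ : IsEval ξ ν) (hQ : IsEval Q μ) : LiesOver ξ Q ↔ onSubfield Kp ν = μ :=
  isEquiv_comap_iff (Kp.val.restrictScalars Fq) rfl hξ hQ

end LiesOver

/-! ### The chart at infinity -/

section Chart

open IsDedekindDomain

section RatFuncInv

variable (Fq : Type*) [Field Fq]

theorem aeval_inv_injective :
    Function.Injective (aeval (RatFunc.X⁻¹ : RatFunc Fq) : Fq[X] →ₐ[Fq] RatFunc Fq) := by
  rw [← transcendental_iff_injective]
  intro h
  have h1 := h.inv
  rw [inv_inv] at h1
  exact RatFunc.transcendental_X h1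

/-- The substitution `t ↦ 1 / t` of `𝔽_q(t)`. -/
def invHom : RatFunc Fq →ₐ[Fq] RatFunc Fq :=
  IsFractionRing.liftAlgHom (K := RatFunc Fq) (aeval_inv_injective Fq)

theorem invHom_polynomial (p : Fq[X]) :
    invHom Fq (algebraMap Fq[X] (RatFunc Fq) p) = aeval (RatFunc.X⁻¹ : RatFunc Fq) p :=
  IsFractionRing.lift_algebraMap (K := RatFunc Fq) (aeval_inv_injective Fq) p

theorem invHom_X : invHom Fq RatFunc.X = RatFunc.X⁻¹ := by
  rw [← RatFunc.algebraMap_X, invHom_polynomial, aeval_X, RatFunc.algebraMap_X]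

theorem invHom_invHom (x : RatFunc Fq) : invHom Fq (invHom Fq x) = x := by
  have h : ((invHom Fq).comp (invHom Fq)).toRingHom = RingHom.id (RatFunc Fq) := by
    refine IsFractionRing.ringHom_ext (A := Fq[X]) fun p => ?_
    change invHom Fq (invHom Fq _) = _
    rw [invHom_polynomial, ← aeval_algHom_apply, map_inv₀, invHom_X, inv_inv]
    change _ = algebraMap Fq[X] (RatFunc Fq) p
    rw [← RatFunc.algebraMap_X]
    have := aeval_algHom_apply (IsScalarTower.toAlgHom Fq Fq[X] (RatFunc Fq)) X p
    rw [aeval_X_left_apply] at this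
    exact this
  exact DFunLike.congr_fun h x

/-- The substitution `t ↦ 1 / t` as an automorphism. -/
def invEquiv : RatFunc Fq ≃+* RatFunc Fq :=
  RingEquiv.ofBijective (invHom Fq) (Function.Involutive.bijective (invHom_invHom Fq))

end RatFuncInv

/-- The field `L`, viewed as an extension of `𝔽_q(1/t)`. -/
def Inv (L : Type*) : Type _ := L

variable {Fq : Type*} [Field Fq] [Fintype Fq] {L : Type*} [Field L] [Algebra Fq L]
  [Algebra (RatFunc Fq) L] [IsScalarTower Fq (RatFunc Fq) L]

instance invField : Field (Inv L) := inferInstanceAs (Field L)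

instance invConstAlgebra : Algebra Fq (Inv L) := inferInstanceAs (Algebra Fq L)

instance invRatAlgebra : Algebra (RatFunc Fq) (Inv L) :=
  RingHom.toAlgebra (S := Inv L) ((algebraMap (RatFunc Fq) L).comp (invHom Fq).toRingHom)

instance invPolyAlgebra : Algebra Fq[X] (Inv L) :=
  RingHom.toAlgebra ((algebraMap (RatFunc Fq) (Inv L)).comp (algebraMap Fq[X] (RatFunc Fq)))

theorem inv_algebraMap (x : RatFunc Fq) :
    algebraMap (RatFunc Fq) (Inv L) x = (algebraMap (RatFunc Fq) L (invHom Fq x) : L) := rfl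

instance invPolyRatTower : IsScalarTower Fq[X] (RatFunc Fq) (Inv L) :=
  IsScalarTower.of_algebraMap_eq fun _ => rfl

instance invRatTower : IsScalarTower Fq (RatFunc Fq) (Inv L) :=
  IsScalarTower.of_algebraMap_eq fun x => by
    rw [inv_algebraMap, AlgHom.commutes]
    exact IsScalarTower.algebraMap_apply Fq (RatFunc Fq) L x

instance invPolyTower : IsScalarTower Fq Fq[X] (Inv L) :=
  IsScalarTower.of_algebraMap_eq fun x => by
    rw [IsScalarTower.algebraMap_apply Fq (RatFunc Fq) (Inv L),
      IsScalarTower.algebraMap_apply Fq[X] (RatFunc Fq) (Inv L),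
      ← IsScalarTower.algebraMap_apply Fq Fq[X] (RatFunc Fq)]

/-- The identity map. -/
def toInv : L ≃+* Inv L := RingEquiv.refl L

theorem inv_comp_invEquiv : (algebraMap (RatFunc Fq) (Inv L)).comp (invEquiv Fq).toRingHom
    = (toInv : L ≃+* Inv L).toRingHom.comp (algebraMap (RatFunc Fq) L) := by
  ext x
  change (algebraMap (RatFunc Fq) L (invHom Fq (invHom Fq x)) : L) = algebraMap (RatFunc Fq) L x
  rw [invHom_invHom]

theorem finrank_inv : Module.finrank (RatFunc Fq) (Inv L) = Module.finrank (RatFunc Fq) L :=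
  (Algebra.finrank_eq_of_equiv_equiv (invEquiv Fq) (toInv : L ≃+* Inv L) inv_comp_invEquiv).symm

instance invFinite [FiniteDimensional (RatFunc Fq) L] : FiniteDimensional (RatFunc Fq) (Inv L) :=
  FiniteDimensional.of_finrank_pos (by rw [finrank_inv]; exact Module.finrank_pos)

instance invSeparable [Algebra.IsSeparable (RatFunc Fq) L] : Algebra.IsSeparable (RatFunc Fq) (Inv L) :=
  Algebra.IsSeparable.of_equiv_equiv (invEquiv Fq) (toInv : L ≃+* Inv L) inv_comp_invEquiv

theorem inv_algebraMap_X :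
    algebraMap Fq[X] (Inv L) X = ((algebraMap (RatFunc Fq) L RatFunc.X)⁻¹ : L) := by
  rw [IsScalarTower.algebraMap_apply Fq[X] (RatFunc Fq) (Inv L), RatFunc.algebraMap_X, inv_algebraMap,
    invHom_X, map_inv₀]

/-- A valuation of `L`, viewed as a valuation of `Inv L`. -/
def invVal {Γ : Type*} [LinearOrderedCommGroupWithZero Γ] (v : Valuation L Γ) : Valuation (Inv L) Γ := v

theorem invVal_X {Γ : Type*} [LinearOrderedCommGroupWithZero Γ] (v : Valuation L Γ) :
    invVal v (algebraMap Fq[X] (Inv L) X) = (v (algebraMap (RatFunc Fq) L RatFunc.X))⁻¹ := by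
  rw [inv_algebraMap_X]
  exact map_inv₀ v _

theorem one_lt_of_mem_placesAboveInfty {A : ValuationSubring L} (hA : A ∈ placesAboveInfty Fq L) :
    1 < A.valuation (algebraMap (RatFunc Fq) L RatFunc.X) := by
  classical
  have h : A.comap (algebraMap (RatFunc Fq) L) = inftyRing Fq := hA
  rw [← not_le, ValuationSubring.valuation_le_one_iff, ← ValuationSubring.mem_comap, h]
  change ¬ RatFunc.inftyValuation Fq RatFunc.X ≤ 1
  have : RatFunc.inftyValuation Fq RatFunc.X = WithZero.exp 1 := RatFunc.inftyValuation.X Fq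
  rw [this, ← WithZero.exp_zero, WithZero.exp_le_exp]
  norm_num

variable [FiniteDimensional (RatFunc Fq) L] [Algebra.IsSeparable (RatFunc Fq) L]

/-- The place of `L` given by a prime of the chart at infinity. -/
def chartPlace (p : HeightOneSpectrum (OK Fq (Inv L))) : ValuationSubring L :=
  (p.valuation (Inv L)).valuationSubring

theorem mem_chartPlace {p : HeightOneSpectrum (OK Fq (Inv L))} {a : L} :
    a ∈ chartPlace p ↔ p.valuation (Inv L) (toInv a) ≤ 1 := Iff.rfl

theorem eq_chartPlace {A : ValuationSubring L} {p : HeightOneSpectrum (OK Fq (Inv L))}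
    (h : (invVal A.valuation).IsEquiv (p.valuation (Inv L))) : A = chartPlace p := by
  ext a
  rw [mem_chartPlace, ← h.le_one_iff_le_one]
  exact (ValuationSubring.valuation_le_one_iff A a).symm

theorem exists_chart_isEquiv {Γ : Type*} [LinearOrderedCommGroupWithZero Γ] {v : Valuation L Γ}
    (hv : 1 < v (algebraMap (RatFunc Fq) L RatFunc.X)) :
    ∃ p ∈ zeroPrimes Fq (Inv L), (invVal v).IsEquiv (p.valuation (Inv L)) := by
  have hX : invVal v (algebraMap Fq[X] (Inv L) X) < 1 := by
    rw [invVal_X]; exact inv_lt_one_of_one_lt₀ hv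
  obtain ⟨p, hp⟩ := exists_isEquiv_valuation (invVal v) hX
  exact ⟨p, mem_zeroPrimes_of_isEquiv hp hX, hp⟩

/-- Every place above ∞ comes from a prime of the chart above 1/t = 0, and there are at most [L :
𝔽_q(t)] such primes. Having that many places forces complete splitting and makes the two sets of
places coincide. -/
theorem IsTotallyReal.split (h : IsTotallyReal Fq L) :
    (zeroPrimes Fq (Inv L)).ncard = Module.finrank (RatFunc Fq) L ∧
      (∀ p ∈ zeroPrimes Fq (Inv L), ramIdx p = 1 ∧ Module.finrank Fq (OK Fq (Inv L) ⧸ p.asIdeal) = 1) ∧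
      ∀ p ∈ zeroPrimes Fq (Inv L), chartPlace p ∈ placesAboveInfty Fq L := by
  have hsub : placesAboveInfty Fq L ⊆ chartPlace '' zeroPrimes Fq (Inv L) := by
    intro A hA
    obtain ⟨p, hp, hAp⟩ := exists_chart_isEquiv (one_lt_of_mem_placesAboveInfty hA)
    exact ⟨p, hp, (eq_chartPlace hAp).symm⟩
  have hfin : (chartPlace '' zeroPrimes Fq (Inv L)).Finite :=
    (zeroPrimes_finite (Fq := Fq) (L := Inv L)).image _
  have h1 := Set.ncard_le_ncard hsub hfin
  have h2 := Set.ncard_image_le (f := chartPlace) (zeroPrimes_finite (Fq := Fq) (L := Inv L))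
  rw [h.2] at h1
  obtain ⟨h3, h4⟩ := split_of_finrank_le (Fq := Fq) (L := Inv L) (by rw [finrank_inv]; exact h1.trans h2)
  rw [finrank_inv] at h3
  refine ⟨h3, h4, fun p hp => ?_⟩
  have h5 := Set.eq_of_subset_of_ncard_le hsub (by rw [h.2, ← h3]; exact h2) hfin
  rw [h5]
  exact ⟨p, hp, rfl⟩

end Chart

/-! ### Places of a CM field above ∞. -/

section CMChart

open IsDedekindDomain

variable {Fq : Type*} [Field Fq] [Fintype Fq]
  {K : Type*} [Field K] [Algebra Fq K] [Algebra Fq[X] K] [Algebra (RatFunc Fq) K]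
  [IsScalarTower Fq Fq[X] K] [IsScalarTower Fq (RatFunc Fq) K] [IsScalarTower Fq[X] (RatFunc Fq) K]
  [FiniteDimensional (RatFunc Fq) K] [Algebra.IsSeparable (RatFunc Fq) K]
  {Kp : IntermediateField (RatFunc Fq) K}

instance subfieldSeparable : Algebra.IsSeparable (RatFunc Fq) Kp :=
  Algebra.isSeparable_tower_bot_of_isSeparable (RatFunc Fq) Kp K

instance invSubfieldAlgebra : Algebra (Inv Kp) (Inv K) := inferInstanceAs (Algebra Kp K)

instance invSubfieldTower : IsScalarTower (RatFunc Fq) (Inv Kp) (Inv K) :=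
  IsScalarTower.of_algebraMap_eq fun _ => rfl

theorem IsCMField.isTotallyReal (hK : IsCMField Kp) : IsTotallyReal Fq Kp := hK.maximal_real.1

variable {Γ : Type*} [LinearOrderedCommGroupWithZero Γ]

/-- A place of `K⁺` above `∞` has only one extension to `K`. -/
theorem IsCMField.eq_of_isEquiv (hK : IsCMField Kp) {q : HeightOneSpectrum (OK Fq (Inv Kp))}
    (hq : q ∈ zeroPrimes Fq (Inv Kp)) {p p' : HeightOneSpectrum (OK Fq (Inv K))}
    (h : ((p.valuation (Inv K)).comap (algebraMap (Inv Kp) (Inv K))).IsEquiv (q.valuation (Inv Kp)))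
    (h' : ((p'.valuation (Inv K)).comap (algebraMap (Inv Kp) (Inv K))).IsEquiv (q.valuation (Inv Kp))) :
    p = p' := by
  obtain ⟨A, hA, huniq⟩ := hK.nonsplit (chartPlace q) (hK.isTotallyReal.split.2.2 q hq)
  have key : ∀ p : HeightOneSpectrum (OK Fq (Inv K)),
      ((p.valuation (Inv K)).comap (algebraMap (Inv Kp) (Inv K))).IsEquiv (q.valuation (Inv Kp)) →
      chartPlace p = A := by
    intro p hp
    refine huniq _ ?_
    ext a
    rw [ValuationSubring.mem_comap, mem_chartPlace, mem_chartPlace]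
    exact hp.le_one_iff_le_one
  have h1 : chartPlace p = chartPlace p' := (key p h).trans (key p' h').symm
  refine HeightOneSpectrum.eq_of_valuation_isEquiv_valuation (K := Inv K)
    (Valuation.isEquiv_of_val_le_one fun x => ?_)
  have h2 : x ∈ (p.valuation (Inv K)).valuationSubring ↔ x ∈ (p'.valuation (Inv K)).valuationSubring := by
    change x ∈ chartPlace p ↔ x ∈ chartPlace p'
    rw [h1]
  exact h2

/-- The place of `K⁺` below a place of `K` above `∞`, and the local degree. -/
theorem IsCMField.exists_below (hK : IsCMField Kp) {p : HeightOneSpectrum (OK Fq (Inv K))}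
    (hp : p ∈ zeroPrimes Fq (Inv K)) : ∃ q ∈ zeroPrimes Fq (Inv Kp),
      ((p.valuation (Inv K)).comap (algebraMap (Inv Kp) (Inv K))).IsEquiv (q.valuation (Inv Kp)) ∧
      ramIdx p * Module.finrank Fq (OK Fq (Inv K) ⧸ p.asIdeal) * Module.finrank (RatFunc Fq) Kp
        = Module.finrank (RatFunc Fq) K := by
  have hX : ((p.valuation (Inv K)).comap (algebraMap (Inv Kp) (Inv K))) (algebraMap Fq[X] (Inv Kp) X) < 1 := by
    have h1 : p.valuation (Inv K) (algebraMap Fq[X] (Inv K) X) < 1 := by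
      rw [IsScalarTower.algebraMap_apply Fq[X] (OK Fq (Inv K)) (Inv K)]
      exact (p.valuation_lt_one_iff_mem _).2 hp
    exact h1
  obtain ⟨q, hq⟩ := exists_isEquiv_valuation _ hX
  have hqz := mem_zeroPrimes_of_isEquiv hq hX
  have hs := hK.isTotallyReal.split.2.1 q hqz
  refine ⟨q, hqz, hq, ?_⟩
  rw [ramIdx_mul_finrank_of_unique hqz hs.1 hs.2 (fun p'' => ⟨fun h => hK.eq_of_isEquiv hqz h hq, fun h => h ▸ hq⟩)]
  have e : Module.finrank (Inv Kp) (Inv K) = Module.finrank Kp K := rfl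
  rw [e, mul_comm, Module.finrank_mul_finrank]

end CMChart

/-! ### The points `∞̄_ξ` -/

section InftyPoints

open IsDedekindDomain

variable {Fq : Type*} [Field Fq] [Fintype Fq] {𝕂 : Type*} [Field 𝕂] [Algebra Fq 𝕂] [IsAlgClosed 𝕂]
  {L : Type*} [Field L] [Algebra Fq L] [Algebra Fq[X] L] [Algebra (RatFunc Fq) L]
  [IsScalarTower Fq Fq[X] L] [IsScalarTower Fq (RatFunc Fq) L] [IsScalarTower Fq[X] (RatFunc Fq) L]
  [FiniteDimensional (RatFunc Fq) L] [Algebra.IsSeparable (RatFunc Fq) L]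

/-- A point of `𝐗`, viewed in the chart at infinity. -/
def ClosedPoint.toInv (P : ClosedPoint Fq 𝕂 L) : ClosedPoint Fq 𝕂 (Inv L) := P

/-- A point of the chart at infinity, viewed in `𝐗`. -/
def ClosedPoint.ofInv (P : ClosedPoint Fq 𝕂 (Inv L)) : ClosedPoint Fq 𝕂 L := P

theorem ClosedPoint.toInv_restrict (P : ClosedPoint Fq 𝕂 L) : P.toInv.restrict = invVal P.restrict := rfl

theorem ClosedPoint.toInv_twist (P : ClosedPoint Fq 𝕂 L) (n : ℤ) : (P.twist n).toInv = P.toInv.twist n := rfl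

theorem ClosedPoint.toInv_injective : Function.Injective (ClosedPoint.toInv (Fq := Fq) (𝕂 := 𝕂) (L := L)) :=
  fun _ _ h => h

theorem ClosedPoint.toInv_tFun (P : ClosedPoint Fq 𝕂 L) :
    P.toInv.val (tFun Fq 𝕂 (Inv L)) = (P.val (tFun Fq 𝕂 L))⁻¹ := by
  rw [← P.toInv.restrict_X, P.toInv_restrict, invVal_X]
  rfl

theorem ClosedPoint.toInv_tFun_lt_one {P : ClosedPoint Fq 𝕂 L} (hP : P ∉ affinePart Fq 𝕂 L) :
    P.toInv.val (tFun Fq 𝕂 (Inv L)) < 1 := by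
  rw [P.toInv_tFun]
  exact inv_lt_one_of_one_lt₀ (not_le.1 hP)

theorem ClosedPoint.notMem_affinePart_of_toInv {P : ClosedPoint Fq 𝕂 L}
    (h : P.toInv.val (tFun Fq 𝕂 (Inv L)) < 1) : P ∉ affinePart Fq 𝕂 L := by
  intro hP
  rw [P.toInv_tFun] at h
  have h0 : P.val (tFun Fq 𝕂 L) ≠ 0 := by
    change P.restrict _ ≠ 0
    exact (Valuation.ne_zero_iff _).2 ((_root_.map_ne_zero _).2 RatFunc.X_ne_zero)
  exact absurd ((inv_lt_one₀ (zero_lt_iff.2 h0)).1 h) (not_lt.2 hP)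

/-- An embedding of `L`, viewed as an embedding of `Inv L`. -/
def invEmb (ν : L →ₐ[Fq] 𝕂) : Inv L →ₐ[Fq] 𝕂 := ν

theorem invEmb_X (ν : L →ₐ[Fq] 𝕂) :
    invEmb ν (algebraMap Fq[X] (Inv L) X) = (ν (algebraMap Fq[X] L X))⁻¹ := by
  rw [inv_algebraMap_X, ← algebraMap_ratFunc_X]
  exact map_inv₀ ν _

variable {w : Valuation 𝕂 ℝ≥0} {abv : AbsoluteValue 𝕂 ℝ} {θ : 𝕂}

theorem transcendental_of_one_lt (hθ : 1 < w θ) : Transcendental Fq θ := by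
  intro h
  have h0 : θ⁻¹ = 0 := eq_zero_of_isAlgebraic_of_lt_one w h.inv (by
    rw [map_inv₀]; exact inv_lt_one_of_one_lt₀ hθ)
  rw [inv_eq_zero] at h0
  rw [h0, map_zero] at hθ
  exact absurd hθ (not_lt.2 zero_le)

theorem invEmb_X_lt_one (hθ : 1 < w θ) {ν : L →ₐ[Fq] 𝕂} (hν : ν (algebraMap Fq[X] L X) = θ) :
    w (invEmb ν (algebraMap Fq[X] (Inv L) X)) < 1 := by
  rw [invEmb_X, hν, map_inv₀]
  exact inv_lt_one_of_one_lt₀ hθ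

/-- A reduction exists in the chart at infinity, so the choice defining ∞̄_ξ does satisfy its
condition. The embedding occurring in that condition is the given ν, because evaluation at ξ is
unique. -/
theorem isReductionPoint_inftyPoint (hw : ∀ x, (w x : ℝ) = abv x) (hθ : 1 < w θ)
    {ξ : ClosedPoint Fq 𝕂 L} {ν : L →ₐ[Fq] 𝕂} (hξ : IsEval ξ ν) (hν : ν (algebraMap Fq[X] L X) = θ) :
    IsReductionPoint w (invEmb ν) (inftyPoint abv ξ).toInv := by
  have hlt : ∀ x, w x < 1 ↔ abv x < 1 := fun x => by
    rw [← hw, ← NNReal.coe_one, NNReal.coe_lt_coe]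
  have hex : ∃ P, IsReductionAtInfty abv ξ P := by
    obtain ⟨P, hP⟩ := exists_isReductionPoint (invEmb_X_lt_one hθ hν)
    exact ⟨P.ofInv, ν, hξ, fun a c hc h => hP a c hc ((hlt _).2 h)⟩
  obtain ⟨ν', hξ', hred⟩ : IsReductionAtInfty abv ξ (inftyPoint abv ξ) := Classical.epsilon_spec hex
  obtain rfl : ν' = ν := IsEval.unique hξ' hξ
  exact fun a c hc h => hred a c hc ((hlt _).1 h)

theorem IsReductionPoint.notMem_affinePart {P : ClosedPoint Fq 𝕂 L} {ν : L →ₐ[Fq] 𝕂}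
    (h : IsReductionPoint w (invEmb ν) P.toInv) (hθ : 1 < w θ) (hν : ν (algebraMap Fq[X] L X) = θ) :
    P ∉ affinePart Fq 𝕂 L :=
  ClosedPoint.notMem_affinePart_of_toInv (h.val_tFun_lt_one (invEmb_X_lt_one hθ hν))

/-- The points `ξ` and `∞̄_ξ` lie on the same component. -/
theorem IsReductionPoint.mem_component {P ξ : ClosedPoint Fq 𝕂 L} {ν : L →ₐ[Fq] 𝕂}
    (h : IsReductionPoint w (invEmb ν) P.toInv) (hξ : IsEval ξ ν) (ι : ConstField Fq L →ₐ[Fq] 𝕂) {i : ℕ}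
    (hi : ξ ∈ component ι i) : P ∈ component ι i := by
  have h1 : ∀ ε : ConstField Fq L, ν ε = (frob Fq 𝕂 ^ (-(i : ℤ))) (ι ε) := fun ε =>
    const_eq_of_val_lt_one (hξ ε) (by rw [hi ε]; exact zero_lt_one)
  obtain ⟨j, hj, hPj⟩ := exists_mem_component ι P
  -- Constants are algebraic over 𝔽_q, so they reduce to themselves and take the same scalar values
  -- at P as at ξ.
  have h2 : ∀ ε : ConstField Fq L, ν ε = (frob Fq 𝕂 ^ (-(j : ℤ))) (ι ε) := fun ε => by
    have halg : IsAlgebraic Fq (ν ε) := by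
      have : IsAlgebraic Fq (ε : L) := mem_algebraicClosure_iff.1 ε.2
      exact this.algHom ν
    have h3 : P.val (fn Fq (ε : L) - const Fq (ν ε)) < 1 :=
      h (ε : L) (ν ε) halg (by
        have : invEmb ν (ε : L) - ν ε = 0 := sub_self _
        rw [this, map_zero]; exact zero_lt_one)
    exact const_eq_of_val_lt_one h3 (by rw [hPj ε]; exact zero_lt_one)
  intro ε
  rw [← h1, h2]
  exact hPj ε

end InftyPoints

/-! ### Embeddings of `L` above `θ` -/

section Embeddings

variable {Fq : Type*} [Field Fq] [Fintype Fq] {𝕂 : Type*} [Field 𝕂] [Algebra Fq 𝕂] [IsAlgClosed 𝕂]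
  (L : Type*) [Field L] [Algebra Fq L] [Algebra Fq[X] L] [Algebra (RatFunc Fq) L]
  [IsScalarTower Fq Fq[X] L] [IsScalarTower Fq (RatFunc Fq) L] [IsScalarTower Fq[X] (RatFunc Fq) L]
  [FiniteDimensional (RatFunc Fq) L] [Algebra.IsSeparable (RatFunc Fq) L]

/-- Sending t to θ makes 𝕂 an extension of 𝔽_q(t), and a separable extension of degree n has n
embeddings into an algebraically closed field. -/
theorem natCard_embeddings {θ : 𝕂} (hθ : Transcendental Fq θ) :
    Nat.card {ν : L →ₐ[Fq] 𝕂 // ν (algebraMap Fq[X] L X) = θ} = Module.finrank (RatFunc Fq) L := by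
  let g : RatFunc Fq →ₐ[Fq] 𝕂 := IsFractionRing.liftAlgHom (K := RatFunc Fq) (transcendental_iff_injective.1 hθ)
  have hg : ∀ p : Fq[X], g (algebraMap Fq[X] (RatFunc Fq) p) = aeval θ p := fun p =>
    IsFractionRing.lift_algebraMap (K := RatFunc Fq) (transcendental_iff_injective.1 hθ) p
  let _ : Algebra (RatFunc Fq) 𝕂 := g.toRingHom.toAlgebra
  have hmap : ∀ x, algebraMap (RatFunc Fq) 𝕂 x = g x := fun _ => rfl
  have htow : IsScalarTower Fq (RatFunc Fq) 𝕂 := IsScalarTower.of_algebraMap_eq fun x => (g.commutes x).symm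
  rw [← AlgHom.natCard_of_splits (RatFunc Fq) L 𝕂 (fun _ => IsAlgClosed.splits _)]
  refine Nat.card_congr
    { toFun := fun ν => { (ν : L →ₐ[Fq] 𝕂) with commutes' := fun x => ?_ }
      invFun := fun ν => ⟨ν.restrictScalars Fq, ?_⟩
      left_inv := fun ν => rfl
      right_inv := fun ν => rfl }
  · have h : ((ν : L →ₐ[Fq] 𝕂) : L →+* 𝕂).comp (algebraMap (RatFunc Fq) L) = g.toRingHom := by
      refine IsFractionRing.ringHom_ext (A := Fq[X]) fun p => ?_
      change (ν : L →ₐ[Fq] 𝕂) (algebraMap (RatFunc Fq) L (algebraMap Fq[X] _ p)) = g _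
      rw [← IsScalarTower.algebraMap_apply, hg]
      have h2 := aeval_algHom_apply ((ν : L →ₐ[Fq] 𝕂).comp (IsScalarTower.toAlgHom Fq Fq[X] L)) X p
      rw [aeval_X_left_apply] at h2
      have h3 : ((ν : L →ₐ[Fq] 𝕂).comp (IsScalarTower.toAlgHom Fq Fq[X] L)) X = θ := ν.2
      rw [h3] at h2
      exact h2.symm
    exact DFunLike.congr_fun h x
  · change ν (algebraMap Fq[X] L X) = θ
    rw [IsScalarTower.algebraMap_apply Fq[X] (RatFunc Fq) L, AlgHom.commutes, hmap, hg, aeval_X]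

end Embeddings

/-! ### The divisor `I_Ξ` on Frobenius orbits at infinity -/

section OrbitSum

open IsDedekindDomain

variable {Fq : Type*} [Field Fq] [Fintype Fq] {𝕂 : Type*} [Field 𝕂] [Algebra Fq 𝕂] [IsAlgClosed 𝕂]
  {K : Type*} [Field K] [Algebra Fq K] [Algebra Fq[X] K] [Algebra (RatFunc Fq) K]
  [IsScalarTower Fq Fq[X] K] [IsScalarTower Fq (RatFunc Fq) K] [IsScalarTower Fq[X] (RatFunc Fq) K]
  [FiniteDimensional (RatFunc Fq) K] [Algebra.IsSeparable (RatFunc Fq) K]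
  {Kp : IntermediateField (RatFunc Fq) K} {w : Valuation 𝕂 ℝ≥0} {abv : AbsoluteValue 𝕂 ℝ} {θ : 𝕂}

theorem isEquiv_invEmb_onSubfield {Γ : Type*} [LinearOrderedCommGroupWithZero Γ] {v : Valuation (Inv K) Γ}
    {ν : K →ₐ[Fq] 𝕂} (h : (w.comap (invEmb ν : Inv K →+* 𝕂)).IsEquiv v) :
    (w.comap (invEmb (onSubfield Kp ν) : Inv Kp →+* 𝕂)).IsEquiv (v.comap (algebraMap (Inv Kp) (Inv K))) :=
  h.comap (algebraMap (Inv Kp) (Inv K))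

/-- Over a totally real field, the places above `∞` correspond to the embeddings above `θ`. -/
theorem IsTotallyReal.exists_embedding {L : Type*} [Field L] [Algebra Fq L] [Algebra Fq[X] L]
    [Algebra (RatFunc Fq) L] [IsScalarTower Fq Fq[X] L] [IsScalarTower Fq (RatFunc Fq) L]
    [IsScalarTower Fq[X] (RatFunc Fq) L] [FiniteDimensional (RatFunc Fq) L]
    [Algebra.IsSeparable (RatFunc Fq) L] (h : IsTotallyReal Fq L) (hθ : 1 < w θ)
    {q : HeightOneSpectrum (OK Fq (Inv L))} (hq : q ∈ zeroPrimes Fq (Inv L)) :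
    ∃ μ : L →ₐ[Fq] 𝕂, μ (algebraMap Fq[X] L X) = θ ∧
      (w.comap (invEmb μ : Inv L →+* 𝕂)).IsEquiv (q.valuation (Inv L)) := by
  obtain ⟨hcard, hsplit, -⟩ := h.split
  let E := {ν : L →ₐ[Fq] 𝕂 // ν (algebraMap Fq[X] L X) = θ}
  have hex : ∀ ν : E, ∃ p : zeroPrimes Fq (Inv L),
      (w.comap (invEmb ν.1 : Inv L →+* 𝕂)).IsEquiv (p.1.valuation (Inv L)) := by
    intro ν
    have hX : (w.comap (invEmb ν.1 : Inv L →+* 𝕂)) (algebraMap Fq[X] (Inv L) X) < 1 :=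
      invEmb_X_lt_one hθ ν.2
    obtain ⟨p, hp⟩ := exists_isEquiv_valuation _ hX
    exact ⟨⟨p, mem_zeroPrimes_of_isEquiv hp hX⟩, hp⟩
  choose F hF using hex
  -- An embedding is determined by the split place it induces. As there are as many places as
  -- embeddings, every place is induced.
  have hinj : Function.Injective F := by
    intro ν ν' hνν'
    have hs := hsplit (F ν).1 (F ν).2
    have h1 : invEmb ν.1 = invEmb ν'.1 := algHom_eq_of_isEquiv hs.1 hs.2 (invEmb_X_lt_one hθ ν.2) (by
      rw [invEmb_X, invEmb_X, ν.2, ν'.2]) (hF ν) (hνν' ▸ hF ν')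
    exact Subtype.ext h1
  have hfin : Finite (zeroPrimes Fq (Inv L)) := zeroPrimes_finite.to_subtype
  have hEc : Nat.card E = Module.finrank (RatFunc Fq) L := natCard_embeddings L (transcendental_of_one_lt hθ)
  have hbij : Function.Bijective F := hinj.bijective_of_nat_card_le (by
    rw [hEc, Nat.card_coe_set_eq, hcard])
  obtain ⟨ν, hν⟩ := hbij.2 ⟨q, hq⟩
  refine ⟨ν.1, ν.2, ?_⟩
  have := hF ν
  rwa [hν] at this

/-- Sort the points of Ξ by the restriction of their embedding to K⁺. There are [K⁺ : 𝔽_q(t)]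
classes, and the weight condition says that they contribute equally. -/
theorem IsGeneralizedCMType.degree_eq {Ξ : ClosedPoint Fq 𝕂 K →₀ ℕ} (hΞ : IsGeneralizedCMType Kp θ Ξ)
    (hθ : 1 < w θ) {ν : ClosedPoint Fq 𝕂 K → (K →ₐ[Fq] 𝕂)}
    (hν : ∀ ξ ∈ Ξ.support, ν ξ (algebraMap Fq[X] K X) = θ ∧ IsEval ξ (ν ξ))
    {μ : Kp →ₐ[Fq] 𝕂} (hμ : μ (algebraMap Fq[X] Kp X) = θ) [DecidablePred fun ξ => onSubfield Kp (ν ξ) = μ] :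
    degree Ξ = Module.finrank (RatFunc Fq) Kp * ∑ ξ ∈ Ξ.support with onSubfield Kp (ν ξ) = μ, Ξ ξ := by
  classical
  let E := {ν : Kp →ₐ[Fq] 𝕂 // ν (algebraMap Fq[X] Kp X) = θ}
  have hEc : Nat.card E = Module.finrank (RatFunc Fq) Kp := natCard_embeddings Kp (transcendental_of_one_lt hθ)
  have hEf : Finite E := Nat.finite_of_card_ne_zero (by rw [hEc]; exact Module.finrank_pos.ne')
  let _ := Fintype.ofFinite E
  have hsum : ∀ κ : E, ∑ ξ ∈ Ξ.support with onSubfield Kp (ν ξ) = κ.1, Ξ ξ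
      = ∑ ξ ∈ Ξ.support with onSubfield Kp (ν ξ) = μ, Ξ ξ := by
    intro κ
    obtain ⟨Q₁, hQ₁⟩ := exists_isEval κ.1
    obtain ⟨Q₂, hQ₂⟩ := exists_isEval μ
    have h := hΞ.weight Q₁ (hQ₁.mem_pointsAbove κ.2) Q₂ (hQ₂.mem_pointsAbove hμ)
    convert h using 2
    · exact Finset.filter_congr fun ξ hξ => (liesOver_iff (hν ξ hξ).2 hQ₁).symm
    · exact Finset.filter_congr fun ξ hξ => (liesOver_iff (hν ξ hξ).2 hQ₂).symm
  have hdeg : degree Ξ = ∑ κ : E, ∑ ξ ∈ Ξ.support with onSubfield Kp (ν ξ) = κ.1, Ξ ξ := by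
    have hre : ∀ ξ ∈ Ξ.support, onSubfield Kp (ν ξ) (algebraMap Fq[X] Kp X) = θ := fun ξ hξ => (hν ξ hξ).1
    have h1 : ∀ ξ ∈ Ξ.support, Ξ ξ = ∑ κ : E, if onSubfield Kp (ν ξ) = κ.1 then Ξ ξ else 0 := by
      intro ξ hξ
      rw [Finset.sum_eq_single (⟨onSubfield Kp (ν ξ), hre ξ hξ⟩ : E)]
      · simp
      · intro κ _ hne
        rw [if_neg]
        intro h; exact hne (Subtype.ext h.symm)
      · intro h; exact absurd (Finset.mem_univ _) h
    unfold degree Finsupp.sum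
    rw [Finset.sum_congr rfl h1, Finset.sum_comm]
    refine Finset.sum_congr rfl fun κ _ => ?_
    rw [Finset.sum_filter]
  rw [hdeg, Finset.sum_congr rfl (fun κ _ => hsum κ), Finset.sum_const, Finset.card_univ, smul_eq_mul,
    ← Nat.card_eq_fintype_card, hEc]

/-- The divisor `I_Ξ`. -/
def inftyDivisor (abv : AbsoluteValue 𝕂 ℝ) (Ξ : ClosedPoint Fq 𝕂 K →₀ ℕ) : Divisor Fq 𝕂 K :=
  (toDivisor Ξ).mapDomain (inftyPoint abv)

open Classical in
theorem inftyDivisor_apply (Ξ : ClosedPoint Fq 𝕂 K →₀ ℕ) (P : ClosedPoint Fq 𝕂 K) :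
    inftyDivisor abv Ξ P = ∑ ξ ∈ Ξ.support, if inftyPoint abv ξ = P then (Ξ ξ : ℤ) else 0 := by
  have hsupp : (toDivisor Ξ).support = Ξ.support :=
    Finsupp.support_mapRange_of_injective Nat.cast_zero Ξ Nat.cast_injective
  rw [inftyDivisor, Finsupp.mapDomain, Finsupp.sum_apply, Finsupp.sum, hsupp]
  exact Finset.sum_congr rfl fun ξ _ => by rw [Finsupp.single_apply]; rfl

-- The orbit of P consists of the points inducing its place 𝔭; its length f is the residue degree,
-- and the pole order of t is the ramification index e. The point ∞̄_ξ lies in the orbit exactly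
-- when ν_ξ restricts on K⁺ to the embedding μ attached to the place below. So the orbit sum of I_Ξ
-- is deg Ξ / [K⁺ : 𝔽_q(t)], and e f [K⁺ : 𝔽_q(t)] = [K : 𝔽_q(t)].
set_option maxHeartbeats 800000 in
theorem IsCMField.orbit_sum_inftyDivisor (hK : IsCMField Kp) {Ξ : ClosedPoint Fq 𝕂 K →₀ ℕ}
    (hΞ : IsGeneralizedCMType Kp θ Ξ) (hw : ∀ x, (w x : ℝ) = abv x) (hθ : 1 < w θ)
    {P : ClosedPoint Fq 𝕂 K} (hP : P ∉ affinePart Fq 𝕂 K) :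
    ∃ f : ℕ, 0 < f ∧ P.twist f = P ∧
      (Module.finrank (RatFunc Fq) K : ℤ) * ∑ i ∈ Finset.range f, inftyDivisor abv Ξ (P.twist i)
        = degree Ξ * f * WithZero.log (P.val (tFun Fq 𝕂 K)) := by
  classical
  have htr := transcendental_of_one_lt (Fq := Fq) hθ
  have hPX := P.toInv_tFun_lt_one hP
  obtain ⟨p, -, -, -, hPp⟩ := P.toInv.exists_center_of_lt_one hPX
  have hXv : P.toInv.restrict (algebraMap Fq[X] (Inv K) X) < 1 := by rw [P.toInv.restrict_X]; exact hPX
  have hPp' : P.toInv.restrict.IsEquiv (p.valuation (Inv K)) := Valuation.IsEquiv.of_eq hPp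
  have hpz : p ∈ zeroPrimes Fq (Inv K) := mem_zeroPrimes_of_isEquiv hPp' hXv
  obtain ⟨q, hqz, hpq, hdeg⟩ := hK.exists_below hpz
  obtain ⟨μ, hμθ, hμq⟩ := hK.isTotallyReal.exists_embedding hθ hqz
  have hs := hK.isTotallyReal.split.2.1 q hqz
  set f := Module.finrank Fq (OK Fq (Inv K) ⧸ p.asIdeal) with hf
  have hlog : WithZero.log (P.val (tFun Fq 𝕂 K)) = ramIdx p := by
    have h1 : (P.val (tFun Fq 𝕂 K))⁻¹ = WithZero.exp (-(ramIdx p : ℤ)) := by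
      rw [← P.toInv_tFun, ← P.toInv.restrict_X, hPp, valuation_X_eq]
    rw [← inv_inv (P.val (tFun Fq 𝕂 K)), h1, ← WithZero.exp_neg, neg_neg, WithZero.log_exp]
  have hex : ∀ ξ, ∃ ν : K →ₐ[Fq] 𝕂, ξ ∈ Ξ.support → ν (algebraMap Fq[X] K X) = θ ∧ IsEval ξ ν := by
    intro ξ
    by_cases hξ : ξ ∈ Ξ.support
    · obtain ⟨ν, h1, h2⟩ := exists_isEval_of_mem_pointsAbove htr (hΞ.support_subset ξ hξ)
      exact ⟨ν, fun _ => ⟨h1, h2⟩⟩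
    · obtain ⟨ξ₀, h0⟩ := Finsupp.support_nonempty_iff.2 hΞ.ne_zero
      obtain ⟨ν, -⟩ := exists_isEval_of_mem_pointsAbove htr (hΞ.support_subset ξ₀ h0)
      exact ⟨ν, fun h => absurd h hξ⟩
  choose ν hν using hex
  have hred : ∀ ξ ∈ Ξ.support, IsReductionPoint w (invEmb (ν ξ)) (inftyPoint abv ξ).toInv := fun ξ hξ =>
    isReductionPoint_inftyPoint hw hθ (hν ξ hξ).2 (hν ξ hξ).1
  have hequiv : ∀ ξ ∈ Ξ.support,
      (inftyPoint abv ξ).toInv.restrict.IsEquiv (w.comap (invEmb (ν ξ) : Inv K →+* 𝕂)) := fun ξ hξ =>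
    (hred ξ hξ).isEquiv (invEmb_X_lt_one hθ (hν ξ hξ).1)
  have hkey : ∀ ξ ∈ Ξ.support, (inftyPoint abv ξ).toInv.restrict.IsEquiv (p.valuation (Inv K)) ↔
      onSubfield Kp (ν ξ) = μ := by
    intro ξ hξ
    constructor
    · intro h
      have h1 : (w.comap (invEmb (onSubfield Kp (ν ξ)) : Inv Kp →+* 𝕂)).IsEquiv (q.valuation (Inv Kp)) :=
        (isEquiv_invEmb_onSubfield ((hequiv ξ hξ).symm.trans h)).trans hpq
      have h2 : onSubfield Kp (ν ξ) (algebraMap Fq[X] Kp X) = θ := (hν ξ hξ).1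
      have h3 : invEmb (onSubfield Kp (ν ξ)) = invEmb μ :=
        algHom_eq_of_isEquiv hs.1 hs.2 (invEmb_X_lt_one hθ h2) (by
          rw [invEmb_X, h2, invEmb_X, hμθ]) h1 hμq
      exact h3
    · intro h
      have hXξ : (inftyPoint abv ξ).toInv.restrict (algebraMap Fq[X] (Inv K) X) < 1 := by
        rw [ClosedPoint.restrict_X]
        exact (hred ξ hξ).val_tFun_lt_one (invEmb_X_lt_one hθ (hν ξ hξ).1)
      obtain ⟨p₁, hp₁⟩ := exists_isEquiv_valuation _ hXξ
      have h1 : (w.comap (invEmb (onSubfield Kp (ν ξ)) : Inv Kp →+* 𝕂)).IsEquiv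
          ((p₁.valuation (Inv K)).comap (algebraMap (Inv Kp) (Inv K))) :=
        isEquiv_invEmb_onSubfield ((hequiv ξ hξ).symm.trans hp₁)
      rw [h] at h1
      -- The CM condition enters here: p₁ and p extend the same place of K⁺, hence agree.
      have := hK.eq_of_isEquiv hqz (h1.symm.trans hμq) hpq
      exact this ▸ hp₁
  obtain ⟨hper, -⟩ := ClosedPoint.existsUnique_twist hPX hPp' hPp'
  -- A point ∞̄_ξ in the orbit is met exactly once among the first f twists of P.
  have hcount : ∀ ξ ∈ Ξ.support, ∑ i ∈ Finset.range f,
      (if inftyPoint abv ξ = P.twist (i : ℕ) then (Ξ ξ : ℤ) else 0)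
        = if onSubfield Kp (ν ξ) = μ then (Ξ ξ : ℤ) else 0 := by
    intro ξ hξ
    by_cases h : onSubfield Kp (ν ξ) = μ
    · obtain ⟨-, i, hi, huniq⟩ := ClosedPoint.existsUnique_twist hPX hPp' ((hkey ξ hξ).2 h)
      rw [if_pos h, Finset.sum_eq_single (i : ℕ)]
      · rw [if_pos]
        exact ClosedPoint.toInv_injective hi.symm
      · intro j hj hne
        rw [if_neg]
        intro he
        refine hne ?_
        have := huniq ⟨j, Finset.mem_range.1 hj⟩ (by
          change P.toInv.twist (j : ℕ) = _
          rw [he]; rfl)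
        rw [← this]
      · intro hi'; exact absurd (Finset.mem_range.2 i.2) hi'
    · rw [if_neg h]
      refine Finset.sum_eq_zero fun j _ => if_neg fun he => h ((hkey ξ hξ).1 ?_)
      rw [he, P.toInv_twist, ClosedPoint.restrict_twist]
      exact hPp'
  refine ⟨f, finrank_residue_pos hpz, ClosedPoint.toInv_injective hper, ?_⟩
  have hsum : ∑ i ∈ Finset.range f, inftyDivisor abv Ξ (P.twist i)
      = ((∑ ξ ∈ Ξ.support with onSubfield Kp (ν ξ) = μ, Ξ ξ : ℕ) : ℤ) := by
    simp_rw [inftyDivisor_apply]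
    rw [Finset.sum_comm, Finset.sum_congr rfl hcount, Finset.sum_filter]
    push_cast
    rfl
  rw [hsum, hlog, hΞ.degree_eq hθ hν hμθ, ← hdeg]
  push_cast
  ring

end OrbitSum

/-! ### Solving the divisor equation on Frobenius orbits -/

section Potential

theorem orbit_sum_eq_zero {α : Type*} {T : α → α} {g : α → ℤ} {x : α}
    (h : ∃ m, 0 < m ∧ T^[m] x = x ∧ ∑ i ∈ Finset.range m, g (T^[i] x) = 0) {n : ℕ} (hn : T^[n] x = x) :
    ∑ i ∈ Finset.range n, g (T^[i] x) = 0 := by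
  obtain ⟨m, hm, hmx, hsum⟩ := h
  have h1 := sum_range_mul_of_periodic (a := fun i => g (T^[i] x)) (f := m) (fun i => by
    rw [Function.iterate_add_apply, hmx]) n
  have h2 := sum_range_mul_of_periodic (a := fun i => g (T^[i] x)) (f := n) (fun i => by
    rw [Function.iterate_add_apply, hn]) m
  rw [hsum, mul_zero, mul_comm n m, h2] at h1
  exact (mul_eq_zero.1 h1).resolve_left (by exact_mod_cast hm.ne')

/-- A function with vanishing orbit sums is a coboundary. -/
theorem exists_potential {α : Type*} {T : α → α} (hT : Function.Injective T) {g : α → ℤ}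
    (h : ∀ x, ∃ m, 0 < m ∧ T^[m] x = x ∧ ∑ i ∈ Finset.range m, g (T^[i] x) = 0) :
    ∃ W : α → ℤ, ∀ x, W x - W (T x) = g x := by
  classical
  have hback : ∀ x y n, T^[n] x = y → ∃ k, T^[k] y = x := by
    rintro x _ n rfl
    obtain ⟨m, hm, hmx, -⟩ := h x
    refine ⟨n * m - n, ?_⟩
    rw [← Function.iterate_add_apply, Nat.sub_add_cancel (Nat.le_mul_of_pos_right n hm), mul_comm,
      Function.iterate_mul]
    exact Function.iterate_fixed hmx n
  let s : Setoid α :=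
    { r := fun x y => ∃ n, T^[n] x = y
      iseqv := ⟨fun x => ⟨0, rfl⟩, fun {x y} ⟨n, hn⟩ => hback x y n hn, fun {x y z} ⟨n, hn⟩ ⟨m, hm⟩ =>
        ⟨m + n, by rw [Function.iterate_add_apply, hn, hm]⟩⟩ }
  let rep : α → α := fun x => (Quotient.mk s x).out
  have hrep : ∀ x, ∃ n, T^[n] (rep x) = x := fun x => Quotient.mk_out (s := s) x
  have hrepT : ∀ x, rep (T x) = rep x := fun x =>
    congrArg Quotient.out (Quotient.sound (s := s) (hback x (T x) 1 rfl))
  let N : α → ℕ := fun x => Nat.find (hrep x)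
  have hN : ∀ x, T^[N x] (rep x) = x := fun x => Nat.find_spec (hrep x)
  have hmin : ∀ x k, T^[k] (rep x) = x → N x ≤ k := fun x k hk => Nat.find_min' (hrep x) hk
  -- W(x) is minus the sum of g along the shortest path from the chosen representative of the orbit
  -- to x.
  refine ⟨fun x => -∑ i ∈ Finset.range (N x), g (T^[i] (rep x)), fun x => ?_⟩
  have h1 : T^[N x + 1] (rep (T x)) = T x := by rw [hrepT, Function.iterate_succ_apply', hN]
  have hle := hmin _ _ h1
  -- The only step at which the path does not grow by one is the return to the representative; there
  -- the vanishing of the sum over the orbit is used.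
  rcases Nat.eq_zero_or_pos (N (T x)) with h0 | hpos
  · have h2 : rep x = T x := by
      have := hN (T x)
      rw [h0, hrepT] at this
      exact this
    have h3 := orbit_sum_eq_zero (h (rep x)) (n := N x + 1) (by
      rw [Function.iterate_succ_apply', hN, h2])
    rw [Finset.sum_range_succ, hN] at h3
    change -∑ i ∈ Finset.range (N x), g (T^[i] (rep x))
      - -∑ i ∈ Finset.range (N (T x)), g (T^[i] (rep (T x))) = g x
    rw [h0, Finset.range_zero, Finset.sum_empty]
    linarith
  · obtain ⟨k, hk⟩ := Nat.exists_eq_succ_of_ne_zero hpos.ne'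
    have h2 := hN (T x)
    rw [hk, hrepT, Function.iterate_succ_apply'] at h2
    have h3 := hmin _ _ (hT h2)
    have h4 : N (T x) = N x + 1 := by omega
    change -∑ i ∈ Finset.range (N x), g (T^[i] (rep x))
      - -∑ i ∈ Finset.range (N (T x)), g (T^[i] (rep (T x))) = g x
    rw [h4, hrepT, Finset.sum_range_succ, hN]
    ring

end Potential

/-! ### The divisors `Ξ^#`, `I_Ξ^#` and the divisor of `M_{(W,h)}` -/

section Sharp

variable {Fq : Type*} [Field Fq] [Fintype Fq] {𝕂 : Type*} [Field 𝕂] [Algebra Fq 𝕂] [IsAlgClosed 𝕂]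
  {K : Type*} [Field K] [Algebra Fq K] [Algebra Fq[X] K] [Algebra (RatFunc Fq) K]
  [IsScalarTower Fq Fq[X] K] [IsScalarTower Fq (RatFunc Fq) K] [IsScalarTower Fq[X] (RatFunc Fq) K]
  [FiniteDimensional (RatFunc Fq) K] [Algebra.IsSeparable (RatFunc Fq) K]
  (ι : ConstField Fq K →ₐ[Fq] 𝕂)

theorem twist_mem_component_sub {P : ClosedPoint Fq 𝕂 K} {i k : ℕ} (hP : P ∈ component ι i) (hk : k ≤ i) :
    P.twist k ∈ component ι (i - k) :=
  (twist_mem_component (by rw [Nat.cast_sub hk])).2 hP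

theorem twist_constDegree_mem {P : ClosedPoint Fq 𝕂 K} {n : ℤ} :
    P.twist (n * constDegree Fq K) ∈ component ι 0 ↔ P ∈ component ι 0 := by
  have hstep : ∀ Q : ClosedPoint Fq 𝕂 K, Q.twist (constDegree Fq K) ∈ component ι 0 ↔ Q ∈ component ι 0 := by
    intro Q
    rw [twist_mem_component (j := 0) (i := constDegree Fq K) (n := constDegree Fq K) (by simp),
      component_constDegree]
  induction n using Int.induction_on with
  | zero => simp [P.twist_zero]
  | succ i ih =>
    refine Iff.trans ?_ ih
    rw [add_mul, one_mul, ← ClosedPoint.twist_twist, hstep]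
  | pred i ih =>
    refine Iff.trans ?_ ih
    rw [← hstep, ClosedPoint.twist_twist]
    have e : (-(i : ℤ) - 1) * constDegree Fq K + constDegree Fq K = -(i : ℤ) * constDegree Fq K := by ring
    rw [e]

theorem twist_notMem_component_zero {P : ClosedPoint Fq 𝕂 K} (hP : P ∈ component ι 0) {i : ℕ} (h0 : 0 < i)
    (hi : i < constDegree Fq K) : P.twist i ∉ component ι 0 := by
  intro h
  rw [← component_constDegree ι] at hP
  have := component_disjoint ι (constDegree_pos (Fq := Fq) (L := K)) (by omega) h
    (twist_mem_component_sub ι hP hi.le)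
  omega

/-- On 𝐗_{(0)} the summand with index j contributes the value of D₀ at P^{(ℓ-j)}, a point of
𝐗_{(j)}, because 𝐗_{(ℓ)} = 𝐗_{(0)}. The construction ^# is therefore a trace over ℓ consecutive
twists. -/
theorem sharp_apply {D : ℕ → Divisor Fq 𝕂 K} {D₀ : Divisor Fq 𝕂 K}
    (h : ∀ j < constDegree Fq K, ∀ Q ∈ component ι j, D j Q = D₀ Q) {P : ClosedPoint Fq 𝕂 K}
    (hP : P ∈ component ι 0) :
    sharp D P = ∑ i ∈ Finset.range (constDegree Fq K), D₀ (P.twist i) := by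
  have hpos := constDegree_pos (Fq := Fq) (L := K)
  have h1 : ∀ j ∈ Finset.Ico 1 (constDegree Fq K),
      twistDiv ((j : ℤ) - constDegree Fq K) (D j) P = D₀ (P.twist ((constDegree Fq K - j : ℕ) : ℤ)) := by
    intro j hj
    rw [Finset.mem_Ico] at hj
    have e : -((j : ℤ) - constDegree Fq K) = ((constDegree Fq K - j : ℕ) : ℤ) := by omega
    rw [twistDiv_apply, e]
    refine h j hj.2 _ ?_
    have hP' := hP
    rw [← component_constDegree ι] at hP'
    have := twist_mem_component_sub ι hP' (Nat.sub_le (constDegree Fq K) j)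
    rwa [Nat.sub_sub_self hj.2.le] at this
  rw [sharp, Finsupp.add_apply, Finsupp.finsetSum_apply, Finset.sum_congr rfl h1, h 0 hpos P hP,
    Finset.range_eq_Ico, Finset.sum_eq_sum_Ico_succ_bot hpos, add_comm]
  have e0 : P.twist ((0 : ℕ) : ℤ) = P := P.twist_zero
  rw [e0]
  congr 1
  have := Finset.sum_Ico_reflect (fun i => D₀ (P.twist (i : ℤ))) 1 (m := constDegree Fq K)
    (n := constDegree Fq K) (by omega)
  rw [show constDegree Fq K + 1 - constDegree Fq K = 1 by omega, Nat.add_sub_cancel] at this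
  exact this

theorem partOn_apply {Ξ : ClosedPoint Fq 𝕂 K →₀ ℕ} {j : ℕ} {Q : ClosedPoint Fq 𝕂 K}
    (hQ : Q ∈ component ι j) : partOn ι Ξ j Q = toDivisor Ξ Q := by
  classical
  rw [partOn, Finsupp.filter_apply_pos _ _ hQ]

theorem partOn_apply_of_notMem {Ξ : ClosedPoint Fq 𝕂 K →₀ ℕ} {j : ℕ} {Q : ClosedPoint Fq 𝕂 K}
    (hQ : Q ∉ component ι j) : partOn ι Ξ j Q = 0 := by
  classical
  rw [partOn, Finsupp.filter_apply_neg _ _ hQ]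

/-- If reduction preserves components, points of Ξ off 𝐗_{(j)} contribute nothing to I_Ξ on 𝐗_{(j)}.
-/
theorem inftyPartOn_apply {abv : AbsoluteValue 𝕂 ℝ} {Ξ : ClosedPoint Fq 𝕂 K →₀ ℕ}
    (h : ∀ ξ ∈ Ξ.support, ∀ i, ξ ∈ component ι i → inftyPoint abv ξ ∈ component ι i)
    {j : ℕ} (hj : j < constDegree Fq K) {Q : ClosedPoint Fq 𝕂 K} (hQ : Q ∈ component ι j) :
    inftyPartOn abv ι Ξ j Q = inftyDivisor abv Ξ Q := by
  classical
  have hsupp : ∀ ξ ∈ (toDivisor Ξ).support, ξ ∈ Ξ.support := by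
    intro ξ hξ
    rw [Finsupp.mem_support_iff] at hξ ⊢
    rw [toDivisor_apply] at hξ
    exact_mod_cast hξ
  have e : toDivisor Ξ = partOn ι Ξ j + (toDivisor Ξ).filter (fun ξ => ¬ ξ ∈ component ι j) :=
    (Finsupp.filter_add_filter_not _ _).symm
  rw [inftyDivisor, e, Finsupp.mapDomain_add, Finsupp.add_apply, inftyPartOn, left_eq_add]
  rw [Finsupp.mapDomain, Finsupp.sum_apply, Finsupp.sum]
  refine Finset.sum_eq_zero fun ξ hξ => ?_
  rw [Finsupp.support_filter, Finset.mem_filter] at hξ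
  rw [Finsupp.single_apply, if_neg]
  intro he
  obtain ⟨i, hi, hξi⟩ := exists_mem_component ι ξ
  have h1 := h ξ (hsupp ξ hξ.1) i hξi
  rw [he] at h1
  obtain rfl := component_disjoint ι hi hj h1 hQ
  exact hξ.2 hξi

/-- Only the summand with index i is supported on 𝐗_{(i)}; the substitution k = i - j turns its
second part into a sum over the first i twists of Q. -/
theorem motiveDivisor_apply {Ξ : ClosedPoint Fq 𝕂 K →₀ ℕ} {W : Divisor Fq 𝕂 K}
    (hW : ∀ P ∈ W.support, P ∈ component ι 0) {i : ℕ} (hi : i < constDegree Fq K)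
    {Q : ClosedPoint Fq 𝕂 K} (hQ : Q ∈ component ι i) :
    motiveDivisor ι Ξ W Q = -W (Q.twist (i - constDegree Fq K))
      + ∑ k ∈ Finset.range i, toDivisor Ξ (Q.twist k) := by
  have hW0 : ∀ j < constDegree Fq K, j ≠ i → W (Q.twist (j - constDegree Fq K)) = 0 := by
    intro j hj hne
    by_contra h0
    have h1 := hW _ (Finsupp.mem_support_iff.2 h0)
    rw [← component_constDegree ι, twist_mem_component (i := j) (by ring)] at h1
    exact hne (component_disjoint ι hj hi h1 hQ)
  rw [motiveDivisor, Finsupp.finsetSum_apply, Finset.sum_eq_single i]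
  · rw [Finsupp.add_apply, Finsupp.neg_apply, twistDiv_apply, neg_sub, Finsupp.finsetSum_apply]
    congr 1
    have h1 : ∀ j ∈ Finset.Icc 1 i, twistDiv ((j : ℤ) - i) (partOn ι Ξ j) Q
        = toDivisor Ξ (Q.twist ((i - j : ℕ) : ℤ)) := by
      intro j hj
      rw [Finset.mem_Icc] at hj
      have e : -((j : ℤ) - i) = ((i - j : ℕ) : ℤ) := by omega
      rw [twistDiv_apply, e]
      refine partOn_apply ι ?_
      have := twist_mem_component_sub ι hQ (Nat.sub_le i j)
      rwa [Nat.sub_sub_self hj.2] at this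
    rw [Finset.sum_congr rfl h1]
    refine Finset.sum_nbij' (fun j => i - j) (fun k => i - k) ?_ ?_ ?_ ?_ fun j _ => rfl
    all_goals
      intro a ha
      simp only [Finset.mem_Icc, Finset.mem_range] at ha ⊢
      omega
  · intro j hj hne
    rw [Finset.mem_range] at hj
    rw [Finsupp.add_apply, Finsupp.neg_apply, twistDiv_apply, neg_sub, hW0 j hj hne, neg_zero, zero_add,
      Finsupp.finsetSum_apply]
    refine Finset.sum_eq_zero fun k hk => ?_
    rw [twistDiv_apply, neg_sub]
    refine partOn_apply_of_notMem ι fun h1 => hne ?_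
    rw [twist_mem_component (i := j) (by ring)] at h1
    exact component_disjoint ι hj hi h1 hQ
  · intro h; exact absurd (Finset.mem_range.2 hi) h

theorem finite_notMem_affinePart : {P : ClosedPoint Fq 𝕂 K | P ∉ affinePart Fq 𝕂 K}.Finite := by
  have hu : IsUnit (tFun Fq 𝕂 (Inv K)) := by
    have h : algebraMap (RatFunc Fq) (Inv K) RatFunc.X ≠ 0 := (_root_.map_ne_zero _).2 RatFunc.X_ne_zero
    exact h.isUnit.map (fnHom : Inv K →+* FunRing Fq 𝕂 (Inv K))
  refine ((finite_val_ne_one hu).preimage (f := ClosedPoint.toInv)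
    ClosedPoint.toInv_injective.injOn).subset fun P hP => ?_
  have h := P.toInv_tFun_lt_one hP
  exact ⟨h.le, h.ne⟩

end Sharp

/-! ### Construction of the shtuka function -/

section Construction

theorem sum_range_mul_eq (a : ℕ → ℤ) (m l : ℕ) :
    ∑ n ∈ Finset.range m, ∑ i ∈ Finset.range l, a (n * l + i) = ∑ i ∈ Finset.range (m * l), a i := by
  induction m with
  | zero => simp
  | succ m ih => rw [Finset.sum_range_succ, ih, Nat.succ_mul, Finset.sum_range_add]

variable {Fq : Type*} [Field Fq] [Fintype Fq] {𝕂 : Type*} [Field 𝕂] [Algebra Fq 𝕂] [IsAlgClosed 𝕂]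
  {K : Type*} [Field K] [Algebra Fq K] [Algebra Fq[X] K] [Algebra (RatFunc Fq) K]
  [IsScalarTower Fq Fq[X] K] [IsScalarTower Fq (RatFunc Fq) K] [IsScalarTower Fq[X] (RatFunc Fq) K]
  [FiniteDimensional (RatFunc Fq) K] [Algebra.IsSeparable (RatFunc Fq) K]
  {Kp : IntermediateField (RatFunc Fq) K} {w : Valuation 𝕂 ℝ≥0} {abv : AbsoluteValue 𝕂 ℝ} {θ : 𝕂}
  {M : Type*} [AddCommGroup M] [Module 𝕂[X] M] {σ : M →ₛₗ[polyTwistInv Fq 𝕂] M} {φ : OKEmbedding K σ}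

theorem IsGeneralizedCMType.exists_isEval {Ξ : ClosedPoint Fq 𝕂 K →₀ ℕ} (hΞ : IsGeneralizedCMType Kp θ Ξ)
    (hw : ∀ x, (w x : ℝ) = abv x) (hθ : 1 < w θ) {ξ : ClosedPoint Fq 𝕂 K} (hξ : ξ ∈ Ξ.support) :
    ∃ ν : K →ₐ[Fq] 𝕂, ν (algebraMap Fq[X] K X) = θ ∧ IsEval ξ ν ∧
      IsReductionPoint w (invEmb ν) (inftyPoint abv ξ).toInv := by
  obtain ⟨ν, h1, h2⟩ := exists_isEval_of_mem_pointsAbove (transcendental_of_one_lt hθ) (hΞ.support_subset ξ hξ)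
  exact ⟨ν, h1, h2, isReductionPoint_inftyPoint hw hθ h2 h1⟩

theorem IsGeneralizedCMType.inftyDivisor_eq_zero {Ξ : ClosedPoint Fq 𝕂 K →₀ ℕ}
    (hΞ : IsGeneralizedCMType Kp θ Ξ) (hw : ∀ x, (w x : ℝ) = abv x) (hθ : 1 < w θ)
    {P : ClosedPoint Fq 𝕂 K} (hP : P ∈ affinePart Fq 𝕂 K) : inftyDivisor abv Ξ P = 0 := by
  classical
  rw [inftyDivisor_apply]
  refine Finset.sum_eq_zero fun ξ hξ => if_neg ?_
  rintro rfl
  obtain ⟨ν, h1, -, h3⟩ := hΞ.exists_isEval hw hθ hξ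
  exact h3.notMem_affinePart hθ h1 hP

theorem IsGeneralizedCMType.support_subset_affinePart {Ξ : ClosedPoint Fq 𝕂 K →₀ ℕ}
    (hΞ : IsGeneralizedCMType Kp θ Ξ) : ∀ ξ ∈ Ξ.support, ξ ∈ affinePart Fq 𝕂 K := fun ξ hξ =>
  mem_affinePart_of_mem_pointsAbove (hΞ.support_subset ξ hξ)

theorem toDivisor_eq_zero {Ξ : ClosedPoint Fq 𝕂 K →₀ ℕ} (hΞ : ∀ ξ ∈ Ξ.support, ξ ∈ affinePart Fq 𝕂 K)
    {P : ClosedPoint Fq 𝕂 K} (hP : P ∉ affinePart Fq 𝕂 K) : toDivisor Ξ P = 0 := by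
  rw [toDivisor_apply, Nat.cast_eq_zero]
  by_contra h
  exact hP (hΞ P (Finsupp.mem_support_iff.2 h))

variable (ι : ConstField Fq K →ₐ[Fq] 𝕂)

theorem log_val_eq_zero {P : ClosedPoint Fq 𝕂 K} {h : FunRing Fq 𝕂 K}
    (h1 : P.val (h - 1) = 0) : WithZero.log (P.val h) = 0 := by
  have h2 : P.val h = 1 := by
    have h3 := Valuation.map_add_eq_of_lt_right P.val (x := h - 1) (y := 1) (by
      rw [h1, map_one]; exact zero_lt_one)
    rwa [sub_add_cancel, map_one] at h3
  rw [h2]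
  exact WithZero.log_one

/-- The twists of P by 0 < i < ℓ leave 𝐗_{(0)}, and there h equals 1. -/
theorem sum_log_val {P : ClosedPoint Fq 𝕂 K} (hP : P ∈ component ι 0) {h : FunRing Fq 𝕂 K}
    (h1 : ∀ P ∉ component ι 0, P.val (h - 1) = 0) :
    ∑ i ∈ Finset.range (constDegree Fq K), WithZero.log ((P.twist (i : ℕ)).val h) = WithZero.log (P.val h) := by
  rw [Finset.sum_eq_single 0]
  · rw [Nat.cast_zero, P.twist_zero]
  · intro i hi h0
    exact log_val_eq_zero (h1 _ (twist_notMem_component_zero ι hP (Nat.pos_of_ne_zero h0) (Finset.mem_range.1 hi)))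
  · intro h0
    exact absurd (Finset.mem_range.2 constDegree_pos) h0

/-- The part at infinity of the divisor `W`. -/
theorem Realization.exists_divisor_at_infty (R : Realization φ) (hK : IsCMField Kp)
    (hw : ∀ x, (w x : ℝ) = abv x) (hθ : 1 < w θ) (hM : IsDualTMotive θ σ)
    (hrank : Module.finrank 𝕂[X] M = Module.finrank (RatFunc Fq) K) (hpure : IsPure σ)
    {Ξ : ClosedPoint Fq 𝕂 K →₀ ℕ} (hΞ : IsGeneralizedCMType Kp θ Ξ)
    (hσ : (σ.toAddMonoidHom.range : Set M) = φ.idealMul (typeIdeal Ξ))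
    (h1 : ∀ P ∉ component ι 0, P.val (R.mult - 1) = 0) :
    ∃ V : ClosedPoint Fq 𝕂 K → ℤ, ∀ P ∉ affinePart Fq 𝕂 K, P ∈ component ι 0 →
      V (P.twist (-(constDegree Fq K : ℤ))) - V P
        = ∑ i ∈ Finset.range (constDegree Fq K), inftyDivisor abv Ξ (P.twist i) - WithZero.log (P.val R.mult) := by
  classical
  set l := constDegree Fq K with hl
  -- The equation lives on the points at infinity of 𝐗_{(0)}, a set preserved by the twist T by ℓ.
  let α := {P : ClosedPoint Fq 𝕂 K // P ∉ affinePart Fq 𝕂 K ∧ P ∈ component ι 0}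
  have hmem : ∀ (P : ClosedPoint Fq 𝕂 K) (n : ℤ), P ∉ affinePart Fq 𝕂 K ∧ P ∈ component ι 0 →
      P.twist (n * l) ∉ affinePart Fq 𝕂 K ∧ P.twist (n * l) ∈ component ι 0 := fun P n h =>
    ⟨fun h' => h.1 (twist_mem_affinePart.1 h'), (twist_constDegree_mem ι).2 h.2⟩
  let T : α → α := fun P => ⟨P.1.twist l, by simpa using hmem P.1 1 P.2⟩
  have hT : Function.Injective T := fun P Q h =>
    Subtype.ext (ClosedPoint.twist_injective _ (congrArg Subtype.val h))
  have hiter : ∀ (n : ℕ) (P : α), (T^[n] P).1 = P.1.twist ((n * l : ℕ) : ℤ) := by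
    intro n
    induction n with
    | zero => intro P; simp [P.1.twist_zero]
    | succ n ih =>
      intro P
      rw [Function.iterate_succ_apply']
      change (T^[n] P).1.twist l = _
      rw [ih, ClosedPoint.twist_twist]
      push_cast
      congr 1
      ring
  let J : ClosedPoint Fq 𝕂 K → ℤ := fun P => inftyDivisor abv Ξ P - WithZero.log (P.val R.mult)
  let ψ : α → ℤ := fun P => ∑ i ∈ Finset.range l, J (P.1.twist (i : ℕ))
  have hsum : ∀ P : α, ∃ m, 0 < m ∧ T^[m] P = P ∧ ∑ i ∈ Finset.range m, ψ (T^[i] P) = 0 := by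
    intro P
    obtain ⟨f, hf0, hf, hI⟩ := hK.orbit_sum_inftyDivisor hΞ hw hθ P.2.1
    have hper : P.1.twist ((l * f : ℕ) : ℤ) = P.1 := ClosedPoint.twist_mul hf l
    refine ⟨f, hf0, Subtype.ext (by rw [hiter, mul_comm, hper]), ?_⟩
    -- Along f steps of T, each carrying a sum over ℓ consecutive twists, one runs through ℓ f
    -- consecutive twists. On this range the orbit sums of the multiplier and of I_Ξ are known and
    -- equal.
    have e : ∀ n ∈ Finset.range f, ψ (T^[n] P)
        = ∑ i ∈ Finset.range l, (fun k : ℕ => J (P.1.twist (k : ℤ))) (n * l + i) := by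
      intro n _
      refine Finset.sum_congr rfl fun i _ => ?_
      rw [hiter, ClosedPoint.twist_twist, ← Nat.cast_add]
    rw [Finset.sum_congr rfl e, sum_range_mul_eq (fun k : ℕ => J (P.1.twist (k : ℤ))) f l, mul_comm f l]
    have hr : (Module.finrank (RatFunc Fq) K : ℤ) ≠ 0 := by
      exact_mod_cast (Module.finrank_pos (R := RatFunc Fq) (M := K)).ne'
    refine (mul_eq_zero.1 ?_).resolve_left hr
    have h2 := R.orbit_sum_mult hM hrank hpure hΞ.support_subset_affinePart hσ P.2.1 hper
    have h3 := sum_range_mul_of_periodic (a := fun i : ℕ => inftyDivisor abv Ξ (P.1.twist (i : ℤ))) (f := f)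
      (fun i => by
        have : ((i + f : ℕ) : ℤ) = f + i := by push_cast; ring
        rw [this, ← ClosedPoint.twist_twist, hf]) l
    change _ * ∑ i ∈ Finset.range (l * f), (inftyDivisor abv Ξ (P.1.twist (i : ℤ))
      - WithZero.log ((P.1.twist (i : ℤ)).val R.mult)) = 0
    rw [Finset.sum_sub_distrib, mul_sub, h2, h3, mul_left_comm, hI]
    push_cast
    ring
  -- A potential satisfies W(x) - W(Tx) = g(x), while the required difference is between P^{(-ℓ)}
  -- and P. Hence g is ψ shifted by T, and the relation is used at x = P^{(-ℓ)}.
  obtain ⟨W, hW⟩ := exists_potential hT (g := fun P => ψ (T P)) (fun P => by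
    obtain ⟨m, hm, -, h3⟩ := hsum (T P)
    obtain ⟨m', hm', h2', -⟩ := hsum P
    refine ⟨m', hm', h2', ?_⟩
    have h4 := orbit_sum_eq_zero (hsum (T P)) (n := m') (by
      rw [← Function.iterate_succ_apply, Function.iterate_succ_apply', h2'])
    refine Eq.trans (Finset.sum_congr rfl fun i _ => ?_) h4
    rw [← Function.iterate_succ_apply' T, Function.iterate_succ_apply])
  refine ⟨fun P => if h : P ∉ affinePart Fq 𝕂 K ∧ P ∈ component ι 0 then W ⟨P, h⟩ else 0,
    fun P hP hP0 => ?_⟩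
  have hP' : P ∉ affinePart Fq 𝕂 K ∧ P ∈ component ι 0 := ⟨hP, hP0⟩
  have hQ' : P.twist (-(l : ℤ)) ∉ affinePart Fq 𝕂 K ∧ P.twist (-(l : ℤ)) ∈ component ι 0 := by
    have := hmem P (-1) hP'
    rwa [neg_one_mul] at this
  have hTQ : T ⟨P.twist (-(l : ℤ)), hQ'⟩ = ⟨P, hP'⟩ := Subtype.ext (by
    change (P.twist (-(l : ℤ))).twist l = P
    rw [ClosedPoint.twist_twist, neg_add_cancel, P.twist_zero])
  have h2 := hW ⟨P.twist (-(l : ℤ)), hQ'⟩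
  rw [hTQ] at h2
  beta_reduce
  rw [dif_pos hP', dif_pos hQ', h2]
  change ∑ i ∈ Finset.range l, (inftyDivisor abv Ξ (P.twist (i : ℤ))
    - WithZero.log ((P.twist (i : ℤ)).val R.mult)) = _
  rw [Finset.sum_sub_distrib, sum_log_val ι hP0 h1]

/-- On 𝐔 the divisor W is forced by M = Γ(𝐔, O(D)), and at infinity it comes from the potential. On
the affine part of the components 𝐗_{(i)} with i > 0, D needs no choice: f = 1 there, so D(Q) =
D(Q^{(i)}) + ∑_{k<i} Ξ(Q^{(k)}) with Q^{(i)} on 𝐗_{(0)}, the shape of the divisor of M_{(W,h)}. -/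
theorem Realization.isCMWithType (R : Realization φ) (hK : IsCMField Kp)
    (hw : ∀ x, (w x : ℝ) = abv x) (hθ : 1 < w θ) (hM : IsDualTMotive θ σ)
    (hrank : Module.finrank 𝕂[X] M = Module.finrank (RatFunc Fq) K) (hpure : IsPure σ)
    {Ξ : ClosedPoint Fq 𝕂 K →₀ ℕ} (hΞ : IsGeneralizedCMType Kp θ Ξ)
    (hσ : (σ.toAddMonoidHom.range : Set M) = φ.idealMul (typeIdeal Ξ))
    (h1 : ∀ P ∉ component ι 0, P.val (R.mult - 1) = 0) : IsCMWithType abv ι Ξ σ := by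
  classical
  have hfin := hM.finite
  have hU := hΞ.support_subset_affinePart
  obtain ⟨V, hV⟩ := R.exists_divisor_at_infty ι hK hw hθ hM hrank hpure hΞ hσ h1
  obtain ⟨v, hv⟩ := R.exists_unit
  obtain ⟨D, hD, hDU⟩ := exists_attains R.image_fg hv ⟨v, rfl⟩
  set l := constDegree Fq K with hl
  have hlpos : 0 < l := constDegree_pos
  have htwl : ∀ P : ClosedPoint Fq 𝕂 K, (P.twist (-(l : ℤ))).twist l = P := fun P => by
    rw [ClosedPoint.twist_twist, neg_add_cancel, P.twist_zero]
  have hcomp : ∀ P ∈ component ι 0, P.twist (-(l : ℤ)) ∈ component ι 0 := fun P hP => by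
    have := (twist_constDegree_mem ι (P := P) (n := -1)).2 hP
    rwa [neg_one_mul] at this
  -- The motive has divisor -W^{(ℓ)} on 𝐗_{(0)}, so on the affine part W must be -D^{(-ℓ)}, whose
  -- value at P is -D(P^{(ℓ)}).
  let Wf : ClosedPoint Fq 𝕂 K → ℤ := fun P =>
    if P ∈ component ι 0 then (if P ∈ affinePart Fq 𝕂 K then -D (P.twist l) else V P) else 0
  have hWfin : (Function.support Wf).Finite := by
    refine ((D.support.finite_toSet.preimage (f := ClosedPoint.twist l)
      (ClosedPoint.twist_injective _).injOn).union finite_notMem_affinePart).subset fun P hP => ?_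
    by_cases hPU : P ∈ affinePart Fq 𝕂 K
    · left
      rw [Set.mem_preimage, Finset.mem_coe, Finsupp.mem_support_iff]
      intro h0
      apply hP
      simp only [Wf, if_pos hPU, h0, neg_zero, ite_self]
    · exact Or.inr hPU
  let W : Divisor Fq 𝕂 K := Finsupp.ofSupportFinite Wf hWfin
  have hWapp : ∀ P, W P = Wf P := fun P => rfl
  have hWsupp : ∀ P ∈ W.support, P ∈ component ι 0 := by
    intro P hP
    by_contra h0
    rw [Finsupp.mem_support_iff, hWapp] at hP
    exact hP (if_neg h0)
  have hWU : ∀ P ∈ affinePart Fq 𝕂 K, P ∈ component ι 0 → W P = -D (P.twist l) := fun P hP h0 => by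
    rw [hWapp]; simp only [Wf, if_pos hP, if_pos h0]
  have hWinf : ∀ P ∉ affinePart Fq 𝕂 K, P ∈ component ι 0 → W P = V P := fun P hP h0 => by
    rw [hWapp]; simp only [Wf, if_neg hP, if_pos h0]
  have hstep : ∀ P ∈ affinePart Fq 𝕂 K, ∀ k : ℕ,
      D (P.twist k) - D (P.twist ((k + 1 : ℕ) : ℤ)) = toDivisor Ξ (P.twist k)
        + WithZero.log ((P.twist k).val R.mult) := by
    intro P hP k
    rw [R.val_mult hU hσ hD (twist_mem_affinePart.2 hP), WithZero.log_exp, ClosedPoint.twist_twist,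
      toDivisor_apply, Nat.cast_succ]
    ring
  -- Telescoping of the formula for the order of the multiplier: n = ℓ yields the divisor of h on
  -- 𝐗_{(0)}, and n = i yields D on 𝐗_{(i)}.
  have htel : ∀ P ∈ affinePart Fq 𝕂 K, ∀ n : ℕ, D P - D (P.twist n)
      = ∑ k ∈ Finset.range n, toDivisor Ξ (P.twist k)
        + ∑ k ∈ Finset.range n, WithZero.log ((P.twist k).val R.mult) := by
    intro P hP n
    have h2 := Finset.sum_range_sub' (fun k : ℕ => D (P.twist k)) n
    rw [Nat.cast_zero, P.twist_zero] at h2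
    rw [← h2, ← Finset.sum_add_distrib]
    exact Finset.sum_congr rfl fun k _ => hstep P hP k
  have hsharpI : ∀ P ∈ component ι 0, sharp (inftyPartOn abv ι Ξ) P
      = ∑ i ∈ Finset.range l, inftyDivisor abv Ξ (P.twist i) := fun P hP =>
    sharp_apply ι (fun j hj Q hQ => inftyPartOn_apply ι (fun ξ hξ i hi => by
      obtain ⟨ν, -, h2, h3⟩ := hΞ.exists_isEval hw hθ hξ
      exact h3.mem_component h2 ι hi) hj hQ) hP
  have hsharp : ∀ P ∈ component ι 0, sharp (partOn ι Ξ) P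
      = ∑ i ∈ Finset.range l, toDivisor Ξ (P.twist i) := fun P hP =>
    sharp_apply ι (fun j _ Q hQ => partOn_apply ι hQ) hP
  have hmot : ∀ Q ∈ affinePart Fq 𝕂 K, motiveDivisor ι Ξ W Q = D Q := by
    intro Q hQ
    obtain ⟨i, hi, hQi⟩ := exists_mem_component ι Q
    rw [motiveDivisor_apply ι hWsupp hi hQi, hWU _ (twist_mem_affinePart.2 hQ) (by
      rw [← component_constDegree ι]
      exact (twist_mem_component (by ring)).2 hQi), ClosedPoint.twist_twist]
    have e : (i : ℤ) - constDegree Fq K + l = i := by rw [hl]; ring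
    have h2 := htel Q hQ i
    have h3 : ∑ k ∈ Finset.range i, WithZero.log ((Q.twist k).val R.mult) = 0 := by
      refine Finset.sum_eq_zero fun k hk => log_val_eq_zero (h1 _ fun h0 => ?_)
      rw [Finset.mem_range] at hk
      have := component_disjoint ι constDegree_pos (by omega) h0 (twist_mem_component_sub ι hQi hk.le)
      omega
    rw [e]
    rw [h3, add_zero] at h2
    linarith
  have hmemI : ∀ m, R.toHom m ∈ affineSections (motiveDivisor ι Ξ W) := by
    intro m P hP
    rw [hmot P hP]
    exact (hD P hP).1 _ ⟨m, rfl⟩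
  refine ⟨W, R.mult, ⟨hWsupp, h1, fun P hP => ?_⟩, ?_⟩
  · have hne := val_ne_zero_of_isUnit P R.isUnit_mult
    rw [← WithZero.exp_log hne, Finsupp.sub_apply, Finsupp.add_apply, Finsupp.sub_apply, twistDiv_apply,
      hsharp P hP, hsharpI P hP]
    congr 1
    -- On the affine part I_Ξ^# vanishes, and the equation is the telescoped one; at infinity Ξ^#
    -- vanishes, and the equation is the one solved by the potential.
    by_cases hPU : P ∈ affinePart Fq 𝕂 K
    · have h2 := htel P hPU l
      rw [hl, sum_log_val ι hP h1, ← hl] at h2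
      rw [hWU P hPU hP, hWU _ (twist_mem_affinePart.2 hPU) (hcomp P hP), htwl,
        Finset.sum_eq_zero (s := Finset.range l) (f := fun i : ℕ => inftyDivisor abv Ξ (P.twist i))
          (fun i _ => hΞ.inftyDivisor_eq_zero hw hθ (twist_mem_affinePart.2 hPU))]
      linarith
    · have h2 := hV P hPU hP
      have hPU' : P.twist (-(l : ℤ)) ∉ affinePart Fq 𝕂 K := fun h => hPU (twist_mem_affinePart.1 h)
      rw [hWinf P hPU hP, hWinf _ hPU' (hcomp P hP),
        Finset.sum_eq_zero (s := Finset.range l) (f := fun i : ℕ => toDivisor Ξ (P.twist i))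
          (fun i _ => toDivisor_eq_zero hU fun h => hPU (twist_mem_affinePart.1 h))]
      linarith
  · let F : M →+ affineSections (motiveDivisor ι Ξ W) :=
      { toFun := fun m => ⟨R.toHom m, hmemI m⟩
        map_zero' := Subtype.ext (map_zero R.toHom)
        map_add' := fun x y => Subtype.ext (map_add R.toHom x y) }
    have hF : Function.Bijective F := by
      refine ⟨fun x y h => R.injective (congrArg Subtype.val h), fun x => ?_⟩
      have hx : (x : FunRing Fq 𝕂 K) ∈ R.image := hD.mem_iff.2 fun P hP => by
        rw [← hmot P hP]; exact x.2 P hP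
      obtain ⟨m, hm⟩ := hx
      exact ⟨m, Subtype.ext hm⟩
    refine ⟨AddEquiv.ofBijective F hF, fun c m => ?_, fun m => ?_, fun m => R.map_sigma m⟩
    · change R.toHom _ = _ * R.toHom m
      rw [R.map_smul, algebraMap_bigO_C]
      exact congrArg (· * R.toHom m) (bigOToFun_const c)
    · change R.toHom _ = _ * R.toHom m
      rw [R.map_smul, bigOToFun_X]

theorem OKEmbedding.isCMWithType (φ : OKEmbedding K σ) (hK : IsCMField Kp)
    (hw : ∀ x, (w x : ℝ) = abv x) (hθ : 1 < w θ) (hM : IsDualTMotive θ σ)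
    (hrank : Module.finrank 𝕂[X] M = Module.finrank (RatFunc Fq) K) (hpure : IsPure σ)
    {Ξ : ClosedPoint Fq 𝕂 K →₀ ℕ} (hΞ : IsGeneralizedCMType Kp θ Ξ)
    (hσ : (σ.toAddMonoidHom.range : Set M) = φ.idealMul (typeIdeal Ξ)) : IsCMWithType abv ι Ξ σ := by
  obtain ⟨R⟩ := φ.nonempty_realization hM hrank
  obtain ⟨g, hg⟩ := exists_normalizing_unit ι R.isUnit_mult
  exact (R.rescale g).isCMWithType ι hK hw hθ hM hrank hpure hΞ hσ hg

end Construction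

/-! ### The absolute value of `ℂ_∞` -/

section AbsoluteValue

variable (Fq : Type*) [Field Fq] [Fintype Fq]

theorem kInfBar_isNonarchimedean (x y : KInfBar Fq) : ‖x + y‖ ≤ max ‖x‖ ‖y‖ :=
  isNonarchimedean_spectralNorm (K := KInf Fq) (L := KInfBar Fq) x y

/-- The ultrametric inequality is a closed condition and holds on the dense subfield by the
properties of the spectral norm. It makes the absolute value of ℂ_∞ a valuation. -/
instance cInf_isUltrametricDist : IsUltrametricDist (CInf Fq) :=
  IsUltrametricDist.isUltrametricDist_of_forall_norm_add_le_max_norm fun x y => by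
    induction x, y using UniformSpace.Completion.induction_on₂ with
    | hp => exact isClosed_le (by fun_prop) (by fun_prop)
    | ih a b =>
      rw [← UniformSpace.Completion.coe_add]
      simp only [UniformSpace.Completion.norm_coe]
      exact kInfBar_isNonarchimedean Fq a b

theorem one_lt_norm_theta : 1 < ‖theta Fq‖ := by
  have h1 : ‖theta Fq‖ = ‖(HahnSeries.single (-1 : ℤ) (1 : Fq) : KInf Fq)‖ :=
    (UniformSpace.Completion.norm_coe _).trans
      (spectralNorm_extends (K := KInf Fq) (L := KInfBar Fq) _)
  have h2 : (HahnSeries.single (-1 : ℤ) (1 : Fq) : KInf Fq) = (HahnSeries.single (1 : ℤ) (1 : Fq))⁻¹ :=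
    eq_inv_of_mul_eq_one_left (by simp)
  rw [h1, h2, norm_inv, one_lt_inv_iff₀]
  exact ⟨by simp, Valued.toNormedField.norm_lt_one_iff.2 (valuation_uniformizer Fq)⟩

variable {Fq}

/-- The absolute value of a subfield `𝕂` of `ℂ_∞` as a valuation. -/
def valOn (𝕂 : IntermediateField Fq (CInf Fq)) : Valuation 𝕂 ℝ≥0 :=
  (NormedField.valuation (K := CInf Fq)).comap (algebraMap 𝕂 (CInf Fq))

theorem coe_valOn (𝕂 : IntermediateField Fq (CInf Fq)) (x : 𝕂) : (valOn 𝕂 x : ℝ) = absOn 𝕂 x := rfl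

theorem one_lt_valOn_theta {𝕂 : IntermediateField Fq (CInf Fq)} (hθ : theta Fq ∈ 𝕂) :
    1 < valOn 𝕂 ⟨theta Fq, hθ⟩ := by
  rw [← NNReal.coe_lt_coe]
  exact one_lt_norm_theta Fq

end AbsoluteValue

end CMMotive

end

theorem mainTheorem7
    {Fq : Type*} [Field Fq] [Fintype Fq]
    (𝕂 : IntermediateField Fq (CMMotive.CInf Fq)) [IsAlgClosed 𝕂]
    (hθ : CMMotive.theta Fq ∈ 𝕂)
    {K : Type*} [Field K] [Algebra Fq K] [Algebra (Polynomial Fq) K] [Algebra (RatFunc Fq) K]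
    [IsScalarTower Fq (Polynomial Fq) K] [IsScalarTower Fq (RatFunc Fq) K]
    [IsScalarTower (Polynomial Fq) (RatFunc Fq) K]
    (Kp : IntermediateField (RatFunc Fq) K) (hK : CMMotive.IsCMField Kp)
    (ι : CMMotive.ConstField Fq K →ₐ[Fq] 𝕂)
    {M : Type*} [AddCommGroup M] [Module (Polynomial 𝕂) M]
    (σ : M →ₛₗ[CMMotive.polyTwistInv Fq 𝕂] M)
    (hM : CMMotive.IsDualTMotive (⟨CMMotive.theta Fq, hθ⟩ : 𝕂) σ)
    (hrank : Module.finrank (Polynomial 𝕂) M = Module.finrank (RatFunc Fq) K)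
    (φ : CMMotive.OKEmbedding K σ)
    (Ξ : CMMotive.ClosedPoint Fq 𝕂 K →₀ ℕ)
    (hΞ : CMMotive.IsGeneralizedCMType Kp (⟨CMMotive.theta Fq, hθ⟩ : 𝕂) Ξ)
    (hσ : (σ.toAddMonoidHom.range : Set M) = φ.idealMul (CMMotive.typeIdeal Ξ))
    (hpure : CMMotive.IsPure σ) :
    CMMotive.IsCMWithType (CMMotive.absOn 𝕂) ι Ξ σ := by
  have := hK.finite
  have := hK.separable
  exact φ.isCMWithType ι hK (CMMotive.coe_valOn 𝕂) (CMMotive.one_lt_valOn_theta hθ) hM hrank hpure hΞ hσ
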